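/- Let $\Sigma=\Sigma_{g,1}$ be the compact oriented surface of genus $g\ge 0$ with one boundary component, $I=[0,1]$ (the coordinate in $I$ is called height), $p:\Sigma\times I\to\Sigma$ the projection, and $a\cdot b$ the intersection form on $H_1(\Sigma;\mathbb Z)$. Let $\mathfrak b=(b_i)$ be a framed oriented link in $\Sigma\times I$, given by disjointly embedded annuli with cores $b_i$ and parallel copies $b_i^+$, whose components represent a basis of $H_1(\Sigma\times I;\mathbb Z)$. Let $\mathcal A=\mathcal A(\Sigma\times I)$ be the abelian group generated by finite graphs $\Gamma$ with trivalent and univalent vertices such that every connected component of $\Gamma$ has a trivalent vertex, with a cyclic order of the half-edges at each trivalent vertex, and with each univalent vertex (leg) coloured by an element of $H_1(\Sigma\times I;\mathbb Z)\cong H_1(\Sigma;\mathbb Z)$, modulo isomorphism, antisymmetry (reversing the cyclic order at one vertex changes the sign), the IHX relation, and linearity in the colour of each leg. Let $\mathcal A^c\subseteq\mathcal A$ be the subgroup generated by the nonempty connected graphs. (i) There is a unique bilinear form $\langle\cdot,\cdot\rangle^{\mathfrak b}:H_1(\Sigma;\mathbb Z)\otimes H_1(\Sigma;\mathbb Z)\to\mathbb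 Z$ such that $\langle [b_i],[b_j]\rangle^{\mathfrak b}$ is, for all $i,j$, the signed number of those crossings of the projections $p(b_i)$, $p(b_j^+)$ at which $b_i$ passes over $b_j^+$, counted after any sufficiently small perturbation of the pair $(b_i,b_j^+)$ to general position (and such perturbations exist). Here a crossing has the sign of the local intersection number of $p(b_i)$ with $p(b_j^+)$. If $\mathfrak b'$ is isotopic to $\mathfrak b$ and generic (the $p(b'_i)$ are immersions, all double points of $p(\mathfrak b')$ are transverse, and the framing points upwards in the $I$-direction), then $\langle [b'_i],[b'_j]\rangle^{\mathfrak b}$ is the sum of the signs of the crossings at which $b'_i$ passes over $b'_j$ (for $i=j$: of the self-crossings of $b_i'$). Moreover, for all $a,b\in H_1(\Sigma;\mathbb Z)$, $$\langle a,b\rangle^{\mathfrak b}-\langle b,a\rangle^{\mathfrak b}=a\cdot b .$$ (ii) There is a biadditive product $\ast$ on $\mathcal A$ given on graphs by $$\Gamma\ast\Gamma'=\sum_{l\ge 0}\langle\Gamma,\Gamma'\rangle_l,\qquad \langle\Gamma,\Gamma'\rangle_l=(-1)^l\sum_{\{(a_1,b_1),\dots,(a_l,b_l)\}}\ \prod_{k=1}^l\langle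 a_k,b_k\rangle^{\mathfrak b}\ \Gamma_a\,\mathrm{glue}\,\Gamma'_b ,$$ where the (finite) sum is over all sets of $l$ pairs consisting of $l$ different legs $a_1,\dots,a_l$ of $\Gamma$ and $l$ different legs $b_1,\dots,b_l$ of $\Gamma'$, $\langle a_k,b_k\rangle^{\mathfrak b}$ is the value of the form on the colours of the legs, and $\Gamma_a\,\mathrm{glue}\,\Gamma'_b$ is obtained from the disjoint union of $\Gamma$ and $\Gamma'$ by gluing the leg $a_k$ to the leg $b_k$ for every $k$. With this product $\mathcal A$ is an associative ring with the empty graph as unit. (iii) For graphs $\Gamma,\Gamma'$ one has $[\Gamma,\Gamma']=\Gamma\ast\Gamma'-\Gamma'\ast\Gamma=\sum_{l\ge 1}\big(\langle\Gamma,\Gamma'\rangle_l-\langle\Gamma',\Gamma\rangle_l\big)$, and $\mathcal A^c$ is a Lie subring of $\mathcal A$ with the commutator bracket. (iv) There is an isomorphism of $\mathbb Q$-algebras $\mathsf U(\mathbb Q\otimes\mathcal A^c)\cong\mathbb Q\otimes\mathcal A$ that restricts to the inclusion on $\mathbb Q\otimes\mathcal A^c$, where $\mathsf U$ is the universal enveloping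 algebra. -/

import Mathlib

open scoped TensorProduct

namespace FramedGraph

noncomputable section

open scoped unitInterval Topology

section Homology

open scoped Simplicial

/-! ### First singular homology -/

/-- `H₁(X; ℤ)`: the first singular homology group of a topological space. -/
abbrev H1 (X : Type) [TopologicalSpace X] : Type :=
  ((AlgebraicTopology.singularHomologyFunctor (ModuleCat.{0} ℤ) 1).obj
    (ModuleCat.of ℤ ℤ)).obj (TopCat.of X)

/-- The homomorphism induced on `H₁` by a continuous map. -/
def H1.map {X Y : Type} [TopologicalSpace X] [TopologicalSpace Y] (f : C(X, Y)) :
    H1 X →ₗ[ℤ] H1 Y :=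
  (((AlgebraicTopology.singularHomologyFunctor (ModuleCat.{0} ℤ) 1).obj
    (ModuleCat.of ℤ ℤ)).map (TopCat.ofHom f)).hom

/-- The singular `1`-simplex that runs once along a loop. -/
def loopSimplex {X : Type} [TopologicalSpace X] (γ : C(UnitAddCircle, X)) :
    (TopCat.toSSet.obj (TopCat.of X)) _⦋1⦌ :=
  ((TopCat.of X).toSSetObjEquiv (.op ⦋1⦌)).symm
    ⟨fun x => γ (((stdSimplexHomeomorphUnitInterval x : I) : ℝ) : UnitAddCircle), by
      have h := (AddCircle.continuous_mk' (1 : ℝ)).comp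
        (continuous_subtype_val.comp stdSimplexHomeomorphUnitInterval.continuous)
      exact γ.continuous.comp h⟩

theorem loopSimplex_faces {X : Type} [TopologicalSpace X] (γ : C(UnitAddCircle, X)) :
    (TopCat.toSSet.obj (TopCat.of X)).δ 0 (loopSimplex γ) =
      (TopCat.toSSet.obj (TopCat.of X)).δ 1 (loopSimplex γ) := by
  apply ((TopCat.of X).toSSetObjEquiv _).injective
  ext z
  have hz : z = stdSimplex.vertex (S := ℝ) (0 : Fin 1) :=
    Subsingleton.elim (α := stdSimplex ℝ (Fin 1)) _ _
  have key : ∀ i : Fin 2, (TopCat.of X).toSSetObjEquiv _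
      ((TopCat.toSSet.obj (TopCat.of X)).δ i (loopSimplex γ)) z = γ 0 := by
    intro i
    refine (TopCat.toSSetObjEquiv_δ_apply _ _ _).trans ?_
    rw [hz]
    erw [stdSimplex.map_vertex]
    simp only [loopSimplex]
    erw [Equiv.apply_symm_apply]
    simp only [ContinuousMap.coe_mk]
    congr 1
    fin_cases i
    · have : ((1 : ℝ) : UnitAddCircle) = 0 := AddCircle.coe_period 1
      exact this
    · exact AddCircle.coe_zero 1
  rw [key, key]

/-- The `1`-cycle carried by a loop. -/
def loopCycle {X : Type} [TopologicalSpace X] (γ : C(UnitAddCircle, X)) :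
    Quiver.Hom (ModuleCat.of ℤ ℤ)
      (((TopCat.toSSet.obj (TopCat.of X)).chainComplex (ModuleCat.of ℤ ℤ)).cycles 1) :=
  HomologicalComplex.liftCycles _ ((TopCat.toSSet.obj (TopCat.of X)).ιChainComplex (loopSimplex γ))
    0 (ChainComplex.next_nat_succ 0) (by
      rw [SSet.ιChainComplex_d, Fin.sum_univ_two, ← loopSimplex_faces]
      simp)

/-- The homology class `[γ] ∈ H₁(X; ℤ)` of a loop `γ`. -/
def loopClass {X : Type} [TopologicalSpace X] (γ : C(UnitAddCircle, X)) : H1 X :=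
  (CategoryTheory.CategoryStruct.comp (loopCycle γ)
    (((TopCat.toSSet.obj (TopCat.of X)).chainComplex (ModuleCat.of ℤ ℤ)).homologyπ 1)).hom (1 : ℤ)

end Homology

/-! ### The surface of genus `g` with one boundary component -/

/-- The rectangle `[0, 4g + 1] × [0, 1]`. -/
abbrev Rectangle (g : ℕ) : Type := Set.Icc (0 : ℝ) (4 * g + 1) × Set.Icc (0 : ℝ) 1

/-- The index, counted from the left, of the first of the two slots on the top side of the
rectangle that are glued to each other. Handle `i` uses the slots `4i, 4i + 1, 4i + 2, 4i + 3`;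
the slot `4i + r` is glued to the slot `4i + r + 2`, for `r = 0, 1`. -/
def slot {g : ℕ} (i : Fin g) (r : Fin 2) : ℝ := 4 * (i : ℕ) + (r : ℕ)

/-- The slot with index `j` is the segment `[j + 1/4, j + 3/4] × {1}`. The slots `j` and `j + 2`
are glued by the rotation by `π` of the plane `(x, y) ↦ (2j + 3 - x, 2 - y)`, which exchanges
them; so the plane orientation of the rectangle is preserved. -/
def Glued (g : ℕ) (p q : Rectangle g) : Prop :=
  ∃ (i : Fin g) (r : Fin 2), (p.1 : ℝ) ∈ Set.Icc (slot i r + 1 / 4) (slot i r + 3 / 4) ∧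
    (p.2 : ℝ) = 1 ∧ (q.2 : ℝ) = 1 ∧ (q.1 : ℝ) = 2 * slot i r + 3 - p.1

/-- The compact oriented surface `Σ_{g,1}` of genus `g` with one boundary component: a rectangle
with `g` interlocked pairs of glued slots, that is, a disc with `g` interlocked pairs of bands. -/
def Surface (g : ℕ) : Type := Quot (Glued g)

instance (g : ℕ) : TopologicalSpace (Surface g) :=
  inferInstanceAs (TopologicalSpace (Quot (Glued g)))

/-- The image in the surface of a point of the plane that lies in the rectangle (points outside
the rectangle are first retracted to it; this is never used). -/
def Surface.mk (g : ℕ) (p : ℝ × ℝ) : Surface g :=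
  Quot.mk _ (Set.projIcc (0 : ℝ) (4 * g + 1) (by positivity) p.1,
    Set.projIcc (0 : ℝ) 1 zero_le_one p.2)

/-- The oriented flat charts of the interior of `Σ_{g,1}`: the open rectangle, and, for each pair
of glued slots, a neighbourhood of the open slot. -/
inductive FlatChart (g : ℕ) : Type
  | cell : FlatChart g
  | seam (i : Fin g) (r : Fin 2) : FlatChart g

/-- The open subset of the plane that is parametrised by the chart. -/
def FlatChart.domain {g : ℕ} : FlatChart g → Set (ℝ × ℝ)
  | .cell => Set.Ioo 0 (4 * (g : ℝ) + 1) ×ˢ Set.Ioo 0 1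
  | .seam i r => Set.Ioo (slot i r + 1 / 4) (slot i r + 3 / 4) ×ˢ Set.Ioo 0 2

open Classical in
/-- The parametrisation (inverse of the chart map): the inclusion of the open rectangle; and for a
seam, the part of the domain above the height `1` continues below the partner slot. -/
def FlatChart.param {g : ℕ} : FlatChart g → ℝ × ℝ → Surface g
  | .cell, p => Surface.mk g p
  | .seam i r, p =>
      if p.2 ≤ 1 then Surface.mk g p else Surface.mk g (2 * slot i r + 3 - p.1, 2 - p.2)

/-! ### Intersection numbers of curves on the surface -/

/-- At the parameter `s` the loop `α` lies in the flat chart `c` and has, in that chart, the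
derivative `v`. -/
def HasVelocity {g : ℕ} (c : FlatChart g) (α : C(UnitAddCircle, Surface g)) (s : UnitAddCircle)
    (v : ℝ × ℝ) : Prop :=
  ∃ (s₀ : ℝ) (u : ℝ → ℝ × ℝ), (s₀ : UnitAddCircle) = s ∧ HasDerivAt u v s₀ ∧
    u s₀ ∈ c.domain ∧ ∀ᶠ τ : ℝ in 𝓝 s₀, α (τ : UnitAddCircle) = c.param (u τ)

/-- For `ε = 1` or `ε = -1`: the loops `α` and `β` meet at the parameters `z = (s, t)`, they cross
transversely there, and the local intersection number of `α` with `β` is `ε`: the pair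
of velocities `(α'(s), β'(t))` is a positive, respectively negative, basis of the plane. -/
def CrossesWithSign {g : ℕ} (ε : ℤ) (α β : C(UnitAddCircle, Surface g))
    (z : UnitAddCircle × UnitAddCircle) : Prop :=
  α z.1 = β z.2 ∧ ∃ (c : FlatChart g) (v w : ℝ × ℝ),
    HasVelocity c α z.1 v ∧ HasVelocity c β z.2 w ∧ 0 < (ε : ℝ) * (v.1 * w.2 - v.2 * w.1)

/-- `α` and `β` cross transversely at the parameters `z`. -/
def CrossesTransversely {g : ℕ} (α β : C(UnitAddCircle, Surface g))
    (z : UnitAddCircle × UnitAddCircle) : Prop :=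
  CrossesWithSign 1 α β z ∨ CrossesWithSign (-1) α β z

/-- The loops `α` and `β` are transverse to each other. -/
def Transverse {g : ℕ} (α β : C(UnitAddCircle, Surface g)) : Prop :=
  ∀ z : UnitAddCircle × UnitAddCircle, α z.1 = β z.2 → CrossesTransversely α β z

/-- The sum of the signs of all crossings of two transverse loops. -/
def crossingSum {g : ℕ} (α β : C(UnitAddCircle, Surface g)) : ℤ :=
  (Set.ncard {z | CrossesWithSign 1 α β z} : ℤ) - Set.ncard {z | CrossesWithSign (-1) α β z}

/-- `ω` is the (homological) intersection form of the surface: the intersection number of the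
classes of two transverse loops is the sum of the signs of their crossings. -/
def IsIntersectionForm {g : ℕ} (ω : H1 (Surface g) →ₗ[ℤ] H1 (Surface g) →ₗ[ℤ] ℤ) : Prop :=
  ∀ α β : C(UnitAddCircle, Surface g), Transverse α β →
    ω (loopClass α) (loopClass β) = crossingSum α β

open Classical in
/-- The intersection form `a · b` on `H₁(Σ_{g,1}; ℤ)`. -/
def intersectionForm (g : ℕ) : H1 (Surface g) →ₗ[ℤ] H1 (Surface g) →ₗ[ℤ] ℤ :=
  if h : ∃ ω : H1 (Surface g) →ₗ[ℤ] H1 (Surface g) →ₗ[ℤ] ℤ, IsIntersectionForm ω then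
    h.choose else 0

/-! ### Framed links in `Σ_{g,1} × I` -/

/-- The cylinder `Σ_{g,1} × I`. The second coordinate is the height. -/
abbrev Cylinder (g : ℕ) : Type := Surface g × I

/-- The projection `p : Σ_{g,1} × I → Σ_{g,1}`. -/
def proj (g : ℕ) : C(Cylinder g, Surface g) := ContinuousMap.fst

/-- An oriented framed link in `Σ_{g,1} × I` with components indexed by `ι`: an embedding of a
disjoint union of annuli `S¹ × I`. The link itself consists of the oriented curves `S¹ × {0}`; the
framing is recorded by the parallel curves `S¹ × {1}`. -/
structure FramedLink (g : ℕ) (ι : Type) where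
  ribbon : ι → C(UnitAddCircle × I, Cylinder g)
  injective : Function.Injective fun z : ι × (UnitAddCircle × I) => ribbon z.1 z.2

namespace FramedLink

variable {g : ℕ} {ι : Type}

/-- The component `b_i` of the link. -/
def core (b : FramedLink g ι) (i : ι) : C(UnitAddCircle, Cylinder g) :=
  (b.ribbon i).comp ⟨fun s => (s, 0), by fun_prop⟩

/-- The parallel copy of the component `b_i`, pushed off along the framing. -/
def pushoff (b : FramedLink g ι) (i : ι) : C(UnitAddCircle, Cylinder g) :=
  (b.ribbon i).comp ⟨fun s => (s, 1), by fun_prop⟩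

/-- The class in `H₁(Σ_{g,1}; ℤ)` of the projection of the component `b_i`. -/
def projClass (b : FramedLink g ι) (i : ι) : H1 (Surface g) :=
  loopClass ((proj g).comp (b.core i))

/-- The components of the link represent a basis of `H₁(Σ_{g,1} × I; ℤ)`. -/
def IsBasisLink (b : FramedLink g ι) : Prop :=
  LinearIndependent ℤ (fun i => loopClass (b.core i)) ∧
    Submodule.span ℤ (Set.range fun i => loopClass (b.core i)) = ⊤

/-- Isotopy of oriented framed links. -/
def Isotopic (b b' : FramedLink g ι) : Prop :=
  ∃ F : I → FramedLink g ι, F 0 = b ∧ F 1 = b' ∧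
    ∀ i, Continuous fun z : I × (UnitAddCircle × I) => (F z.1).ribbon i z.2

end FramedLink

/-! ### The form induced by a framed link -/

/-- At the parameters `z = (s, t)` the projections of the curves `K` and `L` cross
transversely with sign `ε` and `K` passes over `L`. -/
def OvercrossesWithSign {g : ℕ} (ε : ℤ) (K L : C(UnitAddCircle, Cylinder g))
    (z : UnitAddCircle × UnitAddCircle) : Prop :=
  CrossesWithSign ε ((proj g).comp K) ((proj g).comp L) z ∧ (L z.2).2 < (K z.1).2

/-- The sum of the signs of those crossings of the projections of `K` and `L` at which `K` passes
over `L`. -/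
def overcrossingSum {g : ℕ} (K L : C(UnitAddCircle, Cylinder g)) : ℤ :=
  (Set.ncard {z | OvercrossesWithSign 1 K L z} : ℤ) -
    Set.ncard {z | OvercrossesWithSign (-1) K L z}

/-- `K` and `L` are in general position as far as the overcrossings of `K` are concerned: where
their projections meet, either `K` is below `L`, or `K` is above `L` and the projections cross
transversely. -/
def OverTransverse {g : ℕ} (K L : C(UnitAddCircle, Cylinder g)) : Prop :=
  ∀ z : UnitAddCircle × UnitAddCircle, (K z.1).1 = (L z.2).1 →
    (K z.1).2 < (L z.2).2 ∨
      ((L z.2).2 < (K z.1).2 ∧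
        CrossesTransversely ((proj g).comp K) ((proj g).comp L) z)

/-- `n` is the signed number of overcrossings of `K` over `L`, for arbitrary curves `K` and `L`:
the curves can be brought to general position by arbitrarily small perturbations, and `n` is
the sum of the signs of the overcrossings after every such perturbation. -/
def HasOvercrossingNumber {g : ℕ} (K L : C(UnitAddCircle, Cylinder g)) (n : ℤ) : Prop :=
  (∃ᶠ P in 𝓝 (K, L), OverTransverse P.1 P.2) ∧
    ∀ᶠ P in 𝓝 (K, L), OverTransverse P.1 P.2 → overcrossingSum P.1 P.2 = n

namespace FramedLink

variable {g : ℕ} {ι : Type}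

/-- `Φ` is the form induced by the framed link `b`: the number `Φ([b_i], [b_j])` is the signed
number of overcrossings of `b_i` over the parallel copy of `b_j` (for `i ≠ j`, equivalently, over
`b_j` itself). -/
def Induces (b : FramedLink g ι) (Φ : H1 (Surface g) →ₗ[ℤ] H1 (Surface g) →ₗ[ℤ] ℤ) : Prop :=
  ∀ i j, HasOvercrossingNumber (b.core i) (b.pushoff j) (Φ (b.projClass i) (b.projClass j))

/-- A generic framed link: the framing points upwards in the direction of `I`, the projections
of the components are immersions, and all double points of the projection of the link are
transverse. -/
structure IsGeneric (b : FramedLink g ι) : Prop where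
  vertical : ∀ i s t, (b.ribbon i (s, t)).1 = (b.core i s).1
  upward : ∀ i s, (b.core i s).2 < (b.pushoff i s).2
  immersed : ∀ i s, ∃ c v, v ≠ 0 ∧ HasVelocity c ((proj g).comp (b.core i)) s v
  transverse : ∀ i j s t, (i, s) ≠ (j, t) → (b.core i s).1 = (b.core j t).1 →
    CrossesTransversely ((proj g).comp (b.core i)) ((proj g).comp (b.core j)) (s, t)

end FramedLink

/-- A form on `H₁(Σ_{g,1})`, regarded as a form on `H₁(Σ_{g,1} × I)` by means of the
isomorphism `p_* : H₁(Σ_{g,1} × I) → H₁(Σ_{g,1})`. -/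
def cylinderForm {g : ℕ} (Φ : H1 (Surface g) →ₗ[ℤ] H1 (Surface g) →ₗ[ℤ] ℤ)
    (x y : H1 (Cylinder g)) : ℤ :=
  Φ (H1.map (proj g) x) (H1.map (proj g) y)

/-! ### Graphs -/

/-- A finite graph with trivalent and univalent vertices, each connected component of which has a
trivalent vertex, with a cyclic order at every trivalent vertex and legs coloured by `H`.

The trivalent vertices are numbered; `(v, 0), (v, 1), (v, 2)` are the three half-edges at the
trivalent vertex `v`, in their cyclic order. Each half-edge `h` either is joined by an
edge of the graph to the half-edge `edge h ≠ h`, or ends in a univalent vertex, which is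
expressed by `edge h = h`; so the legs are the fixed points of `edge`. Only the values of `colour`
on the legs matter: graphs that agree except for the other values are isomorphic. -/
structure UniTriGraph (H : Type) where
  order : ℕ
  edge : Fin order × Fin 3 → Fin order × Fin 3
  edge_edge : Function.Involutive edge
  colour : Fin order × Fin 3 → H

namespace UniTriGraph

variable {H : Type}

/-- The half-edges at the trivalent vertices. -/
abbrev HalfEdge (Γ : UniTriGraph H) : Type := Fin Γ.order × Fin 3

/-- The legs (univalent vertices). -/
abbrev Leg (Γ : UniTriGraph H) : Type := {h : Γ.HalfEdge // Γ.edge h = h}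

/-- The empty graph. -/
def empty : UniTriGraph H where
  order := 0
  edge := id
  edge_edge := fun _ => rfl
  colour := fun h => h.1.elim0

/-- Two trivalent vertices are adjacent if an edge joins them. -/
def Adj (Γ : UniTriGraph H) (v w : Fin Γ.order) : Prop := ∃ i j, Γ.edge (v, i) = (w, j)

/-- The graph is connected (and not empty). -/
def Connected (Γ : UniTriGraph H) : Prop :=
  0 < Γ.order ∧ ∀ v w, Relation.ReflTransGen Γ.Adj v w

/-- An isomorphism of graphs with coloured legs, which need not respect the cyclic orders: a
bijection of the trivalent vertices together with a bijection of the half-edges at each of them. -/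
structure Iso (Γ Γ' : UniTriGraph H) where
  vertex : Fin Γ.order ≃ Fin Γ'.order
  perm : Fin Γ.order → Equiv.Perm (Fin 3)
  edge_map : ∀ h : Γ.HalfEdge, Γ'.edge (vertex h.1, perm h.1 h.2) =
    (vertex (Γ.edge h).1, perm (Γ.edge h).1 (Γ.edge h).2)
  colour_map : ∀ h : Γ.HalfEdge, Γ.edge h = h → Γ'.colour (vertex h.1, perm h.1 h.2) = Γ.colour h

/-- The sign of an isomorphism: `(-1)^k`, where `k` is the number of trivalent vertices at which the
cyclic order is reversed. -/
def Iso.sign {Γ Γ' : UniTriGraph H} (φ : Iso Γ Γ') : ℤ :=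
  ∏ v, (Equiv.Perm.sign (φ.perm v) : ℤ)

/-- Detach whatever is attached to the half-edges and attach it again after permuting the
half-edges by `ρ`: what was attached to `h` becomes attached to `ρ h`. -/
def permute (Γ : UniTriGraph H) (ρ : Equiv.Perm Γ.HalfEdge) : UniTriGraph H where
  order := Γ.order
  edge := fun h => ρ (Γ.edge (ρ.symm h))
  edge_edge := fun h => by simp [Γ.edge_edge (ρ.symm h)]
  colour := fun h => Γ.colour (ρ.symm h)

/-- The cyclic permutation `(v, 1) ↦ (v, 2) ↦ (w, 1) ↦ (v, 1)` of half-edges. -/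
def ihxCycle (Γ : UniTriGraph H) (v w : Fin Γ.order) : Equiv.Perm Γ.HalfEdge :=
  Equiv.swap (v, 1) (v, 2) * Equiv.swap (v, 2) (w, 1)

/-- Change the colour of one leg. -/
def recolour (Γ : UniTriGraph H) (h : Γ.Leg) (x : H) : UniTriGraph H where
  order := Γ.order
  edge := Γ.edge
  edge_edge := Γ.edge_edge
  colour := Function.update Γ.colour h.1 x

/-- The half-edges of a disjoint union. -/
def sumHalfEdge (m n : ℕ) : (Fin m × Fin 3) ⊕ (Fin n × Fin 3) ≃ Fin (m + n) × Fin 3 :=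
  (Equiv.sumProdDistrib (Fin m) (Fin n) (Fin 3)).symm.trans
    (Equiv.prodCongr finSumFinEquiv (Equiv.refl (Fin 3)))

/-- The edges of the graph that results from the disjoint union of `Γ` and `Γ'` by gluing the legs
of `Γ` in the domain of the partial bijection `m` to the corresponding legs of `Γ'`. -/
def glueEdge (Γ Γ' : UniTriGraph H) (m : Γ.Leg ≃. Γ'.Leg) :
    Γ.HalfEdge ⊕ Γ'.HalfEdge → Γ.HalfEdge ⊕ Γ'.HalfEdge
  | .inl h => if hh : Γ.edge h = h then
      (m ⟨h, hh⟩).elim (.inl h) (fun k => .inr k.1) else .inl (Γ.edge h)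
  | .inr k => if hk : Γ'.edge k = k then
      (m.symm ⟨k, hk⟩).elim (.inr k) (fun h => .inl h.1) else .inr (Γ'.edge k)

theorem glueEdge_involutive (Γ Γ' : UniTriGraph H) (m : Γ.Leg ≃. Γ'.Leg) :
    Function.Involutive (glueEdge Γ Γ' m) := by
  rintro (h | k)
  · by_cases hh : Γ.edge h = h
    · rcases hm : m ⟨h, hh⟩ with _ | k
      · simp [glueEdge, hh, hm]
      · have hk : m.symm k = some ⟨h, hh⟩ := (PEquiv.eq_some_iff m).2 hm
        simp [glueEdge, hh, hm, k.2, hk]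
    · have hh' : ¬ Γ.edge (Γ.edge h) = Γ.edge h := by
        rw [Γ.edge_edge h]; exact fun e => hh e.symm
      simp only [glueEdge, hh, hh', dite_false]
      rw [Γ.edge_edge h]
  · by_cases hk : Γ'.edge k = k
    · rcases hm : m.symm ⟨k, hk⟩ with _ | h
      · simp [glueEdge, hk, hm]
      · have hh : m h = some ⟨k, hk⟩ := (PEquiv.eq_some_iff m).1 hm
        simp [glueEdge, hk, hm, h.2, hh]
    · have hk' : ¬ Γ'.edge (Γ'.edge k) = Γ'.edge k := by
        rw [Γ'.edge_edge k]; exact fun e => hk e.symm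
      simp only [glueEdge, hk, hk', dite_false]
      rw [Γ'.edge_edge k]

/-- The graph obtained from the disjoint union of `Γ` and `Γ'` by gluing the legs of `Γ` in the
domain of `m` to the corresponding legs of `Γ'`. For `m = ⊥` this is the disjoint union. -/
def glue (Γ Γ' : UniTriGraph H) (m : Γ.Leg ≃. Γ'.Leg) : UniTriGraph H where
  order := Γ.order + Γ'.order
  edge := fun h => sumHalfEdge _ _ (glueEdge Γ Γ' m ((sumHalfEdge _ _).symm h))
  edge_edge := fun h => by simp [glueEdge_involutive Γ Γ' m ((sumHalfEdge _ _).symm h)]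
  colour := fun h => Sum.elim Γ.colour Γ'.colour ((sumHalfEdge _ _).symm h)

end UniTriGraph

/-! ### The group of graphs -/

section GraphSpace

variable (H : Type) [AddCommGroup H]

/-- The relators of the group of graphs. -/
inductive IsRelator : FreeAbelianGroup (UniTriGraph H) → Prop
  /-- Isomorphic graphs are equal, and (antisymmetry) reversing the cyclic order at one trivalent
  vertex changes the sign. -/
  | antisymmetry (Γ Γ' : UniTriGraph H) (φ : UniTriGraph.Iso Γ Γ') :
      IsRelator (FreeAbelianGroup.of Γ' - φ.sign • FreeAbelianGroup.of Γ)
  /-- The IHX relation (Jacobi identity) at an edge that joins two different vertices `v` and `w`: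
  the sum over the three cyclic permutations of the ends at `(v, 1)`, `(v, 2)` and `(w, 1)`. -/
  | ihx (Γ : UniTriGraph H) (v w : Fin Γ.order) (hvw : v ≠ w) (h : Γ.edge (v, 0) = (w, 0)) :
      IsRelator (FreeAbelianGroup.of Γ + FreeAbelianGroup.of (Γ.permute (Γ.ihxCycle v w)) +
        FreeAbelianGroup.of (Γ.permute (Γ.ihxCycle v w * Γ.ihxCycle v w)))
  /-- Linearity in the colour of each leg. -/
  | linear (Γ : UniTriGraph H) (h : Γ.Leg) (x y : H) :
      IsRelator (FreeAbelianGroup.of (Γ.recolour h (x + y)) -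
        FreeAbelianGroup.of (Γ.recolour h x) - FreeAbelianGroup.of (Γ.recolour h y))

/-- The abelian group `𝒜` generated by the graphs with legs coloured by `H`, modulo
antisymmetry, the IHX relation and linearity in the colours. -/
def GraphSpace : Type :=
  FreeAbelianGroup (UniTriGraph H) ⧸ AddSubgroup.closure {x | IsRelator H x}

instance : AddCommGroup (GraphSpace H) :=
  inferInstanceAs (AddCommGroup
    (FreeAbelianGroup (UniTriGraph H) ⧸ AddSubgroup.closure {x | IsRelator H x}))

end GraphSpace

section Star

variable {H : Type} [AddCommGroup H]

/-- The element of `𝒜` represented by a graph. -/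
def graphClass (Γ : UniTriGraph H) : GraphSpace H :=
  QuotientAddGroup.mk' (AddSubgroup.closure {x | IsRelator H x}) (FreeAbelianGroup.of Γ)

instance finite_pequiv (α β : Type) [Finite α] [Finite β] : Finite (α ≃. β) :=
  Finite.of_injective (fun (m : α ≃. β) (a : α) => m a) DFunLike.coe_injective

instance (α β : Type) [Finite α] [Finite β] : Fintype (α ≃. β) := Fintype.ofFinite _

/-- The number of pairs of legs that are glued. -/
def gluedPairs {α β : Type} [Fintype α] (m : α ≃. β) : ℕ :=
  (Finset.univ.filter fun a => (m a).isSome).card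

/-- The product of `⟨a, b⟩` over the colours `a, b` of all pairs of legs that are glued. -/
def weight (B : H → H → ℤ) (Γ Γ' : UniTriGraph H) (m : Γ.Leg ≃. Γ'.Leg) : ℤ :=
  ∏ a : Γ.Leg, (m a).elim 1 fun b => B (Γ.colour a) (Γ'.colour b)

/-- `⟨Γ, Γ'⟩_l`: `(-1)^l` times the sum over all ways to glue `l` legs of `Γ` to `l` legs of `Γ'`,
each weighted by the product of the values of the form `B` on the glued pairs. -/
def contraction (B : H → H → ℤ) (l : ℕ) (Γ Γ' : UniTriGraph H) : GraphSpace H :=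
  (-1 : ℤ) ^ l • ∑ m : Γ.Leg ≃. Γ'.Leg with gluedPairs m = l,
    weight B Γ Γ' m • graphClass (Γ.glue Γ' m)

/-- There are no terms with more glued pairs than legs: the sum over `l` in the definition of the
product is finite. -/
theorem contraction_eq_zero (B : H → H → ℤ) (Γ Γ' : UniTriGraph H) (l : ℕ)
    (hl : Fintype.card Γ.Leg < l) : contraction B l Γ Γ' = 0 := by
  have : (Finset.univ.filter fun m : Γ.Leg ≃. Γ'.Leg => gluedPairs m = l) = ∅ := by
    refine Finset.filter_eq_empty_iff.2 fun m _ h => ?_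
    have := Finset.card_filter_le (Finset.univ : Finset Γ.Leg) fun a => (m a).isSome
    rw [Finset.card_univ] at this
    unfold gluedPairs at h
    omega
  rw [contraction, this, Finset.sum_empty, smul_zero]

/-- An associative, unital `∗`-product on `𝒜`: a biadditive product given on graphs by
`Γ ∗ Γ' = ∑_l ⟨Γ, Γ'⟩_l`, with the empty graph as unit. -/
structure StarProduct (B : H → H → ℤ) where
  mul : GraphSpace H →+ GraphSpace H →+ GraphSpace H
  mul_graphClass : ∀ Γ Γ' : UniTriGraph H,
    mul (graphClass Γ) (graphClass Γ') = ∑ᶠ l : ℕ, contraction B l Γ Γ'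
  mul_assoc : ∀ x y z, mul (mul x y) z = mul x (mul y z)
  one_mul : ∀ x, mul (graphClass UniTriGraph.empty) x = x
  mul_one : ∀ x, mul x (graphClass UniTriGraph.empty) = x

namespace StarProduct

variable {B : H → H → ℤ}

/-- The group `𝒜`, regarded as a ring with the `∗`-product. -/
def Carrier (_S : StarProduct B) : Type := GraphSpace H

instance (S : StarProduct B) : AddCommGroup S.Carrier :=
  inferInstanceAs (AddCommGroup (GraphSpace H))

instance (S : StarProduct B) : Ring S.Carrier where
  __ := (inferInstance : AddCommGroup S.Carrier)
  mul x y := S.mul x y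
  one := graphClass UniTriGraph.empty
  left_distrib x y z := (S.mul x).map_add y z
  right_distrib x y z := DFunLike.congr_fun (S.mul.map_add x y) z
  zero_mul x := DFunLike.congr_fun S.mul.map_zero x
  mul_zero x := (S.mul x).map_zero
  mul_assoc := S.mul_assoc
  one_mul := S.one_mul
  mul_one := S.mul_one

/-- The bracket of `𝒜` is the commutator `x ∗ y - y ∗ x`. -/
instance (S : StarProduct B) : LieRing S.Carrier := LieRing.ofAssociativeRing

/-- The element of the ring represented by a graph. -/
def ofGraph (S : StarProduct B) (Γ : UniTriGraph H) : S.Carrier := graphClass Γ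

/-- `𝒜ᶜ`: the subgroup generated by the connected graphs. -/
def connectedPart (S : StarProduct B) : AddSubgroup S.Carrier :=
  AddSubgroup.closure {x | ∃ Γ : UniTriGraph H, Γ.Connected ∧ x = S.ofGraph Γ}

end StarProduct

end Star

end

end FramedGraph

/-!
# The form of a framed link and the star product of graphs

**The form.** For disjoint curves `K`, `L` in the cylinder, the overcrossing number is computed as
an index that makes sense for all continuous curves. Surface points are represented by points of
the rectangle (`rep`). For a pair `(u, v)` of them, the *wall* is the set where `v` lies vertically
above `u`. Its cochain (`wallX`, `wallY`) counts the passages of a discretized pair of curves through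
the wall, and its coboundary `wallD` on a grid square is a local intersection number: away from the
diagonal it vanishes, except when the two points jump through the two interlocked seams of a handle
(`wallD_eq_interlock`). The index `loopIndex` is the sum of `wallD` over the grid squares at which
`K` runs above and near `L`; near the diagonal there are no interlocked jumps, so summation by parts
shows that the index is locally constant on pairs of disjoint curves (`exists_nhds_loopIndex_eq`).
In a flat chart, the sum around a transverse crossing is the sign of the crossing
(`CrossesWithSign.exists_sum_eq`), so the index of a pair in general position is the signed number
of overcrossings (`OverTransverse.eventually_loopIndex_eq`). Every pair of curves on the surface is
close to a transverse pair: push it into the interior, and follow it by staircase loops on disjoint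
grids, one rational and one irrational (`exists_transverse`). Hence every disjoint pair has an
overcrossing number, which is invariant under isotopy.

If `K` lies above `L` everywhere, the sum of the coboundary over *all* squares is zero, and what is
left of the index is the count of interlocked jumps (`gridIndex_above`). The jumps through a seam are
counted by a winding number, hence by a homomorphism on homology (`exists_seamHom`). This gives the
intersection form. Every crossing of `K` and `L` is an overcrossing of `K` over `L` or, with the
opposite sign, of `L` over `K`; thus the antisymmetrization of the form of the link is the
intersection form.

**The product.** A way to glue legs of two graphs is an involution of the half-edges of their disjoint
union that extends the edge involution (`Extension`). With the weight `-B` for a pair of legs of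
different factors, the star product is the weighted sum over all extensions (`star`, `extSum`); this
sum is compatible with the relations in each factor. Associativity holds since both bracketings are
the weighted sum over the ways to join legs of different factors of a triple disjoint union
(`sum_star_extend`). Gluings correspond to the extensions of nonzero weight (`glueExtension`), which
identifies the star product with the sum of contractions.

**The Lie subring.** The term without glued legs is symmetric. In all other terms the factors are
joined, so that for connected factors the result is connected. The number of components is measured
by the number of saturated sets of vertices (`two_mul_saturatedCount_extend_le`).

**The enveloping algebra.** The algebra map `universalHom` is surjective by induction on the number of
components: the star product of a connected graph with a graph is their disjoint union up to graphs
with fewer components (`star_sub_sum_mem`). For injectivity, `symmetrize n` sends a graph with `n`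
components to the sum over all orders of the product of its components in the enveloping algebra, and
all other graphs to zero; it is built by splitting off components one by one (`peel`). On products of
at most `n` factors, `symmetrize n` inverts `universalHom` up to the factor `n!` and up to products of
fewer factors (`rationalSymmetrize_comp`), so over `ℚ` the kernel is zero by induction on `n`. No
Poincaré-Birkhoff-Witt theorem is needed.
-/

namespace FramedGraph

noncomputable section

open scoped unitInterval Topology

local notation "𝕋" => UnitAddCircle

section

open scoped Simplicial
open CategoryTheory

/-! ### Singular homology of loops -/

lemma H1.map_loopClass {X Y : Type} [TopologicalSpace X] [TopologicalSpace Y] (f : C(X, Y))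
    (γ : C(𝕋, X)) : H1.map f (loopClass γ) = loopClass (f.comp γ) := by
  have hs : (TopCat.toSSet.map (TopCat.ofHom f)).app (.op ⦋1⦌) (loopSimplex γ) =
      loopSimplex (f.comp γ) := rfl
  have h1 : loopCycle γ ≫ HomologicalComplex.cyclesMap
      (SSet.chainComplexMap (TopCat.toSSet.map (TopCat.ofHom f)) (ModuleCat.of ℤ ℤ)) 1 =
      loopCycle (f.comp γ) := by
    rw [← cancel_mono (HomologicalComplex.iCycles _ _)]
    simp only [loopCycle, Category.assoc, HomologicalComplex.cyclesMap_i,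
      HomologicalComplex.liftCycles_i_assoc, HomologicalComplex.liftCycles_i]
    rw [SSet.ι_chainComplexMap_f, hs]
  have h2 : (loopCycle γ ≫ HomologicalComplex.homologyπ _ 1) ≫ HomologicalComplex.homologyMap
      (SSet.chainComplexMap (TopCat.toSSet.map (TopCat.ofHom f)) (ModuleCat.of ℤ ℤ)) 1 =
      loopCycle (f.comp γ) ≫ HomologicalComplex.homologyπ _ 1 := by
    rw [← h1, Category.assoc, HomologicalComplex.homologyπ_naturality, Category.assoc]
  exact congrArg (fun m => m.hom (1 : ℤ)) h2

lemma H1.map_comp {X Y Z : Type} [TopologicalSpace X] [TopologicalSpace Y] [TopologicalSpace Z]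
    (f : C(X, Y)) (h : C(Y, Z)) (x : H1 X) : H1.map (h.comp f) x = H1.map h (H1.map f x) := by
  have := (((AlgebraicTopology.singularHomologyFunctor (ModuleCat.{0} ℤ) 1).obj
    (ModuleCat.of ℤ ℤ)).map_comp (TopCat.ofHom f) (TopCat.ofHom h))
  exact congrArg (fun m => m.hom x) this

lemma H1.map_id {X : Type} [TopologicalSpace X] (x : H1 X) :
    H1.map (ContinuousMap.id X) x = x := by
  have := (((AlgebraicTopology.singularHomologyFunctor (ModuleCat.{0} ℤ) 1).obj
    (ModuleCat.of ℤ ℤ)).map_id (TopCat.of X))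
  exact congrArg (fun m => m.hom x) this

lemma H1.map_eq_of_homotopic {X Y : Type} [TopologicalSpace X] [TopologicalSpace Y]
    {f h : C(X, Y)} (H : f.Homotopic h) : H1.map f = H1.map h := by
  obtain ⟨H⟩ := H
  have H' : TopCat.Homotopy (TopCat.ofHom f) (TopCat.ofHom h) := H
  exact congrArg (fun m => m.hom)
    (H'.congr_homologyMap_singularChainComplexFunctor (ModuleCat.of ℤ ℤ) 1)

lemma loopClass_eq_of_homotopic {X : Type} [TopologicalSpace X] {γ γ' : C(𝕋, X)}
    (H : γ.Homotopic γ') : loopClass γ = loopClass γ' := by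
  have h := H1.map_loopClass γ (ContinuousMap.id _)
  have h' := H1.map_loopClass γ' (ContinuousMap.id _)
  rw [H1.map_eq_of_homotopic H] at h
  exact h.symm.trans h'

/-- The projection of a cylinder induces an isomorphism on `H₁`. -/
lemma H1.map_proj_bijective (g : ℕ) : Function.Bijective (H1.map (proj g)) := by
  let s : C(Surface g, Cylinder g) := ⟨fun x => (x, 0), by fun_prop⟩
  have h1 : ∀ x, H1.map (proj g) (H1.map s x) = x := fun x => by
    rw [← H1.map_comp]; exact H1.map_id x
  have hh : (s.comp (proj g)).Homotopic (ContinuousMap.id (Cylinder g)) :=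
    ⟨{ toFun := fun z => (z.2.1, z.1 * z.2.2)
       continuous_toFun := by fun_prop
       map_zero_left := fun x => by ext <;> simp [s, proj]
       map_one_left := fun x => by ext <;> simp }⟩
  have h2 : ∀ x, H1.map s (H1.map (proj g) x) = x := fun x => by
    rw [← H1.map_comp, H1.map_eq_of_homotopic hh]; exact H1.map_id x
  exact ⟨Function.LeftInverse.injective h2, Function.RightInverse.surjective h1⟩

/-- An integral singular `1`-cocycle defines a homomorphism `H₁(X) → ℤ`. -/
lemma exists_hom_of_cocycle {X : Type} [TopologicalSpace X]
    (φ : (TopCat.toSSet.obj (TopCat.of X)) _⦋1⦌ → ℤ)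
    (hφ : ∀ τ : (TopCat.toSSet.obj (TopCat.of X)) _⦋2⦌,
      φ ((TopCat.toSSet.obj (TopCat.of X)).δ 0 τ) - φ ((TopCat.toSSet.obj (TopCat.of X)).δ 1 τ) +
        φ ((TopCat.toSSet.obj (TopCat.of X)).δ 2 τ) = 0) :
    ∃ h : H1 X →ₗ[ℤ] ℤ, ∀ γ : C(𝕋, X), h (loopClass γ) = φ (loopSimplex γ) := by
  obtain ⟨d, hd⟩ : ∃ d : ((TopCat.toSSet.obj (TopCat.of X)).chainComplex (ModuleCat.of ℤ ℤ)).X 1 ⟶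
      ModuleCat.of ℤ ℤ, ∀ e, (TopCat.toSSet.obj (TopCat.of X)).ιChainComplex e ≫ d =
        φ e • 𝟙 (ModuleCat.of ℤ ℤ) :=
    ⟨Limits.Cofan.IsColimit.desc
      ((TopCat.toSSet.obj (TopCat.of X)).isColimitChainComplexXCofan (ModuleCat.of ℤ ℤ) 1)
      (fun e => φ e • 𝟙 (ModuleCat.of ℤ ℤ)), fun e => Limits.Cofan.IsColimit.fac _ _ e⟩
  have hd0 : ((TopCat.toSSet.obj (TopCat.of X)).chainComplex (ModuleCat.of ℤ ℤ)).d 2 1 ≫ d = 0 := by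
    apply SSet.chainComplex_hom_ext
    intro τ
    rw [SSet.ιChainComplex_d_assoc, Limits.comp_zero, Preadditive.sum_comp, Fin.sum_univ_three]
    simp only [Preadditive.zsmul_comp, hd]
    simp only [Fin.val_zero, Fin.val_one, Fin.val_two, pow_zero, pow_one, even_two,
      Even.neg_pow, one_pow, one_smul, neg_smul]
    rw [← neg_smul, ← add_smul, ← add_smul, ← sub_eq_add_neg, hφ τ, zero_smul]
  let m := HomologicalComplex.homologyι
      ((TopCat.toSSet.obj (TopCat.of X)).chainComplex (ModuleCat.of ℤ ℤ)) 1 ≫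
    HomologicalComplex.descOpcycles _ d 2 (ChainComplex.prev ℕ 1) hd0
  refine ⟨m.hom, fun γ => ?_⟩
  have h : (loopCycle γ ≫ HomologicalComplex.homologyπ _ 1) ≫ m =
      φ (loopSimplex γ) • 𝟙 (ModuleCat.of ℤ ℤ) := by
    rw [Category.assoc, HomologicalComplex.homology_π_ι_assoc, HomologicalComplex.p_descOpcycles,
      loopCycle, HomologicalComplex.liftCycles_i_assoc, hd]
  have h' := congrArg (fun m => m.hom (1 : ℤ)) h
  refine h'.trans ?_
  simp

lemma exists_lift_unitAddCircle {A : Type} [TopologicalSpace A] [ContractibleSpace A]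
    (f : C(A, 𝕋)) : ∃ F : C(A, ℝ), ∀ a, (F a : 𝕋) = f a := by
  obtain ⟨y, ⟨H⟩⟩ := id_nullhomotopic A
  obtain ⟨r, hr⟩ := QuotientAddGroup.mk_surjective (f y)
  let G : C(I × A, 𝕋) := f.comp H.symm.toContinuousMap
  have cov := AddCircle.isCoveringMap_coe (1 : ℝ)
  have h0 : ∀ a, G (0, a) = ((ContinuousMap.const A r a : ℝ) : 𝕋) := fun a => by
    simp only [G, ContinuousMap.comp_apply]
    erw [H.symm.apply_zero]
    exact hr.symm
  refine ⟨(cov.liftHomotopy G (ContinuousMap.const A r) h0).comp ⟨fun a => (1, a), by fun_prop⟩,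
    fun a => ?_⟩
  have := congrFun (cov.liftHomotopy_lifts G (ContinuousMap.const A r) h0) (1, a)
  refine this.trans ?_
  simp only [G, ContinuousMap.comp_apply]
  erw [H.symm.apply_one]
  rfl

lemma lift_sub_lift_eq {A : Type} [TopologicalSpace A] [PreconnectedSpace A] (F F' : C(A, ℝ))
    (h : ∀ a, (F a : 𝕋) = F' a) (a b : A) : F b - F a = F' b - F' a := by
  have h1 : ∀ a, ∃ n : ℤ, F a - F' a = n := fun a => by
    have := (QuotientAddGroup.eq (s := AddSubgroup.zmultiples (1 : ℝ))).1 (h a)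
    obtain ⟨n, hn⟩ := AddSubgroup.mem_zmultiples_iff.1 this
    refine ⟨-n, ?_⟩
    simp at hn
    push_cast; linarith
  choose n hn using h1
  have hc : Continuous fun a => n a := by
    rw [Int.isClosedEmbedding_coe_real.isEmbedding.continuous_iff]
    have : ((fun m : ℤ => (m : ℝ)) ∘ fun a => n a) = fun a => F a - F' a := by
      ext a; exact (hn a).symm
    rw [this]; fun_prop
  have := PreconnectedSpace.constant (α := A) inferInstance hc (x := a) (y := b)
  have h2 := hn a
  have h3 := hn b
  rw [this] at h2
  linarith

instance contractibleSpace_stdSimplex (n : ℕ) : ContractibleSpace (stdSimplex ℝ (Fin (n + 1))) :=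
  (convex_stdSimplex ℝ (Fin (n + 1))).contractibleSpace ⟨_, (stdSimplex.vertex (S := ℝ) 0).2⟩

/-- A map to the circle defines a homomorphism `H₁(X) → ℤ`: the winding number, that is, the
difference of the end points of a real lift of the composite loop. -/
lemma exists_windingHom {X : Type} [TopologicalSpace X] (f : C(X, 𝕋)) :
    ∃ h : H1 X →ₗ[ℤ] ℤ, ∀ (γ : C(𝕋, X)) (G : C(I, ℝ)),
      (∀ t : I, (G t : 𝕋) = f (γ ((t : ℝ) : 𝕋))) →
      (h (loopClass γ) : ℝ) = G 1 - G 0 := by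
  obtain ⟨U, hU⟩ : ∃ U : X → ℝ, ∀ x, (U x : 𝕋) = f x :=
    ⟨fun x => Quotient.out (f x), fun x => Quotient.out_eq _⟩
  let ev : ∀ {n : ℕ}, (TopCat.toSSet.obj (TopCat.of X)) _⦋n⦌ → C(stdSimplex ℝ (Fin (n + 1)), X) :=
    fun {n} e => (TopCat.of X).toSSetObjEquiv (.op ⦋n⦌) e
  have key : ∀ e : (TopCat.toSSet.obj (TopCat.of X)) _⦋1⦌, ∃ n : ℤ,
      ∀ F : C(stdSimplex ℝ (Fin 2), ℝ), (∀ a, (F a : 𝕋) = f (ev e a)) →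
      (n : ℝ) = (F (stdSimplex.vertex 1) - U (ev e (stdSimplex.vertex 1))) -
        (F (stdSimplex.vertex 0) - U (ev e (stdSimplex.vertex 0))) := by
    intro e
    obtain ⟨F, hF⟩ := exists_lift_unitAddCircle (f.comp (ev e))
    have h1 : ∀ a, ∃ n : ℤ, F a - U (ev e a) = n := fun a => by
      have : ((F a : ℝ) : 𝕋) = U (ev e a) := by rw [hU, hF]; rfl
      have := (QuotientAddGroup.eq (s := AddSubgroup.zmultiples (1 : ℝ))).1 this
      obtain ⟨n, hn⟩ := AddSubgroup.mem_zmultiples_iff.1 this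
      refine ⟨-n, ?_⟩
      simp at hn
      push_cast; linarith
    obtain ⟨n0, h0⟩ := h1 (stdSimplex.vertex 0)
    obtain ⟨n1, h1⟩ := h1 (stdSimplex.vertex 1)
    refine ⟨n1 - n0, fun F' hF' => ?_⟩
    have := lift_sub_lift_eq F F' (fun a => (hF a).trans (hF' a).symm) (stdSimplex.vertex 0)
      (stdSimplex.vertex 1)
    push_cast
    linarith
  choose φ hφ using key
  have hc : ∀ τ : (TopCat.toSSet.obj (TopCat.of X)) _⦋2⦌,
      φ ((TopCat.toSSet.obj (TopCat.of X)).δ 0 τ) - φ ((TopCat.toSSet.obj (TopCat.of X)).δ 1 τ) +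
        φ ((TopCat.toSSet.obj (TopCat.of X)).δ 2 τ) = 0 := by
    intro τ
    obtain ⟨F, hF⟩ := exists_lift_unitAddCircle (f.comp (ev τ))
    have hd : ∀ i : Fin 3, (φ ((TopCat.toSSet.obj (TopCat.of X)).δ i τ) : ℝ) =
        (F (stdSimplex.vertex (i.succAbove 1)) - U (ev τ (stdSimplex.vertex (i.succAbove 1)))) -
        (F (stdSimplex.vertex (i.succAbove 0)) - U (ev τ (stdSimplex.vertex (i.succAbove 0)))) := by
      intro i
      have he : ∀ z, ev ((TopCat.toSSet.obj (TopCat.of X)).δ i τ) z =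
          ev τ (stdSimplex.map i.succAbove z) := fun z => TopCat.toSSetObjEquiv_δ_apply _ _ _
      have := hφ ((TopCat.toSSet.obj (TopCat.of X)).δ i τ)
        (F.comp ⟨stdSimplex.map i.succAbove, by continuity⟩) (fun a => by
          rw [he]; exact hF _)
      rw [this, he, he]
      simp only [ContinuousMap.comp_apply, ContinuousMap.coe_mk, stdSimplex.map_vertex]
    have h0 := hd 0
    have h1 := hd 1
    have h2 := hd 2
    have : (((φ ((TopCat.toSSet.obj (TopCat.of X)).δ 0 τ) -
      φ ((TopCat.toSSet.obj (TopCat.of X)).δ 1 τ) +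
        φ ((TopCat.toSSet.obj (TopCat.of X)).δ 2 τ) : ℤ)) : ℝ) = 0 := by
      push_cast
      rw [h0, h1, h2]
      have e1 : (0 : Fin 3).succAbove (1 : Fin 2) = 2 := rfl
      have e2 : (0 : Fin 3).succAbove (0 : Fin 2) = 1 := rfl
      have e3 : (1 : Fin 3).succAbove (1 : Fin 2) = 2 := rfl
      have e4 : (1 : Fin 3).succAbove (0 : Fin 2) = 0 := rfl
      have e5 : (2 : Fin 3).succAbove (1 : Fin 2) = 1 := rfl
      have e6 : (2 : Fin 3).succAbove (0 : Fin 2) = 0 := rfl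
      rw [e1, e2, e3, e4, e5, e6]
      ring
    exact_mod_cast this
  obtain ⟨h, hh⟩ := exists_hom_of_cocycle φ hc
  refine ⟨h, fun γ G hG => ?_⟩
  rw [hh]
  have he : ∀ z, ev (loopSimplex γ) z =
      γ (((stdSimplexHomeomorphUnitInterval z : I) : ℝ) : 𝕋) := fun z => by
    simp only [ev, loopSimplex]
    erw [Equiv.apply_symm_apply]
    rfl
  have v0 : stdSimplexHomeomorphUnitInterval (stdSimplex.vertex (S := ℝ) (0 : Fin 2)) = 0 := rfl
  have v1 : stdSimplexHomeomorphUnitInterval (stdSimplex.vertex (S := ℝ) (1 : Fin 2)) = 1 := rfl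
  rw [hφ (loopSimplex γ) (G.comp ⟨stdSimplexHomeomorphUnitInterval, by fun_prop⟩)
    (fun a => by rw [he]; exact hG _), he, he]
  simp only [ContinuousMap.comp_apply, ContinuousMap.coe_mk, v0, v1]
  have : (((1 : I) : ℝ) : 𝕋) = (((0 : I) : ℝ) : 𝕋) := by
    simp
  rw [this]
  ring

end

section

/-! ### Closeness of points of the rectangle and the wall cochain -/

lemma slot_eq {g : ℕ} (i : Fin g) (r : Fin 2) : (slot i r : ℝ) = ((4 * i.val + r.val : ℕ) : ℝ) := by
  simp [slot]

lemma slot_lt_or_lt {g : ℕ} {i j : Fin g} {r s : Fin 2} (h : (i, r) ≠ (j, s)) :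
    slot i r + 1 ≤ slot j s ∨ slot j s + 1 ≤ slot i r := by
  simp only [slot_eq]
  norm_cast
  have := r.isLt; have := s.isLt
  by_contra! hc
  apply h
  have h1 : i.val = j.val := by omega
  have h2 : r.val = s.val := by omega
  exact Prod.ext (Fin.ext h1) (Fin.ext h2)

/-- No left slot is a right slot. -/
lemma slot_ne_right {g : ℕ} (i j : Fin g) (r s : Fin 2) :
    slot i r + 3 ≤ slot j s ∨ slot j s ≤ slot i r + 1 := by
  simp only [slot_eq]
  norm_cast
  have := r.isLt; have := s.isLt
  by_contra! hc
  omega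

lemma slot_nonneg {g : ℕ} (i : Fin g) (r : Fin 2) : (0 : ℝ) ≤ slot i r := by
  rw [slot_eq]; positivity

lemma slot_le {g : ℕ} (i : Fin g) (r : Fin 2) : slot i r + 3 ≤ 4 * g := by
  rw [slot_eq]; norm_cast; have := r.isLt; have := i.isLt; omega

/-- Two points of the plane have sup distance less than `μ`. -/
def Near (μ : ℝ) (u v : ℝ × ℝ) : Prop := |u.1 - v.1| < μ ∧ |u.2 - v.2| < μ

/-- The point `u` is within `μ` of a point `(p, 1)` of the left slot of a seam, and `v` is within
`μ` of the point to which `(p, 1)` is glued. -/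
def JumpAt {g : ℕ} (μ : ℝ) (a : Fin g × Fin 2) (u v : ℝ × ℝ) : Prop :=
  ∃ p, slot a.1 a.2 + 1 / 4 ≤ p ∧ p ≤ slot a.1 a.2 + 3 / 4 ∧ Near μ u (p, 1) ∧
    Near μ v (2 * slot a.1 a.2 + 3 - p, 1)

/-- Points of the rectangle that are close in the surface: directly, or across a seam. -/
def Close (g : ℕ) (μ : ℝ) (u v : ℝ × ℝ) : Prop :=
  Near μ u v ∨ ∃ a : Fin g × Fin 2, JumpAt μ a u v ∨ JumpAt μ a v u

/-- The indicator of the event that `v` lies to the left of `u`. -/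
def leftInd (u v : ℝ × ℝ) : ℤ := if v.1 < u.1 then 1 else 0

/-- The wall cochain on a step `u → u'` of the first point: it counts the passages of `v` through
the vertical ray above the first point. At a jump across a seam the first point is at the top, so
that nothing lies above it. -/
def wallX (u u' v : ℝ × ℝ) : ℤ :=
  if |u.1 - u'.1| < 1 ∧ u.2 < v.2 then leftInd u v - leftInd u' v else 0

/-- The wall cochain on a step `v → v'` of the second point. At a jump across a seam the second
point is at the top, above every other point. -/
def wallY (u v v' : ℝ × ℝ) : ℤ :=
  if u.2 < v.2 ∨ 1 ≤ |v.1 - v'.1| then leftInd u v - leftInd u v' else 0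

/-- The coboundary of the wall cochain on a square. -/
def wallD (u u' v v' : ℝ × ℝ) : ℤ := wallX u u' v + wallY u' v v' - wallX u u' v' - wallY u v v'

variable {g : ℕ} {μ ν : ℝ} {u u' u'' v v' v'' : ℝ × ℝ} {a b : Fin g × Fin 2}

lemma Near.symm (h : Near μ u v) : Near μ v u := by
  unfold Near at *; rwa [abs_sub_comm, abs_sub_comm v.2]

lemma Near.trans (h : Near μ u v) (h' : Near ν v v') : Near (μ + ν) u v' := by
  obtain ⟨h1, h2⟩ := h; obtain ⟨h3, h4⟩ := h'
  constructor
  · have := abs_sub_le u.1 v.1 v'.1; linarith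
  · have := abs_sub_le u.2 v.2 v'.2; linarith

lemma Near.mono (h : Near μ u v) (hμ : μ ≤ ν) : Near ν u v := ⟨h.1.trans_le hμ, h.2.trans_le hμ⟩

lemma JumpAt.mono (h : JumpAt μ a u v) (hμ : μ ≤ ν) : JumpAt ν a u v := by
  obtain ⟨p, h1, h2, h3, h4⟩ := h
  exact ⟨p, h1, h2, h3.mono hμ, h4.mono hμ⟩

lemma Close.mono (h : Close g μ u v) (hμ : μ ≤ ν) : Close g ν u v := by
  rcases h with h | ⟨a, h | h⟩
  · exact .inl (h.mono hμ)
  · exact .inr ⟨a, .inl (h.mono hμ)⟩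
  · exact .inr ⟨a, .inr (h.mono hμ)⟩

lemma Close.symm (h : Close g μ u v) : Close g μ v u := by
  rcases h with h | ⟨a, h | h⟩
  · exact .inl h.symm
  · exact .inr ⟨a, .inr h⟩
  · exact .inr ⟨a, .inl h⟩

lemma Close.refl (hμ : 0 < μ) : Close g μ u u := .inl ⟨by simpa, by simpa⟩

lemma JumpAt.left_bounds (h : JumpAt μ a u v) : slot a.1 a.2 + 1 / 4 - μ < u.1 ∧
    u.1 < slot a.1 a.2 + 3 / 4 + μ ∧ 1 - μ < u.2 ∧ u.2 < 1 + μ := by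
  obtain ⟨p, h1, h2, ⟨h3, h4⟩, h5, h6⟩ := h
  rw [abs_lt] at *
  refine ⟨?_, ?_, ?_, ?_⟩ <;> simp only at * <;> linarith

lemma JumpAt.right_bounds (h : JumpAt μ a u v) : slot a.1 a.2 + 9 / 4 - μ < v.1 ∧
    v.1 < slot a.1 a.2 + 11 / 4 + μ ∧ 1 - μ < v.2 ∧ v.2 < 1 + μ := by
  obtain ⟨p, h1, h2, ⟨h3, h4⟩, h5, h6⟩ := h
  rw [abs_lt] at *
  refine ⟨?_, ?_, ?_, ?_⟩ <;> simp only at * <;> linarith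

lemma JumpAt.sum_bounds (h : JumpAt μ a u v) : |u.1 + v.1 - (2 * slot a.1 a.2 + 3)| < 2 * μ := by
  obtain ⟨p, h1, h2, ⟨h3, h4⟩, h5, h6⟩ := h
  rw [abs_lt] at *
  constructor <;> simp only at * <;> linarith

lemma JumpAt.one_le_abs (h : JumpAt μ a u v) (hμ : μ ≤ 1 / 8) : 1 ≤ |u.1 - v.1| := by
  have h1 := h.left_bounds; have h2 := h.right_bounds
  rw [le_abs]; right; linarith

lemma JumpAt.trans_near (h : JumpAt μ a u v) (h' : Near ν v v') : JumpAt (μ + ν) a u v' := by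
  obtain ⟨p, h1, h2, h3, h4⟩ := h
  have : 0 ≤ ν := (abs_nonneg _).trans h'.1.le
  exact ⟨p, h1, h2, h3.mono (by linarith), (h'.symm.trans h4).mono (by linarith)⟩

lemma JumpAt.near_trans (h' : Near ν u' u) (h : JumpAt μ a u v) : JumpAt (μ + ν) a u' v := by
  obtain ⟨p, h1, h2, h3, h4⟩ := h
  have : 0 ≤ ν := (abs_nonneg _).trans h'.1.le
  exact ⟨p, h1, h2, (h'.trans h3).mono (by linarith), h4.mono (by linarith)⟩

lemma JumpAt.eq_of_left (h : JumpAt μ a u v) (h' : JumpAt ν b u v') (hμ : μ ≤ 1 / 8)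
    (hν : ν ≤ 1 / 8) : a = b := by
  by_contra hab
  have h1 := h.left_bounds; have h2 := h'.left_bounds
  rcases slot_lt_or_lt (i := a.1) (r := a.2) (j := b.1) (s := b.2) hab with h | h <;> linarith

lemma JumpAt.eq_of_right (h : JumpAt μ a u v) (h' : JumpAt ν b u' v) (hμ : μ ≤ 1 / 8)
    (hν : ν ≤ 1 / 8) : a = b := by
  by_contra hab
  have h1 := h.right_bounds; have h2 := h'.right_bounds
  rcases slot_lt_or_lt (i := a.1) (r := a.2) (j := b.1) (s := b.2) hab with h | h <;> linarith

lemma JumpAt.not_left_right (h : JumpAt μ a u v) (h' : JumpAt ν b v v') (hμ : μ ≤ 1 / 8)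
    (hν : ν ≤ 1 / 8) : False := by
  have h1 := h.right_bounds; have h2 := h'.left_bounds
  rcases slot_ne_right a.1 b.1 a.2 b.2 with h | h <;> linarith

/-- Two jumps in opposite directions lead to a nearby point. -/
lemma JumpAt.near_of_left (h : JumpAt μ a u v) (h' : JumpAt ν a u v') : Near (2 * (μ + ν)) v v' := by
  obtain ⟨p, h1, h2, ⟨h3, h4⟩, h5, h6⟩ := h
  obtain ⟨q, k1, k2, ⟨k3, k4⟩, k5, k6⟩ := h'
  simp only [abs_lt] at *
  unfold Near
  simp only [abs_lt]
  refine ⟨⟨?_, ?_⟩, ?_, ?_⟩ <;> linarith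

lemma JumpAt.near_of_right (h : JumpAt μ a u v) (h' : JumpAt ν a u' v) :
    Near (2 * (μ + ν)) u u' := by
  obtain ⟨p, h1, h2, ⟨h3, h4⟩, h5, h6⟩ := h
  obtain ⟨q, k1, k2, ⟨k3, k4⟩, k5, k6⟩ := h'
  simp only [abs_lt] at *
  unfold Near
  simp only [abs_lt]
  refine ⟨⟨?_, ?_⟩, ?_, ?_⟩ <;> linarith

lemma Close.pos (h : Close g μ u v) : 0 < μ := by
  rcases h with h | ⟨a, h | h⟩
  · exact (abs_nonneg _).trans_lt h.1
  · obtain ⟨p, _, _, h, _⟩ := h; exact (abs_nonneg _).trans_lt h.1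
  · obtain ⟨p, _, _, h, _⟩ := h; exact (abs_nonneg _).trans_lt h.1

lemma Close.trans (h : Close g μ u v) (h' : Close g ν v v') (hμ : μ ≤ 1 / 8) (hν : ν ≤ 1 / 8) :
    Close g (2 * (μ + ν)) u v' := by
  have p1 := h.pos; have p2 := h'.pos
  rcases h with h | ⟨a, h | h⟩ <;> rcases h' with h' | ⟨b, h' | h'⟩
  · exact .inl ((h.trans h').mono (by linarith))
  · exact .inr ⟨b, .inl ((h'.near_trans h).mono (by linarith))⟩
  · exact .inr ⟨b, .inr ((h'.trans_near h.symm).mono (by linarith))⟩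
  · exact .inr ⟨a, .inl ((h.trans_near h').mono (by linarith))⟩
  · exact (h.not_left_right h' hμ hν).elim
  · obtain rfl := h.eq_of_right h' hμ hν
    exact .inl (h.near_of_right h')
  · exact .inr ⟨a, .inr ((h.near_trans h'.symm).mono (by linarith))⟩
  · obtain rfl := h.eq_of_left h' hμ hν
    exact .inl (h.near_of_left h')
  · exact (h'.not_left_right h hν hμ).elim

/-- A short step does not change the left-right order of two points of about the same height that are
not near each other. -/
lemma leftInd_eq_of_near (h : Near μ u u') (hs : ¬ Near (2 * μ) u v) (h2 : |u.2 - v.2| < 2 * μ) :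
    leftInd u v = leftInd u' v := by
  have : 2 * μ ≤ |u.1 - v.1| := by
    by_contra hc; exact hs ⟨by linarith, h2⟩
  obtain ⟨h1, -⟩ := h
  rw [abs_lt] at h1
  unfold leftInd
  rcases le_abs.1 this with h | h <;> split_ifs <;> first | rfl | (exfalso; linarith)

lemma leftInd_eq_of_near' (h : Near μ v v') (hs : ¬ Near (2 * μ) u v) (h2 : |u.2 - v.2| < 2 * μ) :
    leftInd u v = leftInd u v' := by
  have : 2 * μ ≤ |u.1 - v.1| := by
    by_contra hc; exact hs ⟨by linarith, h2⟩
  obtain ⟨h1, -⟩ := h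
  rw [abs_lt] at h1
  unfold leftInd
  rcases le_abs.1 this with h | h <;> split_ifs <;> first | rfl | (exfalso; linarith)

/-- Nothing is above a point near the top. -/
lemma wallX_eq_zero_of_top (h : Near μ u u') (hs : ¬ Near (2 * μ) u v) (hu : 1 - 2 * μ < u.2)
    (hv : v.2 ≤ 1) : wallX u u' v = 0 := by
  unfold wallX
  split_ifs with hc
  · rw [leftInd_eq_of_near h hs (by rw [abs_lt]; constructor <;> linarith), sub_self]
  · rfl

lemma wallY_eq_zero_of_top (h : Near μ v v') (hμ : μ ≤ 1 / 8) (hs : ¬ Near (2 * μ) u v)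
    (hu : 1 - 2 * μ < u.2) (hv : v.2 ≤ 1) : wallY u v v' = 0 := by
  unfold wallY
  split_ifs with hc
  · rcases hc with hc | hc
    · rw [leftInd_eq_of_near' h hs (by rw [abs_lt]; constructor <;> linarith), sub_self]
    · have := h.1; linarith
  · rfl

/-- A point near the top is above every other point. -/
lemma wallX_eq_of_top (h : Near μ u u') (hμ : μ ≤ 1 / 8) (hs : ¬ Near (2 * μ) u v)
    (hv : 1 - 2 * μ < v.2) (hu : u.2 ≤ 1) : wallX u u' v = leftInd u v - leftInd u' v := by
  unfold wallX
  split_ifs with hc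
  · rfl
  · have h1 : v.2 ≤ u.2 := by
      by_contra! hc'
      exact hc ⟨by have := h.1; linarith, hc'⟩
    by_cases h2 : u.2 - v.2 < 2 * μ
    · rw [leftInd_eq_of_near h hs (by rw [abs_lt]; constructor <;> linarith), sub_self]
    · linarith

lemma wallY_eq_of_top (h : Near μ v v') (hs : ¬ Near (2 * μ) u v)
    (hv : 1 - 2 * μ < v.2) (hu : u.2 ≤ 1) : wallY u v v' = leftInd u v - leftInd u v' := by
  unfold wallY
  split_ifs with hc
  · rfl
  · have h1 : v.2 ≤ u.2 := by
      by_contra! hc'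
      exact hc (.inl hc')
    rw [leftInd_eq_of_near' h hs (by rw [abs_lt]; constructor <;> linarith), sub_self]

lemma wallX_of_jump (h : 1 ≤ |u.1 - u'.1|) : wallX u u' v = 0 := by
  rw [wallX, if_neg (by rintro ⟨h', -⟩; linarith)]

lemma wallY_of_jump (h : 1 ≤ |v.1 - v'.1|) : wallY u v v' = leftInd u v - leftInd u v' := by
  rw [wallY, if_pos (.inr h)]

lemma not_close_of_close_left (hs : ¬ Close g (2 * (μ + ν)) u v) (h : Close g μ u u')
    (hμ : μ ≤ 1 / 8) (hν : ν ≤ 1 / 8) : ¬ Close g ν u' v :=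
  fun h' => hs (h.trans h' hμ hν)

lemma not_close_of_close_right (hs : ¬ Close g (2 * (μ + ν)) u v) (h : Close g μ v v')
    (hμ : μ ≤ 1 / 8) (hν : ν ≤ 1 / 8) : ¬ Close g ν u v' :=
  fun h' => hs ((h'.trans h.symm hν hμ).mono (by linarith))

lemma not_near_of_not_close (hs : ¬ Close g μ u v) (h : ν ≤ μ) : ¬ Near ν u v :=
  fun h' => hs (.inl (h'.mono h))

lemma wallX_add_of_near (h : Near μ u u') (h' : Near μ u' u'') (hμ : μ ≤ 1 / 8)
    (hs : ¬ Near (4 * μ) u v) : wallX u u' v + wallX u' u'' v = wallX u u'' v := by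
  have a1 := h.1; have a2 := h.2; have b1 := h'.1; have b2 := h'.2
  rw [abs_lt] at a2 b2
  by_cases h2 : |u.2 - v.2| < 2 * μ
  · have e1 := leftInd_eq_of_near (v := v) h (fun hc => hs (hc.mono (by linarith))) h2
    have e2 := leftInd_eq_of_near (v := v) (h.trans h')
      (fun hc => hs (hc.mono (by linarith))) (by linarith)
    have : wallX u u' v = 0 := by rw [wallX]; split_ifs <;> simp [e1]
    rw [this]
    have : wallX u' u'' v = 0 := by rw [wallX]; split_ifs <;> simp [← e1, e2]
    rw [this, wallX]; split_ifs <;> simp [e2]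
  · have hc : u.2 < v.2 ↔ u'.2 < v.2 := by
      rw [not_lt, le_abs] at h2
      constructor <;> intro hc <;> rcases h2 with h2 | h2 <;> linarith
    have h3 : |u.1 - u''.1| < 1 := by have := abs_sub_le u.1 u'.1 u''.1; linarith
    unfold wallX
    have h4 : |u.1 - u'.1| < 1 := by linarith
    have h5 : |u'.1 - u''.1| < 1 := by linarith
    simp only [h3, h4, h5, true_and, hc]
    split_ifs <;> ring

lemma wallY_add_of_near (h : Near μ v v') (h' : Near μ v' v'') (hμ : μ ≤ 1 / 8)
    (hs : ¬ Near (4 * μ) u v) : wallY u v v' + wallY u v' v'' = wallY u v v'' := by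
  have a1 := h.1; have a2 := h.2; have b1 := h'.1; have b2 := h'.2
  rw [abs_lt] at a2 b2
  by_cases h2 : |u.2 - v.2| < 2 * μ
  · have e1 := leftInd_eq_of_near' (u := u) h (fun hc => hs (hc.mono (by linarith))) h2
    have e2 := leftInd_eq_of_near' (u := u) (h.trans h')
      (fun hc => hs (hc.mono (by linarith))) (by linarith)
    have : wallY u v v' = 0 := by rw [wallY]; split_ifs <;> simp [e1]
    rw [this]
    have : wallY u v' v'' = 0 := by rw [wallY]; split_ifs <;> simp [← e1, e2]
    rw [this, wallY]; split_ifs <;> simp [e2]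
  · have hc : u.2 < v.2 ↔ u.2 < v'.2 := by
      rw [not_lt, le_abs] at h2
      constructor <;> intro hc <;> rcases h2 with h2 | h2 <;> linarith
    have h3 : ¬ 1 ≤ |v.1 - v''.1| := by have := abs_sub_le v.1 v'.1 v''.1; linarith
    unfold wallY
    have h4 : ¬ 1 ≤ |v.1 - v'.1| := by linarith
    have h5 : ¬ 1 ≤ |v'.1 - v''.1| := by linarith
    simp only [h3, h4, h5, or_false, hc]
    split_ifs <;> ring

/-- A jump ends near the top, in either direction. -/
lemma jump_bounds (h : JumpAt μ a u v ∨ JumpAt μ a v u) (hμ : μ ≤ 1 / 8) :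
    1 - μ < u.2 ∧ 1 - μ < v.2 ∧ 1 ≤ |u.1 - v.1| := by
  rcases h with h | h
  · exact ⟨h.left_bounds.2.2.1, h.right_bounds.2.2.1, h.one_le_abs hμ⟩
  · exact ⟨h.right_bounds.2.2.1, h.left_bounds.2.2.1, by rw [abs_sub_comm]; exact h.one_le_abs hμ⟩

/-- The composite of a jump with a short step is a jump. -/
lemma jump_trans_near (h : JumpAt μ a u v ∨ JumpAt μ a v u) (h' : Near μ v v') :
    JumpAt (2 * μ) a u v' ∨ JumpAt (2 * μ) a v' u := by
  rcases h with h | h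
  · exact .inl ((h.trans_near h').mono (by linarith))
  · exact .inr ((h.near_trans h'.symm).mono (by linarith))

lemma near_of_jump_jump (h : JumpAt μ a u v ∨ JumpAt μ a v u)
    (h' : JumpAt μ b v v' ∨ JumpAt μ b v' v) (hμ : μ ≤ 1 / 8) : Near (4 * μ) u v' := by
  rcases h with h | h <;> rcases h' with h' | h'
  · exact (h.not_left_right h' hμ hμ).elim
  · obtain rfl := h.eq_of_right h' hμ hμ
    exact (h.near_of_right h').mono (by linarith)
  · obtain rfl := h.eq_of_left h' hμ hμ
    exact (h.near_of_left h').mono (by linarith)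
  · exact (h'.not_left_right h hμ hμ).elim

/-- The wall cochain is additive along the first point as long as it stays away from the second. -/
lemma wallX_add (h : Close g μ u u') (h' : Close g μ u' u'') (hμ : μ ≤ 1 / 64)
    (hs : ¬ Close g (40 * μ) u v) (hv : v.2 ≤ 1) :
    wallX u u' v + wallX u' u'' v = wallX u u'' v := by
  have hp := h.pos
  have hs' : ¬ Close g (4 * μ) u' v :=
    not_close_of_close_left (fun hc => hs (hc.mono (by linarith))) h (by linarith) (by linarith)
  rcases h with h | ⟨a, h⟩ <;> rcases h' with h' | ⟨b, h'⟩
  · exact wallX_add_of_near h h' (by linarith) (not_near_of_not_close hs (by linarith))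
  · obtain ⟨t1, t2, t3⟩ := jump_bounds h' (by linarith)
    have t4 := (jump_bounds ((jump_trans_near h'.symm h.symm).symm) (by linarith)).2.2
    rw [wallX_of_jump t3, wallX_of_jump t4, wallX_eq_zero_of_top h
      (not_near_of_not_close hs (by linarith)) (by have := h.2; rw [abs_lt] at this; linarith) hv,
      add_zero]
  · obtain ⟨t1, t2, t3⟩ := jump_bounds h (by linarith)
    have t4 := (jump_bounds (jump_trans_near h h') (by linarith)).2.2
    rw [wallX_of_jump t3, wallX_of_jump t4, wallX_eq_zero_of_top h'
      (not_near_of_not_close hs' (by linarith)) (by linarith) hv, add_zero]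
  · obtain ⟨t1, t2, t3⟩ := jump_bounds h (by linarith)
    obtain ⟨s1, s2, s3⟩ := jump_bounds h' (by linarith)
    rw [wallX_of_jump t3, wallX_of_jump s3, wallX_eq_zero_of_top
      (near_of_jump_jump h h' (by linarith))
      (not_near_of_not_close hs (by linarith)) (by linarith) hv, add_zero]

lemma wallY_add (h : Close g μ v v') (h' : Close g μ v' v'') (hμ : μ ≤ 1 / 64)
    (hs : ¬ Close g (40 * μ) u v) (hu : u.2 ≤ 1) :
    wallY u v v' + wallY u v' v'' = wallY u v v'' := by
  have hp := h.pos
  have hs' : ¬ Close g (4 * μ) u v' :=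
    not_close_of_close_right (fun hc => hs (hc.mono (by linarith))) h (by linarith) (by linarith)
  rcases h with h | ⟨a, h⟩ <;> rcases h' with h' | ⟨b, h'⟩
  · exact wallY_add_of_near h h' (by linarith) (not_near_of_not_close hs (by linarith))
  · obtain ⟨t1, t2, t3⟩ := jump_bounds h' (by linarith)
    have t4 := (jump_bounds ((jump_trans_near h'.symm h.symm).symm) (by linarith)).2.2
    rw [wallY_of_jump t3, wallY_of_jump t4, wallY_eq_of_top h
      (not_near_of_not_close hs (by linarith)) (by have := h.2; rw [abs_lt] at this; linarith) hu]
    ring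
  · obtain ⟨t1, t2, t3⟩ := jump_bounds h (by linarith)
    have t4 := (jump_bounds (jump_trans_near h h') (by linarith)).2.2
    rw [wallY_of_jump t3, wallY_of_jump t4, wallY_eq_of_top h'
      (not_near_of_not_close hs' (by linarith)) (by linarith) hu]
    ring
  · obtain ⟨t1, t2, t3⟩ := jump_bounds h (by linarith)
    obtain ⟨s1, s2, s3⟩ := jump_bounds h' (by linarith)
    rw [wallY_of_jump t3, wallY_of_jump s3, wallY_eq_of_top
      (near_of_jump_jump h h' (by linarith))
      (not_near_of_not_close hs (by linarith)) (by linarith) hu]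
    ring

/-- The wall cochain is closed on a square of separated points, unless both points jump. -/
lemma wallD_of_near_near (h : Near μ u u') (h' : Near μ v v') (hμ : μ ≤ 1 / 8)
    (hs : ¬ Near (6 * μ) u v) : wallD u u' v v' = 0 := by
  have a1 := h.1; have a2 := h.2; have b1 := h'.1; have b2 := h'.2
  have h4 : |u.1 - u'.1| < 1 := by linarith
  have h5 : ¬ 1 ≤ |v.1 - v'.1| := by linarith
  rw [abs_lt] at a2 b2 a1 b1
  unfold wallD wallX wallY
  simp only [h4, h5, true_and, or_false]
  by_cases h2 : |u.2 - v.2| < 6 * μ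
  · have h3 : 6 * μ ≤ |u.1 - v.1| := by by_contra hc; exact hs ⟨by linarith, h2⟩
    have e1 : leftInd u' v = leftInd u v := by
      unfold leftInd
      rcases le_abs.1 h3 with h | h <;> split_ifs <;> first | rfl | (exfalso; linarith)
    have e2 : leftInd u v' = leftInd u v := by
      unfold leftInd
      rcases le_abs.1 h3 with h | h <;> split_ifs <;> first | rfl | (exfalso; linarith)
    have e3 : leftInd u' v' = leftInd u v := by
      unfold leftInd
      rcases le_abs.1 h3 with h | h <;> split_ifs <;> first | rfl | (exfalso; linarith)
    simp [e1, e2, e3]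
  · have hc1 : u'.2 < v.2 ↔ u.2 < v.2 := by
      rw [not_lt, le_abs] at h2
      constructor <;> intro hc <;> rcases h2 with h2 | h2 <;> linarith
    have hc2 : u.2 < v'.2 ↔ u.2 < v.2 := by
      rw [not_lt, le_abs] at h2
      constructor <;> intro hc <;> rcases h2 with h2 | h2 <;> linarith
    simp only [hc1, hc2]
    split_ifs <;> ring

/-- The signed passage through the seam `a`. -/
def jumpInd (a : Fin g × Fin 2) (u u' : ℝ × ℝ) : ℤ :=
  open Classical in if JumpAt (1 / 8) a u u' then 1 else if JumpAt (1 / 8) a u' u then -1 else 0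

/-- The correction to the closedness of the wall cochain at pairs of interlocked seams. -/
def interlock (g : ℕ) (u u' v v' : ℝ × ℝ) : ℤ :=
  ∑ i : Fin g, (jumpInd (i, 0) u u' * jumpInd (i, 1) v v' -
    jumpInd (i, 1) u u' * jumpInd (i, 0) v v')

lemma jumpInd_of_near (h : Near (1 / 2) u u') : jumpInd a u u' = 0 := by
  have := h.1
  rw [jumpInd, if_neg, if_neg]
  · intro h'; have := h'.one_le_abs le_rfl; rw [abs_sub_comm] at this; linarith
  · intro h'; have := h'.one_le_abs le_rfl; linarith

lemma jumpInd_of_left (h : JumpAt (1 / 8) a u u') :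
    jumpInd b u u' = if b = a then 1 else 0 := by
  rw [jumpInd]
  split_ifs with h1 h2 h3 h4 h5
  · rfl
  · exact (h2 (h1.eq_of_left h le_rfl le_rfl)).elim
  · subst h4; exact (h1 h).elim
  · exact (h.not_left_right h3 le_rfl le_rfl).elim
  · subst h5; exact (h1 h).elim
  · rfl

lemma jumpInd_of_right (h : JumpAt (1 / 8) a u' u) :
    jumpInd b u u' = if b = a then -1 else 0 := by
  rw [jumpInd]
  split_ifs with h1 h2 h3 h4 h5
  · exact (h.not_left_right h1 le_rfl le_rfl).elim
  · exact (h.not_left_right h1 le_rfl le_rfl).elim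
  · rfl
  · exact (h4 (h3.eq_of_left h le_rfl le_rfl)).elim
  · subst h5; exact (h3 h).elim
  · rfl

lemma interlock_of_near_left (h : Near (1 / 2) u u') : interlock g u u' v v' = 0 := by
  simp [interlock, jumpInd_of_near h]

lemma interlock_of_near_right (h : Near (1 / 2) v v') : interlock g u u' v v' = 0 := by
  simp [interlock, jumpInd_of_near h]

lemma jumpInd_antisymm : jumpInd a u' u = - jumpInd a u u' := by
  by_cases h : JumpAt (1 / 8) a u u'
  · rw [jumpInd_of_left h, jumpInd_of_right h]; simp
  · by_cases h' : JumpAt (1 / 8) a u' u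
    · rw [jumpInd_of_left h', jumpInd_of_right h']; simp
    · rw [jumpInd, if_neg h', if_neg h, jumpInd, if_neg h, if_neg h', neg_zero]

/-- The value of the correction if both points jump from left to right. -/
lemma interlock_of_left_left (h : JumpAt (1 / 8) a u u') (h' : JumpAt (1 / 8) b v v') :
    interlock g u u' v v' = if a.1 = b.1 then (b.2 : ℤ) - (a.2 : ℤ) else 0 := by
  unfold interlock
  simp only [jumpInd_of_left h, jumpInd_of_left h']
  obtain ⟨i, r⟩ := a
  obtain ⟨j, s⟩ := b
  simp only [Prod.mk.injEq]
  by_cases hij : i = j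
  · subst hij
    rw [Finset.sum_eq_single i]
    · fin_cases r <;> fin_cases s <;> simp
    · intro k _ hk; simp [hk]
    · simp
  · rw [Finset.sum_eq_zero]
    · simp [hij]
    · intro k _
      by_cases hk : k = i
      · subst hk; simp [hij]
      · simp [hk]

/-- If both points jump from left to right, the left-right orders of the four pairs of end points
determine the correction. -/
lemma leftInd_second_difference (h : JumpAt μ a u u') (h' : JumpAt μ b v v') (hμ : μ ≤ 1 / 64)
    (hs : ¬ Near (6 * μ) u v) :
    leftInd u' v - leftInd u' v' - leftInd u v + leftInd u v' = interlock g u u' v v' := by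
  rw [interlock_of_left_left (h.mono (by linarith)) (h'.mono (by linarith))]
  have b1 := h.left_bounds; have b2 := h.right_bounds; have b3 := h.sum_bounds
  have c1 := h'.left_bounds; have c2 := h'.right_bounds; have c3 := h'.sum_bounds
  rw [abs_lt] at b3 c3
  obtain ⟨i, r⟩ := a
  obtain ⟨j, s⟩ := b
  simp only at *
  by_cases hij : (i, r) = (j, s)
  · obtain ⟨rfl, rfl⟩ := Prod.mk.inj hij
    have h3 : 6 * μ ≤ |u.1 - v.1| := by
      by_contra hc; exact hs ⟨by linarith, by rw [abs_lt]; constructor <;> linarith⟩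
    simp only [leftInd, if_true, sub_self]
    rcases le_abs.1 h3 with h | h
    · rw [if_pos (by linarith), if_neg (by linarith), if_pos (by linarith), if_neg (by linarith)]
      ring
    · rw [if_pos (by linarith), if_pos (by linarith), if_neg (by linarith), if_neg (by linarith)]
      ring
  · by_cases hij' : i = j
    · subst hij'
      have hr := r.isLt; have hs := s.isLt
      have e1 : slot i r = slot i 0 + (r.val : ℝ) := by simp [slot]
      have e2 : slot i s = slot i 0 + (s.val : ℝ) := by simp [slot]
      have hrs : (r = 0 ∧ s = 1) ∨ (r = 1 ∧ s = 0) := by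
        have : r ≠ s := fun h => hij (by rw [h])
        fin_cases r <;> fin_cases s <;> simp_all
      rw [if_pos rfl]
      rw [e1] at b1 b2 b3
      rw [e2] at c1 c2 c3
      rcases hrs with ⟨rfl, rfl⟩ | ⟨rfl, rfl⟩
      · simp only [Fin.val_zero, Fin.val_one, Nat.cast_zero, Nat.cast_one, add_zero] at *
        simp only [leftInd]
        rw [if_pos (by linarith), if_neg (by linarith), if_neg (by linarith), if_neg (by linarith)]
        simp
      · simp only [Fin.val_zero, Fin.val_one, Nat.cast_zero, Nat.cast_one, add_zero] at *
        simp only [leftInd]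
        rw [if_pos (by linarith), if_pos (by linarith), if_pos (by linarith), if_neg (by linarith)]
        simp
    · rw [if_neg hij']
      have e1 : slot i r = 4 * (i.val : ℝ) + (r.val : ℝ) := by simp [slot]
      have e2 : slot j s = 4 * (j.val : ℝ) + (s.val : ℝ) := by simp [slot]
      have r0 : (0 : ℝ) ≤ r.val := by positivity
      have s0 : (0 : ℝ) ≤ s.val := by positivity
      have r1 : (r.val : ℝ) ≤ 1 := by have := r.isLt; exact_mod_cast (by omega : r.val ≤ 1)
      have s1 : (s.val : ℝ) ≤ 1 := by have := s.isLt; exact_mod_cast (by omega : s.val ≤ 1)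
      simp only [leftInd]
      rcases lt_or_gt_of_ne (fun h => hij' (Fin.ext h) : i.val ≠ j.val) with h | h
      · have : (i.val : ℝ) + 1 ≤ j.val := by exact_mod_cast h
        rw [if_neg (by linarith), if_neg (by linarith), if_neg (by linarith), if_neg (by linarith)]
        simp
      · have : (j.val : ℝ) + 1 ≤ i.val := by exact_mod_cast h
        rw [if_pos (by linarith), if_pos (by linarith), if_pos (by linarith), if_pos (by linarith)]
        simp

lemma interlock_swap_left : interlock g u' u v v' = - interlock g u u' v v' := by
  simp only [interlock, ← Finset.sum_neg_distrib]
  refine Finset.sum_congr rfl fun i _ => ?_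
  rw [jumpInd_antisymm (u := u), jumpInd_antisymm (u := u)]; ring

lemma interlock_swap_right : interlock g u u' v' v = - interlock g u u' v v' := by
  simp only [interlock, ← Finset.sum_neg_distrib]
  refine Finset.sum_congr rfl fun i _ => ?_
  rw [jumpInd_antisymm (u := v), jumpInd_antisymm (u := v)]; ring

/-- The coboundary of the wall cochain on a square of separated points is concentrated at the pairs
of interlocked seams. -/
lemma wallD_eq_interlock (h : Close g μ u u') (h' : Close g μ v v') (hμ : μ ≤ 1 / 400)
    (hs : ¬ Close g (100 * μ) u v) (hu : u.2 ≤ 1 ∧ u'.2 ≤ 1) (hv : v.2 ≤ 1 ∧ v'.2 ≤ 1) :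
    wallD u u' v v' = interlock g u u' v v' := by
  have hp := h.pos
  have s2 : ¬ Close g (40 * μ) u' v :=
    not_close_of_close_left (fun hc => hs (hc.mono (by linarith))) h (by linarith) (by linarith)
  have s3 : ¬ Close g (40 * μ) u v' :=
    not_close_of_close_right (fun hc => hs (hc.mono (by linarith))) h' (by linarith) (by linarith)
  have s4 : ¬ Close g (6 * μ) u' v' :=
    not_close_of_close_right (fun hc => s2 (hc.mono (by linarith))) h' (by linarith) (by linarith)
  have n1 : ¬ Near (6 * μ) u v := not_near_of_not_close hs (by linarith)
  have n2 : ¬ Near (6 * μ) u' v := not_near_of_not_close s2 (by linarith)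
  have n3 : ¬ Near (6 * μ) u v' := not_near_of_not_close s3 (by linarith)
  have n4 : ¬ Near (6 * μ) u' v' := not_near_of_not_close s4 (by linarith)
  have m : ∀ {x y : ℝ × ℝ}, ¬ Near (6 * μ) x y → ¬ Near (2 * μ) x y :=
    fun h h' => h (h'.mono (by linarith))
  rcases h with h | ⟨a, h⟩ <;> rcases h' with h' | ⟨b, h'⟩
  · rw [interlock_of_near_left (h.mono (by linarith)),
      wallD_of_near_near h h' (by linarith) n1]
  · obtain ⟨t1, t2, t3⟩ := jump_bounds h' (by linarith)
    rw [interlock_of_near_left (h.mono (by linarith)), wallD, wallY_of_jump t3, wallY_of_jump t3,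
      wallX_eq_of_top h (by linarith) (m n1) (by linarith) hu.1,
      wallX_eq_of_top h (by linarith) (m n3) (by linarith) hu.1]
    ring
  · obtain ⟨t1, t2, t3⟩ := jump_bounds h (by linarith)
    rw [interlock_of_near_right (h'.mono (by linarith)), wallD, wallX_of_jump t3, wallX_of_jump t3,
      wallY_eq_zero_of_top h' (by linarith) (m n1) (by linarith) hv.1,
      wallY_eq_zero_of_top h' (by linarith) (m n2) (by linarith) hv.1]
    ring
  · obtain ⟨t1, t2, t3⟩ := jump_bounds h (by linarith)
    obtain ⟨r1, r2, r3⟩ := jump_bounds h' (by linarith)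
    rw [wallD, wallX_of_jump t3, wallX_of_jump t3, wallY_of_jump r3, wallY_of_jump r3]
    have hμ' : μ ≤ 1 / 64 := by linarith
    rcases h with h | h <;> rcases h' with h' | h'
    · rw [← leftInd_second_difference h h' hμ' n1]; ring
    · have := leftInd_second_difference h h' hμ' n3
      rw [interlock_swap_right] at this; linarith
    · have := leftInd_second_difference h h' hμ' n2
      rw [interlock_swap_left] at this; linarith
    · have := leftInd_second_difference h h' hμ' n4
      rw [interlock_swap_left, interlock_swap_right] at this; linarith

/-- Close points do not jump through different seams. -/
lemma interlock_eq_zero_of_close (h : Close g μ u u') (h' : Close g μ v v') (hμ : μ ≤ 1 / 64)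
    (hc : Close g (1 / 16) u v) : interlock g u u' v v' = 0 := by
  have hp := h.pos
  rcases h with h | ⟨a, h⟩
  · exact interlock_of_near_left (h.mono (by linarith))
  rcases h' with h' | ⟨b, h'⟩
  · exact interlock_of_near_right (h'.mono (by linarith))
  have hab : a = b := by
    by_contra hab
    have k1 := slot_lt_or_lt (i := a.1) (r := a.2) (j := b.1) (s := b.2) hab
    have k2 := slot_ne_right a.1 b.1 a.2 b.2
    have k3 := slot_ne_right b.1 a.1 b.2 a.2
    have hμ' : μ ≤ 1 / 8 := by linarith
    rcases hc with hc | ⟨c, hc | hc⟩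
    · have hc := hc.1
      rw [abs_lt] at hc
      rcases h with h | h <;> rcases h' with h' | h' <;>
        have b1 := h.left_bounds <;> have b2 := h.right_bounds <;>
        have c1 := h'.left_bounds <;> have c2 := h'.right_bounds <;>
        rcases k1 with k1 | k1 <;> rcases k2 with k2 | k2 <;> rcases k3 with k3 | k3 <;> linarith
    · have h1 : c = a := by
        rcases h with h | h
        · exact hc.eq_of_left h (by norm_num) hμ'
        · exact (h.not_left_right hc hμ' (by norm_num)).elim
      have h2 : c = b := by
        rcases h' with h' | h'
        · exact (hc.not_left_right h' (by norm_num) hμ').elim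
        · exact hc.eq_of_right h' (by norm_num) hμ'
      exact hab (h1.symm.trans h2)
    · have h1 : c = a := by
        rcases h with h | h
        · exact (hc.not_left_right h (by norm_num) hμ').elim
        · exact hc.eq_of_right h (by norm_num) hμ'
      have h2 : c = b := by
        rcases h' with h' | h'
        · exact hc.eq_of_left h' (by norm_num) hμ'
        · exact (h'.not_left_right hc hμ' (by norm_num)).elim
      exact hab (h1.symm.trans h2)
  subst hab
  have m : ∀ {x y : ℝ × ℝ}, JumpAt μ a x y → JumpAt (1 / 8) a x y := fun h => h.mono (by linarith)
  rcases h with h | h <;> rcases h' with h' | h'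
  · rw [interlock_of_left_left (m h) (m h')]; simp
  · rw [← neg_eq_zero, ← interlock_swap_right, interlock_of_left_left (m h) (m h')]; simp
  · rw [← neg_eq_zero, ← interlock_swap_left, interlock_of_left_left (m h) (m h')]; simp
  · rw [← neg_eq_zero, ← interlock_swap_right, ← neg_eq_zero, ← interlock_swap_left,
      interlock_of_left_left (m h) (m h')]; simp

end

section

/-! ### Canonical representatives and the topology of the surface -/

variable {g : ℕ}

/-- The point of the plane lies on the closed left slot of the seam `a`. -/
def OnLeft (a : Fin g × Fin 2) (p : ℝ × ℝ) : Prop :=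
  slot a.1 a.2 + 1 / 4 ≤ p.1 ∧ p.1 ≤ slot a.1 a.2 + 3 / 4 ∧ p.2 = 1

/-- The point of the plane lies on the closed right slot of the seam `a`. -/
def OnRight (a : Fin g × Fin 2) (p : ℝ × ℝ) : Prop :=
  slot a.1 a.2 + 9 / 4 ≤ p.1 ∧ p.1 ≤ slot a.1 a.2 + 11 / 4 ∧ p.2 = 1

/-- The rotation by `π` that exchanges the two slots of the seam `a`. -/
def turn (a : Fin g × Fin 2) (p : ℝ × ℝ) : ℝ × ℝ := (2 * slot a.1 a.2 + 3 - p.1, 2 - p.2)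

@[simp] lemma turn_turn (a : Fin g × Fin 2) (p : ℝ × ℝ) : turn a (turn a p) = p := by
  ext <;> simp [turn]

lemma continuous_turn (a : Fin g × Fin 2) : Continuous (turn a) := by
  unfold turn; fun_prop

lemma OnLeft.jumpAt {a : Fin g × Fin 2} {p : ℝ × ℝ} (h : OnLeft a p) {μ : ℝ} (hμ : 0 < μ) :
    JumpAt μ a p (turn a p) := by
  obtain ⟨h1, h2, h3⟩ := h
  exact ⟨p.1, h1, h2, ⟨by simpa, by simpa [h3]⟩, ⟨by simpa [turn], by norm_num [turn, h3, hμ]⟩⟩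

lemma OnLeft.turn {a : Fin g × Fin 2} {p : ℝ × ℝ} (h : OnLeft a p) : OnRight a (turn a p) := by
  obtain ⟨h1, h2, h3⟩ := h
  refine ⟨?_, ?_, ?_⟩ <;> simp only [FramedGraph.turn] <;> linarith

lemma OnRight.turn {a : Fin g × Fin 2} {p : ℝ × ℝ} (h : OnRight a p) : OnLeft a (turn a p) := by
  obtain ⟨h1, h2, h3⟩ := h
  refine ⟨?_, ?_, ?_⟩ <;> simp only [FramedGraph.turn] <;> linarith

lemma OnRight.eq {a b : Fin g × Fin 2} {p : ℝ × ℝ} (h : OnRight a p) (h' : OnRight b p) :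
    a = b := by
  by_contra hab
  obtain ⟨h1, h2, h3⟩ := h
  obtain ⟨k1, k2, k3⟩ := h'
  rcases slot_lt_or_lt (i := a.1) (r := a.2) (j := b.1) (s := b.2) hab with h | h <;> linarith

lemma OnLeft.not_onRight {a b : Fin g × Fin 2} {p : ℝ × ℝ} (h : OnLeft a p) : ¬ OnRight b p := by
  intro h'
  obtain ⟨h1, h2, h3⟩ := h
  obtain ⟨k1, k2, k3⟩ := h'
  rcases slot_ne_right b.1 a.1 b.2 a.2 with h | h <;> linarith

open Classical in
/-- The canonical representative: a point of a right slot is moved to the left slot. -/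
def canon (g : ℕ) (p : ℝ × ℝ) : ℝ × ℝ :=
  if h : ∃ a : Fin g × Fin 2, OnRight a p then turn h.choose p else p

lemma canon_of_onRight {a : Fin g × Fin 2} {p : ℝ × ℝ} (h : OnRight a p) :
    canon g p = turn a p := by
  have h' : ∃ a : Fin g × Fin 2, OnRight a p := ⟨a, h⟩
  rw [canon, dif_pos h', h'.choose_spec.eq h]

lemma canon_of_not {p : ℝ × ℝ} (h : ∀ a : Fin g × Fin 2, ¬ OnRight a p) : canon g p = p := by
  rw [canon, dif_neg (by simpa using h)]

/-- The canonical representative in the rectangle of a point of the surface. -/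
def rep (x : Surface g) : ℝ × ℝ :=
  Quot.lift (fun p : Rectangle g => canon g ((p.1 : ℝ), (p.2 : ℝ))) (by
    rintro p q ⟨i, r, h1, h2, h3, h4⟩
    have hl : OnLeft (i, r) ((p.1 : ℝ), (p.2 : ℝ)) := ⟨h1.1, h1.2, h2⟩
    have hr : ((q.1 : ℝ), (q.2 : ℝ)) = turn (i, r) ((p.1 : ℝ), (p.2 : ℝ)) := by
      ext <;> simp only [turn, h2, h3, h4]; norm_num
    have hr' : OnRight (i, r) ((q.1 : ℝ), (q.2 : ℝ)) := by rw [hr]; exact hl.turn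
    rw [canon_of_onRight hr', hr, turn_turn, canon_of_not fun a => hl.not_onRight]) x

/-- The rectangle as a subset of the plane. -/
def InRect (g : ℕ) (p : ℝ × ℝ) : Prop := 0 ≤ p.1 ∧ p.1 ≤ 4 * g + 1 ∧ 0 ≤ p.2 ∧ p.2 ≤ 1

lemma OnLeft.inRect {a : Fin g × Fin 2} {p : ℝ × ℝ} (h : OnLeft a p) : InRect g p := by
  have := slot_nonneg a.1 a.2; have := slot_le a.1 a.2
  obtain ⟨h1, h2, h3⟩ := h
  refine ⟨?_, ?_, ?_, ?_⟩ <;> linarith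

lemma OnRight.inRect {a : Fin g × Fin 2} {p : ℝ × ℝ} (h : OnRight a p) : InRect g p := by
  have := slot_nonneg a.1 a.2; have := slot_le a.1 a.2
  obtain ⟨h1, h2, h3⟩ := h
  refine ⟨?_, ?_, ?_, ?_⟩ <;> linarith

lemma mk_of_inRect {p : ℝ × ℝ} (h : InRect g p) :
    Surface.mk g p = Quot.mk _ ((⟨p.1, h.1, h.2.1⟩, ⟨p.2, h.2.2.1, h.2.2.2⟩) : Rectangle g) := by
  unfold Surface.mk
  congr 2
  · exact Set.projIcc_of_mem _ ⟨h.1, h.2.1⟩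
  · exact Set.projIcc_of_mem _ ⟨h.2.2.1, h.2.2.2⟩

lemma rep_mk {p : ℝ × ℝ} (h : InRect g p) : rep (Surface.mk g p) = canon g p := by
  rw [mk_of_inRect h]; rfl

lemma mk_turn_of_onLeft {a : Fin g × Fin 2} {p : ℝ × ℝ} (h : OnLeft a p) :
    Surface.mk g (turn a p) = Surface.mk g p := by
  rw [mk_of_inRect h.inRect, mk_of_inRect h.turn.inRect]
  symm
  apply Quot.sound
  refine ⟨a.1, a.2, ⟨h.1, h.2.1⟩, h.2.2, h.turn.2.2, rfl⟩

lemma mk_turn_of_onRight {a : Fin g × Fin 2} {p : ℝ × ℝ} (h : OnRight a p) :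
    Surface.mk g (turn a p) = Surface.mk g p := by
  have := mk_turn_of_onLeft h.turn
  rw [turn_turn] at this
  exact this.symm

lemma mk_canon (p : ℝ × ℝ) : Surface.mk g (canon g p) = Surface.mk g p := by
  by_cases h : ∃ a : Fin g × Fin 2, OnRight a p
  · obtain ⟨a, h⟩ := h
    rw [canon_of_onRight h, mk_turn_of_onRight h]
  · rw [canon_of_not (by simpa using h)]

lemma exists_mk_eq (x : Surface g) : ∃ p, InRect g p ∧ Surface.mk g p = x := by
  induction x using Quot.ind with
  | mk p =>
    have h : InRect g ((p.1 : ℝ), (p.2 : ℝ)) := ⟨p.1.2.1, p.1.2.2, p.2.2.1, p.2.2.2⟩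
    exact ⟨_, h, mk_of_inRect h⟩

lemma canon_inRect {p : ℝ × ℝ} (h : InRect g p) : InRect g (canon g p) := by
  by_cases h' : ∃ a : Fin g × Fin 2, OnRight a p
  · obtain ⟨a, h'⟩ := h'
    rw [canon_of_onRight h']; exact h'.turn.inRect
  · rwa [canon_of_not (by simpa using h')]

lemma not_onRight_canon (p : ℝ × ℝ) (a : Fin g × Fin 2) : ¬ OnRight a (canon g p) := by
  by_cases h' : ∃ a : Fin g × Fin 2, OnRight a p
  · obtain ⟨b, h'⟩ := h'
    rw [canon_of_onRight h']; exact h'.turn.not_onRight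
  · rw [canon_of_not (by simpa using h')]; exact fun h => h' ⟨a, h⟩

lemma mk_rep (x : Surface g) : Surface.mk g (rep x) = x := by
  obtain ⟨p, hp, rfl⟩ := exists_mk_eq x
  rw [rep_mk hp, mk_canon]

lemma rep_inRect (x : Surface g) : InRect g (rep x) := by
  obtain ⟨p, hp, rfl⟩ := exists_mk_eq x
  rw [rep_mk hp]; exact canon_inRect hp

lemma not_onRight_rep (x : Surface g) (a : Fin g × Fin 2) : ¬ OnRight a (rep x) := by
  obtain ⟨p, hp, rfl⟩ := exists_mk_eq x
  rw [rep_mk hp]; exact not_onRight_canon p a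

lemma rep_injective : Function.Injective (rep : Surface g → ℝ × ℝ) :=
  Function.LeftInverse.injective mk_rep

lemma rep_le_one (x : Surface g) : (rep x).2 ≤ 1 := (rep_inRect x).2.2.2

instance : CompactSpace (Surface g) := inferInstanceAs (CompactSpace (Quot (Glued g)))

lemma continuous_mk : Continuous (Surface.mk g) := by
  unfold Surface.mk
  exact continuous_quot_mk.comp (by fun_prop)

/-- A set of points of the plane that is open and is a union of classes of glued points describes
an open set of the surface. -/
lemma isOpen_of_saturated {W : Set (ℝ × ℝ)} (hW : IsOpen W)
    (hs : ∀ (a : Fin g × Fin 2) p, OnLeft a p → (p ∈ W ↔ turn a p ∈ W)) :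
    IsOpen {x : Surface g | rep x ∈ W} := by
  have hq : IsOpen (Quot.mk (Glued g) ⁻¹' {x : Surface g | rep x ∈ W}) := by
    have : Quot.mk (Glued g) ⁻¹' {x : Surface g | rep x ∈ W} =
        (fun p : Rectangle g => ((p.1 : ℝ), (p.2 : ℝ))) ⁻¹' W := by
      ext p
      simp only [Set.mem_preimage]
      change canon g ((p.1 : ℝ), (p.2 : ℝ)) ∈ W ↔ _
      by_cases h : ∃ a : Fin g × Fin 2, OnRight a ((p.1 : ℝ), (p.2 : ℝ))
      · obtain ⟨a, h⟩ := h
        rw [canon_of_onRight h, hs a _ h.turn, turn_turn]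
      · rw [canon_of_not (by simpa using h)]
    rw [this]
    exact hW.preimage (by fun_prop)
  exact hq

lemma isClosed_onSlots : IsClosed {p : ℝ × ℝ | ∃ a : Fin g × Fin 2, OnLeft a p ∨ OnRight a p} := by
  simp only [Set.ofPred_exists, Set.ofPred_or]
  refine isClosed_iUnion_of_finite fun a => IsClosed.union ?_ ?_
  · exact (isClosed_le continuous_const continuous_fst).inter
      ((isClosed_le continuous_fst continuous_const).inter
        (isClosed_eq continuous_snd continuous_const))
  · exact (isClosed_le continuous_const continuous_fst).inter
      ((isClosed_le continuous_fst continuous_const).inter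
        (isClosed_eq continuous_snd continuous_const))

lemma isOpen_near (μ : ℝ) (u : ℝ × ℝ) : IsOpen {p : ℝ × ℝ | Near μ u p} := by
  have h1 : IsOpen {p : ℝ × ℝ | |u.1 - p.1| < μ} := isOpen_lt (by fun_prop) continuous_const
  have h2 : IsOpen {p : ℝ × ℝ | |u.2 - p.2| < μ} := isOpen_lt (by fun_prop) continuous_const
  exact h1.inter h2

/-- Away from the seams, the canonical representative is continuous. -/
lemma continuousAt_rep {x : Surface g} (hx : ∀ a : Fin g × Fin 2, ¬ OnLeft a (rep x)) :
    ContinuousAt rep x := by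
  intro S hS
  obtain ⟨W, hWS, hW, hxW⟩ := mem_nhds_iff.1 hS
  have ho : IsOpen (W ∩ {p : ℝ × ℝ | ∃ a : Fin g × Fin 2, OnLeft a p ∨ OnRight a p}ᶜ) :=
    hW.inter isClosed_onSlots.isOpen_compl
  have := isOpen_of_saturated (g := g) ho (fun a p hp => by
    constructor
    · rintro ⟨-, h⟩; exact (h ⟨a, .inl hp⟩).elim
    · rintro ⟨-, h⟩; exact (h ⟨a, .inr hp.turn⟩).elim)
  refine Filter.mem_of_superset (this.mem_nhds ⟨hxW, ?_⟩) fun y hy => hWS hy.1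
  rintro ⟨a, h | h⟩
  · exact hx a h
  · exact not_onRight_rep x a h

/-- Near a point of a seam, the canonical representatives are near to the point of the left slot or
to the point of the right slot. -/
lemma eventually_rep_near {x : Surface g} {a : Fin g × Fin 2} (hx : OnLeft a (rep x)) {μ : ℝ}
    (hμ : 0 < μ) : ∀ᶠ y in 𝓝 x, Near μ (rep x) (rep y) ∨ Near μ (turn a (rep x)) (rep y) := by
  wlog hμ' : μ ≤ 1 / 16 generalizing μ
  · refine (this (μ := 1 / 16) (by norm_num) le_rfl).mono fun y hy => ?_
    exact hy.imp (fun h => h.mono (by linarith)) (fun h => h.mono (by linarith))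
  have ho : IsOpen ({p | Near μ (rep x) p} ∪ {p | Near μ (turn a (rep x)) p}) :=
    (isOpen_near _ _).union (isOpen_near _ _)
  refine (isOpen_of_saturated (g := g) ho ?_).mem_nhds (.inl ⟨by simpa, by simpa⟩)
  intro b p hp
  have hj := hx.jumpAt hμ
  have hj' := hp.jumpAt hμ
  have ht : ∀ u v : ℝ × ℝ, Near μ (turn a u) (turn a v) ↔ Near μ u v := fun u v => by
    simp only [Near, turn]
    rw [show 2 * slot a.1 a.2 + 3 - u.1 - (2 * slot a.1 a.2 + 3 - v.1) = -(u.1 - v.1) by ring,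
      show 2 - u.2 - (2 - v.2) = -(u.2 - v.2) by ring, abs_neg, abs_neg]
  constructor
  · rintro (h | h)
    · have : b = a := (hj'.near_trans h).eq_of_left hj (by linarith) (by linarith)
      subst this
      exact .inr ((ht _ _).2 h)
    · exact ((hj.trans_near h).not_left_right hj' (by linarith) (by linarith)).elim
  · rintro (h | h)
    · exact (hj'.not_left_right (hj.near_trans h.symm) (by linarith) (by linarith)).elim
    · have : b = a := hj'.eq_of_right (hj.trans_near h) (by linarith) (by linarith)
      subst this
      exact .inl ((ht _ _).1 h)

lemma eventually_close (x : Surface g) {μ : ℝ} (hμ : 0 < μ) :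
    ∀ᶠ y in 𝓝 x, Close g μ (rep x) (rep y) := by
  by_cases hx : ∃ a : Fin g × Fin 2, OnLeft a (rep x)
  · obtain ⟨a, ha⟩ := hx
    filter_upwards [eventually_rep_near ha hμ] with y hy
    rcases hy with hy | hy
    · exact .inl hy
    · obtain ⟨p, h1, h2, h3, h4⟩ := ha.jumpAt hμ
      refine .inr ⟨a, .inl ⟨(rep x).1, ha.1, ha.2.1, ⟨by simpa, by simpa [ha.2.2]⟩, ?_⟩⟩
      have e : turn a (rep x) = (2 * slot a.1 a.2 + 3 - (rep x).1, 1) := by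
        ext <;> simp [turn, ha.2.2]; norm_num
      rw [← e]; exact hy.symm
  · exact ((continuousAt_rep (by simpa using hx)).eventually
      ((isOpen_near μ (rep x)).mem_nhds ⟨by simpa, by simpa⟩)).mono fun y hy => .inl hy

lemma eventually_close_prod (x : Surface g) {μ : ℝ} (hμ : 0 < μ) :
    ∀ᶠ p in 𝓝 (x, x), Close g μ (rep p.1) (rep p.2) := by
  set ν := min (μ / 4) (1 / 8) with hν
  have hν0 : 0 < ν := by positivity
  have h := eventually_close x hν0
  rw [nhds_prod_eq]
  filter_upwards [h.prod_mk h] with p hp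
  exact (hp.1.symm.trans hp.2 (min_le_right _ _) (min_le_right _ _)).mono (by
    have := min_le_left (μ / 4) (1 / 8 : ℝ); rw [← hν] at this; linarith)

lemma exists_not_close {x y : Surface g} (hxy : x ≠ y) :
    ∃ μ > 0, ¬ Close g μ (rep x) (rep y) := by
  by_contra! hc
  have h1 : ∃ μ > 0, μ ≤ 1 / 8 ∧ ¬ Near μ (rep x) (rep y) := by
    by_contra! hn
    apply hxy
    apply rep_injective
    have : ∀ a b : ℝ, (∀ μ > 0, μ ≤ 1 / 8 → |a - b| < μ) → a = b := fun a b h => by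
      by_contra hab
      have hp : 0 < |a - b| := abs_pos.2 (sub_ne_zero.2 hab)
      have := h (min |a - b| (1 / 8)) (by positivity) (min_le_right _ _)
      exact absurd this (not_lt.2 (min_le_left _ _))
    exact Prod.ext (this _ _ fun μ h h' => (hn μ h h').1) (this _ _ fun μ h h' => (hn μ h h').2)
  obtain ⟨μ, hμ, hμ8, hn⟩ := h1
  have hj : ∀ (x y : Surface g), (∀ μ > 0, Close g μ (rep x) (rep y)) →
      ¬ Near μ (rep x) (rep y) → ∀ a : Fin g × Fin 2, JumpAt μ a (rep x) (rep y) → False := by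
    intro x y hc hn a ha
    have hall : ∀ ν > 0, ν ≤ μ → JumpAt ν a (rep x) (rep y) := by
      intro ν hν hνμ
      rcases hc ν hν with h | ⟨b, h | h⟩
      · exact (hn (h.mono hνμ)).elim
      · rwa [ha.eq_of_left h hμ8 (by linarith)]
      · exact (ha.not_left_right h hμ8 (by linarith)).elim
    apply not_onRight_rep y a
    have hle : ∀ c d : ℝ, (∀ ν > 0, ν ≤ μ → c - ν < d) → c ≤ d := fun c d h => by
      by_contra! hcd
      have := h (min (c - d) μ) (lt_min (by linarith) hμ) (min_le_right _ _)
      have := min_le_left (c - d) μ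
      linarith
    refine ⟨?_, ?_, le_antisymm (rep_le_one y) ?_⟩
    · exact hle _ _ fun ν h h' => (hall ν h h').right_bounds.1
    · exact hle _ _ fun ν h h' => by have := (hall ν h h').right_bounds.2.1; linarith
    · exact hle _ _ fun ν h h' => (hall ν h h').right_bounds.2.2.1
  rcases hc μ hμ with h | ⟨a, h | h⟩
  · exact hn h
  · exact hj x y hc hn a h
  · exact hj y x (fun ν hν => (hc ν hν).symm) (fun h => hn h.symm) a h

lemma exists_eventually_not_close {x y : Surface g} (hxy : x ≠ y) :
    ∃ μ > 0, ∀ᶠ p in 𝓝 (x, y), ¬ Close g μ (rep p.1) (rep p.2) := by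
  obtain ⟨μ, hμ, h⟩ := exists_not_close hxy
  set ν := min (μ / 16) (1 / 64) with hν
  have hν0 : 0 < ν := by positivity
  have h1 := min_le_left (μ / 16) (1 / 64 : ℝ)
  have h2 := min_le_right (μ / 16) (1 / 64 : ℝ)
  rw [← hν] at h1 h2
  refine ⟨ν, hν0, ?_⟩
  rw [nhds_prod_eq]
  filter_upwards [(eventually_close x hν0).prod_mk (eventually_close y hν0)] with p hp hc
  have := (hp.1.trans hc (by linarith) (by linarith)).trans hp.2.symm (by linarith) (by linarith)
  exact h (this.mono (by linarith))

/-- On a compact set of pairs of distinct points, the points are uniformly separated. -/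
lemma exists_forall_not_close {Q : Set (Surface g × Surface g)} (hQ : IsCompact Q)
    (hd : ∀ p ∈ Q, p.1 ≠ p.2) : ∃ μ > 0, ∀ p ∈ Q, ¬ Close g μ (rep p.1) (rep p.2) := by
  refine hQ.induction_on (p := fun Q => ∃ μ > 0, ∀ p ∈ Q, ¬ Close g μ (rep p.1) (rep p.2))
    ⟨1, one_pos, by simp⟩ ?_ ?_ ?_
  · rintro s t hst ⟨μ, hμ, h⟩
    exact ⟨μ, hμ, fun p hp => h p (hst hp)⟩
  · rintro s t ⟨μ, hμ, h⟩ ⟨ν, hν, h'⟩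
    refine ⟨min μ ν, lt_min hμ hν, fun p hp hc => ?_⟩
    rcases hp with hp | hp
    · exact h p hp (hc.mono (min_le_left _ _))
    · exact h' p hp (hc.mono (min_le_right _ _))
  · intro p hp
    obtain ⟨μ, hμ, h⟩ := exists_eventually_not_close (hd p hp)
    exact ⟨_, mem_nhdsWithin_of_mem_nhds h, μ, hμ, fun q hq => hq⟩

end

section

/-! ### The index of a pair of discretized curves -/

variable {g : ℕ}

/-- Summation by parts on a discrete torus: the sum of a coboundary over a region vanishes if the
cochain vanishes on the boundary of the region. -/
lemma sum_coboundary_eq_zero {N : ℕ} [NeZero N] (o : ZMod N → ZMod N → ℤ)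
    (Gx Gy : ZMod N → ZMod N → ℤ) (hx : ∀ k l, o k (l + 1) = o k l ∨ Gx k (l + 1) = 0)
    (hy : ∀ k l, o (k + 1) l = o k l ∨ Gy (k + 1) l = 0) :
    ∑ k, ∑ l, o k l * (Gx k l + Gy (k + 1) l - Gx k (l + 1) - Gy k l) = 0 := by
  have e1 : ∑ k, ∑ l, o k l * Gx k l = ∑ k, ∑ l, o k l * Gx k (l + 1) := by
    refine Finset.sum_congr rfl fun k _ => ?_
    rw [← Equiv.sum_comp (Equiv.addRight (1 : ZMod N))]
    refine Finset.sum_congr rfl fun l _ => ?_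
    rcases hx k l with h | h <;> simp [h]
  have e2 : ∑ k, ∑ l, o k l * Gy k l = ∑ k, ∑ l, o k l * Gy (k + 1) l := by
    rw [← Equiv.sum_comp (Equiv.addRight (1 : ZMod N))]
    refine Finset.sum_congr rfl fun k _ => Finset.sum_congr rfl fun l _ => ?_
    rcases hy k l with h | h <;> simp [h]
  simp only [mul_sub, mul_add, Finset.sum_sub_distrib, Finset.sum_add_distrib, e1, e2]
  ring

/-- The distance below which two points count as near each other. -/
def nearRadius : ℝ := 1 / 1000

open Classical in
/-- The indicator of the squares at which the first curve runs above and near the second. -/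
def overInd (g : ℕ) (u v : ℝ × ℝ) (h h' : ℝ) : ℤ :=
  if h' < h ∧ Close g nearRadius u v then 1 else 0

/-- The index of two discretized curves with vertices `x k`, `y l` and heights `h k`, `h' l`: the
sum of the coboundary of the wall cochain over the squares at which the first curve runs above and
near the second. -/
def gridIndex (g : ℕ) {N : ℕ} [NeZero N] (x y : ZMod N → ℝ × ℝ) (h h' : ZMod N → ℝ) : ℤ :=
  ∑ k, ∑ l, overInd g (x k) (y l) (h k) (h' l) * wallD (x k) (x (k + 1)) (y l) (y (l + 1))

/-- Under a small move the indicator changes only at squares of separated points that are not far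
from each other, where the wall cochain is closed. -/
lemma overInd_eq_or {μ ε : ℝ} (hμ : μ ≤ 1 / 10 ^ 7) {u u' v v' : ℝ × ℝ} {h k h' k' : ℝ}
    (hu : Close g μ u u') (hv : Close g μ v v') (hh : |h - h'| < ε) (hk : |k - k'| < ε)
    (hs : |h - k| < 2 * ε → ¬ Close g (1000 * μ) u v) :
    overInd g u v h k = overInd g u' v' h' k' ∨
      (¬ Close g (1000 * μ) u v ∧ Close g (1 / 200) u v) := by
  have hp := hu.pos
  by_cases h1 : k < h ∧ Close g nearRadius u v
  · by_cases h2 : k' < h' ∧ Close g nearRadius u' v'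
    · left; rw [overInd, overInd, if_pos h1, if_pos h2]
    · right
      refine ⟨?_, h1.2.mono (by norm_num [nearRadius])⟩
      by_cases h3 : k' < h'
      · intro hc
        apply h2 ⟨h3, ?_⟩
        exact ((hu.symm.trans hc (by linarith) (by linarith)).trans hv (by linarith)
          (by linarith)).mono (by unfold nearRadius; linarith)
      · apply hs
        rw [abs_lt] at *
        constructor <;> linarith [h1.1]
  · by_cases h2 : k' < h' ∧ Close g nearRadius u' v'
    · right
      have hc' : Close g (1 / 200) u v :=
        ((hu.trans h2.2 (by linarith) (by norm_num [nearRadius])).trans hv.symm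
          (by unfold nearRadius; linarith)
          (by linarith)).mono (by unfold nearRadius; linarith)
      refine ⟨?_, hc'⟩
      by_cases h3 : k < h
      · intro hc
        exact h1 ⟨h3, hc.mono (by unfold nearRadius; linarith)⟩
      · apply hs
        rw [abs_lt] at *
        constructor <;> linarith [h2.1]
    · left; rw [overInd, overInd, if_neg h1, if_neg h2]

/-- On a square of separated points that are not far from each other the wall cochain is closed. -/
lemma wallD_eq_zero {μ : ℝ} (hμ : μ ≤ 1 / 10 ^ 7) {u u' v v' : ℝ × ℝ}
    (h : Close g μ u u') (h' : Close g μ v v')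
    (hs : ¬ Close g (100 * μ) u v) (hc : Close g (1 / 16) u v) (hu : u.2 ≤ 1 ∧ u'.2 ≤ 1)
    (hv : v.2 ≤ 1 ∧ v'.2 ≤ 1) : wallD u u' v v' = 0 := by
  rw [wallD_eq_interlock h h' (by linarith) hs hu hv,
    interlock_eq_zero_of_close h h' (by linarith) hc]

/-- The index does not change under a small perturbation of the curves if the points at (nearly) the
same height are separated. -/
lemma gridIndex_eq {N : ℕ} [NeZero N] {x x' y y' : ZMod N → ℝ × ℝ} {h h' k k' : ZMod N → ℝ}
    {μ ε : ℝ} (hμ : μ ≤ 1 / 10 ^ 7)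
    (hx : ∀ i, (x i).2 ≤ 1) (hx' : ∀ i, (x' i).2 ≤ 1) (hy : ∀ i, (y i).2 ≤ 1)
    (hy' : ∀ i, (y' i).2 ≤ 1)
    (sx : ∀ i, Close g μ (x i) (x (i + 1))) (sx' : ∀ i, Close g μ (x' i) (x' (i + 1)))
    (sy : ∀ i, Close g μ (y i) (y (i + 1))) (sy' : ∀ i, Close g μ (y' i) (y' (i + 1)))
    (px : ∀ i, Close g μ (x i) (x' i)) (py : ∀ i, Close g μ (y i) (y' i))
    (sh : ∀ i, |h (i + 1) - h i| < ε) (sk : ∀ i, |k (i + 1) - k i| < ε)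
    (ph : ∀ i, |h i - h' i| < ε) (pk : ∀ i, |k i - k' i| < ε)
    (hs : ∀ i j, |h i - k j| < 2 * ε → ¬ Close g (1000 * μ) (x i) (y j)) :
    gridIndex g x y h k = gridIndex g x' y' h' k' := by
  have hp := (px 0).pos
  have hε : 0 < ε := (abs_nonneg _).trans_lt (ph 0)
  set o : ZMod N → ZMod N → ℤ := fun i j => overInd g (x i) (y j) (h i) (k j) with ho
  have step1 : gridIndex g x' y' h' k' =
      ∑ i, ∑ j, o i j * wallD (x' i) (x' (i + 1)) (y' j) (y' (j + 1)) := by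
    refine Finset.sum_congr rfl fun i _ => Finset.sum_congr rfl fun j _ => ?_
    rcases overInd_eq_or hμ (px i) (py j) (ph i) (pk j) (hs i j) with h1 | ⟨h1, h2⟩
    · rw [ho]; simp only [h1]
    · rw [wallD_eq_zero hμ (sx' i) (sy' j) ?_ ?_ ⟨hx' _, hx' _⟩ ⟨hy' _, hy' _⟩, mul_zero, mul_zero]
      · intro hc
        apply h1
        exact (((px i).trans hc (by linarith) (by linarith)).trans (py j).symm (by linarith)
          (by linarith)).mono (by linarith)
      · exact (((px i).symm.trans h2 (by linarith) (by linarith)).trans (py j) (by linarith)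
          (by linarith)).mono (by linarith)
  set f : ZMod N → ZMod N → ℤ := fun i j => wallX (x i) (x' i) (y j) + wallY (x' i) (y j) (y' j)
    with hf
  set Gx : ZMod N → ZMod N → ℤ := fun i j => wallX (x i) (x (i + 1)) (y j) -
    wallX (x' i) (x' (i + 1)) (y' j) + f (i + 1) j - f i j with hGx
  set Gy : ZMod N → ZMod N → ℤ := fun i j => wallY (x i) (y j) (y (j + 1)) -
    wallY (x' i) (y' j) (y' (j + 1)) + f i (j + 1) - f i j with hGy
  have zx : ∀ i j, ¬ Close g (1000 * μ) (x i) (y j) → Close g (1 / 200) (x i) (y j) →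
      Gx i j = 0 := by
    intro i j h1 h2
    have a1 := wallX_add (g := g) (sx i) (px (i + 1)) (v := y j) (by linarith)
      (fun hc => h1 (hc.mono (by linarith))) (hy _)
    have a2 := wallX_add (g := g) (px i) (sx' i) (v := y j) (by linarith)
      (fun hc => h1 (hc.mono (by linarith))) (hy _)
    have a3 := wallD_eq_zero (g := g) hμ (sx' i) (py j) (fun hc => h1
      (((px i).trans hc (by linarith) (by linarith)).mono (by linarith)))
      (((px i).symm.trans h2 (by linarith) (by linarith)).mono (by linarith))
      ⟨hx' _, hx' _⟩ ⟨hy _, hy' _⟩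
    rw [wallD] at a3
    simp only [hGx, hf]
    linarith
  have zy : ∀ i j, ¬ Close g (1000 * μ) (x i) (y j) → Close g (1 / 200) (x i) (y j) →
      Gy i j = 0 := by
    intro i j h1 h2
    have h1' : ¬ Close g (40 * μ) (x' i) (y j) := fun hc => h1
      (((px i).trans hc (by linarith) (by linarith)).mono (by linarith))
    have a1 := wallY_add (g := g) (sy j) (py (j + 1)) (u := x' i) (by linarith) h1' (hx' _)
    have a2 := wallY_add (g := g) (py j) (sy' j) (u := x' i) (by linarith) h1' (hx' _)
    have a3 := wallD_eq_zero (g := g) hμ (px i) (sy j) (fun hc => h1 (hc.mono (by linarith)))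
      (h2.mono (by norm_num)) ⟨hx _, hx' _⟩ ⟨hy _, hy _⟩
    rw [wallD] at a3
    simp only [hGy, hf]
    linarith
  have key := sum_coboundary_eq_zero o Gx Gy (fun i j => by
      rcases overInd_eq_or (h := h i) (h' := h i) hμ (Close.refl hp) (sy j).symm (by simpa using hε) (sk j)
        (hs i (j + 1)) with h1 | ⟨h1, h2⟩
      · exact .inl h1
      · exact .inr (zx _ _ h1 h2)) (fun i j => by
      rcases overInd_eq_or (k := k j) (k' := k j) hμ (sx i).symm (Close.refl hp) (sh i) (by simpa using hε)
        (hs (i + 1) j) with h1 | ⟨h1, h2⟩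
      · exact .inl h1
      · exact .inr (zy _ _ h1 h2))
  rw [step1, gridIndex, ← sub_eq_zero, ← Finset.sum_sub_distrib, ← key]
  refine Finset.sum_congr rfl fun i _ => ?_
  rw [← Finset.sum_sub_distrib]
  refine Finset.sum_congr rfl fun j _ => ?_
  simp only [hGx, hGy, ho, wallD]
  ring

end

section

open Filter

/-! ### Discretized loops -/

variable {g : ℕ}

lemma exists_forall_dist_lt {X : Type} [PseudoMetricSpace X] [CompactSpace X] {D : Set (X × X)}
    (hD : ∀ x, D ∈ 𝓝 (x, x)) : ∃ δ > 0, ∀ x y, dist x y < δ → (x, y) ∈ D := by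
  have : D ∈ uniformity X := by
    rw [compactSpace_uniformity, mem_iSup]; exact hD
  obtain ⟨δ, hδ, h⟩ := Metric.mem_uniformity_dist.1 this
  exact ⟨δ, hδ, fun x y hxy => h hxy⟩

lemma eventually_forall_mem {X Y : Type} [TopologicalSpace X] [TopologicalSpace Y]
    [CompactSpace X] [LocallyCompactSpace X] (K : C(X, Y)) {D : Set (Y × Y)} (hD : ∀ y, D ∈ 𝓝 (y, y)) :
    ∀ᶠ P in 𝓝 K, ∀ s, (K s, P s) ∈ D := by
  have hc : Continuous fun z : C(X, Y) × X => (K z.2, z.1 z.2) := by fun_prop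
  have h := isCompact_univ.eventually_forall_of_forall_eventually (x₀ := K)
    (P := fun (P : C(X, Y)) (s : X) => (K s, P s) ∈ D) (fun s _ =>
      (hc.tendsto (K, s)).eventually (hD (K s)))
  exact h.mono fun P hP s => hP s trivial

/-- The vertices of a discretized loop. -/
def gridRep (n : ℕ) (α : C(𝕋, Surface g)) (k : ZMod (n + 1)) : ℝ × ℝ :=
  rep (α (ZMod.toAddCircle k))

/-- The index of two curves in the cylinder, discretized with `n + 1` vertices. -/
def loopIndex (n : ℕ) (K L : C(𝕋, Cylinder g)) : ℤ :=
  gridIndex g (gridRep n ((proj g).comp K)) (gridRep n ((proj g).comp L))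
    (fun k => ((K (ZMod.toAddCircle k)).2 : ℝ)) (fun k => ((L (ZMod.toAddCircle k)).2 : ℝ))

lemma dist_toAddCircle_succ (n : ℕ) (k : ZMod (n + 1)) :
    dist (ZMod.toAddCircle k) (ZMod.toAddCircle (k + 1)) ≤ 1 / ((n : ℝ) + 1) := by
  have h1 : ZMod.toAddCircle (1 : ZMod (n + 1)) = ((1 / ((n : ℝ) + 1) : ℝ) : 𝕋) := by
    have := ZMod.toAddCircle_intCast (N := n + 1) 1
    simpa using this
  rw [map_add, dist_eq_norm, sub_add_cancel_left, norm_neg, h1]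
  rw [UnitAddCircle.norm_eq]
  refine (round_le _ 0).trans (le_of_eq ?_)
  rw [Int.cast_zero, sub_zero, abs_of_nonneg (by positivity)]

lemma eventually_grid {D : Set (𝕋 × 𝕋)} (hD : ∀ x, D ∈ 𝓝 (x, x)) :
    ∀ᶠ n : ℕ in atTop, ∀ k : ZMod (n + 1),
      (ZMod.toAddCircle k, ZMod.toAddCircle (k + 1)) ∈ D := by
  obtain ⟨δ, hδ, h⟩ := exists_forall_dist_lt hD
  filter_upwards [tendsto_one_div_add_atTop_nhds_zero_nat.eventually (gt_mem_nhds hδ)] with n hn k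
  exact h _ _ ((dist_toAddCircle_succ n k).trans_lt hn)

lemma eventually_close_grid (α : C(𝕋, Surface g)) {μ : ℝ} (hμ : 0 < μ) :
    ∀ᶠ n : ℕ in atTop, ∀ k : ZMod (n + 1), Close g μ (gridRep n α k) (gridRep n α (k + 1)) := by
  refine eventually_grid (D := {p | Close g μ (rep (α p.1)) (rep (α p.2))}) fun s => ?_
  have hc : Continuous fun p : 𝕋 × 𝕋 => (α p.1, α p.2) := by fun_prop
  exact (hc.tendsto (s, s)).eventually (eventually_close_prod (α s) hμ)

lemma eventually_abs_grid (f : C(𝕋, I)) {ε : ℝ} (hε : 0 < ε) :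
    ∀ᶠ n : ℕ in atTop, ∀ k : ZMod (n + 1),
      |(f (ZMod.toAddCircle (k + 1)) : ℝ) - f (ZMod.toAddCircle k)| < ε := by
  refine eventually_grid (D := {p | |(f p.2 : ℝ) - f p.1| < ε}) fun s => ?_
  have hc : Continuous fun p : 𝕋 × 𝕋 => |(f p.2 : ℝ) - f p.1| := by fun_prop
  exact (hc.tendsto (s, s)).eventually (gt_mem_nhds (by simpa))

/-- Disjoint curves are uniformly separated. -/
lemma exists_separation {K L : C(𝕋, Cylinder g)} (h : ∀ s t, K s ≠ L t) :
    ∃ μ > 0, ∃ ε > 0, ∀ s t, |((K s).2 : ℝ) - (L t).2| < ε →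
      ¬ Close g μ (rep (K s).1) (rep (L t).1) := by
  have key : ∃ μ > 0, ∃ ε > 0, ∀ z ∈ (Set.univ : Set (𝕋 × 𝕋)),
      |((K z.1).2 : ℝ) - (L z.2).2| < ε → ¬ Close g μ (rep (K z.1).1) (rep (L z.2).1) := by
    refine isCompact_univ.induction_on (p := fun Q : Set (𝕋 × 𝕋) => ∃ μ > 0, ∃ ε > 0, ∀ z ∈ Q,
      |((K z.1).2 : ℝ) - (L z.2).2| < ε → ¬ Close g μ (rep (K z.1).1) (rep (L z.2).1))
      ⟨1, one_pos, 1, one_pos, by simp⟩ ?_ ?_ ?_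
    · rintro s t hst ⟨μ, hμ, ε, hε, h⟩
      exact ⟨μ, hμ, ε, hε, fun p hp => h p (hst hp)⟩
    · rintro s t ⟨μ, hμ, ε, hε, h⟩ ⟨ν, hν, ε', hε', h'⟩
      refine ⟨min μ ν, lt_min hμ hν, min ε ε', lt_min hε hε', fun p hp hh hc => ?_⟩
      rcases hp with hp | hp
      · exact h p hp (hh.trans_le (min_le_left _ _)) (hc.mono (min_le_left _ _))
      · exact h' p hp (hh.trans_le (min_le_right _ _)) (hc.mono (min_le_right _ _))
    · rintro ⟨s, t⟩ -
      by_cases hst : (K s).1 = (L t).1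
      · have h2 : ((K s).2 : ℝ) ≠ (L t).2 := fun h' => h s t (Prod.ext hst (Subtype.ext h'))
        have hpos : 0 < |((K s).2 : ℝ) - (L t).2| := abs_pos.2 (sub_ne_zero.2 h2)
        have hc : Continuous fun z : 𝕋 × 𝕋 =>
          |((K z.1).2 : ℝ) - (L z.2).2| := by fun_prop
        have hev := (hc.tendsto (s, t)).eventually (lt_mem_nhds (half_lt_self hpos))
        refine ⟨_, mem_nhdsWithin_of_mem_nhds hev, 1, one_pos, _, half_pos hpos, fun z hz hz' => ?_⟩
        exact absurd hz' (not_lt.2 (le_of_lt hz))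
      · obtain ⟨μ, hμ, hm⟩ := exists_eventually_not_close hst
        have hc : Continuous fun z : 𝕋 × 𝕋 => ((K z.1).1, (L z.2).1) := by
          fun_prop
        have hev := (hc.tendsto (s, t)).eventually hm
        exact ⟨_, mem_nhdsWithin_of_mem_nhds hev, μ, hμ, 1, one_pos, fun z hz _ => hz⟩
  obtain ⟨μ, hμ, ε, hε, h⟩ := key
  exact ⟨μ, hμ, ε, hε, fun s t => h (s, t) trivial⟩

/-- The points of a curve in the cylinder stay close under small perturbations. -/
lemma eventually_forall_close (K : C(𝕋, Cylinder g)) {μ ε : ℝ} (hμ : 0 < μ)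
    (hε : 0 < ε) : ∀ᶠ P in 𝓝 K, ∀ s, Close g μ (rep (K s).1) (rep (P s).1) ∧
      |((K s).2 : ℝ) - (P s).2| < ε := by
  refine eventually_forall_mem K (D := {p | Close g μ (rep p.1.1) (rep p.2.1) ∧
    |(p.1.2 : ℝ) - p.2.2| < ε}) fun y => ?_
  have h1 : ∀ᶠ p : Cylinder g × Cylinder g in 𝓝 (y, y), Close g μ (rep p.1.1) (rep p.2.1) := by
    have hc : Continuous fun p : Cylinder g × Cylinder g => (p.1.1, p.2.1) := by fun_prop
    exact (hc.tendsto (y, y)).eventually (eventually_close_prod y.1 hμ)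
  have h2 : ∀ᶠ p : Cylinder g × Cylinder g in 𝓝 (y, y), |(p.1.2 : ℝ) - p.2.2| < ε := by
    have hc : Continuous fun p : Cylinder g × Cylinder g => |(p.1.2 : ℝ) - p.2.2| := by fun_prop
    exact (hc.tendsto (y, y)).eventually (gt_mem_nhds (by simpa))
  exact h1.and h2

/-- The index of disjoint curves does not change under small perturbations. -/
lemma exists_nhds_loopIndex_eq {K L : C(𝕋, Cylinder g)} (h : ∀ s t, K s ≠ L t) :
    ∃ U ∈ 𝓝 (K, L), ∀ P ∈ U, ∀ P' ∈ U, ∀ᶠ n : ℕ in atTop,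
      loopIndex n P.1 P.2 = loopIndex n P'.1 P'.2 := by
  obtain ⟨μ₀, hμ₀, ε₀, hε₀, hs⟩ := exists_separation h
  set μ := min (μ₀ / 20000) (1 / 10 ^ 8) with hμ
  have hμp : 0 < μ := by positivity
  have hμ1 : μ ≤ μ₀ / 20000 := min_le_left _ _
  have hμ2 : μ ≤ 1 / 10 ^ 8 := min_le_right _ _
  set ε := ε₀ / 6 with hε
  have hεp : 0 < ε := by positivity
  refine ⟨_, (eventually_forall_close K hμp hεp).prod_nhds (eventually_forall_close L hμp hεp), ?_⟩
  rintro ⟨P, Q⟩ ⟨hP, hQ⟩ ⟨P', Q'⟩ ⟨hP', hQ'⟩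
  have h4 : (0 : ℝ) < 4 * μ := by positivity
  have h2 : (0 : ℝ) < 2 * ε := by positivity
  filter_upwards [eventually_close_grid ((proj g).comp P) h4,
    eventually_close_grid ((proj g).comp P') h4, eventually_close_grid ((proj g).comp Q) h4,
    eventually_close_grid ((proj g).comp Q') h4,
    eventually_abs_grid (ContinuousMap.snd.comp P) h2,
    eventually_abs_grid (ContinuousMap.snd.comp Q) h2] with n c1 c2 c3 c4 c5 c6
  refine gridIndex_eq (μ := 4 * μ) (ε := 2 * ε) (by linarith) (fun _ => rep_le_one _)
    (fun _ => rep_le_one _) (fun _ => rep_le_one _) (fun _ => rep_le_one _) c1 c2 c3 c4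
    (fun i => ?_) (fun i => ?_) c5 c6 (fun i => ?_) (fun i => ?_) (fun i j hij hc => ?_)
  · exact ((hP _).1.symm.trans (hP' _).1 (by linarith) (by linarith)).mono (by linarith)
  · exact ((hQ _).1.symm.trans (hQ' _).1 (by linarith) (by linarith)).mono (by linarith)
  · have a1 := (hP (ZMod.toAddCircle i)).2; have a2 := (hP' (ZMod.toAddCircle i)).2
    rw [abs_lt] at *
    constructor <;> linarith
  · have a1 := (hQ (ZMod.toAddCircle i)).2; have a2 := (hQ' (ZMod.toAddCircle i)).2
    rw [abs_lt] at *
    constructor <;> linarith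
  · have a1 := hP (ZMod.toAddCircle i); have a2 := hQ (ZMod.toAddCircle j)
    refine hs (ZMod.toAddCircle i) (ZMod.toAddCircle j) ?_ ?_
    · have b1 := a1.2; have b2 := a2.2
      rw [abs_lt] at *
      constructor <;> linarith
    · exact ((a1.1.trans hc (by linarith) (by linarith)).trans a2.1.symm (by linarith)
        (by linarith)).mono (by linarith)

end

section

/-! ### The wall cochain in a flat chart -/

variable {g : ℕ}

/-- The canonical representative of the point with coordinates `ξ` in a flat chart. -/
def chartRep : FlatChart g → ℝ × ℝ → ℝ × ℝ
  | .cell, ξ => ξ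
  | .seam i r, ξ => if ξ.2 ≤ 1 then ξ else turn (i, r) ξ

/-- The function whose coboundary is the difference of the wall cochain and the wall cochain in a
chart. -/
def chartGauge : FlatChart g → ℝ × ℝ → ℝ × ℝ → ℤ
  | .cell, _, _ => 0
  | .seam _ _, ξ, η => if η.2 ≤ 1 then 0 else if ξ.2 < η.2 then (if η.1 < ξ.1 then 1 else 0)
      else if η.1 ≤ ξ.1 then 1 else 0

lemma param_eq_mk_chartRep (c : FlatChart g) (ξ : ℝ × ℝ) :
    c.param ξ = Surface.mk g (chartRep c ξ) := by
  cases c with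
  | cell => rfl
  | seam i r =>
    simp only [FlatChart.param, chartRep, turn]
    split_ifs <;> rfl

lemma rep_param {c : FlatChart g} {ξ : ℝ × ℝ} (h : ξ ∈ c.domain) :
    rep (c.param ξ) = chartRep c ξ := by
  rw [param_eq_mk_chartRep]
  cases c with
  | cell =>
    obtain ⟨⟨h1, h2⟩, h3, h4⟩ := h
    rw [chartRep, rep_mk ⟨h1.le, h2.le, h3.le, h4.le⟩, canon_of_not]
    rintro a ⟨-, -, h⟩; linarith
  | seam i r =>
    obtain ⟨⟨h1, h2⟩, h3, h4⟩ := h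
    have := slot_nonneg i r; have := slot_le i r
    simp only [chartRep]
    split_ifs with h5
    · rw [rep_mk ⟨by linarith, by linarith, h3.le, h5⟩, canon_of_not]
      rintro a ⟨k1, k2, k3⟩
      rcases slot_ne_right a.1 i a.2 r with h | h <;> linarith
    · rw [not_le] at h5
      rw [rep_mk ⟨by simp only [turn]; linarith, by simp only [turn]; linarith,
        by simp only [turn]; linarith, by simp only [turn]; linarith⟩, canon_of_not]
      rintro a ⟨k1, k2, k3⟩
      simp only [turn] at k3; linarith

lemma separated_of_not_near {μ : ℝ} {ξ ξ' η : ℝ × ℝ} (h : Near μ ξ ξ') (hs : ¬ Near (4 * μ) ξ η)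
    (h2 : |ξ.2 - η.2| < 4 * μ) : (η.1 < ξ.1 ∧ η.1 < ξ'.1) ∨ (ξ.1 < η.1 ∧ ξ'.1 < η.1) := by
  have h3 : 4 * μ ≤ |ξ.1 - η.1| := by
    by_contra! hc; exact hs ⟨hc, h2⟩
  have h1 := h.1
  rw [abs_lt] at h1
  rcases le_abs.1 h3 with h | h
  · left; constructor <;> linarith
  · right; constructor <;> linarith

/-- In a chart at a seam, the wall cochain of the rectangle differs from the wall cochain of the chart
by the coboundary of `chartGauge`. -/
lemma wallX_chartRep (c : FlatChart g) {μ : ℝ} (hμ : μ ≤ 1 / 8) {ξ ξ' η : ℝ × ℝ}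
    (hξ : ξ ∈ c.domain) (hξ' : ξ' ∈ c.domain) (hη : η ∈ c.domain)
    (h : Near μ ξ ξ') (hs : ¬ Near (4 * μ) ξ η) :
    wallX (chartRep c ξ) (chartRep c ξ') (chartRep c η) =
      wallX ξ ξ' η + chartGauge c ξ' η - chartGauge c ξ η := by
  cases c with
  | cell => simp [chartRep, chartGauge]
  | seam i r =>
    obtain ⟨⟨a1, a2⟩, -⟩ := hξ
    obtain ⟨⟨b1, b2⟩, -⟩ := hξ'
    obtain ⟨⟨c1, c2⟩, -⟩ := hη
    have key := separated_of_not_near h hs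
    obtain ⟨d1, d2⟩ := h
    have d3 : |ξ.1 - ξ'.1| < 1 := by linarith
    rw [abs_lt] at d2
    have e1 : |2 * slot i r + 3 - ξ.1 - (2 * slot i r + 3 - ξ'.1)| < 1 := by
      rwa [sub_sub_sub_cancel_left, abs_sub_comm]
    have e2 : ¬ |2 * slot i r + 3 - ξ.1 - ξ'.1| < 1 := by
      rw [not_lt, le_abs]; left; linarith
    have e3 : ¬ |ξ.1 - (2 * slot i r + 3 - ξ'.1)| < 1 := by
      rw [not_lt, le_abs]; right; linarith
    have n1 : ¬ 2 * slot i r + 3 - η.1 < ξ.1 := by linarith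
    have n2 : ¬ 2 * slot i r + 3 - η.1 < ξ'.1 := by linarith
    have n3 : η.1 < 2 * slot i r + 3 - ξ.1 := by linarith
    have n4 : η.1 < 2 * slot i r + 3 - ξ'.1 := by linarith
    simp only [chartRep, chartGauge, wallX, leftInd, d3, true_and]
    rw [abs_lt] at key
    by_cases t1 : ξ.2 ≤ 1 <;> by_cases t2 : ξ'.2 ≤ 1 <;> by_cases t3 : η.2 ≤ 1 <;>
      simp only [t1, t2, t3, if_true, if_false, turn, e1, d3, e2, e3, false_and, true_and, n1, n2,
        n3, n4, sub_lt_sub_iff_left] <;> clear e1 e2 e3 n1 n2 n3 n4 d3 d1 hs a1 a2 b1 b2 c1 c2 <;>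
      grind

lemma wallY_chartRep (c : FlatChart g) {μ : ℝ} (hμ : μ ≤ 1 / 8) {ξ η η' : ℝ × ℝ}
    (hξ : ξ ∈ c.domain) (hη : η ∈ c.domain) (hη' : η' ∈ c.domain)
    (h : Near μ η η') (hs : ¬ Near (4 * μ) η ξ) :
    wallY (chartRep c ξ) (chartRep c η) (chartRep c η') =
      wallY ξ η η' + chartGauge c ξ η' - chartGauge c ξ η := by
  cases c with
  | cell => simp [chartRep, chartGauge]
  | seam i r =>
    obtain ⟨⟨a1, a2⟩, -⟩ := hη
    obtain ⟨⟨b1, b2⟩, -⟩ := hη'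
    obtain ⟨⟨c1, c2⟩, -⟩ := hξ
    have key := separated_of_not_near h hs
    obtain ⟨d1, d2⟩ := h
    have d3 : ¬ 1 ≤ |η.1 - η'.1| := by linarith
    rw [abs_lt] at d2
    have e1 : ¬ 1 ≤ |2 * slot i r + 3 - η.1 - (2 * slot i r + 3 - η'.1)| := by
      rwa [sub_sub_sub_cancel_left, abs_sub_comm]
    have e2 : 1 ≤ |2 * slot i r + 3 - η.1 - η'.1| := by
      rw [le_abs]; left; linarith
    have e3 : 1 ≤ |η.1 - (2 * slot i r + 3 - η'.1)| := by
      rw [le_abs]; right; linarith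
    have n1 : ¬ 2 * slot i r + 3 - η.1 < ξ.1 := by linarith
    have n2 : ¬ 2 * slot i r + 3 - η'.1 < ξ.1 := by linarith
    have n3 : η.1 < 2 * slot i r + 3 - ξ.1 := by linarith
    have n4 : η'.1 < 2 * slot i r + 3 - ξ.1 := by linarith
    simp only [chartRep, chartGauge, wallY, leftInd, d3, or_false]
    rw [abs_lt] at key
    by_cases t1 : η.2 ≤ 1 <;> by_cases t2 : η'.2 ≤ 1 <;> by_cases t3 : ξ.2 ≤ 1 <;>
      simp only [t1, t2, t3, if_true, if_false, turn, e1, d3, e2, e3, or_true, or_false, n1, n2,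
        n3, n4, sub_lt_sub_iff_left] <;> clear e1 e2 e3 n1 n2 n3 n4 d3 d1 hs a1 a2 b1 b2 c1 c2 <;>
      grind

end

section

/-! ### The boundary of a square around a transverse crossing -/

variable {g : ℕ}

/-- A path of the first point that stays below (`0 < c`) or above (`c < 0`) the second point while it
passes it. -/
lemma sum_wallX_eq {m : ℕ} {u : ℕ → ℝ × ℝ} {v : ℝ × ℝ} {κ c : ℝ} (hκ : κ < 1)
    (hu : ∀ j < m, |(u j).1 - (u (j + 1)).1| ≤ κ)
    (hc : ∀ j < m, |v.1 - (u j).1| ≤ κ → 0 < c * (v.2 - (u j).2)) :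
    ∑ j ∈ Finset.range m, wallX (u j) (u (j + 1)) v =
      if 0 < c then leftInd (u 0) v - leftInd (u m) v else 0 := by
  have h : ∀ j ∈ Finset.range m, wallX (u j) (u (j + 1)) v =
      (if 0 < c then leftInd (u j) v else 0) - if 0 < c then leftInd (u (j + 1)) v else 0 := by
    intro j hj
    rw [Finset.mem_range] at hj
    have h1 : |(u j).1 - (u (j + 1)).1| < 1 := (hu j hj).trans_lt hκ
    by_cases he : leftInd (u j) v = leftInd (u (j + 1)) v
    · simp [wallX, he]
    · have h2 : |v.1 - (u j).1| ≤ κ := by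
        have := hu j hj
        rw [abs_le] at *
        unfold leftInd at he
        split_ifs at he <;> first | (exact absurd rfl he) | (constructor <;> linarith)
      have h3 := hc j hj h2
      rcases lt_trichotomy c 0 with h0 | h0 | h0
      · rw [wallX, if_neg, if_neg h0.not_gt, if_neg h0.not_gt, sub_zero]
        rintro ⟨-, h4⟩
        nlinarith
      · simp [h0] at h3
      · have h4 := pos_of_mul_pos_right h3 h0.le
        rw [wallX, if_pos ⟨h1, by linarith⟩, if_pos h0, if_pos h0]
  rw [Finset.sum_congr rfl h, Finset.sum_range_sub' (fun j => if 0 < c then leftInd (u j) v else 0)]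
  split_ifs <;> simp

lemma sum_wallY_eq {n : ℕ} {u : ℝ × ℝ} {v : ℕ → ℝ × ℝ} {κ c : ℝ} (hκ : κ < 1)
    (hv : ∀ j < n, |(v j).1 - (v (j + 1)).1| ≤ κ)
    (hc : ∀ j < n, |(v j).1 - u.1| ≤ κ → 0 < c * ((v j).2 - u.2)) :
    ∑ j ∈ Finset.range n, wallY u (v j) (v (j + 1)) =
      if 0 < c then leftInd u (v 0) - leftInd u (v n) else 0 := by
  have h : ∀ j ∈ Finset.range n, wallY u (v j) (v (j + 1)) =
      (if 0 < c then leftInd u (v j) else 0) - if 0 < c then leftInd u (v (j + 1)) else 0 := by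
    intro j hj
    rw [Finset.mem_range] at hj
    have h1 : ¬ 1 ≤ |(v j).1 - (v (j + 1)).1| := not_le.2 ((hv j hj).trans_lt hκ)
    by_cases he : leftInd u (v j) = leftInd u (v (j + 1))
    · simp [wallY, he]
    · have h2 : |(v j).1 - u.1| ≤ κ := by
        have := hv j hj
        rw [abs_le] at *
        unfold leftInd at he
        split_ifs at he <;> first | (exact absurd rfl he) | (constructor <;> linarith)
      have h3 := hc j hj h2
      rcases lt_trichotomy c 0 with h0 | h0 | h0
      · rw [wallY, if_neg, if_neg h0.not_gt, if_neg h0.not_gt, sub_zero]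
        rintro (h4 | h4)
        · nlinarith
        · exact h1 h4
      · simp [h0] at h3
      · have h4 := pos_of_mul_pos_right h3 h0.le
        rw [wallY, if_pos (.inl (by linarith)), if_pos h0, if_pos h0]
  rw [Finset.sum_congr rfl h, Finset.sum_range_sub' (fun j => if 0 < c then leftInd u (v j) else 0)]
  split_ifs <;> simp

/-- The points `u j` follow, up to the error `e * δ`, the line through `P` with velocity `V` for the
times from `-δ` to `δ`. -/
structure Follows (e δ : ℝ) (P V : ℝ × ℝ) (m : ℕ) (u : ℕ → ℝ × ℝ) (s : ℕ → ℝ) : Prop where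
  fst : ∀ j ≤ m, |(u j).1 - P.1 - s j * V.1| ≤ e * δ
  snd : ∀ j ≤ m, |(u j).2 - P.2 - s j * V.2| ≤ e * δ
  first : |s 0 + δ| ≤ e * δ
  last : |s m - δ| ≤ e * δ
  step : ∀ j < m, Near (e * δ) (u j) (u (j + 1))

/-- If `|z₁|` is small then `z` is, up to a small error, vertical, so that the sign of `z × V`
determines whether `z` points up or down. -/
lemma vertical_sign {ε D M E κ a x y v₁ v₂ z₁ z₂ : ℝ} (hε : ε = 1 ∨ ε = -1) 
    (h1 : |v₁| ≤ M) (h2 : |v₂| ≤ M) (hx : |x| ≤ E) (hy : |y| ≤ E)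
    (hz : z₁ * v₂ - z₂ * v₁ = a * D + (x * v₂ - y * v₁)) (hz1 : |z₁| ≤ κ)
    (hD : 2 * M * E + M * κ < ε * (a * D)) : 0 < -ε * v₁ * z₂ := by
  have b1 : |x * v₂| ≤ E * M := by rw [abs_mul]; exact mul_le_mul hx h2 (abs_nonneg _) ((abs_nonneg _).trans hx)
  have b2 : |y * v₁| ≤ E * M := by rw [abs_mul]; exact mul_le_mul hy h1 (abs_nonneg _) ((abs_nonneg _).trans hx)
  have b3 : |z₁ * v₂| ≤ κ * M := by rw [abs_mul]; exact mul_le_mul hz1 h2 (abs_nonneg _) ((abs_nonneg _).trans hz1)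
  rw [abs_le] at b1 b2 b3
  rcases hε with rfl | rfl <;> linarith

lemma not_both_small {ε D M E κ a x y v₁ v₂ z₁ z₂ : ℝ} (hε : ε = 1 ∨ ε = -1)
    (h1 : |v₁| ≤ M) (h2 : |v₂| ≤ M) (hx : |x| ≤ E) (hy : |y| ≤ E)
    (hz : z₁ * v₂ - z₂ * v₁ = a * D + (x * v₂ - y * v₁)) (hz1 : |z₁| ≤ κ) (hz2 : |z₂| ≤ κ)
    (hD : 2 * M * E + 2 * M * κ < ε * (a * D)) : False := by
  have b1 : |x * v₂| ≤ E * M := by rw [abs_mul]; exact mul_le_mul hx h2 (abs_nonneg _) ((abs_nonneg _).trans hx)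
  have b2 : |y * v₁| ≤ E * M := by rw [abs_mul]; exact mul_le_mul hy h1 (abs_nonneg _) ((abs_nonneg _).trans hx)
  have b3 : |z₁ * v₂| ≤ κ * M := by rw [abs_mul]; exact mul_le_mul hz1 h2 (abs_nonneg _) ((abs_nonneg _).trans hz1)
  have b4 : |z₂ * v₁| ≤ κ * M := by rw [abs_mul]; exact mul_le_mul hz2 h1 (abs_nonneg _) ((abs_nonneg _).trans hz1)
  rw [abs_le] at b1 b2 b3 b4
  rcases hε with rfl | rfl <;> linarith

lemma abs_sub_mul_le {t r b c M : ℝ} (h : |t - r| ≤ c) (hb : |b| ≤ M) :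
    |t * b - r * b| ≤ c * M := by
  rw [← sub_mul, abs_mul]; exact mul_le_mul h hb (abs_nonneg _) ((abs_nonneg _).trans h)

/-- The signs of the first coordinates of the difference vectors at the four corners of a square
around a crossing, weighted by the directions of the sides. -/
lemma corner_sum {A B Q u₀ u₁ v₀ v₁ : ℝ} (hQ : 0 < Q) (hA : A ≠ 0 → 8 * Q ≤ |A|)
    (hB : B ≠ 0 → 8 * Q ≤ |B|) (hAB : A ≠ 0 ∨ B ≠ 0) (c00 : |v₀ - u₀ - (A - B)| ≤ 4 * Q)
    (c01 : |v₀ - u₁ - (-A - B)| ≤ 4 * Q) (c10 : |v₁ - u₀ - (A + B)| ≤ 4 * Q)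
    (c11 : |v₁ - u₁ - (B - A)| ≤ 4 * Q) :
    ((if A < 0 then (if v₀ < u₀ then 1 else 0) - (if v₀ < u₁ then 1 else 0) else 0) +
      (if 0 < B then (if v₀ < u₁ then 1 else 0) - (if v₁ < u₁ then 1 else 0) else 0) -
      (if 0 < A then (if v₁ < u₀ then 1 else 0) - (if v₁ < u₁ then 1 else 0) else 0) -
      (if B < 0 then (if v₀ < u₀ then 1 else 0) - (if v₁ < u₀ then 1 else 0) else 0) : ℤ) = 1 ∧
    ((if 0 < A then (if v₀ < u₀ then 1 else 0) - (if v₀ < u₁ then 1 else 0) else 0) +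
      (if B < 0 then (if v₀ < u₁ then 1 else 0) - (if v₁ < u₁ then 1 else 0) else 0) -
      (if A < 0 then (if v₁ < u₀ then 1 else 0) - (if v₁ < u₁ then 1 else 0) else 0) -
      (if 0 < B then (if v₀ < u₀ then 1 else 0) - (if v₁ < u₀ then 1 else 0) else 0) : ℤ) = -1 := by
  simp only [abs_le] at c00 c01 c10 c11
  constructor <;> rcases lt_trichotomy A 0 with h | h | h <;> rcases lt_trichotomy B 0 with h' | h' | h' <;>
    grind

/-- The sum of the planar wall cochain over the boundary of a square around a transverse
crossing is the sign of the crossing. -/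
lemma exists_boundary_sum_eq {ε : ℤ} (hε : ε = 1 ∨ ε = -1) {V W : ℝ × ℝ}
    (hD : 0 < (ε : ℝ) * (V.1 * W.2 - V.2 * W.1)) : ∃ e > 0, ∀ (δ : ℝ) (P : ℝ × ℝ) (m n : ℕ)
      (u v : ℕ → ℝ × ℝ) (s t : ℕ → ℝ), 0 < δ → δ ≤ 1 →
      Follows e δ P V m u s → Follows e δ P W n v t →
      ((∀ j ≤ m, ¬ Near (4 * (e * δ)) (u j) (v 0)) ∧ (∀ j ≤ m, ¬ Near (4 * (e * δ)) (u j) (v n)) ∧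
       (∀ j ≤ n, ¬ Near (4 * (e * δ)) (v j) (u 0)) ∧ (∀ j ≤ n, ¬ Near (4 * (e * δ)) (v j) (u m))) ∧
      e * δ ≤ 1 / 8 ∧
      ∑ j ∈ Finset.range m, wallX (u j) (u (j + 1)) (v 0) +
        ∑ j ∈ Finset.range n, wallY (u m) (v j) (v (j + 1)) -
        ∑ j ∈ Finset.range m, wallX (u j) (u (j + 1)) (v n) -
        ∑ j ∈ Finset.range n, wallY (u 0) (v j) (v (j + 1)) = ε := by
  set M : ℝ := max 1 (max (max |V.1| |V.2|) (max |W.1| |W.2|)) with hM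
  have M1 : 1 ≤ M := le_max_left _ _
  have V1 : |V.1| ≤ M := ((le_max_left _ _).trans (le_max_left _ _)).trans (le_max_right _ _)
  have V2 : |V.2| ≤ M := ((le_max_right _ _).trans (le_max_left _ _)).trans (le_max_right _ _)
  have W1 : |W.1| ≤ M := ((le_max_left _ _).trans (le_max_right _ _)).trans (le_max_right _ _)
  have W2 : |W.2| ≤ M := ((le_max_right _ _).trans (le_max_right _ _)).trans (le_max_right _ _)
  clear_value M
  obtain ⟨e, he, he8, heD, heV, heW⟩ : ∃ e : ℝ, 0 < e ∧ e ≤ 1 / 8 ∧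
      16 * M ^ 2 * e ≤ ε * (V.1 * W.2 - V.2 * W.1) ∧ (V.1 ≠ 0 → 8 * M * e ≤ |V.1|) ∧
      (W.1 ≠ 0 → 8 * M * e ≤ |W.1|) := by
    have aux : ∀ x : ℝ, ∃ e : ℝ, 0 < e ∧ (x ≠ 0 → 8 * M * e ≤ |x|) := fun x => by
      by_cases hx : x = 0
      · exact ⟨1, one_pos, fun h => absurd hx h⟩
      · refine ⟨|x| / (8 * M), by positivity, fun _ => le_of_eq (by field_simp)⟩
    obtain ⟨e1, p1, q1⟩ := aux V.1
    obtain ⟨e2, p2, q2⟩ := aux W.1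
    set D := (ε : ℝ) * (V.1 * W.2 - V.2 * W.1)
    set e3 := D / (16 * M ^ 2) with he3
    have p3 : 0 < e3 := by positivity
    have q3 : 16 * M ^ 2 * e3 ≤ D := le_of_eq (by rw [he3]; field_simp)
    refine ⟨min (min e1 e2) (min e3 (1 / 8)), by positivity,
      (min_le_right _ _).trans (min_le_right _ _), le_trans ?_ q3, fun h => le_trans ?_ (q1 h),
      fun h => le_trans ?_ (q2 h)⟩ <;> gcongr
    · exact (min_le_right _ _).trans (min_le_left _ _)
    · exact (min_le_left _ _).trans (min_le_left _ _)
    · exact (min_le_left _ _).trans (min_le_right _ _)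
  refine ⟨e, he, fun δ P m n u v s t hδ hδ1 hu hv => ?_⟩
  have hεR : (ε : ℝ) = 1 ∨ (ε : ℝ) = -1 := by rcases hε with rfl | rfl <;> simp
  set D := V.1 * W.2 - V.2 * W.1 with hDd
  set κ := e * δ with hκ
  have hκ0 : 0 < κ := by positivity
  have hκ1 : κ ≤ 1 / 8 := by nlinarith
  have M2 : M ≤ M ^ 2 := by nlinarith
  have hDκ : 16 * M ^ 2 * κ ≤ ε * (δ * D) := by
    have := mul_le_mul_of_nonneg_right heD hδ.le
    linarith
  have hMκ : M * κ ≤ M ^ 2 * κ := mul_le_mul_of_nonneg_right M2 hκ0.le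
  have hM2κ : 0 < M ^ 2 * κ := by positivity
  have hκM : κ ≤ M * κ := by nlinarith
  -- the error of the difference vector on a side where one of the times is fixed
  have errT : ∀ i j, i ≤ n → j ≤ m → ∀ r, |t i - r| ≤ κ →
      |(v i).1 - (u j).1 - (r * W.1 - s j * V.1)| ≤ 3 * M * κ ∧
      |(v i).2 - (u j).2 - (r * W.2 - s j * V.2)| ≤ 3 * M * κ := by
    intro i j hi hj r hr
    have a1 := hu.fst j hj; have a2 := hu.snd j hj; have b1 := hv.fst i hi; have b2 := hv.snd i hi
    have c1 := abs_sub_mul_le hr W1; have c2 := abs_sub_mul_le hr W2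
    simp only [abs_le] at *
    refine ⟨⟨?_, ?_⟩, ?_, ?_⟩ <;> linarith
  have errS : ∀ i j, i ≤ n → j ≤ m → ∀ r, |s j - r| ≤ κ →
      |(v i).1 - (u j).1 - (t i * W.1 - r * V.1)| ≤ 3 * M * κ ∧
      |(v i).2 - (u j).2 - (t i * W.2 - r * V.2)| ≤ 3 * M * κ := by
    intro i j hi hj r hr
    have a1 := hu.fst j hj; have a2 := hu.snd j hj; have b1 := hv.fst i hi; have b2 := hv.snd i hi
    have c1 := abs_sub_mul_le hr V1; have c2 := abs_sub_mul_le hr V2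
    simp only [abs_le] at *
    refine ⟨⟨?_, ?_⟩, ?_, ?_⟩ <;> linarith
  have signT : ∀ η : ℝ, η = 1 ∨ η = -1 → ∀ i j, i ≤ n → j ≤ m → |t i - -(η * δ)| ≤ κ →
      |(v i).1 - (u j).1| ≤ 4 * κ → 0 < (-(η * ε) * V.1) * ((v i).2 - (u j).2) := by
    intro η hη i j hi hj hr hz
    obtain ⟨x1, x2⟩ := errT i j hi hj _ hr
    refine vertical_sign (ε := η * ε) (D := D) (M := M) (E := 3 * M * κ) (κ := 4 * κ)
      (a := η * δ) (z₁ := (v i).1 - (u j).1) ?_ V1 V2 x1 x2 ?_ hz ?_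
    · rcases hη with rfl | rfl <;> rcases hεR with h | h <;> simp [h]
    · rw [hDd]; ring
    · have : η * ε * (η * δ * D) = ε * (δ * D) := by rcases hη with rfl | rfl <;> ring
      rw [this]; nlinarith
  have signS : ∀ η : ℝ, η = 1 ∨ η = -1 → ∀ i j, i ≤ n → j ≤ m → |s j - -(η * δ)| ≤ κ →
      |(v i).1 - (u j).1| ≤ 4 * κ → 0 < (-(η * ε) * W.1) * ((v i).2 - (u j).2) := by
    intro η hη i j hi hj hr hz
    obtain ⟨x1, x2⟩ := errS i j hi hj _ hr
    refine vertical_sign (ε := η * ε) (D := D) (M := M) (E := 3 * M * κ) (κ := 4 * κ)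
      (a := η * δ) (z₁ := (v i).1 - (u j).1) ?_ W1 W2 x1 x2 ?_ hz ?_
    · rcases hη with rfl | rfl <;> rcases hεR with h | h <;> simp [h]
    · rw [hDd]; ring
    · have : η * ε * (η * δ * D) = ε * (δ * D) := by rcases hη with rfl | rfl <;> ring
      rw [this]; nlinarith
  have farT : ∀ η : ℝ, η = 1 ∨ η = -1 → ∀ i j, i ≤ n → j ≤ m → |t i - -(η * δ)| ≤ κ →
      ¬ Near (4 * κ) (u j) (v i) := by
    intro η hη i j hi hj hr hz
    obtain ⟨x1, x2⟩ := errT i j hi hj _ hr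
    refine not_both_small (ε := η * ε) (D := D) (M := M) (E := 3 * M * κ) (κ := 4 * κ)
      (a := η * δ) (z₁ := (v i).1 - (u j).1) (z₂ := (v i).2 - (u j).2) ?_ V1 V2 x1 x2 ?_
      hz.symm.1.le hz.symm.2.le ?_
    · rcases hη with rfl | rfl <;> rcases hεR with h | h <;> simp [h]
    · rw [hDd]; ring
    · have : η * ε * (η * δ * D) = ε * (δ * D) := by rcases hη with rfl | rfl <;> ring
      rw [this]; nlinarith
  have farS : ∀ η : ℝ, η = 1 ∨ η = -1 → ∀ i j, i ≤ n → j ≤ m → |s j - -(η * δ)| ≤ κ →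
      ¬ Near (4 * κ) (v i) (u j) := by
    intro η hη i j hi hj hr hz
    obtain ⟨x1, x2⟩ := errS i j hi hj _ hr
    refine not_both_small (ε := η * ε) (D := D) (M := M) (E := 3 * M * κ) (κ := 4 * κ)
      (a := η * δ) (z₁ := (v i).1 - (u j).1) (z₂ := (v i).2 - (u j).2) ?_ W1 W2 x1 x2 ?_
      hz.1.le hz.2.le ?_
    · rcases hη with rfl | rfl <;> rcases hεR with h | h <;> simp [h]
    · rw [hDd]; ring
    · have : η * ε * (η * δ * D) = ε * (δ * D) := by rcases hη with rfl | rfl <;> ring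
      rw [this]; nlinarith
  have t0 : |t 0 - -(1 * δ)| ≤ κ := by simpa using hv.first
  have tn : |t n - -(-1 * δ)| ≤ κ := by simpa using hv.last
  have s0 : |s 0 - -(1 * δ)| ≤ κ := by simpa using hu.first
  have sm : |s m - -(-1 * δ)| ≤ κ := by simpa using hu.last
  have corner : ∀ i j, i ≤ n → j ≤ m → ∀ r q, |t i - r| ≤ κ → |s j - q| ≤ κ →
      |(v i).1 - (u j).1 - (r * W.1 - q * V.1)| ≤ 4 * M * κ := by
    intro i j hi hj r q hr hq
    have x1 := (errT i j hi hj r hr).1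
    have x2 := abs_sub_mul_le hq V1
    rw [abs_le] at *
    constructor <;> linarith
  have c00 := corner 0 0 (Nat.zero_le _) (Nat.zero_le _) _ _ t0 s0
  have c0m := corner 0 m (Nat.zero_le _) le_rfl _ _ t0 sm
  have cn0 := corner n 0 le_rfl (Nat.zero_le _) _ _ tn s0
  have cnm := corner n m le_rfl le_rfl _ _ tn sm
  refine ⟨⟨fun j hj => farT 1 (.inl rfl) _ _ (Nat.zero_le _) hj t0,
    fun j hj => farT (-1) (.inr rfl) _ _ le_rfl hj tn,
    fun j hj => farS 1 (.inl rfl) _ _ hj (Nat.zero_le _) s0,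
    fun j hj => farS (-1) (.inr rfl) _ _ hj le_rfl sm⟩, hκ1, ?_⟩
  rw [sum_wallX_eq (κ := κ) (c := -(1 * ε) * V.1) (by linarith) (fun j hj => (hu.step j hj).1.le)
      (fun j hj hz => signT 1 (.inl rfl) 0 j (Nat.zero_le _) hj.le t0 (by linarith)),
    sum_wallX_eq (κ := κ) (c := -(-1 * ε) * V.1) (by linarith) (fun j hj => (hu.step j hj).1.le)
      (fun j hj hz => signT (-1) (.inr rfl) n j le_rfl hj.le tn (by linarith)),
    sum_wallY_eq (κ := κ) (c := -(1 * ε) * W.1) (by linarith) (fun j hj => (hv.step j hj).1.le)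
      (fun j hj hz => signS 1 (.inl rfl) j 0 hj.le (Nat.zero_le _) s0 (by linarith)),
    sum_wallY_eq (κ := κ) (c := -(-1 * ε) * W.1) (by linarith) (fun j hj => (hv.step j hj).1.le)
      (fun j hj hz => signS (-1) (.inr rfl) j m hj.le le_rfl sm (by linarith))]
  have hA : V.1 ≠ 0 → 8 * (M * κ) ≤ |δ * V.1| := fun h => by
    rw [abs_mul, abs_of_pos hδ]
    have := mul_le_mul_of_nonneg_left (heV h) hδ.le
    linarith
  have hB : W.1 ≠ 0 → 8 * (M * κ) ≤ |δ * W.1| := fun h => by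
    rw [abs_mul, abs_of_pos hδ]
    have := mul_le_mul_of_nonneg_left (heW h) hδ.le
    linarith
  have hVW : V.1 ≠ 0 ∨ W.1 ≠ 0 := by
    by_contra! hc
    rw [hDd, hc.1, hc.2] at hD
    simp at hD
  have hMκ0 : 0 < M * κ := by positivity
  have sA : (0 < V.1 ↔ 0 < δ * V.1) ∧ (V.1 < 0 ↔ δ * V.1 < 0) :=
    ⟨(mul_pos_iff_of_pos_left hδ).symm, ⟨fun h => mul_neg_of_pos_of_neg hδ h, fun h => by by_contra! hc; exact absurd h (not_lt.2 (by positivity))⟩⟩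
  have sB : (0 < W.1 ↔ 0 < δ * W.1) ∧ (W.1 < 0 ↔ δ * W.1 < 0) :=
    ⟨(mul_pos_iff_of_pos_left hδ).symm, ⟨fun h => mul_neg_of_pos_of_neg hδ h, fun h => by by_contra! hc; exact absurd h (not_lt.2 (by positivity))⟩⟩
  have hAB : δ * V.1 ≠ 0 ∨ δ * W.1 ≠ 0 := hVW.imp (mul_ne_zero hδ.ne') (mul_ne_zero hδ.ne')
  have key := corner_sum (A := δ * V.1) (B := δ * W.1) hMκ0
    (fun h => hA (right_ne_zero_of_mul h)) (fun h => hB (right_ne_zero_of_mul h)) hAB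
    (u₀ := (u 0).1) (u₁ := (u m).1) (v₀ := (v 0).1) (v₁ := (v n).1)
    (by rw [← mul_assoc]; convert c00 using 2; ring) (by rw [← mul_assoc]; convert c0m using 2; ring)
    (by rw [← mul_assoc]; convert cn0 using 2; ring) (by rw [← mul_assoc]; convert cnm using 2; ring)
  rcases hε with rfl | rfl
  · refine Eq.trans ?_ key.1
    simp [leftInd, sA.1, sA.2, sB.1, sB.2]
  · refine Eq.trans ?_ key.2
    simp [leftInd, sA.1, sA.2, sB.1, sB.2]

end

section

open Filter

/-! ### The index near a transverse crossing -/

variable {g : ℕ}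

lemma toAddCircle_eq_div {n : ℕ} (k : ℤ) :
    ZMod.toAddCircle ((k : ℤ) : ZMod (n + 1)) = (((k : ℝ) / (n + 1) : ℝ) : 𝕋) := by
  rw [ZMod.toAddCircle_intCast]; simp

/-- The vertices of the discretization that lie in an interval of the circle. -/
lemma exists_sum_interval (s₀ : ℝ) {δ : ℝ} (hδ : 0 < δ) (hδ' : δ < 1 / 4) (n : ℕ) :
    ∃ (k₁ : ℤ) (m : ℕ), (∀ f : ZMod (n + 1) → ℤ,
      (∑ k, if dist (ZMod.toAddCircle k) (s₀ : 𝕋) < δ then f k else 0) =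
        ∑ j ∈ Finset.range m, f ((k₁ + j : ℤ) : ZMod (n + 1))) ∧
      |(k₁ : ℝ) / (n + 1) - (s₀ - δ)| ≤ 1 / (n + 1) ∧
      |((k₁ + m : ℤ) : ℝ) / (n + 1) - (s₀ + δ)| ≤ 1 / (n + 1) := by
  set N : ℝ := n + 1 with hN
  have hN0 : 0 < N := by positivity
  set k₁ : ℤ := ⌊(s₀ - δ) * N⌋ + 1 with hk₁
  set k₂ : ℤ := ⌈(s₀ + δ) * N⌉ with hk₂
  have a1 := Int.lt_floor_add_one ((s₀ - δ) * N)
  have a2 := Int.floor_le ((s₀ - δ) * N)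
  have b1 := Int.le_ceil ((s₀ + δ) * N)
  have b2 := Int.ceil_lt_add_one ((s₀ + δ) * N)
  have ek₁ : (k₁ : ℝ) = ⌊(s₀ - δ) * N⌋ + 1 := by rw [hk₁]; push_cast; ring
  have hle : k₁ ≤ k₂ := by
    have : (k₁ : ℝ) < k₂ + 1 := by rw [ek₁]; nlinarith
    have : k₁ < k₂ + 1 := by exact_mod_cast this
    omega
  have hm : k₁ + ((k₂ - k₁).toNat : ℤ) = k₂ := by rw [Int.toNat_of_nonneg (by omega)]; ring
  refine ⟨k₁, (k₂ - k₁).toNat, fun f => ?_, ?_, ?_⟩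
  · rw [← Finset.sum_filter]
    symm
    refine Finset.sum_bij (fun j _ => ((k₁ + j : ℤ) : ZMod (n + 1))) ?_ ?_ ?_ (fun _ _ => rfl)
    · intro j hj
      rw [Finset.mem_range] at hj
      rw [Finset.mem_filter]
      refine ⟨Finset.mem_univ _, ?_⟩
      rw [toAddCircle_eq_div, dist_eq_norm, ← AddCircle.coe_sub, UnitAddCircle.norm_eq]
      refine (round_le _ 0).trans_lt ?_
      have h1 : k₁ + (j : ℤ) + 1 ≤ k₂ := by omega
      have h2 : (k₁ : ℝ) + j + 1 ≤ k₂ := by exact_mod_cast h1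
      have h3 : (0 : ℝ) ≤ j := by positivity
      rw [Int.cast_zero, sub_zero, abs_lt, ← hN]
      push_cast
      constructor
      · rw [lt_sub_iff_add_lt, lt_div_iff₀ hN0]; linarith
      · rw [sub_lt_iff_lt_add, div_lt_iff₀ hN0]; linarith
    · intro i hi j hj hij
      rw [Finset.mem_range] at hi hj
      rw [ZMod.intCast_eq_intCast_iff_dvd_sub] at hij
      have h5 : ((k₂ - k₁ : ℤ) : ℝ) < N + 1 := by push_cast; rw [ek₁]; nlinarith
      have h6 : k₂ - k₁ < (n : ℤ) + 1 + 1 := by rw [hN] at h5; exact_mod_cast h5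
      obtain ⟨c, hc⟩ := hij
      have h7 : c = 0 := by
        push_cast at hc
        by_contra hne
        rcases lt_or_gt_of_ne hne with h | h
        · nlinarith [show c ≤ -1 by omega]
        · nlinarith [show 1 ≤ c by omega]
      subst h7
      push_cast at hc
      omega
    · intro k hk
      rw [Finset.mem_filter] at hk
      have hk2 := hk.2
      have e : ((k.val : ℤ) : ZMod (n + 1)) = k := by simp
      rw [← e, toAddCircle_eq_div, dist_eq_norm, ← AddCircle.coe_sub, UnitAddCircle.norm_eq] at hk2
      set q := round (((k.val : ℤ) : ℝ) / (n + 1) - s₀) with hq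
      have h1 : |(((k.val : ℤ) - q * (n + 1) : ℤ) : ℝ) / N - s₀| < δ := by
        have : (((k.val : ℤ) - q * (n + 1) : ℤ) : ℝ) / N - s₀ =
            ((k.val : ℤ) : ℝ) / (n + 1) - s₀ - q := by
          push_cast; rw [← hN]; field_simp; ring
        rwa [this]
      set κ : ℤ := (k.val : ℤ) - q * (n + 1) with hκ
      rw [abs_lt, lt_sub_iff_add_lt, lt_div_iff₀ hN0, sub_lt_iff_lt_add, div_lt_iff₀ hN0] at h1
      have h2 : k₁ ≤ κ := by
        rw [hk₁]
        have : (⌊(s₀ - δ) * N⌋ : ℝ) < κ := by linarith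
        have : ⌊(s₀ - δ) * N⌋ < κ := by exact_mod_cast this
        omega
      have h3 : κ < k₂ := by
        have : (κ : ℝ) < k₂ := by linarith
        exact_mod_cast this
      refine ⟨(κ - k₁).toNat, by rw [Finset.mem_range]; omega, ?_⟩
      rw [Int.toNat_of_nonneg (by omega), add_sub_cancel, hκ]
      have hz : ((n : ZMod (n + 1)) + 1) = 0 := by exact_mod_cast ZMod.natCast_self (n + 1)
      push_cast
      rw [hz, mul_zero, sub_zero, ZMod.natCast_zmod_val]
  · have : (k₁ : ℝ) / N - (s₀ - δ) = (k₁ - (s₀ - δ) * N) / N := by field_simp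
    rw [this, abs_of_nonneg (div_nonneg (by linarith) hN0.le)]
    gcongr
    linarith
  · rw [hm]
    have : (k₂ : ℝ) / N - (s₀ + δ) = (k₂ - (s₀ + δ) * N) / N := by field_simp
    rw [this, abs_of_nonneg (div_nonneg (by linarith) hN0.le)]
    gcongr
    linarith

lemma chartRep_injOn (c : FlatChart g) {ξ η : ℝ × ℝ} (hξ : ξ ∈ c.domain) (hη : η ∈ c.domain)
    (h : chartRep c ξ = chartRep c η) : ξ = η := by
  cases c with
  | cell => exact h
  | seam i r =>
    obtain ⟨⟨a1, a2⟩, -⟩ := hξ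
    obtain ⟨⟨b1, b2⟩, -⟩ := hη
    simp only [chartRep, turn] at h
    split_ifs at h <;> simp only [Prod.ext_iff] at h ⊢ <;> constructor <;> linarith [h.1, h.2]

/-- A curve with a velocity stays close to its tangent. -/
lemma tangent_bound {X : ℝ → ℝ × ℝ} {V : ℝ × ℝ} {s₀ : ℝ} (h : HasDerivAt X V s₀) {e : ℝ}
    (he : 0 < e) : ∀ᶠ r in 𝓝 s₀, |(X r).1 - (X s₀).1 - (r - s₀) * V.1| ≤ e * |r - s₀| ∧
      |(X r).2 - (X s₀).2 - (r - s₀) * V.2| ≤ e * |r - s₀| := by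
  filter_upwards [h.isLittleO.def he] with r hr
  rw [Real.norm_eq_abs] at hr
  exact ⟨(norm_fst_le _).trans hr, (norm_snd_le _).trans hr⟩

lemma sum_sum_wallD (m n : ℕ) (u v : ℕ → ℝ × ℝ) :
    ∑ j ∈ Finset.range m, ∑ i ∈ Finset.range n, wallD (u j) (u (j + 1)) (v i) (v (i + 1)) =
      ∑ j ∈ Finset.range m, wallX (u j) (u (j + 1)) (v 0) +
        ∑ j ∈ Finset.range n, wallY (u m) (v j) (v (j + 1)) -
        ∑ j ∈ Finset.range m, wallX (u j) (u (j + 1)) (v n) -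
        ∑ j ∈ Finset.range n, wallY (u 0) (v j) (v (j + 1)) := by
  have h1 : ∀ j ∈ Finset.range m,
      ∑ i ∈ Finset.range n, wallD (u j) (u (j + 1)) (v i) (v (i + 1)) =
      (wallX (u j) (u (j + 1)) (v 0) - wallX (u j) (u (j + 1)) (v n)) +
      (∑ i ∈ Finset.range n, wallY (u (j + 1)) (v i) (v (i + 1)) -
        ∑ i ∈ Finset.range n, wallY (u j) (v i) (v (i + 1))) := by
    intro j _
    rw [← Finset.sum_range_sub' (fun i => wallX (u j) (u (j + 1)) (v i)), ← Finset.sum_sub_distrib,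
      ← Finset.sum_add_distrib]
    refine Finset.sum_congr rfl fun i _ => ?_
    unfold wallD; ring
  rw [Finset.sum_congr rfl h1, Finset.sum_add_distrib, Finset.sum_sub_distrib,
    Finset.sum_range_sub (fun j => ∑ i ∈ Finset.range n, wallY (u j) (v i) (v (i + 1)))]
  ring

/-- The sum over a square around a transverse crossing, in a chart. -/
lemma sum_wallD_chart (c : FlatChart g) {μ : ℝ} (hμ : μ ≤ 1 / 8) {m n : ℕ} {u v : ℕ → ℝ × ℝ}
    (hu : ∀ j ≤ m, u j ∈ c.domain) (hv : ∀ j ≤ n, v j ∈ c.domain)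
    (su : ∀ j < m, Near μ (u j) (u (j + 1))) (sv : ∀ j < n, Near μ (v j) (v (j + 1)))
    (h1 : ∀ j ≤ m, ¬ Near (4 * μ) (u j) (v 0)) (h2 : ∀ j ≤ m, ¬ Near (4 * μ) (u j) (v n))
    (h3 : ∀ j ≤ n, ¬ Near (4 * μ) (v j) (u 0)) (h4 : ∀ j ≤ n, ¬ Near (4 * μ) (v j) (u m)) :
    ∑ j ∈ Finset.range m, ∑ i ∈ Finset.range n, wallD (chartRep c (u j)) (chartRep c (u (j + 1)))
        (chartRep c (v i)) (chartRep c (v (i + 1))) =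
      ∑ j ∈ Finset.range m, wallX (u j) (u (j + 1)) (v 0) +
        ∑ j ∈ Finset.range n, wallY (u m) (v j) (v (j + 1)) -
        ∑ j ∈ Finset.range m, wallX (u j) (u (j + 1)) (v n) -
        ∑ j ∈ Finset.range n, wallY (u 0) (v j) (v (j + 1)) := by
  rw [sum_sum_wallD m n (fun j => chartRep c (u j)) (fun j => chartRep c (v j))]
  have x : ∀ i ≤ n, (∀ j ≤ m, ¬ Near (4 * μ) (u j) (v i)) → ∑ j ∈ Finset.range m,
      wallX (chartRep c (u j)) (chartRep c (u (j + 1))) (chartRep c (v i)) =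
      ∑ j ∈ Finset.range m, wallX (u j) (u (j + 1)) (v i) +
      (chartGauge c (u m) (v i) - chartGauge c (u 0) (v i)) := by
    intro i hi h
    rw [← Finset.sum_range_sub (fun j => chartGauge c (u j) (v i)), ← Finset.sum_add_distrib]
    refine Finset.sum_congr rfl fun j hj => ?_
    rw [Finset.mem_range] at hj
    rw [wallX_chartRep c hμ (hu j hj.le) (hu (j + 1) hj) (hv i hi) (su j hj) (h j hj.le)]
    ring
  have y : ∀ j ≤ m, (∀ i ≤ n, ¬ Near (4 * μ) (v i) (u j)) → ∑ i ∈ Finset.range n,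
      wallY (chartRep c (u j)) (chartRep c (v i)) (chartRep c (v (i + 1))) =
      ∑ i ∈ Finset.range n, wallY (u j) (v i) (v (i + 1)) +
      (chartGauge c (u j) (v n) - chartGauge c (u j) (v 0)) := by
    intro j hj h
    rw [← Finset.sum_range_sub (fun i => chartGauge c (u j) (v i)), ← Finset.sum_add_distrib]
    refine Finset.sum_congr rfl fun i hi => ?_
    rw [Finset.mem_range] at hi
    rw [wallY_chartRep c hμ (hu j hj) (hv i hi.le) (hv (i + 1) hi) (sv i hi) (h i hi.le)]
    ring
  rw [x 0 (Nat.zero_le _) h1, x n le_rfl h2, y 0 (Nat.zero_le _) h3, y m le_rfl h4]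
  ring

/-- Two curves with linearly independent velocities do not meet again near their crossing. -/
lemma isolated_of_bounds {V W : ℝ × ℝ} {ε e M a b x y : ℝ} (hε : ε = 1 ∨ ε = -1)
    (hD : 4 * M * e < ε * (V.1 * W.2 - V.2 * W.1)) (V1 : |V.1| ≤ M) (V2 : |V.2| ≤ M)
    (W1 : |W.1| ≤ M) (W2 : |W.2| ≤ M) (h1 : |x - y| ≤ e * (|a| + |b|))
    (hx : x = a * V.1 - b * W.1) {x' y' : ℝ} (h2 : |x' - y'| ≤ e * (|a| + |b|))
    (hx' : x' = a * V.2 - b * W.2) (hy : y = 0) (hy' : y' = 0) : a = 0 ∧ b = 0 := by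
  subst hy hy'
  rw [sub_zero] at h1 h2
  have hM : 0 ≤ M := (abs_nonneg _).trans V1
  set S := e * (|a| + |b|) with hS
  have hS0 : 0 ≤ S := (abs_nonneg _).trans h1
  have k : ∀ p q : ℝ, |p| ≤ M → |q| ≤ S → |p * q| ≤ M * S := fun p q hp hq => by
    rw [abs_mul]; exact mul_le_mul hp hq (abs_nonneg _) hM
  have ha : |a * (V.1 * W.2 - V.2 * W.1)| ≤ 2 * (M * S) := by
    have : a * (V.1 * W.2 - V.2 * W.1) = W.2 * x - W.1 * x' := by rw [hx, hx']; ring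
    rw [this]
    have := abs_sub (W.2 * x) (W.1 * x'); have := k _ _ W2 h1; have := k _ _ W1 h2
    linarith
  have hb : |b * (V.1 * W.2 - V.2 * W.1)| ≤ 2 * (M * S) := by
    have : b * (V.1 * W.2 - V.2 * W.1) = V.2 * x - V.1 * x' := by rw [hx, hx']; ring
    rw [this]
    have := abs_sub (V.2 * x) (V.1 * x'); have := k _ _ V2 h1; have := k _ _ V1 h2
    linarith
  have hD' : 4 * M * e < |V.1 * W.2 - V.2 * W.1| := by
    rcases hε with rfl | rfl
    · exact (one_mul (V.1 * W.2 - V.2 * W.1) ▸ hD).trans_le (le_abs_self _)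
    · exact (neg_one_mul (V.1 * W.2 - V.2 * W.1) ▸ hD).trans_le (neg_le_abs _)
  rw [abs_mul] at ha hb
  have hsum : |a| + |b| = 0 := by
    by_contra hne
    have hpos : 0 < |a| + |b| := lt_of_le_of_ne (by positivity) (Ne.symm hne)
    have := mul_lt_mul_of_pos_left hD' hpos
    rw [hS] at ha hb
    nlinarith
  have := abs_nonneg a; have := abs_nonneg b
  exact ⟨abs_eq_zero.1 (by linarith), abs_eq_zero.1 (by linarith)⟩

lemma exists_coe_eq_of_dist_lt {s₀ δ : ℝ} {x : 𝕋} (h : dist x (s₀ : 𝕋) < δ) :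
    ∃ r : ℝ, (r : 𝕋) = x ∧ |r - s₀| < δ := by
  induction x using QuotientAddGroup.induction_on with
  | H x =>
    change dist ((x : ℝ) : 𝕋) s₀ < δ at h
    rw [dist_eq_norm, ← AddCircle.coe_sub, UnitAddCircle.norm_eq] at h
    refine ⟨x - round (x - s₀), ?_, by rwa [sub_right_comm]⟩
    rw [AddCircle.coe_sub, sub_eq_self]
    exact AddCircle.coe_eq_zero_iff (p := (1 : ℝ)) |>.2 ⟨round (x - s₀), by simp⟩

/-- Around a transverse crossing the wall cochain contributes the sign of the crossing to the index,
and there are no other crossings. -/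
lemma CrossesWithSign.exists_sum_eq {ε : ℤ} (hε : ε = 1 ∨ ε = -1)
    {α β : C(𝕋, Surface g)} {z : 𝕋 × 𝕋}
    (h : CrossesWithSign ε α β z) :
    ∃ δ₀ > 0, (∀ z' ∈ Metric.ball z δ₀, α z'.1 = β z'.2 → z' = z) ∧
      ∀ δ, 0 < δ → δ < δ₀ → ∀ᶠ n : ℕ in atTop, (∑ k : ZMod (n + 1), ∑ l : ZMod (n + 1),
        if dist (ZMod.toAddCircle k, ZMod.toAddCircle l) z < δ then
          wallD (gridRep n α k) (gridRep n α (k + 1)) (gridRep n β l) (gridRep n β (l + 1))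
        else 0) = ε := by
  obtain ⟨hz, c, V, W, ⟨s₀, X, hs, hX, hXd, hXe⟩, ⟨t₀, Y, ht, hY, hYd, hYe⟩, hD⟩ := h
  obtain ⟨zs, zt⟩ := z
  simp only at hs ht hz
  subst hs ht
  have hεR : (ε : ℝ) = 1 ∨ (ε : ℝ) = -1 := by rcases hε with rfl | rfl <;> simp
  have hopen : IsOpen c.domain := by
    cases c <;> exact isOpen_Ioo.prod isOpen_Ioo
  have hXY : X s₀ = Y t₀ := by
    apply chartRep_injOn c hXd hYd
    rw [← rep_param hXd, ← rep_param hYd, ← hXe.self_of_nhds, ← hYe.self_of_nhds, hz]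
  obtain ⟨e, he, hbox⟩ := exists_boundary_sum_eq hε hD
  obtain ⟨M, M1, V1, V2, W1, W2⟩ : ∃ M : ℝ, 1 ≤ M ∧ |V.1| ≤ M ∧ |V.2| ≤ M ∧ |W.1| ≤ M ∧ |W.2| ≤ M :=
    ⟨1 + |V.1| + |V.2| + |W.1| + |W.2|, by
      have := abs_nonneg V.1; have := abs_nonneg V.2; have := abs_nonneg W.1
      have := abs_nonneg W.2
      refine ⟨?_, ?_, ?_, ?_, ?_⟩ <;> linarith⟩
  set D := (ε : ℝ) * (V.1 * W.2 - V.2 * W.1) with hDd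
  set e' := min (e / 8) (D / (8 * M)) with he'
  have he'0 : 0 < e' := by positivity
  have he'1 : e' ≤ e / 8 := min_le_left _ _
  have he'2 : 4 * M * e' < D := by
    have : e' ≤ D / (8 * M) := min_le_right _ _
    calc 4 * M * e' ≤ 4 * M * (D / (8 * M)) := by gcongr
      _ = D / 2 := by field_simp; ring
      _ < D := by linarith
  obtain ⟨δ₁, hδ₁, hX1⟩ := Metric.eventually_nhds_iff.1
    ((tangent_bound hX he'0).and (hXe.and (hX.continuousAt.eventually (hopen.mem_nhds hXd))))
  obtain ⟨δ₂, hδ₂, hY1⟩ := Metric.eventually_nhds_iff.1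
    ((tangent_bound hY he'0).and (hYe.and (hY.continuousAt.eventually (hopen.mem_nhds hYd))))
  simp only [Real.dist_eq] at hX1 hY1
  refine ⟨min (min δ₁ δ₂ / 2) (1 / 4), by positivity, ?_, ?_⟩
  · rintro ⟨x, y⟩ hxy hαβ
    rw [Metric.mem_ball, Prod.dist_eq, max_lt_iff] at hxy
    obtain ⟨r, rfl, hr⟩ := exists_coe_eq_of_dist_lt hxy.1
    obtain ⟨q, rfl, hq⟩ := exists_coe_eq_of_dist_lt hxy.2
    simp only [lt_min_iff] at hr hq
    have m1 := min_le_left δ₁ δ₂; have m2 := min_le_right δ₁ δ₂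
    obtain ⟨⟨x1, x2⟩, x3, x4⟩ := hX1 (y := r) (by linarith)
    obtain ⟨⟨y1, y2⟩, y3, y4⟩ := hY1 (y := q) (by linarith)
    have hXY' : X r = Y q := by
      apply chartRep_injOn c x4 y4
      rw [← rep_param x4, ← rep_param y4, ← x3, ← y3]
      exact congrArg rep hαβ
    have key := isolated_of_bounds (x := (r - s₀) * V.1 - (q - t₀) * W.1) (y := 0)
      (x' := (r - s₀) * V.2 - (q - t₀) * W.2) (y' := 0) hεR he'2 V1 V2 W1 W2
      (a := r - s₀) (b := q - t₀) ?_ rfl ?_ rfl rfl rfl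
    · rw [sub_eq_zero.1 key.1, sub_eq_zero.1 key.2]
    · rw [hXY, hXY'] at x1
      rw [mul_add]
      rw [abs_le] at *
      constructor <;> linarith
    · rw [hXY, hXY'] at x2
      rw [mul_add]
      rw [abs_le] at *
      constructor <;> linarith
  · intro δ hδ hδ'
    simp only [lt_min_iff] at hδ'
    have m1 := min_le_left δ₁ δ₂; have m2 := min_le_right δ₁ δ₂
    have hpos : 0 < min (e * δ / (4 * M)) δ := by positivity
    filter_upwards [tendsto_one_div_add_atTop_nhds_zero_nat.eventually (gt_mem_nhds hpos)] with n hn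
    simp only [lt_min_iff] at hn
    obtain ⟨hn1, hn2⟩ := hn
    have hn3 : M * (1 / ((n : ℝ) + 1)) < e * δ / 4 := by
      calc M * (1 / ((n : ℝ) + 1)) < M * (e * δ / (4 * M)) := by gcongr
        _ = e * δ / 4 := by field_simp
    have hn4 : 0 < 1 / ((n : ℝ) + 1) := by positivity
    obtain ⟨k₁, m, hk, hk1, hk2⟩ := exists_sum_interval s₀ hδ hδ'.2 n
    obtain ⟨l₁, m', hl, hl1, hl2⟩ := exists_sum_interval t₀ hδ hδ'.2 n
    -- both curves follow their tangents along the discretization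
    have follow : ∀ (Z : ℝ → ℝ × ℝ) (U : ℝ × ℝ) (r₀ δ' : ℝ) (k₁ : ℤ) (m : ℕ), 2 * δ < δ' →
        |U.1| ≤ M → |U.2| ≤ M → |(k₁ : ℝ) / (n + 1) - (r₀ - δ)| ≤ 1 / (n + 1) →
        |((k₁ + m : ℤ) : ℝ) / (n + 1) - (r₀ + δ)| ≤ 1 / (n + 1) →
        (∀ r, |r - r₀| < δ' → |(Z r).1 - (Z r₀).1 - (r - r₀) * U.1| ≤ e' * |r - r₀| ∧
          |(Z r).2 - (Z r₀).2 - (r - r₀) * U.2| ≤ e' * |r - r₀|) →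
        (∀ j ≤ m, |((k₁ + j : ℤ) : ℝ) / (n + 1) - r₀| < δ') ∧
        Follows e δ (Z r₀) U m (fun j => Z (((k₁ + j : ℤ) : ℝ) / (n + 1)))
          (fun j => ((k₁ + j : ℤ) : ℝ) / (n + 1) - r₀) := by
      intro Z U r₀ δ' k₁ m hδ'' U1 U2 hk1 hk2 hZ
      have bd : ∀ j ≤ m, |((k₁ + j : ℤ) : ℝ) / (n + 1) - r₀| < 2 * δ := by
        intro j hj
        have e1 : (k₁ : ℝ) / (n + 1) ≤ ((k₁ + j : ℤ) : ℝ) / (n + 1) := by gcongr; simp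
        have e2 : ((k₁ + j : ℤ) : ℝ) / (n + 1) ≤ ((k₁ + m : ℤ) : ℝ) / (n + 1) := by
          gcongr
        rw [abs_le] at hk1 hk2
        rw [abs_lt]
        constructor <;> linarith
      have b := fun j hj => hZ _ ((bd j hj).trans hδ'')
      have ee : ∀ j ≤ m, e' * |((k₁ + j : ℤ) : ℝ) / (n + 1) - r₀| ≤ e * δ / 4 := fun j hj => by
        calc e' * |((k₁ + j : ℤ) : ℝ) / (n + 1) - r₀| ≤ e / 8 * (2 * δ) := by
              gcongr; exact (bd j hj).le
          _ = e * δ / 4 := by ring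
      have hee : 0 < e * δ := by positivity
      have h4 : 1 / ((n : ℝ) + 1) ≤ e * δ := by nlinarith
      refine ⟨fun j hj => (bd j hj).trans hδ'', ⟨fun j hj => ?_, fun j hj => ?_, ?_, ?_, ?_⟩⟩
      · have := (b j hj).1; have := ee j hj; linarith
      · have := (b j hj).2; have := ee j hj; linarith
      · have : ((k₁ + (0 : ℕ) : ℤ) : ℝ) / (n + 1) - r₀ + δ = (k₁ : ℝ) / (n + 1) - (r₀ - δ) := by
          push_cast; ring
        rw [this]; exact hk1.trans h4
      · rw [sub_sub]; exact hk2.trans h4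
      · intro j hj
        have c1 := b j hj.le; have c2 := b (j + 1) hj
        have d1 := ee j hj.le; have d2 := ee (j + 1) hj
        have st : ((k₁ + (j + 1 : ℕ) : ℤ) : ℝ) / (n + 1) = ((k₁ + j : ℤ) : ℝ) / (n + 1) +
            1 / (n + 1) := by push_cast; ring
        have f : ∀ x : ℝ, |x| ≤ M → |1 / ((n : ℝ) + 1) * x| ≤ M * (1 / ((n : ℝ) + 1)) := fun x hx => by
          rw [abs_mul, abs_of_pos hn4, mul_comm]; gcongr
        have f1 := f _ U1; have f2 := f _ U2
        rw [st] at c2 d2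
        simp only [st]
        generalize ((k₁ + j : ℤ) : ℝ) / (n + 1) = r at *
        generalize 1 / ((n : ℝ) + 1) = q at *
        have c11 := c1.1.trans d1; have c12 := c1.2.trans d1
        have c21 := c2.1.trans d2; have c22 := c2.2.trans d2
        clear c1 c2 d1 d2 b ee bd hZ
        unfold Near
        simp only [abs_lt, abs_le] at *
        refine ⟨⟨?_, ?_⟩, ?_, ?_⟩ <;> linarith
    obtain ⟨nX, fX⟩ := follow X V s₀ δ₁ k₁ m (by linarith) V1 V2 hk1 hk2 fun r hr => (hX1 hr).1
    obtain ⟨nY, fY⟩ := follow Y W t₀ δ₂ l₁ m' (by linarith) W1 W2 hl1 hl2 fun r hr => (hY1 hr).1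
    rw [← hXY] at fY
    obtain ⟨⟨g1, g2, g3, g4⟩, hμ, hsum⟩ := hbox δ _ m m' _ _ _ _ hδ (by linarith) fX fY
    have hch := sum_wallD_chart c hμ (fun j hj => (hX1 (nX j hj)).2.2)
      (fun j hj => (hY1 (nY j hj)).2.2) fX.step fY.step g1 g2 g3 g4
    have eX : ∀ j ≤ m, gridRep n α ((k₁ + j : ℤ) : ZMod (n + 1)) =
        chartRep c (X (((k₁ + j : ℤ) : ℝ) / (n + 1))) := fun j hj => by
      rw [gridRep, toAddCircle_eq_div, (hX1 (nX j hj)).2.1, rep_param (hX1 (nX j hj)).2.2]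
    have eY : ∀ j ≤ m', gridRep n β ((l₁ + j : ℤ) : ZMod (n + 1)) =
        chartRep c (Y (((l₁ + j : ℤ) : ℝ) / (n + 1))) := fun j hj => by
      rw [gridRep, toAddCircle_eq_div, (hY1 (nY j hj)).2.1, rep_param (hY1 (nY j hj)).2.2]
    rw [← hsum, ← hch]
    have split : ∀ k l : ZMod (n + 1), (if dist (ZMod.toAddCircle k, ZMod.toAddCircle l)
        ((s₀ : 𝕋), (t₀ : 𝕋)) < δ then
          wallD (gridRep n α k) (gridRep n α (k + 1)) (gridRep n β l) (gridRep n β (l + 1))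
        else 0) = if dist (ZMod.toAddCircle k) (s₀ : 𝕋) < δ then
          (if dist (ZMod.toAddCircle l) (t₀ : 𝕋) < δ then
          wallD (gridRep n α k) (gridRep n α (k + 1)) (gridRep n β l) (gridRep n β (l + 1))
        else 0) else 0 := fun k l => by
      rw [Prod.dist_eq, ← ite_and]
      simp only [max_lt_iff]
    simp only [split]
    have pull : ∀ k : ZMod (n + 1), (∑ l : ZMod (n + 1),
        if dist (ZMod.toAddCircle k) (s₀ : 𝕋) < δ then
          (if dist (ZMod.toAddCircle l) (t₀ : 𝕋) < δ then
          wallD (gridRep n α k) (gridRep n α (k + 1)) (gridRep n β l) (gridRep n β (l + 1))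
        else 0) else 0) = if dist (ZMod.toAddCircle k) (s₀ : 𝕋) < δ then
          ∑ i ∈ Finset.range m', wallD (gridRep n α k) (gridRep n α (k + 1))
            (gridRep n β ((l₁ + i : ℤ) : ZMod (n + 1)))
            (gridRep n β (((l₁ + i : ℤ) : ZMod (n + 1)) + 1)) else 0 := fun k => by
      split_ifs with h
      · exact hl _
      · simp
    rw [Finset.sum_congr rfl fun k _ => pull k, hk]
    refine Finset.sum_congr rfl fun j hj => Finset.sum_congr rfl fun i hi => ?_
    rw [Finset.mem_range] at hi hj
    have sX : ((k₁ + j : ℤ) : ZMod (n + 1)) + 1 = ((k₁ + (j + 1 : ℕ) : ℤ) : ZMod (n + 1)) := by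
      push_cast; ring
    have sY : ((l₁ + i : ℤ) : ZMod (n + 1)) + 1 = ((l₁ + (i + 1 : ℕ) : ℤ) : ZMod (n + 1)) := by
      push_cast; ring
    rw [sX, sY, eX j hj.le, eX (j + 1) hj, eY i hi.le, eY (i + 1) hi]

end

section

open Filter

/-! ### The index of curves in general position -/

variable {g : ℕ}

instance : T2Space (Surface g) := by
  rw [t2_iff_isClosed_diagonal, ← isOpen_compl_iff, isOpen_iff_mem_nhds]
  rintro ⟨x, y⟩ hxy
  obtain ⟨μ, hμ, h⟩ := exists_eventually_not_close (show x ≠ y from hxy)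
  filter_upwards [h] with p hp hd
  rw [Set.mem_diagonal_iff] at hd
  rw [hd] at hp
  exact hp (Close.refl hμ)

/-- A transverse crossing has only one sign. -/
lemma CrossesWithSign.not_neg {α β : C(𝕋, Surface g)}
    {z : 𝕋 × 𝕋} (h : CrossesWithSign 1 α β z) :
    ¬ CrossesWithSign (-1) α β z := by
  intro h'
  obtain ⟨δ, hδ, -, h1⟩ := h.exists_sum_eq (.inl rfl)
  obtain ⟨δ', hδ', -, h2⟩ := h'.exists_sum_eq (.inr rfl)
  have hpos : 0 < min δ δ' := lt_min hδ hδ'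
  have h3 := h1 _ (half_pos hpos) ((half_lt_self hpos).trans_le (min_le_left _ _))
  have h4 := h2 _ (half_pos hpos) ((half_lt_self hpos).trans_le (min_le_right _ _))
  obtain ⟨n, h5, h6⟩ := (h3.and h4).exists
  rw [h5] at h6
  norm_num at h6

open Classical in
/-- The sign of a transverse crossing. -/
def crossingSign (α β : C(𝕋, Surface g)) (z : 𝕋 × 𝕋) : ℤ :=
  if CrossesWithSign 1 α β z then 1 else -1

lemma CrossesTransversely.crossesWithSign {α β : C(𝕋, Surface g)}
    {z : 𝕋 × 𝕋} (h : CrossesTransversely α β z) :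
    CrossesWithSign (crossingSign α β z) α β z := by
  rw [crossingSign]
  split_ifs with h1
  · exact h1
  · exact h.resolve_left h1

/-- The set of overcrossings of `K` over `L`. -/
def overSet (K L : C(𝕋, Cylinder g)) : Set (𝕋 × 𝕋) :=
  {z | (K z.1).1 = (L z.2).1 ∧ (L z.2).2 < (K z.1).2}

lemma OverTransverse.finite_overSet {K L : C(𝕋, Cylinder g)}
    (h : OverTransverse K L) : (overSet K L).Finite := by
  have key : ((Set.univ : Set (𝕋 × 𝕋)) ∩ overSet K L).Finite := by
    refine isCompact_univ.induction_on
      (p := fun Q : Set (𝕋 × 𝕋) => (Q ∩ overSet K L).Finite) (by simp)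
      (fun s t hst ht => ht.subset (Set.inter_subset_inter_left _ hst)) (fun s t hs ht => ?_)
      (fun z _ => ?_)
    · rw [Set.union_inter_distrib_right]; exact hs.union ht
    · have hc1 : Continuous fun z : 𝕋 × 𝕋 => ((K z.1).1, (L z.2).1) := by
        fun_prop
      have hc2 : Continuous fun z : 𝕋 × 𝕋 =>
        (((K z.1).2 : I), ((L z.2).2 : I)) := by fun_prop
      by_cases hz : (K z.1).1 = (L z.2).1
      · rcases h z hz with h1 | ⟨-, h1⟩
        · have : ∀ᶠ z' in 𝓝 z, (K z'.1).2 < (L z'.2).2 :=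
            (hc2.tendsto z).eventually ((isOpen_lt continuous_fst continuous_snd).mem_nhds h1)
          refine ⟨_, mem_nhdsWithin_of_mem_nhds this, ?_⟩
          convert Set.finite_empty
          ext z'
          simp only [Set.mem_inter_iff, Set.mem_empty_iff_false, iff_false, not_and]
          intro h2 h3
          exact lt_asymm h2 h3.2
        · obtain ⟨δ, hδ, h2, -⟩ := h1.crossesWithSign.exists_sum_eq (by
            rw [crossingSign]; split_ifs <;> simp)
          refine ⟨_, mem_nhdsWithin_of_mem_nhds (Metric.ball_mem_nhds z hδ), ?_⟩
          refine (Set.finite_singleton z).subset ?_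
          rintro z' ⟨h3, h4⟩
          exact h2 z' h3 h4.1
      · have : ∀ᶠ z' in 𝓝 z, (K z'.1).1 ≠ (L z'.2).1 :=
          (hc1.tendsto z).eventually (isClosed_diagonal.isOpen_compl.mem_nhds hz)
        refine ⟨_, mem_nhdsWithin_of_mem_nhds this, ?_⟩
        convert Set.finite_empty
        ext z'
        simp only [Set.mem_inter_iff, Set.mem_empty_iff_false, iff_false, not_and]
        intro h2 h3
        exact h2 h3.1
  simpa using key

lemma OverTransverse.overcrossingSum_eq {K L : C(𝕋, Cylinder g)}
    (h : OverTransverse K L) : overcrossingSum K L =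
      ∑ z ∈ h.finite_overSet.toFinset, crossingSign ((proj g).comp K) ((proj g).comp L) z := by
  classical
  have hT : ∀ z ∈ overSet K L, CrossesTransversely ((proj g).comp K) ((proj g).comp L) z := by
    intro z hz
    rcases h z hz.1 with h1 | h1
    · exact absurd h1 (lt_asymm hz.2)
    · exact h1.2
  have e1 : {z | OvercrossesWithSign 1 K L z} = (h.finite_overSet.toFinset.filter fun z =>
      CrossesWithSign 1 ((proj g).comp K) ((proj g).comp L) z : Finset _) := by
    ext z
    simp only [Set.mem_ofPred_eq, Finset.coe_filter, Set.Finite.mem_toFinset]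
    exact ⟨fun h => ⟨⟨h.1.1, h.2⟩, h.1⟩, fun h => ⟨h.2, h.1.2⟩⟩
  have e2 : {z | OvercrossesWithSign (-1) K L z} = (h.finite_overSet.toFinset.filter fun z =>
      ¬ CrossesWithSign 1 ((proj g).comp K) ((proj g).comp L) z : Finset _) := by
    ext z
    simp only [Set.mem_ofPred_eq, Finset.coe_filter, Set.Finite.mem_toFinset]
    exact ⟨fun h => ⟨⟨h.1.1, h.2⟩, fun h' => h'.not_neg h.1⟩,
      fun h => ⟨(hT z h.1).resolve_left h.2, h.1.2⟩⟩
  rw [overcrossingSum, e1, e2, Set.ncard_coe_finset, Set.ncard_coe_finset]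
  simp only [crossingSign]
  rw [Finset.sum_ite]
  simp [sub_eq_add_neg]

/-- For curves in general position the index is the signed number of overcrossings. -/
lemma OverTransverse.eventually_loopIndex_eq {K L : C(𝕋, Cylinder g)}
    (h : OverTransverse K L) : ∀ᶠ n : ℕ in atTop, loopIndex n K L = overcrossingSum K L := by
  classical
  set Z := h.finite_overSet.toFinset with hZ
  have hmem : ∀ z, z ∈ Z ↔ z ∈ overSet K L := fun z => by rw [hZ, Set.Finite.mem_toFinset]
  set α := (proj g).comp K with hα
  set β := (proj g).comp L with hβ
  have hT : ∀ z ∈ Z, CrossesWithSign (crossingSign α β z) α β z := by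
    intro z hz
    rw [hmem] at hz
    rcases h z hz.1 with h1 | h1
    · exact absurd h1 (lt_asymm hz.2)
    · exact h1.2.crossesWithSign
  have hsgn : ∀ z, crossingSign α β z = 1 ∨ crossingSign α β z = -1 := fun z => by
    rw [crossingSign]; split_ifs <;> simp
  -- a common radius for the squares around the overcrossings
  have hδ : ∃ δ > 0, (∀ z ∈ Z, ∀ᶠ n : ℕ in atTop, (∑ k : ZMod (n + 1), ∑ l : ZMod (n + 1),
        if dist (ZMod.toAddCircle k, ZMod.toAddCircle l) z < δ then
          wallD (gridRep n α k) (gridRep n α (k + 1)) (gridRep n β l) (gridRep n β (l + 1))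
        else 0) = crossingSign α β z) ∧
      (∀ z ∈ Z, ∀ z' ∈ Z, z ≠ z' → 2 * δ ≤ dist z z') ∧
      (∀ z ∈ Z, ∀ z', dist z' z < δ → (L z'.2).2 < (K z'.1).2 ∧
        Close g nearRadius (rep (α z'.1)) (rep (β z'.2))) := by
    have ev1 : ∀ z ∈ Z, ∀ᶠ δ : ℝ in 𝓝[>] 0, ∀ᶠ n : ℕ in atTop,
        (∑ k : ZMod (n + 1), ∑ l : ZMod (n + 1),
        if dist (ZMod.toAddCircle k, ZMod.toAddCircle l) z < δ then
          wallD (gridRep n α k) (gridRep n α (k + 1)) (gridRep n β l) (gridRep n β (l + 1))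
        else 0) = crossingSign α β z := by
      intro z hz
      obtain ⟨δ₀, hδ₀, -, h1⟩ := (hT z hz).exists_sum_eq (hsgn z)
      filter_upwards [Ioo_mem_nhdsGT hδ₀] with δ hδ
      exact h1 δ hδ.1 hδ.2
    have ev2 : ∀ z ∈ Z, ∀ᶠ δ : ℝ in 𝓝[>] 0, ∀ z' ∈ Z, z ≠ z' → 2 * δ ≤ dist z z' := by
      intro z _
      rw [eventually_all_finset]
      intro z' _
      by_cases hzz : z = z'
      · exact .of_forall fun δ h => absurd hzz h
      · have hd : 0 < dist z z' / 2 := half_pos (dist_pos.2 hzz)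
        filter_upwards [Ioo_mem_nhdsGT hd] with δ hδ _
        linarith [hδ.2]
    have ev3 : ∀ z ∈ Z, ∀ᶠ δ : ℝ in 𝓝[>] 0, ∀ z', dist z' z < δ → (L z'.2).2 < (K z'.1).2 ∧
        Close g nearRadius (rep (α z'.1)) (rep (β z'.2)) := by
      intro z hz
      rw [hmem] at hz
      have hc1 : Continuous fun z : 𝕋 × 𝕋 => (α z.1, β z.2) := by
        fun_prop
      have hc2 : Continuous fun z : 𝕋 × 𝕋 =>
        (((L z.2).2 : I), ((K z.1).2 : I)) := by fun_prop
      have h1 := (hc2.tendsto z).eventually ((isOpen_lt continuous_fst continuous_snd).mem_nhds hz.2)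
      have hz1 : (α z.1, β z.2) = (α z.1, α z.1) := by rw [Prod.mk.injEq]; exact ⟨rfl, hz.1.symm⟩
      have h2 := (hc1.tendsto z).eventually (p := fun p => Close g nearRadius (rep p.1) (rep p.2)) (by
        rw [hz1]; exact eventually_close_prod _ (by norm_num [nearRadius]))
      obtain ⟨δ₀, hδ₀, h3⟩ := Metric.eventually_nhds_iff.1 (h1.and h2)
      filter_upwards [Ioo_mem_nhdsGT hδ₀] with δ hδ z' hz'
      exact h3 (hz'.trans hδ.2)
    have := ((eventually_all_finset Z).2 ev1).and (((eventually_all_finset Z).2 ev2).and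
      ((eventually_all_finset Z).2 ev3))
    obtain ⟨δ, ⟨h1, h2, h3⟩, h0⟩ := (this.and self_mem_nhdsWithin).exists
    exact ⟨δ, h0, h1, h2, h3⟩
  obtain ⟨δ, hδ, hsum, hdisj, hnear⟩ := hδ
  -- away from the overcrossings the curves are separated where the first is above the second
  obtain ⟨μ₀, hμ₀, hsep⟩ : ∃ μ > 0, ∀ z : 𝕋 × 𝕋,
      (L z.2).2 ≤ (K z.1).2 → (∀ z' ∈ Z, δ ≤ dist z z') →
        ¬ Close g μ (rep (α z.1)) (rep (β z.2)) := by
    have hC : IsClosed {z : 𝕋 × 𝕋 |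
        (L z.2).2 ≤ (K z.1).2 ∧ ∀ z' ∈ Z, δ ≤ dist z z'} := by
      have c1 : IsClosed {z : 𝕋 × 𝕋 | (L z.2).2 ≤ (K z.1).2} :=
        isClosed_le (by fun_prop) (by fun_prop)
      have c2 : IsClosed {z : 𝕋 × 𝕋 | ∀ z' ∈ Z, δ ≤ dist z z'} := by
        simp only [Set.ofPred_forall]
        exact isClosed_iInter fun z' => isClosed_iInter fun _ =>
          isClosed_le continuous_const (by fun_prop)
      exact c1.inter c2
    have hc1 : Continuous fun z : 𝕋 × 𝕋 => (α z.1, β z.2) := by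
      fun_prop
    obtain ⟨μ, hμ, h1⟩ := exists_forall_not_close (hC.isCompact.image hc1) (by
      rintro _ ⟨z, ⟨hz1, hz2⟩, rfl⟩ heq
      have hz3 : z ∈ Z := by
        rw [hmem]
        refine ⟨heq, ?_⟩
        rcases h z heq with h1 | h1
        · exact absurd h1 (not_lt.2 hz1)
        · exact h1.1
      have := hz2 z hz3
      rw [dist_self] at this
      linarith)
    exact ⟨μ, hμ, fun z h2 h3 => h1 _ ⟨z, ⟨h2, h3⟩, rfl⟩⟩
  set μ := min (μ₀ / 100) (1 / 10 ^ 7) with hμ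
  have hμ0 : 0 < μ := by positivity
  have hμ1 : μ ≤ μ₀ / 100 := min_le_left _ _
  have hμ2 : μ ≤ 1 / 10 ^ 7 := min_le_right _ _
  filter_upwards [(eventually_all_finset Z).2 hsum, eventually_close_grid α hμ0,
    eventually_close_grid β hμ0] with n hn c1 c2
  rw [h.overcrossingSum_eq, ← hZ, ← hα, ← hβ, ← Finset.sum_congr rfl hn, Finset.sum_comm, loopIndex,
    gridIndex]
  refine Finset.sum_congr rfl fun k _ => ?_
  rw [Finset.sum_comm]
  refine Finset.sum_congr rfl fun l _ => ?_
  rw [← hα, ← hβ]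
  set p : 𝕋 × 𝕋 := (ZMod.toAddCircle k, ZMod.toAddCircle l) with hp
  by_cases hz : ∃ z ∈ Z, dist p z < δ
  · obtain ⟨z, hzZ, hz⟩ := hz
    rw [Finset.sum_eq_single z]
    · rw [if_pos hz, overInd, if_pos, one_mul]
      exact hnear z hzZ p hz
    · intro z' hz' hne
      rw [if_neg]
      intro hd
      have h1 := hdisj z hzZ z' hz' hne.symm
      have h2 := dist_triangle_left z z' p
      linarith
    · intro h1; exact absurd hzZ h1
  · push Not at hz
    rw [Finset.sum_eq_zero fun z hzZ => if_neg (not_lt.2 (hz z hzZ))]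
    by_cases ho : (L p.2).2 < (K p.1).2 ∧ Close g nearRadius (gridRep n α k) (gridRep n β l)
    · rw [wallD_eq_zero hμ2 (c1 k) (c2 l) (fun hc => hsep p ho.1.le hz (hc.mono (by linarith)))
        (ho.2.mono (by norm_num [nearRadius])) ⟨rep_le_one _, rep_le_one _⟩
        ⟨rep_le_one _, rep_le_one _⟩, mul_zero]
    · rw [overInd, if_neg, zero_mul]
      exact ho

end

section

open Filter

/-! ### The intersection form -/

variable {g : ℕ}

/-- A bump function that has the value `1 / 2` on the slot that starts at `c + 1 / 4`, and that
vanishes at all points of distance at least `1 / 4` from the slot. -/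
def bump (c : ℝ) (p : ℝ × ℝ) : ℝ := max 0 (1 / 2 - 2 * max (|p.1 - (c + 1 / 2)| - 1 / 4) (|p.2 - 1|))

/-- The function whose class modulo `1` is a map from the surface to the circle; a loop winds
around the circle as often as it passes through the seam `a`. -/
def seamHeight (a : Fin g × Fin 2) (p : ℝ × ℝ) : ℝ :=
  bump (slot a.1 a.2) p - bump (slot a.1 a.2 + 2) p

lemma abs_bump_sub_le {c μ : ℝ} {p q : ℝ × ℝ} (h : Near μ p q) :
    |bump c p - bump c q| ≤ 2 * μ := by
  obtain ⟨h1, h2⟩ := h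
  have k1 : |(|p.1 - (c + 1 / 2)| - 1 / 4) - (|q.1 - (c + 1 / 2)| - 1 / 4)| ≤ μ := by
    have := abs_abs_sub_abs_le_abs_sub (p.1 - (c + 1 / 2)) (q.1 - (c + 1 / 2))
    rw [sub_sub_sub_cancel_right] at this
    rw [sub_sub_sub_cancel_right]; linarith
  have k2 : |(|p.2 - 1|) - (|q.2 - 1|)| ≤ μ := by
    have := abs_abs_sub_abs_le_abs_sub (p.2 - 1) (q.2 - 1)
    rw [sub_sub_sub_cancel_right] at this
    linarith
  have k3 := (abs_max_sub_max_le_max (|p.1 - (c + 1 / 2)| - 1 / 4) (|p.2 - 1|)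
    (|q.1 - (c + 1 / 2)| - 1 / 4) (|q.2 - 1|)).trans (max_le k1 k2)
  unfold bump
  refine (abs_max_sub_max_le_max 0 _ 0 _).trans (max_le (by simp; linarith [abs_nonneg (p.1 - q.1)]) ?_)
  rw [abs_le] at *
  constructor <;> linarith

lemma bump_eq_half {c : ℝ} {p : ℝ × ℝ} (h1 : c + 1 / 4 ≤ p.1) (h2 : p.1 ≤ c + 3 / 4)
    (h3 : p.2 = 1) : bump c p = 1 / 2 := by
  have : |p.1 - (c + 1 / 2)| - 1 / 4 ≤ 0 := by
    rw [sub_nonpos, abs_le]; constructor <;> linarith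
  rw [bump, h3, sub_self, abs_zero, max_eq_right this]; norm_num

lemma bump_eq_zero {c : ℝ} {p : ℝ × ℝ} (h : p.1 ≤ c - 1 / 4 ∨ c + 5 / 4 ≤ p.1) :
    bump c p = 0 := by
  have : 1 / 2 ≤ |p.1 - (c + 1 / 2)| - 1 / 4 := by
    rcases h with h | h
    · rw [abs_of_nonpos (by linarith)]; linarith
    · rw [abs_of_nonneg (by linarith)]; linarith
  rw [bump, max_eq_left]
  linarith [le_max_left (|p.1 - (c + 1 / 2)| - 1 / 4) (|p.2 - 1|)]

lemma seamHeight_of_onLeft {a b : Fin g × Fin 2} {p : ℝ × ℝ} (h : OnLeft b p) :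
    seamHeight a p = if a = b then 1 / 2 else 0 := by
  obtain ⟨h1, h2, h3⟩ := h
  rw [seamHeight, bump_eq_zero (c := slot a.1 a.2 + 2), sub_zero]
  · split_ifs with hab
    · subst hab; exact bump_eq_half h1 h2 h3
    · apply bump_eq_zero
      rcases slot_lt_or_lt (i := a.1) (r := a.2) (j := b.1) (s := b.2) hab with h | h
      · right; linarith
      · left; linarith
  · rcases slot_ne_right a.1 b.1 a.2 b.2 with h | h
    · right; linarith
    · left; linarith

lemma seamHeight_of_onRight {a b : Fin g × Fin 2} {p : ℝ × ℝ} (h : OnRight b p) :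
    seamHeight a p = if a = b then -(1 / 2) else 0 := by
  obtain ⟨h1, h2, h3⟩ := h
  rw [seamHeight, bump_eq_zero (c := slot a.1 a.2), zero_sub]
  · split_ifs with hab
    · subst hab; rw [bump_eq_half (by linarith) (by linarith) h3]
    · rw [neg_eq_zero]
      apply bump_eq_zero
      rcases slot_lt_or_lt (i := a.1) (r := a.2) (j := b.1) (s := b.2) hab with h | h
      · right; linarith
      · left; linarith
  · rcases slot_ne_right b.1 a.1 b.2 a.2 with h | h
    · left; linarith
    · right; linarith

lemma continuous_seamHeight (a : Fin g × Fin 2) : Continuous (seamHeight a) := by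
  unfold seamHeight bump; fun_prop

/-- The map from the surface to the circle whose preimage of `1 / 2` is the seam `a`. -/
def seamMap (a : Fin g × Fin 2) : C(Surface g, 𝕋) where
  toFun x := (seamHeight a (rep x) : 𝕋)
  continuous_toFun := by
    refine isQuotientMap_quot_mk.continuous_iff.2 ?_
    have h : ((fun x : Surface g => (seamHeight a (rep x) : 𝕋)) ∘ Quot.mk (Glued g)) =
        fun p : Rectangle g => (seamHeight a ((p.1 : ℝ), (p.2 : ℝ)) : 𝕋) := by
      funext p
      change (seamHeight a (canon g ((p.1 : ℝ), (p.2 : ℝ))) : 𝕋) = _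
      by_cases hp : ∃ b : Fin g × Fin 2, OnRight b ((p.1 : ℝ), (p.2 : ℝ))
      · obtain ⟨b, hb⟩ := hp
        rw [canon_of_onRight hb, seamHeight_of_onLeft hb.turn, seamHeight_of_onRight hb]
        split_ifs
        · rw [← sub_eq_zero, ← AddCircle.coe_sub]
          norm_num
        · rfl
      · rw [canon_of_not (by simpa using hp)]
    refine Continuous.congr ?_ fun p => (congrFun h p).symm
    exact (AddCircle.continuous_mk' 1).comp ((continuous_seamHeight a).comp (by fun_prop))

lemma abs_seamHeight_sub_le {a : Fin g × Fin 2} {μ : ℝ} {p q : ℝ × ℝ} (h : Near μ p q) :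
    |seamHeight a p - seamHeight a q| ≤ 4 * μ := by
  have h1 := abs_bump_sub_le (c := slot a.1 a.2) h
  have h2 := abs_bump_sub_le (c := slot a.1 a.2 + 2) h
  unfold seamHeight
  rw [abs_le] at *
  constructor <;> linarith

/-- Along a short step the map to the circle has a small real lift. -/
lemma abs_seamHeight_step_le {a : Fin g × Fin 2} {μ : ℝ} (hμ : μ ≤ 1 / 8) {u u' : ℝ × ℝ}
    (h : Close g μ u u') : |seamHeight a u' - seamHeight a u + jumpInd a u u'| ≤ 8 * μ := by
  have hp := h.pos
  have jump : ∀ {u u' : ℝ × ℝ} {b : Fin g × Fin 2}, JumpAt μ b u u' →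
      |seamHeight a u' - seamHeight a u + jumpInd a u u'| ≤ 8 * μ := by
    intro u u' b h
    rw [jumpInd_of_left (h.mono hμ)]
    obtain ⟨p, h1, h2, h3, h4⟩ := h
    have hl : OnLeft b (p, 1) := ⟨h1, h2, rfl⟩
    have hr : OnRight b (2 * slot b.1 b.2 + 3 - p, 1) := by
      refine ⟨?_, ?_, rfl⟩ <;> simp only <;> linarith
    have a1 := abs_seamHeight_sub_le (a := a) h3
    have a2 := abs_seamHeight_sub_le (a := a) h4
    rw [seamHeight_of_onLeft hl] at a1
    rw [seamHeight_of_onRight hr] at a2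
    rw [abs_le] at *
    split_ifs at * <;> push_cast <;> constructor <;> linarith
  rcases h with h | ⟨b, h | h⟩
  · have := abs_seamHeight_sub_le (a := a) h
    rw [jumpInd_of_near (h.mono (by linarith)), Int.cast_zero, add_zero, abs_sub_comm]
    linarith
  · exact jump h
  · have := jump h
    rw [jumpInd_antisymm, ← abs_neg] at this
    convert this using 2
    push_cast; ring

lemma sum_zmod_eq_sum_range {n : ℕ} {M : Type} [AddCommMonoid M] (f : ZMod (n + 1) → M) :
    ∑ k, f k = ∑ j ∈ Finset.range (n + 1), f (j : ZMod (n + 1)) := by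
  rw [← Fin.sum_univ_eq_sum_range (fun j => f (j : ZMod (n + 1)))]
  refine Finset.sum_congr rfl fun k _ => ?_
  congr 1
  exact (ZMod.natCast_zmod_val (n := n + 1) k).symm

/-- The signed number of passages through a seam is a homomorphism on homology. -/
lemma exists_seamHom (a : Fin g × Fin 2) : ∃ h : H1 (Surface g) →ₗ[ℤ] ℤ,
    ∀ γ : C(𝕋, Surface g), ∀ᶠ n : ℕ in atTop,
      ∑ k : ZMod (n + 1), jumpInd a (gridRep n γ k) (gridRep n γ (k + 1)) = h (loopClass γ) := by
  obtain ⟨h, hh⟩ := exists_windingHom (seamMap a)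
  refine ⟨h, fun γ => ?_⟩
  have : ContractibleSpace I := (convex_Icc (0 : ℝ) 1).contractibleSpace ⟨0, by simp⟩
  obtain ⟨G, hG⟩ := exists_lift_unitAddCircle (A := I) ⟨fun t => seamMap a (γ ((t : ℝ) : 𝕋)), by
    have := AddCircle.continuous_mk' (1 : ℝ)
    fun_prop⟩
  have hw := hh γ G hG
  have huc := CompactSpace.uniformContinuous_of_continuous G.continuous
  rw [Metric.uniformContinuous_iff] at huc
  obtain ⟨δ, hδ, huc⟩ := huc (1 / 4) (by norm_num)
  filter_upwards [eventually_close_grid γ (μ := 1 / 100) (by norm_num),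
    tendsto_one_div_add_atTop_nhds_zero_nat.eventually (gt_mem_nhds hδ)] with n hn hn'
  have hn0 : (0 : ℝ) < n + 1 := by positivity
  set t : ℕ → I := fun j => Set.projIcc 0 1 zero_le_one ((j : ℝ) / (n + 1)) with ht
  have tval : ∀ j ≤ n + 1, ((t j : I) : ℝ) = (j : ℝ) / (n + 1) := fun j hj => by
    have hj' : (j : ℝ) ≤ n + 1 := by exact_mod_cast hj
    rw [ht]
    simp only
    rw [Set.projIcc_of_mem zero_le_one ⟨by positivity, (div_le_one hn0).2 hj'⟩]
  set U : ℕ → ℝ := fun j => seamHeight a (gridRep n γ (j : ZMod (n + 1))) with hU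
  have hGU : ∀ j ≤ n + 1, ∃ c : ℤ, G (t j) - U j = c := fun j hj => by
    have h1 := hG (t j)
    have h2 : ((((t j : I) : ℝ)) : 𝕋) = ZMod.toAddCircle ((j : ℕ) : ZMod (n + 1)) := by
      rw [tval j hj]
      have := toAddCircle_eq_div (n := n) j
      rw [Int.cast_natCast, Int.cast_natCast] at this
      exact this.symm
    have h3 : ((G (t j) : ℝ) : 𝕋) = (U j : 𝕋) := by
      rw [h1]
      change seamMap a (γ _) = _
      rw [h2]; rfl
    obtain ⟨c, hc⟩ := (AddCircle.coe_eq_zero_iff (p := (1 : ℝ))).1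
      (show ((G (t j) - U j : ℝ) : 𝕋) = 0 by rw [AddCircle.coe_sub, h3, sub_self])
    exact ⟨c, by simpa using hc.symm⟩
  have step : ∀ j < n + 1, ((jumpInd a (gridRep n γ (j : ZMod (n + 1)))
      (gridRep n γ ((j : ZMod (n + 1)) + 1)) : ℤ) : ℝ) =
      (G (t (j + 1)) - U (j + 1)) - (G (t j) - U j) := by
    intro j hj
    have h1 := abs_seamHeight_step_le (a := a) (by norm_num) (hn (j : ZMod (n + 1)))
    have h2 : dist (G (t (j + 1))) (G (t j)) < 1 / 4 := by
      apply huc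
      rw [Subtype.dist_eq, tval _ (by omega), tval _ (by omega), Real.dist_eq, ← sub_div]
      push_cast
      rw [add_sub_cancel_left, abs_of_pos (by positivity)]
      exact hn'
    obtain ⟨c, hc⟩ := hGU (j + 1) (by omega)
    obtain ⟨d, hd⟩ := hGU j (by omega)
    have e : gridRep n γ ((j : ZMod (n + 1)) + 1) = gridRep n γ ((j + 1 : ℕ) : ZMod (n + 1)) := by
      push_cast; rfl
    rw [hc, hd]
    rw [e] at h1 ⊢
    have h3 : U (j + 1) - U j + (jumpInd a (gridRep n γ (j : ZMod (n + 1)))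
        (gridRep n γ ((j + 1 : ℕ) : ZMod (n + 1))) : ℤ) =
        (G (t (j + 1)) - G (t j)) + ((jumpInd a (gridRep n γ (j : ZMod (n + 1)))
        (gridRep n γ ((j + 1 : ℕ) : ZMod (n + 1))) - (c - d) : ℤ) : ℝ) := by
      push_cast; linarith
    change |U (j + 1) - U j + _| ≤ _ at h1
    rw [h3] at h1
    rw [Real.dist_eq] at h2
    have h4 : |((jumpInd a (gridRep n γ (j : ZMod (n + 1)))
        (gridRep n γ ((j + 1 : ℕ) : ZMod (n + 1))) - (c - d) : ℤ) : ℝ)| < 1 := by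
      rw [abs_le] at h1
      rw [abs_lt] at h2 ⊢
      constructor <;> linarith
    rw [← Int.cast_abs] at h4
    have h5 : |jumpInd a (gridRep n γ (j : ZMod (n + 1)))
        (gridRep n γ ((j + 1 : ℕ) : ZMod (n + 1))) - (c - d)| < 1 := by exact_mod_cast h4
    rw [Int.abs_lt_one_iff, sub_eq_zero] at h5
    rw [h5]; push_cast; ring
  have hsum : ((∑ k : ZMod (n + 1), jumpInd a (gridRep n γ k) (gridRep n γ (k + 1)) : ℤ) : ℝ) =
      G 1 - G 0 := by
    rw [sum_zmod_eq_sum_range, Int.cast_sum, Finset.sum_congr rfl fun j hj =>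
      step j (Finset.mem_range.1 hj), Finset.sum_range_sub (fun j => G (t j) - U j)]
    have e1 : t (n + 1) = 1 := by
      apply Subtype.ext
      rw [tval _ le_rfl]; push_cast; rw [div_self hn0.ne']
    have e0 : t 0 = 0 := by
      apply Subtype.ext
      rw [tval _ (Nat.zero_le _)]; simp
    have e2 : U (n + 1) = U 0 := by
      simp only [hU]
      rw [ZMod.natCast_self, Nat.cast_zero]
    rw [e1, e0, e2]; ring
  rw [← hw] at hsum
  exact_mod_cast hsum

lemma overTransverse_of_transverse {α β : C(𝕋, Surface g)} (h : Transverse α β) :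
    OverTransverse (α.prodMk (ContinuousMap.const _ (1 : I)))
      (β.prodMk (ContinuousMap.const _ (0 : I))) :=
  fun z hz => .inr ⟨zero_lt_one, h z hz⟩

lemma overcrossingSum_eq_crossingSum (α β : C(𝕋, Surface g)) :
    overcrossingSum (α.prodMk (ContinuousMap.const _ (1 : I)))
      (β.prodMk (ContinuousMap.const _ (0 : I))) = crossingSum α β := by
  have h : ∀ ε z, OvercrossesWithSign ε (α.prodMk (ContinuousMap.const _ (1 : I)))
      (β.prodMk (ContinuousMap.const _ (0 : I))) z ↔ CrossesWithSign ε α β z := fun ε z =>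
    ⟨fun h => h.1, fun h => ⟨h, zero_lt_one⟩⟩
  simp only [overcrossingSum, crossingSum, h]

lemma sum_wallD_eq_zero {N : ℕ} [NeZero N] (x y : ZMod N → ℝ × ℝ) :
    ∑ k, ∑ l, wallD (x k) (x (k + 1)) (y l) (y (l + 1)) = 0 := by
  have := sum_coboundary_eq_zero (fun _ _ => 1) (fun k l => wallX (x k) (x (k + 1)) (y l))
    (fun k l => wallY (x k) (y l) (y (l + 1))) (fun _ _ => .inl rfl) (fun _ _ => .inl rfl)
  simpa only [one_mul, wallD] using this

/-- The index of a curve that runs above another curve everywhere counts the passages of the curves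
through the interlocked seams: the sum of the coboundary over all squares vanishes. -/
lemma gridIndex_above {N : ℕ} [NeZero N] {x y : ZMod N → ℝ × ℝ} {h k : ZMod N → ℝ}
    (hh : ∀ i j, k j < h i) {μ : ℝ} (hμ : μ ≤ 1 / 10 ^ 5)
    (hx : ∀ i, (x i).2 ≤ 1) (hy : ∀ i, (y i).2 ≤ 1) (sx : ∀ i, Close g μ (x i) (x (i + 1)))
    (sy : ∀ i, Close g μ (y i) (y (i + 1))) :
    gridIndex g x y h k = - ∑ i : Fin g,
      ((∑ k, jumpInd (i, 0) (x k) (x (k + 1))) * (∑ l, jumpInd (i, 1) (y l) (y (l + 1))) -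
       (∑ k, jumpInd (i, 1) (x k) (x (k + 1))) * (∑ l, jumpInd (i, 0) (y l) (y (l + 1)))) := by
  have e : ∑ i : Fin g,
      ((∑ k, jumpInd (i, 0) (x k) (x (k + 1))) * (∑ l, jumpInd (i, 1) (y l) (y (l + 1))) -
       (∑ k, jumpInd (i, 1) (x k) (x (k + 1))) * (∑ l, jumpInd (i, 0) (y l) (y (l + 1)))) =
      ∑ k, ∑ l, interlock g (x k) (x (k + 1)) (y l) (y (l + 1)) := by
    simp only [interlock, Finset.sum_mul_sum, ← Finset.sum_sub_distrib]
    rw [Finset.sum_comm]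
    refine Finset.sum_congr rfl fun k _ => ?_
    rw [Finset.sum_comm]
  rw [e, eq_neg_iff_add_eq_zero, ← sum_wallD_eq_zero x y, gridIndex, ← Finset.sum_add_distrib]
  refine Finset.sum_congr rfl fun i _ => ?_
  rw [← Finset.sum_add_distrib]
  refine Finset.sum_congr rfl fun j _ => ?_
  by_cases hc : Close g nearRadius (x i) (y j)
  · rw [overInd, if_pos ⟨hh i j, hc⟩, one_mul, interlock_eq_zero_of_close (sx i) (sy j)
      (by linarith) (hc.mono (by norm_num [nearRadius])), add_zero]
  · rw [overInd, if_neg (fun h => hc h.2), zero_mul, zero_add, wallD_eq_interlock (sx i) (sy j)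
      (by linarith) (fun h' => hc (h'.mono (by unfold nearRadius; linarith))) ⟨hx _, hx _⟩
      ⟨hy _, hy _⟩]

lemma exists_isIntersectionForm (g : ℕ) :
    ∃ ω : H1 (Surface g) →ₗ[ℤ] H1 (Surface g) →ₗ[ℤ] ℤ, IsIntersectionForm ω := by
  choose x hx using exists_seamHom (g := g)
  refine ⟨-∑ i : Fin g, ((x (i, 0)).smulRight (x (i, 1)) - (x (i, 1)).smulRight (x (i, 0))), ?_⟩
  intro α β h
  have h1 := (overTransverse_of_transverse h).eventually_loopIndex_eq
  have h2 : ∀ᶠ n : ℕ in atTop, ∀ a : Fin g × Fin 2,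
      ∑ k : ZMod (n + 1), jumpInd a (gridRep n α k) (gridRep n α (k + 1)) = x a (loopClass α) :=
    eventually_all.2 fun a => hx a α
  have h3 : ∀ᶠ n : ℕ in atTop, ∀ a : Fin g × Fin 2,
      ∑ k : ZMod (n + 1), jumpInd a (gridRep n β k) (gridRep n β (k + 1)) = x a (loopClass β) :=
    eventually_all.2 fun a => hx a β
  have hμ : (0 : ℝ) < 1 / 10 ^ 5 := by positivity
  obtain ⟨n, n1, n2, n3, n4, n5⟩ := (h1.and (h2.and (h3.and ((eventually_close_grid α hμ).and
    (eventually_close_grid β hμ))))).exists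
  rw [overcrossingSum_eq_crossingSum] at n1
  rw [← n1]
  change _ = gridIndex g (gridRep n α) (gridRep n β) (fun _ => ((1 : I) : ℝ))
    (fun _ => ((0 : I) : ℝ))
  rw [gridIndex_above (x := gridRep n α) (y := gridRep n β) (fun _ _ => by simp) le_rfl (fun _ => rep_le_one _) (fun _ => rep_le_one _)
    n4 n5]
  simp only [n2, n3]
  simp [LinearMap.sum_apply]

lemma isIntersectionForm (g : ℕ) : IsIntersectionForm (intersectionForm g) := by
  rw [intersectionForm, dif_pos (exists_isIntersectionForm g)]
  exact (exists_isIntersectionForm g).choose_spec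

end

section

open Filter

/-! ### The interior of the surface -/

variable {g : ℕ}

/-- The first coordinates of the points of the slots, together with a point outside the
rectangle. -/
def slotSet (g : ℕ) : Set ℝ := {-1} ∪ ⋃ a : Fin g × Fin 2,
  (Set.Icc (slot a.1 a.2 + 1 / 4) (slot a.1 a.2 + 3 / 4) ∪
    Set.Icc (slot a.1 a.2 + 9 / 4) (slot a.1 a.2 + 11 / 4))

lemma isClosed_slotSet : IsClosed (slotSet g) :=
  isClosed_singleton.union (isClosed_iUnion_of_finite fun _ => isClosed_Icc.union isClosed_Icc)

/-- The distance from the slots, cut off. -/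
def slotDist (g : ℕ) (x : ℝ) : ℝ := min 1 (Metric.infDist x (slotSet g))

lemma slotDist_eq_zero {x : ℝ} (h : x ∈ slotSet g) : slotDist g x = 0 := by
  rw [slotDist, Metric.infDist_zero_of_mem h]; simp

lemma slotDist_pos {x : ℝ} (h : x ∉ slotSet g) : 0 < slotDist g x :=
  lt_min one_pos ((isClosed_slotSet.notMem_iff_infDist_pos ⟨-1, .inl rfl⟩).1 h)

lemma slotDist_nonneg (x : ℝ) : 0 ≤ slotDist g x := le_min zero_le_one Metric.infDist_nonneg

lemma slotDist_le_one (x : ℝ) : slotDist g x ≤ 1 := min_le_left _ _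

/-- A vector field on the interval `[0, 4g + 1]` that points inwards at the ends of the interval and
at the ends of the slots. -/
def inward (g : ℕ) (x : ℝ) : ℝ :=
  Real.sin (2 * Real.pi * x) + max 0 (1 / 4 - x) - max 0 (x - (4 * g + 3 / 4))

/-- The flow that pushes the rectangle inwards, leaving only the slots on its boundary. -/
def pushPlane (g : ℕ) (ε : ℝ) (p : ℝ × ℝ) : ℝ × ℝ :=
  (p.1 + ε * inward g p.1, (ε + (1 - ε) * p.2) * (1 - ε * slotDist g p.1))

lemma sin_two_pi_natCast_add (j : ℕ) (y : ℝ) :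
    Real.sin (2 * Real.pi * (j + y)) = Real.sin (2 * Real.pi * y) := by
  rw [mul_add, mul_comm _ (j : ℝ), add_comm, Real.sin_add_nat_mul_two_pi]

lemma sin_nonneg_half {y : ℝ} (h0 : 0 ≤ y) (h1 : y ≤ 1 / 2) : 0 ≤ Real.sin (2 * Real.pi * y) :=
  Real.sin_nonneg_of_nonneg_of_le_pi (by positivity) (by nlinarith [Real.pi_pos])

lemma sin_one_sub (y : ℝ) : Real.sin (2 * Real.pi * (1 - y)) = - Real.sin (2 * Real.pi * y) := by
  rw [mul_sub, mul_one, Real.sin_two_pi_sub]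

lemma slot_push {y ε : ℝ} (hε : 0 < ε) (hε' : ε ≤ 1 / 10) (h0 : 1 / 4 ≤ y) (h1 : y ≤ 3 / 4) :
    1 / 4 < y + ε * Real.sin (2 * Real.pi * y) ∧ y + ε * Real.sin (2 * Real.pi * y) < 3 / 4 := by
  have key : ∀ y : ℝ, 1 / 4 ≤ y → y ≤ 1 / 2 →
      1 / 4 < y + ε * Real.sin (2 * Real.pi * y) ∧ y + ε * Real.sin (2 * Real.pi * y) < 3 / 4 := by
    intro y h0 h1
    have a := Real.sin_le_one (2 * Real.pi * y)
    have b := sin_nonneg_half (by linarith) h1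
    have c := mul_nonneg hε.le b
    have d := mul_le_mul_of_nonneg_left a hε.le
    refine ⟨?_, by linarith⟩
    rcases h0.eq_or_lt with h | h
    · rw [← h, show 2 * Real.pi * (1 / 4) = Real.pi / 2 by ring, Real.sin_pi_div_two]; linarith
    · linarith
  rcases le_total y (1 / 2) with h | h
  · exact key y h0 h
  · have := key (1 - y) (by linarith) (by linarith)
    rw [sin_one_sub] at this
    constructor <;> linarith [this.1, this.2]

lemma inward_of_slot {j : ℕ} (hj : j < 4 * g) {y : ℝ} (h0 : 1 / 4 ≤ y) (h1 : y ≤ 3 / 4) :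
    inward g (j + y) = Real.sin (2 * Real.pi * y) := by
  have hj' : (j : ℝ) + 1 ≤ 4 * g := by exact_mod_cast hj
  have hj0 : (0 : ℝ) ≤ j := by positivity
  rw [inward, sin_two_pi_natCast_add, max_eq_left (by linarith), max_eq_left (by linarith)]
  ring

lemma pushPlane_fst {ε : ℝ} (hε : 0 ≤ ε) (hε' : ε ≤ 1 / 10) {x : ℝ} (h0 : 0 ≤ x)
    (h1 : x ≤ 4 * g + 1) : x ≤ x + ε * inward g x ∧ (0 < ε → x < 1 / 4 → 0 < x + ε * inward g x) ∨
      1 / 8 < x + ε * inward g x ∧ 1 / 4 ≤ x := by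
  have hs := Real.neg_one_le_sin (2 * Real.pi * x)
  rcases lt_or_ge x (1 / 4) with h | h
  · left
    have b := sin_nonneg_half h0 (by linarith)
    have hg : (0 : ℝ) ≤ g := by positivity
    have e : inward g x = Real.sin (2 * Real.pi * x) + (1 / 4 - x) := by
      rw [inward, max_eq_right (by linarith), max_eq_left (by linarith), sub_zero]
    have hp : 0 < inward g x := by rw [e]; linarith
    refine ⟨by have := mul_nonneg hε hp.le; linarith, fun h _ => ?_⟩
    have := mul_pos h hp; linarith
  · right
    refine ⟨?_, h⟩
    rcases le_total x (4 * g + 3 / 4) with h2 | h2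
    · have e : inward g x = Real.sin (2 * Real.pi * x) := by
        rw [inward, max_eq_left (by linarith), max_eq_left (by linarith)]; ring
      have : -ε ≤ ε * inward g x := by rw [e]; nlinarith
      linarith
    · have e : inward g x = Real.sin (2 * Real.pi * x) - (x - (4 * g + 3 / 4)) := by
        rw [inward, max_eq_left (by linarith), max_eq_right (by linarith)]; ring
      have : - (5 / 4 * ε) ≤ ε * inward g x := by rw [e]; nlinarith
      linarith

lemma inward_symm (x : ℝ) : inward g (4 * g + 1 - x) = - inward g x := by
  have : Real.sin (2 * Real.pi * (4 * g + 1 - x)) = - Real.sin (2 * Real.pi * x) := by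
    rw [show (4 * (g : ℝ) + 1 - x) = ((4 * g : ℕ) : ℝ) + (1 - x) by push_cast; ring,
      sin_two_pi_natCast_add, sin_one_sub]
  rw [inward, inward, this, show (1 / 4 - (4 * (g : ℝ) + 1 - x)) = x - (4 * g + 3 / 4) by ring,
    show (4 * (g : ℝ) + 1 - x - (4 * g + 3 / 4)) = 1 / 4 - x by ring]
  ring

lemma pushPlane_fst_mem {ε : ℝ} (hε : 0 ≤ ε) (hε' : ε ≤ 1 / 10) {x : ℝ} (h0 : 0 ≤ x)
    (h1 : x ≤ 4 * g + 1) : 0 ≤ x + ε * inward g x ∧ x + ε * inward g x ≤ 4 * g + 1 ∧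
      (0 < ε → 0 < x + ε * inward g x ∧ x + ε * inward g x < 4 * g + 1) := by
  have a := pushPlane_fst (g := g) hε hε' h0 h1
  have b := pushPlane_fst (g := g) (x := 4 * g + 1 - x) hε hε' (by linarith) (by linarith)
  rw [inward_symm] at b
  have hp : ∀ y : ℝ, 0 ≤ y → (y ≤ y + ε * inward g y ∧
      (0 < ε → y < 1 / 4 → 0 < y + ε * inward g y) ∨ 1 / 8 < y + ε * inward g y ∧ 1 / 4 ≤ y) →
      0 ≤ y + ε * inward g y ∧ (0 < ε → 0 < y + ε * inward g y) := by
    rintro y hy (⟨h1, h2⟩ | ⟨h1, h2⟩)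
    · refine ⟨by linarith, fun h => ?_⟩
      rcases lt_or_ge y (1 / 4) with h3 | h3
      · exact h2 h h3
      · linarith
    · exact ⟨by linarith, fun _ => by linarith⟩
  have a' := hp x h0 a
  have b' := hp (4 * g + 1 - x) (by linarith) (by rw [inward_symm]; exact b)
  rw [inward_symm] at b'
  refine ⟨a'.1, by linarith [b'.1], fun h => ⟨a'.2 h, by linarith [b'.2 h]⟩⟩

lemma pushPlane_snd {ε d y : ℝ} (hε : 0 ≤ ε) (hε' : ε ≤ 1 / 10) (hd : 0 ≤ d) (hd' : d ≤ 1)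
    (h0 : 0 ≤ y) (h1 : y ≤ 1) : 0 ≤ (ε + (1 - ε) * y) * (1 - ε * d) ∧
      (ε + (1 - ε) * y) * (1 - ε * d) ≤ 1 ∧ (0 < ε → 0 < (ε + (1 - ε) * y) * (1 - ε * d) ∧
        (y < 1 ∨ 0 < d → (ε + (1 - ε) * y) * (1 - ε * d) < 1)) := by
  have a0 : 0 ≤ ε + (1 - ε) * y := by nlinarith
  have a1 : ε + (1 - ε) * y ≤ 1 := by nlinarith
  have e0 : 0 ≤ ε * d := mul_nonneg hε hd
  have b0 : 0 < 1 - ε * d := by nlinarith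
  refine ⟨mul_nonneg a0 b0.le, by nlinarith, fun h => ⟨mul_pos (by nlinarith) b0, ?_⟩⟩
  rintro (h2 | h2)
  · have : ε + (1 - ε) * y < 1 := by nlinarith
    nlinarith
  · have : 0 < ε * d := mul_pos h h2
    nlinarith

lemma OnLeft.mem_slotSet {a : Fin g × Fin 2} {p : ℝ × ℝ} (h : OnLeft a p) :
    p.1 ∈ slotSet g :=
  .inr (Set.mem_iUnion.2 ⟨a, .inl ⟨h.1, h.2.1⟩⟩)

lemma OnRight.mem_slotSet {a : Fin g × Fin 2} {p : ℝ × ℝ} (h : OnRight a p) :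
    p.1 ∈ slotSet g :=
  .inr (Set.mem_iUnion.2 ⟨a, .inr ⟨h.1, h.2.1⟩⟩)

lemma natCast_slot (a : Fin g × Fin 2) : ∃ j : ℕ, slot a.1 a.2 = j ∧ j + 3 ≤ 4 * g := by
  refine ⟨_, slot_eq _ _, ?_⟩
  have := a.1.isLt; have := a.2.isLt; omega

lemma OnLeft.pushPlane_eq {a : Fin g × Fin 2} {p : ℝ × ℝ} (h : OnLeft a p) (ε : ℝ) :
    pushPlane g ε p = (p.1 + ε * Real.sin (2 * Real.pi * (p.1 - slot a.1 a.2)), 1) := by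
  obtain ⟨h1, h2, h3⟩ := id h
  obtain ⟨j, hj, hj'⟩ := natCast_slot a
  have := inward_of_slot (g := g) (j := j) (by omega) (y := p.1 - slot a.1 a.2) (by linarith) (by linarith)
  rw [hj] at this ⊢
  rw [add_sub_cancel] at this
  rw [pushPlane, slotDist_eq_zero h.mem_slotSet, this, h3]
  simp

lemma OnLeft.pushPlane_turn {a : Fin g × Fin 2} {p : ℝ × ℝ} (h : OnLeft a p) (ε : ℝ) :
    pushPlane g ε (FramedGraph.turn a p) = FramedGraph.turn a (pushPlane g ε p) := by
  obtain ⟨h1, h2, h3⟩ := id h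
  obtain ⟨j, hj, hj'⟩ := natCast_slot a
  have := inward_of_slot (g := g) (j := j + 2) (by omega) (y := 1 - (p.1 - slot a.1 a.2))
    (by linarith) (by linarith)
  have e : ((j + 2 : ℕ) : ℝ) + (1 - (p.1 - slot a.1 a.2)) = (FramedGraph.turn a p).1 := by
    simp only [FramedGraph.turn]; rw [hj]; push_cast; ring
  rw [e, sin_one_sub] at this
  rw [h.pushPlane_eq, pushPlane, slotDist_eq_zero h.turn.mem_slotSet, this]
  simp only [FramedGraph.turn, h3]
  ext <;> simp only <;> ring

/-- The points of the surface that lie in a flat chart. -/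
def IsInterior (x : Surface g) : Prop := ∃ (c : FlatChart g), ∃ ξ ∈ c.domain, c.param ξ = x

lemma isInterior_pushPlane {ε : ℝ} (hε : 0 < ε) (hε' : ε ≤ 1 / 10) {p : ℝ × ℝ}
    (h : InRect g p) : IsInterior (Surface.mk g (pushPlane g ε p)) := by
  have left : ∀ {a : Fin g × Fin 2} {p : ℝ × ℝ}, OnLeft a p →
      IsInterior (Surface.mk g (pushPlane g ε p)) := by
    intro a p h
    have hs := slot_push hε hε' (y := p.1 - slot a.1 a.2) (by linarith [h.1]) (by linarith [h.2.1])
    rw [h.pushPlane_eq]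
    refine ⟨.seam a.1 a.2, (p.1 + ε * Real.sin (2 * Real.pi * (p.1 - slot a.1 a.2)), 1), ?_, ?_⟩
    · refine ⟨⟨?_, ?_⟩, ?_, ?_⟩ <;> norm_num <;> linarith [hs.1, hs.2]
    · simp [FlatChart.param]
  by_cases hl : ∃ a : Fin g × Fin 2, OnLeft a p
  · exact left hl.choose_spec
  by_cases hr : ∃ a : Fin g × Fin 2, OnRight a p
  · obtain ⟨a, ha⟩ := hr
    have e : Surface.mk g (pushPlane g ε p) = Surface.mk g (pushPlane g ε (turn a p)) := by
      have h1 := ha.turn.pushPlane_turn ε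
      rw [turn_turn] at h1
      rw [h1, mk_turn_of_onLeft]
      have hs := slot_push hε hε' (y := (turn a p).1 - slot a.1 a.2) (by linarith [ha.turn.1])
        (by linarith [ha.turn.2.1])
      rw [ha.turn.pushPlane_eq]
      refine ⟨?_, ?_, rfl⟩ <;> simp only <;> linarith [hs.1, hs.2]
    rw [e]; exact left ha.turn
  · obtain ⟨h1, h2, h3, h4⟩ := h
    have a := (pushPlane_fst_mem hε.le hε' h1 h2).2.2 hε
    have b := (pushPlane_snd hε.le hε' (slotDist_nonneg (g := g) p.1) (slotDist_le_one _) h3 h4).2.2 hε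
    refine ⟨.cell, pushPlane g ε p, ⟨⟨a.1, a.2⟩, b.1, b.2 ?_⟩, rfl⟩
    rcases h4.lt_or_eq with h | h
    · exact .inl h
    · right
      apply slotDist_pos
      rintro (h5 | h5)
      · rw [Set.mem_singleton_iff] at h5; linarith
      · obtain ⟨c, h5 | h5⟩ := Set.mem_iUnion.1 h5
        · exact hl ⟨c, h5.1, h5.2, h⟩
        · exact hr ⟨c, h5.1, h5.2, h⟩

/-- The homotopy that pushes the surface into its interior. -/
def pushIn (g : ℕ) : C(Surface g × I, Surface g) where
  toFun z := Quot.lift (fun p : Rectangle g =>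
    Surface.mk g (pushPlane g ((z.2 : ℝ) / 10) ((p.1 : ℝ), (p.2 : ℝ)))) (by
      rintro p q ⟨i, r, h1, h2, h3, h4⟩
      have hl : OnLeft (i, r) ((p.1 : ℝ), (p.2 : ℝ)) := ⟨h1.1, h1.2, h2⟩
      have hr : ((q.1 : ℝ), (q.2 : ℝ)) = turn (i, r) ((p.1 : ℝ), (p.2 : ℝ)) := by
        ext <;> simp only [turn, h2, h3, h4]; norm_num
      rw [hr, hl.pushPlane_turn, mk_turn_of_onLeft]
      have z0 := z.2.2.1; have z1 := z.2.2.2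
      rw [hl.pushPlane_eq]
      rcases z0.eq_or_lt with h | h
      · have key : OnLeft (i, r) ((p.1 : ℝ), (1 : ℝ)) := ⟨hl.1, hl.2.1, rfl⟩
        rw [← h]; simpa using key
      · have hs := slot_push (ε := (z.2 : ℝ) / 10) (by positivity) (by linarith)
          (y := (p.1 : ℝ) - slot i r) (by linarith [h1.1]) (by linarith [h1.2])
        refine ⟨?_, ?_, rfl⟩ <;> simp only <;> linarith [hs.1, hs.2]) z.1
  continuous_toFun := by
    refine (isQuotientMap_quot_mk (r := Glued g)).continuous_lift_prod_left ?_
    refine continuous_mk.comp ?_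
    unfold pushPlane inward slotDist
    fun_prop

lemma pushIn_mk {p : ℝ × ℝ} (h : InRect g p) (t : I) :
    pushIn g (Surface.mk g p, t) = Surface.mk g (pushPlane g ((t : ℝ) / 10) p) := by
  rw [mk_of_inRect h]; rfl

lemma pushIn_zero (x : Surface g) : pushIn g (x, 0) = x := by
  obtain ⟨p, hp, rfl⟩ := exists_mk_eq x
  rw [pushIn_mk hp]
  simp [pushPlane]

lemma isInterior_pushIn (x : Surface g) {t : I} (ht : 0 < t) : IsInterior (pushIn g (x, t)) := by
  obtain ⟨p, hp, rfl⟩ := exists_mk_eq x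
  rw [pushIn_mk hp]
  have h0 : (0 : ℝ) < t := ht
  have h1 := t.2.2
  exact isInterior_pushPlane (by positivity) (by linarith) hp

end

section

open Filter

/-! ### Flat charts are open and close curves are homotopic -/

variable {g : ℕ}

lemma FlatChart.isOpen_domain (c : FlatChart g) : IsOpen c.domain := by
  cases c <;> exact isOpen_Ioo.prod isOpen_Ioo

lemma FlatChart.convex_domain (c : FlatChart g) : Convex ℝ c.domain := by
  cases c <;> exact (convex_Ioo _ _).prod (convex_Ioo _ _)

lemma FlatChart.continuousOn_param (c : FlatChart g) : ContinuousOn c.param c.domain := by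
  cases c with
  | cell => exact continuous_mk.continuousOn
  | seam i r =>
    have h1 : Continuous fun p : ℝ × ℝ => Surface.mk g (2 * slot i r + 3 - p.1, 2 - p.2) :=
      continuous_mk.comp (by fun_prop)
    rintro p ⟨hp, -⟩
    refine ContinuousAt.continuousWithinAt ?_
    rcases lt_trichotomy p.2 1 with h | h | h
    · refine continuous_mk.continuousAt.congr ?_
      filter_upwards [continuous_snd.continuousAt.eventually (gt_mem_nhds h)] with q hq
      simp [param, (show q.2 < 1 from hq).le]
    · have e : Surface.mk g (2 * slot i r + 3 - p.1, 2 - p.2) = Surface.mk g p :=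
        mk_turn_of_onLeft (a := (i, r)) ⟨hp.1.le, hp.2.le, h⟩
      have e' : (FlatChart.seam i r).param p = Surface.mk g p := by simp [param, h]
      unfold ContinuousAt
      rw [e']
      exact Tendsto.if' continuous_mk.continuousAt (e ▸ h1.continuousAt)
    · refine h1.continuousAt.congr ?_
      filter_upwards [continuous_snd.continuousAt.eventually (lt_mem_nhds h)] with q hq
      simp [param, not_le.2 hq]

/-- Flat charts are open maps. -/
lemma FlatChart.image_param_mem_nhds {c : FlatChart g} {B : Set (ℝ × ℝ)} (hB : IsOpen B)
    (hBc : B ⊆ c.domain) {ξ : ℝ × ℝ} (hξ : ξ ∈ B) : c.param '' B ∈ 𝓝 (c.param ξ) := by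
  have hrep := rep_param (hBc hξ)
  cases c with
  | cell =>
    have ho := isOpen_of_saturated (g := g) hB fun a p hp => by
      constructor
      · intro h; have := (hBc h).2.2; have := hp.2.2; linarith
      · intro h; have := (hBc h).2.2; have := hp.turn.2.2; linarith
    refine mem_of_superset (ho.mem_nhds ?_) ?_
    · change rep (FlatChart.cell.param ξ) ∈ B
      rw [hrep]; exact hξ
    · intro x hx; exact ⟨rep x, hx, mk_rep x⟩
  | seam i r =>
    have hW : IsOpen (B ∪ turn (i, r) ⁻¹' B) := hB.union (hB.preimage (continuous_turn _))
    have ho := isOpen_of_saturated (g := g) hW fun a p hp => by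
      rcases eq_or_ne a (i, r) with rfl | ha
      · simp only [Set.mem_union, Set.mem_preimage, turn_turn]; exact or_comm
      · have h1 := slot_lt_or_lt ha
        have h2 := slot_ne_right a.1 i a.2 r
        have h3 := slot_ne_right i a.1 r a.2
        obtain ⟨k1, k2, -⟩ := hp
        have n1 : ¬ (p ∈ B ∪ turn (i, r) ⁻¹' B) := by
          rintro (h | h)
          · obtain ⟨⟨j1, j2⟩, -⟩ := hBc h
            rcases h1 with h1 | h1 <;> linarith
          · obtain ⟨⟨j1, j2⟩, -⟩ := hBc h
            simp only [turn] at j1 j2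
            rcases h3 with h3 | h3 <;> linarith
        have n2 : ¬ (turn a p ∈ B ∪ turn (i, r) ⁻¹' B) := by
          rintro (h | h)
          · obtain ⟨⟨j1, j2⟩, -⟩ := hBc h
            simp only [turn] at j1 j2
            rcases h2 with h2 | h2 <;> linarith
          · obtain ⟨⟨j1, j2⟩, -⟩ := hBc h
            simp only [turn] at j1 j2
            rcases h1 with h1 | h1 <;> linarith
        exact ⟨fun h => (n1 h).elim, fun h => (n2 h).elim⟩
    refine mem_of_superset (ho.mem_nhds ?_) ?_
    · change rep ((FlatChart.seam i r).param ξ) ∈ B ∪ turn (i, r) ⁻¹' B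
      rw [hrep, chartRep]
      split_ifs
      · exact .inl hξ
      · right; simpa using hξ
    · rintro x (hx | hx)
      · refine ⟨rep x, hx, ?_⟩
        simp [param, rep_le_one, mk_rep]
      · refine ⟨turn (i, r) (rep x), hx, ?_⟩
        have h1 := rep_le_one x
        have h2 : (rep x).2 ≠ 1 := by
          intro h
          obtain ⟨⟨j1, j2⟩, -⟩ := hBc hx
          simp only [turn] at j1 j2
          exact not_onRight_rep x (i, r) ⟨by simp only; linarith, by simp only; linarith, h⟩
        have h3 : ¬ (turn (i, r) (rep x)).2 ≤ 1 := by
          simp only [turn]; intro h; exact h2 (by linarith)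
        rw [param_eq_mk_chartRep, chartRep, if_neg h3, turn_turn, mk_rep]

/-- A flat chart is an open embedding. -/
lemma FlatChart.map_nhds_param {c : FlatChart g} {ξ : ℝ × ℝ} (hξ : ξ ∈ c.domain) :
    Filter.map c.param (𝓝 ξ) = 𝓝 (c.param ξ) := by
  refine le_antisymm (c.continuousOn_param.continuousAt (c.isOpen_domain.mem_nhds hξ)) ?_
  intro S hS
  obtain ⟨B, hBS, hB, hξB⟩ := mem_nhds_iff.1 (inter_mem (mem_map.1 hS) (c.isOpen_domain.mem_nhds hξ))
  refine mem_of_superset (image_param_mem_nhds hB (fun x hx => (hBS hx).2) hξB) ?_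
  rintro _ ⟨x, hx, rfl⟩
  exact (hBS hx).1

/-- The point at time `t` of the segment from `ξ` to `η`. -/
def segmentPoint (ξ η : ℝ × ℝ) (t : ℝ) : ℝ × ℝ := (1 - t) • ξ + t • η

lemma continuous_segmentPoint :
    Continuous fun z : ((ℝ × ℝ) × (ℝ × ℝ)) × I => segmentPoint z.1.1 z.1.2 z.2 := by
  unfold segmentPoint; fun_prop

lemma segmentPoint_mem {c : FlatChart g} {ξ η : ℝ × ℝ} (hξ : ξ ∈ c.domain) (hη : η ∈ c.domain)
    (t : I) : segmentPoint ξ η t ∈ c.domain :=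
  c.convex_domain hξ hη (by linarith [t.2.2]) t.2.1 (by ring)

/-- The points `x` and `y` have the coordinates `ξ` and `η` in the chart `c`, and these are near
to each other. -/
def NearIn (c : FlatChart g) (ξ η : ℝ × ℝ) (x y : Surface g) : Prop :=
  ξ ∈ c.domain ∧ η ∈ c.domain ∧ Near (1 / 8) ξ η ∧ c.param ξ = x ∧ c.param η = y

lemma turn_segmentPoint (a : Fin g × Fin 2) (ξ η : ℝ × ℝ) (t : ℝ) :
    turn a (segmentPoint ξ η t) = segmentPoint (turn a ξ) (turn a η) t := by
  ext <;> simp only [turn, segmentPoint, Prod.fst_add, Prod.snd_add, Prod.smul_fst, Prod.smul_snd,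
    smul_eq_mul] <;> ring

/-- In every chart, a near pair of points either has canonical representatives as coordinates, or
is obtained from them by turning one or both. -/
lemma param_segmentPoint_eq_mk {c : FlatChart g} {ξ η : ℝ × ℝ} {x y : Surface g}
    (h : NearIn c ξ η x y) (hn : Near (1 / 8) (rep x) (rep y)) (t : I) :
    c.param (segmentPoint ξ η t) = Surface.mk g (segmentPoint (rep x) (rep y) t) := by
  obtain ⟨hξ, hη, h1, rfl, rfl⟩ := h
  rw [rep_param hξ, rep_param hη] at hn ⊢
  cases c with
  | cell => rfl
  | seam i r =>
    have t0 := t.2.1; have t1 := t.2.2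
    have hm := segmentPoint_mem hξ hη t
    rw [param_eq_mk_chartRep]
    by_cases k1 : ξ.2 ≤ 1 <;> by_cases k2 : η.2 ≤ 1
    · have k3 : (segmentPoint ξ η t).2 ≤ 1 := by
        simp only [segmentPoint, Prod.snd_add, Prod.smul_snd, smul_eq_mul]; nlinarith
      simp only [chartRep, if_pos k1, if_pos k2, if_pos k3]
    · exfalso
      simp only [chartRep, if_pos k1, if_neg k2, Near, turn, abs_lt] at hn
      linarith [hξ.1.2, hη.1.2, hn.1.1]
    · exfalso
      simp only [chartRep, if_neg k1, if_pos k2, Near, turn, abs_lt] at hn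
      linarith [hξ.1.2, hη.1.2, hn.1.2]
    · rw [not_le] at k1 k2
      have k3 : ¬ (segmentPoint ξ η t).2 ≤ 1 := by
        rw [not_le]
        simp only [segmentPoint, Prod.snd_add, Prod.smul_snd, smul_eq_mul]
        rcases t0.eq_or_lt with h | h
        · rw [← h]; linarith
        · nlinarith
      simp only [chartRep, if_neg (not_le.2 k1), if_neg (not_le.2 k2), if_neg k3, turn_segmentPoint]

/-- The segment between two near points does not depend on the chart. -/
lemma NearIn.param_segmentPoint_eq {c d : FlatChart g} {ξ η ξ' η' : ℝ × ℝ} {x y : Surface g}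
    (h : NearIn c ξ η x y) (h' : NearIn d ξ' η' x y) (t : I) :
    c.param (segmentPoint ξ η t) = d.param (segmentPoint ξ' η' t) := by
  by_cases hn : Near (1 / 8) (rep x) (rep y)
  · rw [param_segmentPoint_eq_mk h hn, param_segmentPoint_eq_mk h' hn]
  · have key : ∀ {c : FlatChart g} {ξ η : ℝ × ℝ}, NearIn c ξ η x y → ∃ i r, c = .seam i r ∧
        ((rep x = ξ ∧ rep y = turn (i, r) η) ∨ (rep x = turn (i, r) ξ ∧ rep y = η)) := by
      rintro c ξ η ⟨hξ, hη, h1, rfl, rfl⟩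
      rw [rep_param hξ, rep_param hη] at hn ⊢
      cases c with
      | cell => exact (hn h1).elim
      | seam i r =>
        refine ⟨i, r, rfl, ?_⟩
        simp only [chartRep] at hn ⊢
        split_ifs at hn ⊢ with k1 k2 k2
        · exact (hn h1).elim
        · exact .inl ⟨rfl, rfl⟩
        · exact .inr ⟨rfl, rfl⟩
        · refine (hn ?_).elim
          simp only [Near, turn] at h1 ⊢
          rwa [sub_sub_sub_cancel_left, sub_sub_sub_cancel_left, abs_sub_comm, abs_sub_comm η.2]
    obtain ⟨i, r, rfl, k⟩ := key h
    obtain ⟨j, s, rfl, k'⟩ := key h'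
    obtain ⟨⟨⟨a1, a2⟩, -⟩, ⟨⟨a3, a4⟩, -⟩, -⟩ := h
    obtain ⟨⟨⟨b1, b2⟩, -⟩, ⟨⟨b3, b4⟩, -⟩, -⟩ := h'
    have e1 : rep x = ξ ∧ rep y = turn (i, r) η → rep x = turn (j, s) ξ' → False := fun e e' => by
      have := congrArg Prod.fst (e.1.symm.trans e')
      simp only [turn] at this
      rcases slot_ne_right j i s r with h | h <;> linarith
    have e2 : rep x = turn (i, r) ξ ∧ rep y = η → rep x = ξ' → False := fun e e' => by
      have := congrArg Prod.fst (e.1.symm.trans e')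
      simp only [turn] at this
      rcases slot_ne_right i j r s with h | h <;> linarith
    have hij : (i, r) = (j, s) := by
      by_contra hij
      rcases k with k | k <;> rcases k' with k' | k'
      · have := congrArg Prod.fst (k.1.symm.trans k'.1)
        rcases slot_lt_or_lt hij with h | h <;> linarith
      · exact e1 k k'.1
      · exact e2 k k'.1
      · have := congrArg Prod.fst (k.1.symm.trans k'.1)
        simp only [turn] at this
        rcases slot_lt_or_lt hij with h | h <;> linarith
    obtain ⟨rfl, rfl⟩ := Prod.mk.inj hij
    have ht := turn_turn (i, r)
    rcases k with k | k <;> rcases k' with k' | k'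
    · rw [k.1.symm.trans k'.1, ← ht η, ← k.2, k'.2, ht]
    · exact (e1 k k'.1).elim
    · exact (e2 k k'.1).elim
    · rw [k.2.symm.trans k'.2, ← ht ξ, ← k.1, k'.1, ht]

open Classical in
/-- The point at time `t` of the segment between two near points of the surface. -/
def segmentMap (x y : Surface g) (t : I) : Surface g :=
  if h : ∃ z : FlatChart g × (ℝ × ℝ) × (ℝ × ℝ), NearIn z.1 z.2.1 z.2.2 x y then
    h.choose.1.param (segmentPoint h.choose.2.1 h.choose.2.2 t) else x

lemma NearIn.segmentMap_eq {c : FlatChart g} {ξ η : ℝ × ℝ} {x y : Surface g}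
    (h : NearIn c ξ η x y) (t : I) : segmentMap x y t = c.param (segmentPoint ξ η t) := by
  have h' : ∃ z : FlatChart g × (ℝ × ℝ) × (ℝ × ℝ), NearIn z.1 z.2.1 z.2.2 x y := ⟨(c, ξ, η), h⟩
  rw [segmentMap, dif_pos h']
  exact h'.choose_spec.param_segmentPoint_eq h t

lemma isOpen_setOf_near (μ : ℝ) : IsOpen {z : (ℝ × ℝ) × (ℝ × ℝ) | Near μ z.1 z.2} := by
  have h1 : Continuous fun z : (ℝ × ℝ) × (ℝ × ℝ) => |z.1.1 - z.2.1| := by fun_prop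
  have h2 : Continuous fun z : (ℝ × ℝ) × (ℝ × ℝ) => |z.1.2 - z.2.2| := by fun_prop
  exact (isOpen_lt h1 continuous_const).inter (isOpen_lt h2 continuous_const)

lemma NearIn.eventually_domain {c : FlatChart g} {ξ η : ℝ × ℝ} {x y : Surface g}
    (h : NearIn c ξ η x y) : ∀ᶠ z : (ℝ × ℝ) × (ℝ × ℝ) in 𝓝 (ξ, η),
      NearIn c z.1 z.2 (c.param z.1) (c.param z.2) := by
  have h1 := (c.isOpen_domain.prod c.isOpen_domain).mem_nhds (show (ξ, η) ∈ _ from ⟨h.1, h.2.1⟩)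
  filter_upwards [h1, (isOpen_setOf_near (1 / 8)).mem_nhds h.2.2.1] with z hz hz'
  exact ⟨hz.1, hz.2, hz', rfl, rfl⟩

lemma NearIn.nhds_eq {c : FlatChart g} {ξ η : ℝ × ℝ} {x y : Surface g} (h : NearIn c ξ η x y) :
    𝓝 (x, y) = Filter.map (Prod.map c.param c.param) (𝓝 (ξ, η)) := by
  obtain ⟨hξ, hη, -, rfl, rfl⟩ := h
  rw [nhds_prod_eq, nhds_prod_eq, ← Filter.prod_map_map_eq', c.map_nhds_param hξ,
    c.map_nhds_param hη]

lemma NearIn.eventually {c : FlatChart g} {ξ η : ℝ × ℝ} {x y : Surface g}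
    (h : NearIn c ξ η x y) : ∀ᶠ z in 𝓝 (x, y), ∃ c ξ η, NearIn (g := g) c ξ η z.1 z.2 := by
  rw [h.nhds_eq, eventually_map]
  exact h.eventually_domain.mono fun z hz => ⟨_, _, _, hz⟩

lemma NearIn.continuousAt_segmentMap {c : FlatChart g} {ξ η : ℝ × ℝ} {x y : Surface g}
    (h : NearIn c ξ η x y) (t : I) :
    ContinuousAt (fun z : (Surface g × Surface g) × I => segmentMap z.1.1 z.1.2 z.2) ((x, y), t) := by
  rw [ContinuousAt, nhds_prod_eq, h.nhds_eq, ← Filter.map_id (f := 𝓝 t), Filter.prod_map_map_eq',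
    tendsto_map'_iff, ← nhds_prod_eq, h.segmentMap_eq]
  have hc : ContinuousAt (fun z : ((ℝ × ℝ) × (ℝ × ℝ)) × I => c.param (segmentPoint z.1.1 z.1.2 z.2))
      ((ξ, η), t) :=
    ContinuousAt.comp (f := fun z : ((ℝ × ℝ) × (ℝ × ℝ)) × I => segmentPoint z.1.1 z.1.2 z.2)
      (c.continuousOn_param.continuousAt (c.isOpen_domain.mem_nhds (segmentPoint_mem h.1 h.2.1 t)))
      continuous_segmentPoint.continuousAt
  refine Tendsto.congr' ?_ hc
  filter_upwards [continuous_fst.continuousAt.eventually h.eventually_domain] with z hz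
  exact (hz.segmentMap_eq z.2).symm

/-- Near a loop in the interior of the surface all loops are homotopic to it. -/
lemma eventually_homotopic {α : C(𝕋, Surface g)} (hα : ∀ s, IsInterior (α s)) :
    ∀ᶠ α' in 𝓝 α, α.Homotopic α' := by
  have h : ∀ᶠ α' in 𝓝 α, ∀ s, ∃ c ξ η, NearIn (g := g) c ξ η (α s) (α' s) := by
    have hc : Continuous fun z : C(𝕋, Surface g) × 𝕋 =>
      (α z.2, z.1 z.2) := by fun_prop
    have h := isCompact_univ.eventually_forall_of_forall_eventually (x₀ := α)
      (P := fun (P : C(𝕋, Surface g)) (s : 𝕋) =>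
        ∃ c ξ η, NearIn (g := g) c ξ η (α s) (P s)) (fun s _ => by
          obtain ⟨c, ξ, hξ, e⟩ := hα s
          have hn : NearIn c ξ ξ (α s) (α s) := ⟨hξ, hξ, ⟨by norm_num, by norm_num⟩, e, e⟩
          exact (hc.tendsto (α, s)).eventually hn.eventually)
    exact h.mono fun P hP s => hP s trivial
  filter_upwards [h] with α' h'
  refine ⟨⟨⟨fun z => segmentMap (α z.2) (α' z.2) z.1, ?_⟩, fun s => ?_, fun s => ?_⟩⟩
  · refine continuous_iff_continuousAt.2 fun z => ?_
    obtain ⟨c, ξ, η, hn⟩ := h' z.2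
    exact ContinuousAt.comp (f := fun z : I × 𝕋 => ((α z.2, α' z.2), z.1))
      (hn.continuousAt_segmentMap z.1) (by fun_prop)
  · obtain ⟨c, ξ, η, hn⟩ := h' s
    change segmentMap (α s) (α' s) 0 = α s
    rw [hn.segmentMap_eq, ← hn.2.2.2.1]
    simp [segmentPoint]
  · obtain ⟨c, ξ, η, hn⟩ := h' s
    change segmentMap (α s) (α' s) 1 = α' s
    rw [hn.segmentMap_eq, ← hn.2.2.2.2]
    simp [segmentPoint]

end

section

open Filter

/-! ### Approximation by transverse staircase loops -/

variable {g : ℕ}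

/-- A dense set of real numbers that is invariant under the reflections that occur in the gluing. -/
structure IsGridSet (Q : Set ℝ) : Prop where
  dense : Dense Q
  sub_mem : ∀ (m : ℕ) {x : ℝ}, x ∈ Q → m - x ∈ Q

lemma IsGridSet.turn_fst {Q : Set ℝ} (hQ : IsGridSet Q) (a : Fin g × Fin 2) {p : ℝ × ℝ}
    (h : p.1 ∈ Q) : (turn a p).1 ∈ Q := by
  have := hQ.sub_mem (2 * (4 * a.1.val + a.2.val) + 3) h
  simp only [turn, slot_eq]
  push_cast at this ⊢
  exact this

lemma IsGridSet.turn_snd {Q : Set ℝ} (hQ : IsGridSet Q) (a : Fin g × Fin 2) {p : ℝ × ℝ}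
    (h : p.2 ∈ Q) : (turn a p).2 ∈ Q := by
  have := hQ.sub_mem 2 h
  simpa [turn] using this

lemma isGridSet_rat : IsGridSet (Set.range ((↑) : ℚ → ℝ)) where
  dense := Rat.denseRange_cast
  sub_mem := by rintro m _ ⟨q, rfl⟩; exact ⟨m - q, by push_cast; rfl⟩

lemma isGridSet_irrational : IsGridSet {x : ℝ | Irrational x} where
  dense := dense_irrational
  sub_mem := fun m _ h => h.natCast_sub m

/-- The loop runs along the vertical lines and the horizontal lines with coordinate in `Q`. -/
def IsGridLoop (Q : Set ℝ) (α : C(𝕋, Surface g)) : Prop :=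
  ∀ s, (∃ p, InRect g p ∧ α s = Surface.mk g p ∧ p.1 ∈ Q ∧
      (p.2 < 1 → p.2 ∉ Q → ∃ e, e ≠ 0 ∧ HasVelocity .cell α s (0, e))) ∨
    ∃ p ∈ (FlatChart.cell : FlatChart g).domain, α s = Surface.mk g p ∧ p.2 ∈ Q ∧
      (p.1 ∉ Q → ∃ e, e ≠ 0 ∧ HasVelocity .cell α s (e, 0))

lemma inRect_of_mem_cell {p : ℝ × ℝ} (h : p ∈ (FlatChart.cell : FlatChart g).domain) :
    InRect g p := ⟨h.1.1.le, h.1.2.le, h.2.1.le, h.2.2.le⟩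

lemma eq_of_mk_eq_of_mem_cell {p q : ℝ × ℝ} (hp : InRect g p)
    (hq : q ∈ (FlatChart.cell : FlatChart g).domain) (h : Surface.mk g p = Surface.mk g q) :
    p = q := by
  have h1 : canon g p = q := by
    rw [← rep_mk hp, h]; exact rep_param hq
  by_cases ha : ∃ a : Fin g × Fin 2, OnRight a p
  · obtain ⟨a, ha⟩ := ha
    have h2 : q.2 = 1 := by rw [← h1, canon_of_onRight ha]; exact ha.turn.2.2
    exact absurd hq.2.2 (by rw [h2]; exact lt_irrefl _)
  · rwa [canon_of_not (by simpa using ha)] at h1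

lemma IsGridSet.rep_mk_fst {Q : Set ℝ} (hQ : IsGridSet Q) {p : ℝ × ℝ} (hp : InRect g p)
    (h : p.1 ∈ Q) : (rep (Surface.mk g p)).1 ∈ Q := by
  rw [rep_mk hp]
  by_cases ha : ∃ a : Fin g × Fin 2, OnRight a p
  · obtain ⟨a, ha⟩ := ha
    rw [canon_of_onRight ha]; exact hQ.turn_fst a h
  · rwa [canon_of_not (by simpa using ha)]

/-- On disjoint grids, the two loops meet only where a horizontal segment of one crosses a vertical
segment of the other. -/
lemma IsGridLoop.transverse {Q Q' : Set ℝ} (hQ : IsGridSet Q) (hQ' : IsGridSet Q')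
    (hd : ∀ x, x ∈ Q → x ∉ Q') {α β : C(𝕋, Surface g)} (hα : IsGridLoop Q α)
    (hβ : IsGridLoop Q' β) : Transverse α β := by
  rintro ⟨s, t⟩ hst
  simp only at hst
  rcases hα s with ⟨p, hp, ep, h1, h2⟩ | ⟨p, hp, ep, h1, h2⟩ <;>
    rcases hβ t with ⟨q, hq, eq, k1, k2⟩ | ⟨q, hq, eq, k1, k2⟩
  · refine (hd _ (hQ.rep_mk_fst hp h1) ?_).elim
    rw [← ep, hst, eq]; exact hQ'.rep_mk_fst hq k1
  · obtain rfl := eq_of_mk_eq_of_mem_cell hp hq (by rw [← ep, hst, eq])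
    obtain ⟨e, he, hv⟩ := h2 hq.2.2 fun h => hd _ h k1
    obtain ⟨f, hf, hw⟩ := k2 (hd _ h1)
    rcases (mul_ne_zero he hf).lt_or_gt with h | h
    · exact .inl ⟨hst, .cell, _, _, hv, hw, by simp only; push_cast; linarith⟩
    · exact .inr ⟨hst, .cell, _, _, hv, hw, by simp only; push_cast; linarith⟩
  · obtain rfl := eq_of_mk_eq_of_mem_cell hq hp (by rw [← ep, hst, eq])
    obtain ⟨e, he, hv⟩ := h2 (fun h => hd _ h k1)
    obtain ⟨f, hf, hw⟩ := k2 hp.2.2 (hd _ h1)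
    rcases (mul_ne_zero he hf).lt_or_gt with h | h
    · exact .inr ⟨hst, .cell, _, _, hv, hw, by simp only; push_cast; linarith⟩
    · exact .inl ⟨hst, .cell, _, _, hv, hw, by simp only; push_cast; linarith⟩
  · obtain rfl := eq_of_mk_eq_of_mem_cell (inRect_of_mem_cell hp) hq (by rw [← ep, hst, eq])
    exact (hd _ h1 k1).elim

/-- Away from the seam, every chart looks like the chart of the open rectangle, up to a turn. -/
lemma FlatChart.exists_cell {c : FlatChart g} {ζ : ℝ × ℝ} (hζ : ζ ∈ c.domain) (h1 : ζ.2 ≠ 1) :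
    ∃ T : ℝ × ℝ → ℝ × ℝ, (T = id ∨ ∃ a : Fin g × Fin 2, T = turn a) ∧
      T ζ ∈ (FlatChart.cell : FlatChart g).domain ∧
      ∀ᶠ z in 𝓝 ζ, c.param z = Surface.mk g (T z) := by
  cases c with
  | cell => exact ⟨id, .inl rfl, hζ, .of_forall fun z => rfl⟩
  | seam i r =>
    obtain ⟨⟨a1, a2⟩, a3, a4⟩ := hζ
    have := slot_nonneg i r; have := slot_le i r
    rcases h1.lt_or_gt with h | h
    · refine ⟨id, .inl rfl, ⟨⟨?_, ?_⟩, a3, h⟩, ?_⟩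
      · simp only [id]; linarith
      · simp only [id]; linarith
      · filter_upwards [continuous_snd.continuousAt.eventually (gt_mem_nhds h)] with q hq
        simp [param, (show q.2 < 1 from hq).le]
    · refine ⟨turn (i, r), .inr ⟨_, rfl⟩, ⟨⟨?_, ?_⟩, ?_, ?_⟩, ?_⟩
      · simp only [turn]; linarith
      · simp only [turn]; linarith
      · simp only [turn]; linarith
      · simp only [turn]; linarith
      · filter_upwards [continuous_snd.continuousAt.eventually (lt_mem_nhds h)] with q hq
        rw [param_eq_mk_chartRep, chartRep, if_neg (not_le.2 (show 1 < q.2 from hq))]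

/-- A vertex of the grid. -/
def IsGridVertex (Q : Set ℝ) (x : Surface g) : Prop :=
  ∃ p ∈ (FlatChart.cell : FlatChart g).domain, x = Surface.mk g p ∧ p.1 ∈ Q ∧ p.2 ∈ Q

lemma IsGridVertex.coordinates {Q : Set ℝ} (hQ : IsGridSet Q) {c : FlatChart g} {ξ : ℝ × ℝ}
    (hξ : ξ ∈ c.domain) (h : IsGridVertex Q (c.param ξ)) : ξ.1 ∈ Q ∧ ξ.2 ∈ Q ∧ ξ.2 ≠ 1 := by
  obtain ⟨p, hp, e, h1, h2⟩ := h
  have h3 := rep_param hξ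
  rw [e, show rep (Surface.mk g p) = p from rep_param hp] at h3
  have h4 := hp.2.2
  cases c with
  | cell => rw [chartRep] at h3; rw [← h3]; exact ⟨h1, h2, h4.ne⟩
  | seam i r =>
    rw [chartRep] at h3
    split_ifs at h3
    · rw [← h3]; exact ⟨h1, h2, h4.ne⟩
    · have : ξ = turn (i, r) p := by rw [h3, turn_turn]
      rw [this]
      refine ⟨hQ.turn_fst _ h1, hQ.turn_snd _ h2, ?_⟩
      simp only [turn]; intro h; linarith

lemma exists_gridVertex {Q : Set ℝ} (hQ : IsGridSet Q) {x : Surface g} {W : Set (Surface g)}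
    (hW : W ∈ 𝓝 x) : ∃ y ∈ W, IsGridVertex Q y := by
  have h1 : Surface.mk g ⁻¹' W ∈ 𝓝 (rep x) :=
    continuous_mk.continuousAt (by rw [mk_rep]; exact hW)
  have hp : (0 : ℝ) < 4 * g + 1 := by positivity
  have h2 : rep x ∈ closure (FlatChart.cell : FlatChart g).domain := by
    rw [FlatChart.domain, closure_prod_eq, closure_Ioo hp.ne, closure_Ioo zero_ne_one]
    obtain ⟨a1, a2, a3, a4⟩ := rep_inRect x
    exact ⟨⟨a1, a2⟩, a3, a4⟩
  obtain ⟨O, hO, hOo, hxO⟩ := mem_nhds_iff.1 h1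
  obtain ⟨p, hpO, hpc⟩ := mem_closure_iff.1 h2 O hOo hxO
  obtain ⟨q, hq, hqQ⟩ := (hQ.dense.prod hQ.dense).inter_open_nonempty _
    (hOo.inter FlatChart.cell.isOpen_domain) ⟨p, hpO, hpc⟩
  exact ⟨Surface.mk g q, hO hq.1, q, hq.2, rfl, hqQ.1, hqQ.2⟩

/-- The path runs along the grid at the time `r`. -/
def IsGridPathAt (Q : Set ℝ) (f : ℝ → Surface g) (r : ℝ) : Prop :=
  (∃ p, InRect g p ∧ f r = Surface.mk g p ∧ p.1 ∈ Q ∧ (p.2 < 1 → p.2 ∉ Q → ∃ (e : ℝ) (u : ℝ → ℝ × ℝ),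
      e ≠ 0 ∧ HasDerivAt u (0, e) r ∧ u r ∈ (FlatChart.cell : FlatChart g).domain ∧
        ∀ᶠ τ in 𝓝 r, f τ = Surface.mk g (u τ))) ∨
    ∃ p ∈ (FlatChart.cell : FlatChart g).domain, f r = Surface.mk g p ∧ p.2 ∈ Q ∧
      (p.1 ∉ Q → ∃ (e : ℝ) (u : ℝ → ℝ × ℝ),
        e ≠ 0 ∧ HasDerivAt u (e, 0) r ∧ u r ∈ (FlatChart.cell : FlatChart g).domain ∧
          ∀ᶠ τ in 𝓝 r, f τ = Surface.mk g (u τ))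

/-- The retraction of the real line to the unit interval. -/
def clamp (x : ℝ) : ℝ := max 0 (min 1 x)

lemma clamp_mem (x : ℝ) : clamp x ∈ Set.Icc (0 : ℝ) 1 :=
  ⟨le_max_left _ _, max_le zero_le_one (min_le_left _ _)⟩

lemma clamp_of_le {x : ℝ} (h : x ≤ 0) : clamp x = 0 :=
  max_eq_left ((min_le_right _ _).trans h)

lemma clamp_of_mem {x : ℝ} (h : 0 ≤ x) (h' : x ≤ 1) : clamp x = x := by
  rw [clamp, min_eq_right h', max_eq_right h]

lemma clamp_of_one_le {x : ℝ} (h : 1 ≤ x) : clamp x = 1 := by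
  rw [clamp, min_eq_left h, max_eq_right zero_le_one]

/-- The path that runs from `ξ` to `η` first vertically, then horizontally. -/
def stair (ξ η : ℝ × ℝ) (r : ℝ) : ℝ × ℝ :=
  (ξ.1 + clamp (2 * r - 1) * (η.1 - ξ.1), ξ.2 + clamp (2 * r) * (η.2 - ξ.2))

lemma continuous_stair (ξ η : ℝ × ℝ) : Continuous (stair ξ η) := by
  unfold stair clamp; fun_prop

lemma stair_zero (ξ η : ℝ × ℝ) : stair ξ η 0 = ξ := by
  rw [stair, clamp_of_le (by norm_num), clamp_of_le (by norm_num)]; simp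

lemma stair_one (ξ η : ℝ × ℝ) : stair ξ η 1 = η := by
  rw [stair, clamp_of_one_le (by norm_num), clamp_of_one_le (by norm_num)]; simp

lemma stair_mem {S S' : Set ℝ} (hS : Convex ℝ S) (hS' : Convex ℝ S') {ξ η : ℝ × ℝ}
    (hξ : ξ ∈ S ×ˢ S') (hη : η ∈ S ×ˢ S') (r : ℝ) : stair ξ η r ∈ S ×ˢ S' :=
  ⟨hS.add_smul_sub_mem hξ.1 hη.1 (clamp_mem _), hS'.add_smul_sub_mem hξ.2 hη.2 (clamp_mem _)⟩

/-- The staircase path between two grid vertices of a chart runs along the lines of the grid. -/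
lemma isGridPathAt_stair {Q : Set ℝ} (hQ : IsGridSet Q) {c : FlatChart g} {ξ η : ℝ × ℝ}
    (hξ : ξ ∈ c.domain) (hη : η ∈ c.domain) (vξ : IsGridVertex Q (c.param ξ))
    (vη : IsGridVertex Q (c.param η)) {r : ℝ} (h0 : 0 < r) (h1 : r < 1) :
    IsGridPathAt Q (fun r => c.param (stair ξ η r)) r := by
  obtain ⟨x1, x2, x3⟩ := vξ.coordinates hQ hξ
  obtain ⟨y1, y2, y3⟩ := vη.coordinates hQ hη
  have hm : ∀ r, stair ξ η r ∈ c.domain := fun r => by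
    cases c <;> exact stair_mem (convex_Ioo _ _) (convex_Ioo _ _) hξ hη r
  have hd : ∀ T : ℝ × ℝ → ℝ × ℝ, (T = id ∨ ∃ a : Fin g × Fin 2, T = turn a) →
      ∃ ε : ℝ, ε ≠ 0 ∧ (∀ {u : ℝ → ℝ × ℝ} {v}, HasDerivAt u v r →
        HasDerivAt (fun τ => T (u τ)) (ε * v.1, ε * v.2) r) ∧ (∀ p, p.1 ∈ Q → (T p).1 ∈ Q) ∧
          ∀ p, p.2 ∈ Q → (T p).2 ∈ Q := by
    rintro T (rfl | ⟨a, rfl⟩)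
    · exact ⟨1, one_ne_zero, fun h => by simpa using h, fun _ h => h, fun _ h => h⟩
    · refine ⟨-1, by norm_num, fun {u v} h => ?_, fun _ h => hQ.turn_fst a h,
        fun _ h => hQ.turn_snd a h⟩
      change HasDerivAt (fun τ => ((2 * slot a.1 a.2 + 3, 2) : ℝ × ℝ) - u τ) _ r
      rw [show (-1 * v.1, -1 * v.2) = -v by ext <;> simp]
      exact h.const_sub _
  have hdd : ∀ T : ℝ × ℝ → ℝ × ℝ, (T = id ∨ ∃ a : Fin g × Fin 2, T = turn a) →
      ∀ p, T (T p) = p := by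
    rintro T (rfl | ⟨a, rfl⟩) p
    · rfl
    · exact turn_turn a p
  have hc := (continuous_stair ξ η).continuousAt (x := r)
  rcases lt_or_ge r (1 / 2) with hr | hr
  · left
    have e1 : ∀ᶠ τ in 𝓝 r, stair ξ η τ = (ξ.1, ξ.2 + 2 * τ * (η.2 - ξ.2)) := by
      filter_upwards [lt_mem_nhds h0, gt_mem_nhds hr] with τ k0 k1
      rw [stair, clamp_of_le (by linarith), clamp_of_mem (by linarith) (by linarith)]
      simp
    have d1 : HasDerivAt (stair ξ η) (0, 2 * (η.2 - ξ.2)) r := by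
      refine HasDerivAt.congr_of_eventuallyEq ?_ e1
      refine (hasDerivAt_const r ξ.1).prodMk ?_
      simpa using (((hasDerivAt_id r).const_mul 2).mul_const (η.2 - ξ.2)).const_add ξ.2
    have e2 := e1.self_of_nhds
    by_cases ht : (stair ξ η r).2 = 1
    · refine ⟨chartRep c (stair ξ η r), ?_, param_eq_mk_chartRep _ _, ?_, ?_⟩
      · rw [← rep_param (hm r)]; exact rep_inRect _
      · cases c with
        | cell => simp only [chartRep, e2]; exact x1
        | seam i k => rw [chartRep, if_pos ht.le, e2]; exact x1
      · intro h
        cases c with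
        | cell => exact absurd h (by simp only [chartRep]; linarith)
        | seam i k => simp only [chartRep, if_pos ht.le] at h; linarith
    · obtain ⟨T, hT, hT1, hT2⟩ := FlatChart.exists_cell (hm r) ht
      obtain ⟨ε, hε, hTd, q1, q2⟩ := hd T hT
      refine ⟨T (stair ξ η r), inRect_of_mem_cell hT1, hT2.self_of_nhds, q1 _ (by rw [e2]; exact x1),
        fun _ hn => ⟨ε * (2 * (η.2 - ξ.2)), fun τ => T (stair ξ η τ), ?_, ?_, hT1, hc.eventually hT2⟩⟩
      · refine mul_ne_zero hε fun h => hn (q2 _ ?_)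
        rw [e2]
        have : η.2 - ξ.2 = 0 := by linarith
        simpa [this] using x2
      · simpa using hTd d1
  · right
    have e3 : (stair ξ η r).2 = η.2 := by
      rw [stair, clamp_of_one_le (x := 2 * r) (by linarith)]; simp
    obtain ⟨T, hT, hT1, hT2⟩ := FlatChart.exists_cell (hm r) (by rwa [e3])
    obtain ⟨ε, hε, hTd, q1, q2⟩ := hd T hT
    refine ⟨T (stair ξ η r), hT1, hT2.self_of_nhds, q2 _ (by rwa [e3]), fun hn => ?_⟩
    have hn' : (stair ξ η r).1 ∉ Q := fun h => hn (q1 _ h)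
    have hr' : 1 / 2 < r := by
      refine lt_of_le_of_ne hr fun h => hn' ?_
      rw [stair, ← h, clamp_of_le (x := 2 * (1 / 2) - 1) (by norm_num)]; simpa using x1
    have e1 : ∀ᶠ τ in 𝓝 r, stair ξ η τ = (ξ.1 + (2 * τ - 1) * (η.1 - ξ.1), η.2) := by
      filter_upwards [lt_mem_nhds hr', gt_mem_nhds h1] with τ k0 k1
      rw [stair, clamp_of_mem (x := 2 * τ - 1) (by linarith) (by linarith),
        clamp_of_one_le (by linarith)]
      simp
    have d1 : HasDerivAt (stair ξ η) (2 * (η.1 - ξ.1), 0) r := by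
      refine HasDerivAt.congr_of_eventuallyEq ?_ e1
      refine HasDerivAt.prodMk ?_ (hasDerivAt_const r η.2)
      simpa using ((((hasDerivAt_id r).const_mul 2).sub_const 1).mul_const (η.1 - ξ.1)).const_add ξ.1
    refine ⟨ε * (2 * (η.1 - ξ.1)), fun τ => T (stair ξ η τ), ?_, ?_, hT1, hc.eventually hT2⟩
    · refine mul_ne_zero hε fun h => hn' ?_
      have : η.1 - ξ.1 = 0 := by linarith
      rw [e1.self_of_nhds]; simpa [this] using x1
    · simpa using hTd d1

/-- The loop that is composed of `N` paths. -/
def pieceFun {N : ℕ} (F : ZMod N → ℝ → Surface g) (y : ℝ) : Surface g := F (⌊y⌋ : ℤ) (y - ⌊y⌋)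

section Pieces

variable {N : ℕ} {F : ZMod N → ℝ → Surface g}

lemma pieceFun_eq (hF : ∀ k, F k 1 = F (k + 1) 0) (m : ℤ) {y : ℝ} (h0 : (m : ℝ) ≤ y)
    (h1 : y ≤ m + 1) : pieceFun F y = F m (y - m) := by
  rcases h1.lt_or_eq with h | rfl
  · rw [pieceFun, Int.floor_eq_iff.2 ⟨h0, h⟩]
  · have : ⌊(m : ℝ) + 1⌋ = m + 1 := by simp
    rw [pieceFun, this]
    push_cast
    rw [sub_self, add_sub_cancel_left, hF]

lemma continuous_pieceFun (hF : ∀ k, F k 1 = F (k + 1) 0) (hc : ∀ k, Continuous (F k)) :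
    Continuous (pieceFun F) := by
  have h1 : ∀ m : ℤ, ContinuousOn (pieceFun F) (Set.Icc (m : ℝ) (m + 1)) := fun m => by
    refine ContinuousOn.congr (f := fun y => F m (y - m)) ?_ fun y hy => pieceFun_eq hF m hy.1 hy.2
    exact ((hc m).comp (continuous_sub_right (m : ℝ))).continuousOn
  refine continuous_iff_continuousAt.2 fun y => ?_
  have h2 := Int.floor_le y
  have h3 := Int.lt_floor_add_one y
  rcases h2.eq_or_lt with h | h
  · have a := h1 (⌊y⌋ - 1) y ⟨by push_cast; linarith, by push_cast; linarith⟩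
    have b := h1 ⌊y⌋ y ⟨h2, h3.le⟩
    refine (a.union b).continuousAt (mem_of_superset (Ioo_mem_nhds (sub_one_lt y) (lt_add_one y)) ?_)
    rintro z ⟨z1, z2⟩
    rcases le_total z y with hz | hz
    · left; push_cast; constructor <;> linarith
    · right; constructor <;> linarith
  · exact (h1 ⌊y⌋).continuousAt (Icc_mem_nhds h h3)

lemma pieceFun_periodic [NeZero N] :
    Function.Periodic (fun r : ℝ => pieceFun F (N * r)) 1 := fun r => by
  have h : ⌊(N : ℝ) * (r + 1)⌋ = ⌊(N : ℝ) * r⌋ + N := by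
    rw [mul_add, mul_one]; exact Int.floor_add_natCast _ _
  simp only [pieceFun, h]
  push_cast
  rw [ZMod.natCast_self, add_zero]
  congr 1; ring

/-- The loop that is composed of `N` paths, each run through in time `1 / N`. -/
def pieceLoop [NeZero N] (hF : ∀ k, F k 1 = F (k + 1) 0) (hc : ∀ k, Continuous (F k)) :
    C(𝕋, Surface g) where
  toFun := (pieceFun_periodic (F := F)).lift
  continuous_toFun := by
    refine continuous_quot_lift _ ?_
    exact (continuous_pieceFun hF hc).comp (continuous_const_mul (N : ℝ))

lemma pieceLoop_coe [NeZero N] (hF : ∀ k, F k 1 = F (k + 1) 0) (hc : ∀ k, Continuous (F k))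
    (r : ℝ) : pieceLoop hF hc (r : 𝕋) = pieceFun F (N * r) := rfl

lemma isGridLoop_pieceLoop [NeZero N] {Q : Set ℝ} (hF : ∀ k, F k 1 = F (k + 1) 0)
    (hc : ∀ k, Continuous (F k)) (hv : ∀ k, IsGridVertex Q (F k 0))
    (hp : ∀ k r, 0 < r → r < 1 → IsGridPathAt Q (F k) r) : IsGridLoop Q (pieceLoop hF hc) := by
  intro s
  obtain ⟨r, rfl⟩ := QuotientAddGroup.mk_surjective s
  set m := ⌊(N : ℝ) * r⌋ with hm
  have h1 : (m : ℝ) ≤ N * r := Int.floor_le _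
  have h2 : (N : ℝ) * r < m + 1 := Int.lt_floor_add_one _
  have hN : (N : ℝ) ≠ 0 := NeZero.ne _
  have e := pieceLoop_coe hF hc r
  rw [pieceFun_eq hF m h1 h2.le] at e
  rcases h1.eq_or_lt with h | h
  · rw [← h, sub_self] at e
    obtain ⟨p, hp1, hp2, hp3, hp4⟩ := hv m
    exact .inl ⟨p, inRect_of_mem_cell hp1, e.trans hp2, hp3, fun _ hn => (hn hp4).elim⟩
  · have key : ∀ {v : ℝ × ℝ} {u : ℝ → ℝ × ℝ}, HasDerivAt u v (N * r - m) →
        u (N * r - m) ∈ (FlatChart.cell : FlatChart g).domain →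
        (∀ᶠ τ in 𝓝 ((N : ℝ) * r - m), F m τ = Surface.mk g (u τ)) →
        HasVelocity .cell (pieceLoop hF hc) (r : 𝕋) ((N : ℝ) • v) := by
      intro v u hu hd he
      have hl : HasDerivAt (fun τ : ℝ => (N : ℝ) * τ - m) N r := by
        simpa using ((hasDerivAt_id r).const_mul (N : ℝ)).sub_const (m : ℝ)
      refine ⟨r, fun τ => u (N * τ - m), rfl, hu.scomp r hl, hd, ?_⟩
      have hcl := hl.continuousAt
      have hcl' : ContinuousAt (fun τ : ℝ => (N : ℝ) * τ) r := by fun_prop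
      filter_upwards [hcl.eventually he, hcl'.eventually (Ioo_mem_nhds h h2)] with τ t1 t2
      rw [pieceLoop_coe, pieceFun_eq hF m t2.1.le t2.2.le, t1]
      rfl
    rcases hp m (N * r - m) (by linarith) (by linarith) with
      ⟨p, p1, p2, p3, p4⟩ | ⟨p, p1, p2, p3, p4⟩
    · refine .inl ⟨p, p1, e.trans p2, p3, fun q1 q2 => ?_⟩
      obtain ⟨e, u, he, hu, hd, hev⟩ := p4 q1 q2
      refine ⟨N * e, mul_ne_zero hN he, ?_⟩
      simpa using key hu hd hev
    · refine .inr ⟨p, p1, e.trans p2, p3, fun q1 => ?_⟩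
      obtain ⟨e, u, he, hu, hd, hev⟩ := p4 q1
      refine ⟨N * e, mul_ne_zero hN he, ?_⟩
      simpa using key hu hd hev

end Pieces

lemma exists_diagonal_nhds {α : C(𝕋, Surface g)} {U : Set C(𝕋, Surface g)}
    (hU : U ∈ 𝓝 α) : ∃ E : Set (Surface g × Surface g), (∀ x, E ∈ 𝓝 (x, x)) ∧
      ∀ α' : C(𝕋, Surface g), (∀ s, (α s, α' s) ∈ E) → α' ∈ U := by
  let _ : UniformSpace (Surface g) := uniformSpaceOfCompactR1
  obtain ⟨E, hE, h⟩ := (nhds_basis_uniformity'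
    (ContinuousMap.hasBasis_compactConvergenceUniformity_of_compact (α := 𝕋)
      (β := Surface g))).mem_iff.1 hU
  refine ⟨E, fun x => ?_, fun α' h' => h h'⟩
  rw [compactSpace_uniformity] at hE
  exact mem_iSup.1 hE x

/-- Loops in the interior are approximated by staircase loops between grid vertices. -/
lemma exists_isGridLoop {Q : Set ℝ} (hQ : IsGridSet Q) {α : C(𝕋, Surface g)}
    (hα : ∀ s, IsInterior (α s)) {U : Set C(𝕋, Surface g)} (hU : U ∈ 𝓝 α) :
    ∃ α' ∈ U, IsGridLoop Q α' := by
  obtain ⟨E, hE, hEU⟩ := exists_diagonal_nhds hU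
  -- small chart neighbourhoods of the points of the loop
  have h1 : ∀ s, ∃ (c : FlatChart g) (ξ : ℝ × ℝ) (ρ : ℝ), 0 < ρ ∧ c.param ξ = α s ∧
      Metric.ball ξ ρ ⊆ c.domain ∧
      ∀ y ∈ c.param '' Metric.ball ξ ρ, ∀ z ∈ c.param '' Metric.ball ξ ρ, (y, z) ∈ E := by
    intro s
    obtain ⟨c, ξ, hξ, e⟩ := hα s
    have h := hE (α s)
    rw [nhds_prod_eq, ← e, ← c.map_nhds_param hξ] at h
    obtain ⟨A, hA, hAE⟩ := mem_prod_same_iff.1 h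
    obtain ⟨ρ, hρ, hb⟩ := Metric.mem_nhds_iff.1
      (inter_mem (mem_map.1 hA) (c.isOpen_domain.mem_nhds hξ))
    refine ⟨c, ξ, ρ, hρ, e, fun x hx => (hb hx).2, ?_⟩
    rintro _ ⟨y, hy, rfl⟩ _ ⟨z, hz, rfl⟩
    exact hAE ⟨(hb hy).1, (hb hz).1⟩
  choose c ξ ρ hρ e hb hbE using h1
  set O : 𝕋 → Set (Surface g) := fun s => (c s).param '' Metric.ball (ξ s) (ρ s) with hO
  have hOo : ∀ s, IsOpen (O s) := fun s => isOpen_iff_mem_nhds.2 (by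
    rintro _ ⟨x, hx, rfl⟩
    exact FlatChart.image_param_mem_nhds Metric.isOpen_ball (hb s) hx)
  obtain ⟨δ, hδ, hL⟩ := lebesgue_number_lemma_of_metric (s := (Set.univ : Set 𝕋))
    (c := fun s => α ⁻¹' O s) isCompact_univ (fun s => (hOo s).preimage α.continuous)
    fun s _ => Set.mem_iUnion.2 ⟨s, ξ s, Metric.mem_ball_self (hρ s), e s⟩
  obtain ⟨n, hn⟩ := (tendsto_one_div_add_atTop_nhds_zero_nat.eventually (gt_mem_nhds hδ)).exists
  choose q hq using fun k : ZMod (n + 1) => hL (ZMod.toAddCircle k) trivial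
  have hd := dist_toAddCircle_succ n
  have h2 : ∀ k : ZMod (n + 1), ∃ y ∈ O (q k) ∩ O (q (k - 1)), IsGridVertex Q y := by
    refine fun k => exists_gridVertex hQ (x := α (ZMod.toAddCircle k))
      (((hOo _).inter (hOo _)).mem_nhds ⟨hq k (Metric.mem_ball_self hδ), hq (k - 1) ?_⟩)
    rw [Metric.mem_ball, dist_comm]
    have := hd (k - 1)
    rw [sub_add_cancel] at this
    exact this.trans_lt hn
  choose y hy hyv using h2
  have h3 : ∀ k : ZMod (n + 1), ∃ f : ℝ → Surface g, Continuous f ∧ f 0 = y k ∧ f 1 = y (k + 1) ∧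
      (∀ r, f r ∈ O (q k)) ∧ ∀ r, 0 < r → r < 1 → IsGridPathAt Q f r := by
    intro k
    obtain ⟨a, ha, ea⟩ := (hy k).1
    have := (hy (k + 1)).2
    rw [add_sub_cancel_right] at this
    obtain ⟨b, hb', eb⟩ := this
    have hm : ∀ r, stair a b r ∈ Metric.ball (ξ (q k)) (ρ (q k)) := fun r => by
      have h : Metric.ball (ξ (q k)) (ρ (q k)) =
        Metric.ball (ξ (q k)).1 (ρ (q k)) ×ˢ Metric.ball (ξ (q k)).2 (ρ (q k)) :=
          (ball_prod_same _ _ _).symm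
      rw [h] at ha hb' ⊢
      exact stair_mem (convex_ball _ _) (convex_ball _ _) ha hb' r
    refine ⟨fun r => (c (q k)).param (stair a b r), ?_, ?_, ?_, fun r => ⟨_, hm r, rfl⟩, ?_⟩
    · exact (c (q k)).continuousOn_param.comp_continuous (continuous_stair a b)
        fun r => hb _ (hm r)
    · simp only [stair_zero]; exact ea
    · simp only [stair_one]; exact eb
    · intro r r0 r1
      exact isGridPathAt_stair hQ (hb _ ha) (hb _ hb') (ea ▸ hyv k) (eb ▸ hyv (k + 1)) r0 r1
  choose F hFc hF0 hF1 hFm hFg using h3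
  have hF : ∀ k, F k 1 = F (k + 1) 0 := fun k => (hF1 k).trans (hF0 _).symm
  refine ⟨pieceLoop hF hFc, hEU _ fun s => ?_,
    isGridLoop_pieceLoop hF hFc (fun k => by rw [hF0]; exact hyv k) hFg⟩
  obtain ⟨r, rfl⟩ := QuotientAddGroup.mk_surjective s
  rw [pieceLoop_coe]
  refine hbE (q ((⌊((n + 1 : ℕ) : ℝ) * r⌋ : ℤ) : ZMod (n + 1))) _ (hq _ ?_) _ (hFm _ _)
  rw [Metric.mem_ball, toAddCircle_eq_div, dist_eq_norm, ← AddCircle.coe_sub, UnitAddCircle.norm_eq]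
  refine (round_le _ 0).trans_lt (lt_of_le_of_lt ?_ hn)
  have hp : (0 : ℝ) < n + 1 := by positivity
  have k1 := Int.floor_le (((n + 1 : ℕ) : ℝ) * r)
  have k2 := Int.lt_floor_add_one (((n + 1 : ℕ) : ℝ) * r)
  push_cast at k1 k2 ⊢
  have k3 : r - (⌊((n : ℝ) + 1) * r⌋ : ℝ) / (n + 1) =
      (((n : ℝ) + 1) * r - ⌊((n : ℝ) + 1) * r⌋) / (n + 1) := by field_simp
  rw [sub_zero, k3, abs_of_nonneg (div_nonneg (by linarith) hp.le)]
  exact div_le_div_of_nonneg_right (by linarith) hp.le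

lemma loopClass_eq_of_pushIn (α : C(𝕋, Surface g)) (t : I) :
    loopClass (⟨fun s => pushIn g (α s, t), by fun_prop⟩ : C(𝕋, Surface g)) =
      loopClass α := by
  refine (loopClass_eq_of_homotopic ⟨⟨⟨fun z => pushIn g (α z.2, z.1 * t), by fun_prop⟩,
    fun s => ?_, fun s => ?_⟩⟩).symm
  · simp [pushIn_zero]
  · simp

lemma exists_interior_mem {α : C(𝕋, Surface g)} {U : Set C(𝕋, Surface g)}
    (hU : U ∈ 𝓝 α) : ∃ α' ∈ interior U, (∀ s, IsInterior (α' s)) ∧ loopClass α' = loopClass α := by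
  have hc : Continuous fun t : I =>
      (⟨fun s => pushIn g (α s, t), by fun_prop⟩ : C(𝕋, Surface g)) :=
    ContinuousMap.continuous_of_continuous_uncurry _ (by
      change Continuous fun z : I × 𝕋 => pushIn g (α z.2, z.1)
      fun_prop)
  have h0 : (⟨fun s => pushIn g (α s, 0), by fun_prop⟩ : C(𝕋, Surface g)) = α := by
    ext s; exact pushIn_zero _
  have h1 : ∀ᶠ t : I in 𝓝[>] 0,
      (⟨fun s => pushIn g (α s, t), by fun_prop⟩ : C(𝕋, Surface g)) ∈ interior U := by
    refine nhdsWithin_le_nhds ((hc.tendsto 0).eventually ?_)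
    rw [h0]
    exact isOpen_interior.mem_nhds (mem_interior_iff_mem_nhds.2 hU)
  have : (𝓝[>] (0 : I)).NeBot := nhdsGT_neBot_of_exists_gt ⟨1, zero_lt_one⟩
  obtain ⟨t, ht, ht0⟩ := (h1.and self_mem_nhdsWithin).exists
  exact ⟨_, ht, fun s => isInterior_pushIn _ ht0, loopClass_eq_of_pushIn α t⟩

/-- Any two loops can be made transverse by arbitrarily small perturbations that do not change their
homology classes. -/
lemma exists_transverse {α β : C(𝕋, Surface g)} {U V : Set C(𝕋, Surface g)}
    (hU : U ∈ 𝓝 α) (hV : V ∈ 𝓝 β) : ∃ α' ∈ U, ∃ β' ∈ V, Transverse α' β' ∧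
      loopClass α' = loopClass α ∧ loopClass β' = loopClass β := by
  have key : ∀ {Q : Set ℝ}, IsGridSet Q → ∀ {α : C(𝕋, Surface g)} {U}, U ∈ 𝓝 α →
      ∃ α' ∈ U, IsGridLoop Q α' ∧ loopClass α' = loopClass α := by
    intro Q hQ α U hU
    obtain ⟨α₁, h1, h2, h3⟩ := exists_interior_mem hU
    obtain ⟨α', h4, h5⟩ := exists_isGridLoop hQ h2
      (inter_mem (isOpen_interior.mem_nhds h1) (eventually_homotopic h2))
    exact ⟨α', interior_subset h4.1, h5, (loopClass_eq_of_homotopic h4.2).symm.trans h3⟩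
  obtain ⟨α', a1, a2, a3⟩ := key isGridSet_rat hU
  obtain ⟨β', b1, b2, b3⟩ := key isGridSet_irrational hV
  refine ⟨α', a1, β', b1, a2.transverse isGridSet_rat isGridSet_irrational ?_ b2, a3, b3⟩
  rintro _ ⟨q, rfl⟩ h
  exact h ⟨q, rfl⟩

end

section

open Filter

/-! ### Overcrossing numbers of disjoint curves -/

variable {g : ℕ}

/-- Two curves without common points. -/
def DisjointCurves (K L : C(𝕋, Cylinder g)) : Prop := ∀ s t, K s ≠ L t

lemma DisjointCurves.symm {K L : C(𝕋, Cylinder g)} (h : DisjointCurves K L) :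
    DisjointCurves L K := fun s t e => h t s e.symm

lemma DisjointCurves.eventually {K L : C(𝕋, Cylinder g)} (h : DisjointCurves K L) :
    ∀ᶠ P in 𝓝 (K, L), DisjointCurves P.1 P.2 := by
  have hc : Continuous fun z : (C(𝕋, Cylinder g) × C(𝕋, Cylinder g)) ×
    (𝕋 × 𝕋) => (z.1.1 z.2.1, z.1.2 z.2.2) := by fun_prop
  have h1 := isCompact_univ.eventually_forall_of_forall_eventually (x₀ := (K, L))
    (P := fun P (z : 𝕋 × 𝕋) => P.1 z.1 ≠ P.2 z.2) (fun z _ => by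
      have ho : IsOpen {p : Cylinder g × Cylinder g | p.1 ≠ p.2} := isOpen_ne_fun continuous_fst continuous_snd
      exact (hc.tendsto ((K, L), z)).eventually (ho.mem_nhds (h z.1 z.2)))
  exact h1.mono fun P hP s t => hP (s, t) trivial

lemma OverTransverse.disjointCurves {K L : C(𝕋, Cylinder g)}
    (h : OverTransverse K L) : DisjointCurves K L := by
  intro s t e
  have e2 : (K s).2 = (L t).2 := congrArg Prod.snd e
  rcases h (s, t) (congrArg Prod.fst e) with h | ⟨h, -⟩
  · exact h.ne e2
  · exact h.ne e2.symm

/-- The height of a curve in the cylinder. -/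
def heightMap (K : C(𝕋, Cylinder g)) : C(𝕋, I) := ContinuousMap.snd.comp K

lemma overTransverse_of_transverse_of_disjoint {K L : C(𝕋, Cylinder g)}
    (h : Transverse ((proj g).comp K) ((proj g).comp L)) (hd : DisjointCurves K L) :
    OverTransverse K L := by
  intro z hz
  rcases lt_trichotomy (K z.1).2 (L z.2).2 with h1 | h1 | h1
  · exact .inl h1
  · exact (hd z.1 z.2 (Prod.ext hz h1)).elim
  · exact .inr ⟨h1, h z hz⟩

/-- Move the projections to general position, and keep the heights. -/
lemma DisjointCurves.exists_transverse_mem {K L : C(𝕋, Cylinder g)}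
    (h : DisjointCurves K L) {W : Set (C(𝕋, Cylinder g) × C(𝕋, Cylinder g))}
    (hW : W ∈ 𝓝 (K, L)) : ∃ P ∈ W, DisjointCurves P.1 P.2 ∧
      Transverse ((proj g).comp P.1) ((proj g).comp P.2) ∧
      loopClass ((proj g).comp P.1) = loopClass ((proj g).comp K) ∧
      loopClass ((proj g).comp P.2) = loopClass ((proj g).comp L) := by
  have hc : Continuous fun z : C(𝕋, Surface g) × C(𝕋, Surface g) =>
      (z.1.prodMk (heightMap K), z.2.prodMk (heightMap L)) := by
    refine Continuous.prodMk ?_ ?_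
    · exact ContinuousMap.continuous_of_continuous_uncurry _ (by
        change Continuous fun w : (C(𝕋, Surface g) × C(𝕋, Surface g)) ×
          𝕋 => (w.1.1 w.2, heightMap K w.2)
        fun_prop)
    · exact ContinuousMap.continuous_of_continuous_uncurry _ (by
        change Continuous fun w : (C(𝕋, Surface g) × C(𝕋, Surface g)) ×
          𝕋 => (w.1.2 w.2, heightMap L w.2)
        fun_prop)
  have h1 := (hc.tendsto ((proj g).comp K, (proj g).comp L)) (inter_mem hW h.eventually)
  rw [mem_map, nhds_prod_eq] at h1
  obtain ⟨U, hU, V, hV, hUV⟩ := mem_prod_iff.1 h1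
  obtain ⟨α, hα, β, hβ, ht, e1, e2⟩ := exists_transverse hU hV
  have h2 := hUV (show (α, β) ∈ U ×ˢ V from ⟨hα, hβ⟩)
  exact ⟨_, h2.1, h2.2, ht, e1, e2⟩

lemma HasOvercrossingNumber.unique {K L : C(𝕋, Cylinder g)} {n n' : ℤ}
    (h : HasOvercrossingNumber K L n) (h' : HasOvercrossingNumber K L n') : n = n' := by
  obtain ⟨P, hP, h1, h2⟩ := (h.1.and_eventually (h.2.and h'.2)).exists
  exact (h1 hP).symm.trans (h2 hP)

lemma DisjointCurves.frequently_overTransverse {K L : C(𝕋, Cylinder g)}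
    (h : DisjointCurves K L) : ∃ᶠ P in 𝓝 (K, L), OverTransverse P.1 P.2 := by
  refine frequently_iff.2 fun {W} hW => ?_
  obtain ⟨P, hP, hd, ht, -, -⟩ := h.exists_transverse_mem hW
  exact ⟨P, hP, overTransverse_of_transverse_of_disjoint ht hd⟩

lemma DisjointCurves.exists_hasOvercrossingNumber {K L : C(𝕋, Cylinder g)}
    (h : DisjointCurves K L) : ∃ n, HasOvercrossingNumber K L n := by
  obtain ⟨U, hU, hUn⟩ := exists_nhds_loopIndex_eq h
  obtain ⟨P₀, h₀, hP₀⟩ := (h.frequently_overTransverse.and_eventually hU).exists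
  refine ⟨overcrossingSum P₀.1 P₀.2, h.frequently_overTransverse, ?_⟩
  filter_upwards [hU] with P hP hT
  obtain ⟨n, h1, h2, h3⟩ :=
    ((hUn P hP P₀ hP₀).and (hT.eventually_loopIndex_eq.and h₀.eventually_loopIndex_eq)).exists
  rw [← h2, h1, h3]

lemma OverTransverse.hasOvercrossingNumber {K L : C(𝕋, Cylinder g)}
    (h : OverTransverse K L) : HasOvercrossingNumber K L (overcrossingSum K L) := by
  obtain ⟨n, hn⟩ := h.disjointCurves.exists_hasOvercrossingNumber
  rwa [hn.2.self_of_nhds h]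

lemma HasOvercrossingNumber.eventually {K L : C(𝕋, Cylinder g)} {n : ℤ}
    (h : HasOvercrossingNumber K L n) (hd : DisjointCurves K L) :
    ∀ᶠ P in 𝓝 (K, L), HasOvercrossingNumber P.1 P.2 n := by
  filter_upwards [eventually_eventually_nhds.2 h.2, hd.eventually] with P h1 h2
  exact ⟨h2.frequently_overTransverse, h1⟩

/-- The overcrossing number does not change while the curves move and stay disjoint. -/
lemma HasOvercrossingNumber.of_isotopy {K L : I → C(𝕋, Cylinder g)}
    (hK : Continuous fun z : I × 𝕋 => K z.1 z.2)
    (hL : Continuous fun z : I × 𝕋 => L z.1 z.2)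
    (hd : ∀ t, DisjointCurves (K t) (L t)) {n : ℤ} (h : HasOvercrossingNumber (K 0) (L 0) n) :
    HasOvercrossingNumber (K 1) (L 1) n := by
  have hc : Continuous fun t => (K t, L t) :=
    (ContinuousMap.continuous_of_continuous_uncurry _ hK).prodMk
      (ContinuousMap.continuous_of_continuous_uncurry _ hL)
  choose N hN using fun t => (hd t).exists_hasOvercrossingNumber
  have hl : IsLocallyConstant N := (IsLocallyConstant.iff_eventually_eq N).2 fun t => by
    filter_upwards [(hc.tendsto t).eventually ((hN t).eventually (hd t))] with t' ht'
    exact (hN t').unique ht'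
  have e := hl.apply_eq_of_isPreconnected isPreconnected_univ (Set.mem_univ 0) (Set.mem_univ 1)
  rw [h.unique (hN 0), e]
  exact hN 1

lemma CrossesWithSign.swap {ε : ℤ} {α β : C(𝕋, Surface g)}
    {z : 𝕋 × 𝕋} (h : CrossesWithSign ε α β z) :
    CrossesWithSign (-ε) β α z.swap := by
  obtain ⟨e, c, v, w, hv, hw, h⟩ := h
  exact ⟨e.symm, c, w, v, hw, hv, by push_cast; linarith⟩

lemma crossesWithSign_swap_iff {ε : ℤ} {α β : C(𝕋, Surface g)}
    {z : 𝕋 × 𝕋} :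
    CrossesWithSign ε β α z.swap ↔ CrossesWithSign (-ε) α β z :=
  ⟨fun h => h.swap, fun h => by simpa using h.swap⟩

lemma ncard_crossesWithSign_swap (ε : ℤ) (α β : C(𝕋, Surface g)) :
    Set.ncard {z | CrossesWithSign ε β α z} = Set.ncard {z | CrossesWithSign (-ε) α β z} := by
  have : {z | CrossesWithSign (-ε) α β z} = Prod.swap ⁻¹' {z | CrossesWithSign ε β α z} := by
    ext z; exact crossesWithSign_swap_iff.symm
  rw [this, Set.ncard_preimage_of_injective_subset_range Prod.swap_injective]
  intro z _; exact ⟨z.swap, z.swap_swap⟩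

lemma crossingSum_swap (α β : C(𝕋, Surface g)) :
    crossingSum β α = - crossingSum α β := by
  simp only [crossingSum, ncard_crossesWithSign_swap _ α β, neg_neg]; ring

/-- Every crossing is an overcrossing of `K` over `L` or, with the opposite sign, of `L` over `K`. -/
lemma ncard_crossesWithSign {K L : C(𝕋, Cylinder g)} (h : OverTransverse K L)
    (h' : OverTransverse L K) (ε : ℤ) :
    Set.ncard {z | CrossesWithSign ε ((proj g).comp K) ((proj g).comp L) z} =
      Set.ncard {z | OvercrossesWithSign ε K L z} + Set.ncard {z | OvercrossesWithSign (-ε) L K z} := by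
  have e : {z | CrossesWithSign ε ((proj g).comp K) ((proj g).comp L) z} =
      {z | OvercrossesWithSign ε K L z} ∪ Prod.swap ⁻¹' {z | OvercrossesWithSign (-ε) L K z} := by
    ext z
    constructor
    · intro hz
      rcases h z hz.1 with h1 | ⟨h1, -⟩
      · exact .inr ⟨hz.swap, h1⟩
      · exact .inl ⟨hz, h1⟩
    · rintro (hz | hz)
      · exact hz.1
      · have := hz.1.swap
        simpa using this
  have f1 : Set.Finite {z | OvercrossesWithSign ε K L z} := by
    exact h.finite_overSet.subset fun z hz => ⟨hz.1.1, hz.2⟩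
  have f2 : Set.Finite (Prod.swap ⁻¹' {z | OvercrossesWithSign (-ε) L K z}) := by
    exact Set.Finite.preimage Prod.swap_injective.injOn
      (h'.finite_overSet.subset fun z hz => ⟨hz.1.1, hz.2⟩)
  rw [e, Set.ncard_union_eq ?_ f1 f2, Set.ncard_preimage_of_injective_subset_range Prod.swap_injective]
  · intro z _; exact ⟨z.swap, z.swap_swap⟩
  · refine Set.disjoint_left.2 fun z h1 h2 => ?_
    exact lt_asymm h1.2 h2.2

lemma HasOvercrossingNumber.sub_eq {K L : C(𝕋, Cylinder g)} {n m : ℤ}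
    (h : HasOvercrossingNumber K L n) (h' : HasOvercrossingNumber L K m)
    (hd : DisjointCurves K L) : n - m =
      intersectionForm g (loopClass ((proj g).comp K)) (loopClass ((proj g).comp L)) := by
  have h1 : ∀ᶠ P in 𝓝 (K, L), OverTransverse P.2 P.1 → overcrossingSum P.2 P.1 = m :=
    (continuous_swap.tendsto (K, L)).eventually h'.2
  obtain ⟨P, ⟨hP, hP'⟩, hPd, ht, e1, e2⟩ := hd.exists_transverse_mem (inter_mem h.2 h1)
  have t1 := overTransverse_of_transverse_of_disjoint ht hPd
  have ht' : Transverse ((proj g).comp P.2) ((proj g).comp P.1) := fun z hz => by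
    rcases ht z.swap hz.symm with h | h
    · right; simpa using h.swap
    · left; simpa using h.swap
  have t2 := overTransverse_of_transverse_of_disjoint ht' hPd.symm
  rw [← e1, ← e2, isIntersectionForm g _ _ ht, ← hP t1, ← hP' t2, crossingSum,
    ncard_crossesWithSign t1 t2, ncard_crossesWithSign t1 t2]
  simp only [overcrossingSum, neg_neg]
  push_cast; ring

lemma intersectionForm_self (α : C(𝕋, Surface g)) :
    intersectionForm g (loopClass α) (loopClass α) = 0 := by
  obtain ⟨α', -, β', -, ht, e1, e2⟩ := exists_transverse (α := α) (β := α) univ_mem univ_mem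
  have ht' : Transverse β' α' := fun z hz => by
    rcases ht z.swap hz.symm with h | h
    · right; simpa using h.swap
    · left; simpa using h.swap
  have h1 := isIntersectionForm g _ _ ht
  have h2 := isIntersectionForm g _ _ ht'
  rw [e1, e2] at h1 h2
  rw [crossingSum_swap] at h2
  omega

/-! ### The form induced by a framed link -/

namespace FramedLink

variable {ι : Type}

lemma ribbon_ne (b : FramedLink g ι) {i j : ι} {z w : 𝕋 × I} (h : (i, z) ≠ (j, w)) :
    b.ribbon i z ≠ b.ribbon j w := fun e => h (b.injective e)

lemma disjointCurves (b : FramedLink g ι) (i j : ι) :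
    DisjointCurves (b.core i) (b.pushoff j) := fun _ _ =>
  b.ribbon_ne fun h => zero_ne_one (congrArg (fun p : ι × (𝕋 × I) => p.2.2) h)

lemma projClass_eq (b : FramedLink g ι) (i : ι) :
    b.projClass i = H1.map (proj g) (loopClass (b.core i)) := (H1.map_loopClass _ _).symm

lemma loopClass_pushoff (b : FramedLink g ι) (i : ι) :
    loopClass ((proj g).comp (b.pushoff i)) = b.projClass i := by
  refine (loopClass_eq_of_homotopic ⟨⟨⟨fun z => (b.ribbon i (z.2, z.1)).1, by fun_prop⟩,
    fun s => rfl, fun s => rfl⟩⟩).symm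

lemma Isotopic.projClass_eq {b b' : FramedLink g ι} (h : b.Isotopic b') (i : ι) :
    b'.projClass i = b.projClass i := by
  obtain ⟨F, rfl, rfl, hF⟩ := h
  have hc : Continuous fun z : I × 𝕋 => ((F z.1).ribbon i (z.2, 0)).1 :=
    continuous_fst.comp ((hF i).comp (by fun_prop : Continuous fun z : I × 𝕋 =>
      (z.1, (z.2, (0 : I)))))
  exact (loopClass_eq_of_homotopic ⟨⟨⟨_, hc⟩, fun s => rfl, fun s => rfl⟩⟩).symm

lemma Isotopic.hasOvercrossingNumber {b b' : FramedLink g ι} (h : b.Isotopic b') {i j : ι} {n : ℤ}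
    (hn : HasOvercrossingNumber (b.core i) (b.pushoff j) n) :
    HasOvercrossingNumber (b'.core i) (b'.pushoff j) n := by
  obtain ⟨F, rfl, rfl, hF⟩ := h
  refine hn.of_isotopy (K := fun t => (F t).core i) (L := fun t => (F t).pushoff j) ?_ ?_
    fun t => (F t).disjointCurves i j
  · exact (hF i).comp (by fun_prop : Continuous fun z : I × 𝕋 => (z.1, (z.2, (0 : I))))
  · exact (hF j).comp (by fun_prop : Continuous fun z : I × 𝕋 => (z.1, (z.2, (1 : I))))

lemma hasOvercrossingNumber_swap (b : FramedLink g ι) {i j : ι} (hij : i ≠ j) {n : ℤ}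
    (hn : HasOvercrossingNumber (b.core j) (b.pushoff i) n) :
    HasOvercrossingNumber (b.pushoff j) (b.core i) n := by
  have h := HasOvercrossingNumber.of_isotopy
    (K := fun t => (b.ribbon j).comp ⟨fun s => (s, t), by fun_prop⟩)
    (L := fun t => (b.ribbon i).comp ⟨fun s => (s, σ t), by fun_prop⟩) (n := n)
    (by change Continuous fun z : I × 𝕋 => b.ribbon j (z.2, z.1); fun_prop)
    (by change Continuous fun z : I × 𝕋 => b.ribbon i (z.2, σ z.1); fun_prop)
    (fun t s s' => b.ribbon_ne fun h => hij (congrArg Prod.fst h).symm)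
    (by simp only [unitInterval.symm_zero]; exact hn)
  simp only [unitInterval.symm_one] at h
  exact h

/-- In a generic link, a component that meets the vertical line through a point of the link lies
above or below the whole fibre of the ribbon. -/
lemma IsGeneric.pushoff_lt {b : FramedLink g ι} (hb : b.IsGeneric) {i j : ι} {s t : 𝕋}
    (hne : (i, s) ≠ (j, t)) (h : (b.core i s).1 = (b.core j t).1)
    (hlt : (b.core j t).2 ≤ (b.core i s).2) : (b.pushoff j t).2 < (b.core i s).2 := by
  by_contra! hc
  have hcont : Continuous fun τ : I => (b.ribbon j (t, τ)).2 := by fun_prop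
  obtain ⟨τ, -, hτ⟩ := intermediate_value_Icc (zero_le_one : (0 : I) ≤ 1) hcont.continuousOn
    (show (b.core i s).2 ∈ Set.Icc ((b.ribbon j (t, 0)).2) ((b.ribbon j (t, 1)).2) from ⟨hlt, hc⟩)
  refine b.ribbon_ne (i := i) (j := j) (z := (s, 0)) (w := (t, τ)) (fun e => hne ?_)
    (Prod.ext (h.trans (hb.vertical j t τ).symm) hτ.symm)
  exact Prod.ext (congrArg (fun p : ι × (𝕋 × I) => p.1) e)
    (congrArg (fun p : ι × (𝕋 × I) => p.2.1) e)

lemma IsGeneric.proj_pushoff {b : FramedLink g ι} (hb : b.IsGeneric) (j : ι) :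
    (proj g).comp (b.pushoff j) = (proj g).comp (b.core j) :=
  ContinuousMap.ext fun t => hb.vertical j t 1

lemma IsGeneric.overTransverse {b : FramedLink g ι} (hb : b.IsGeneric) (i j : ι) :
    OverTransverse (b.core i) (b.pushoff j) := by
  rintro ⟨s, t⟩ hz
  by_cases hne : (i, s) = (j, t)
  · obtain ⟨rfl, rfl⟩ := Prod.mk.inj hne
    exact .inl (hb.upward i s)
  · have hz' : (b.core i s).1 = (b.core j t).1 := hz.trans (hb.vertical j t 1)
    rcases lt_or_ge (b.core i s).2 (b.core j t).2 with h | h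
    · exact .inl (h.trans (hb.upward j t))
    · refine .inr ⟨hb.pushoff_lt hne hz' h, ?_⟩
      rw [hb.proj_pushoff]
      exact hb.transverse i j s t hne hz'

lemma IsGeneric.overcrossingSum_pushoff {b : FramedLink g ι} (hb : b.IsGeneric) (i j : ι) :
    overcrossingSum (b.core i) (b.pushoff j) = overcrossingSum (b.core i) (b.core j) := by
  have key : ∀ ε z, OvercrossesWithSign ε (b.core i) (b.pushoff j) z ↔
      OvercrossesWithSign ε (b.core i) (b.core j) z := by
    rintro ε ⟨s, t⟩
    simp only [OvercrossesWithSign, hb.proj_pushoff]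
    refine and_congr_right fun h => ⟨fun h' => (hb.upward j t).trans h', fun h' => ?_⟩
    refine hb.pushoff_lt (fun e => ?_) h.1 h'.le
    obtain ⟨rfl, rfl⟩ := Prod.mk.inj e
    exact lt_irrefl _ h'
  simp only [overcrossingSum, key]

/-- The basis of `H₁` given by the projections of the components of a link. -/
def IsBasisLink.basis {b : FramedLink g ι} (hb : b.IsBasisLink) :
    Module.Basis ι ℤ (H1 (Surface g)) :=
  (Module.Basis.mk hb.1 hb.2.ge).map (LinearEquiv.ofBijective _ (H1.map_proj_bijective g))

lemma IsBasisLink.basis_apply {b : FramedLink g ι} (hb : b.IsBasisLink) (i : ι) :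
    hb.basis i = b.projClass i := by
  rw [projClass_eq]
  simp [basis]

lemma IsBasisLink.form_ext {b : FramedLink g ι} (hb : b.IsBasisLink)
    {Φ Φ' : H1 (Surface g) →ₗ[ℤ] H1 (Surface g) →ₗ[ℤ] ℤ}
    (h : ∀ i j, Φ (b.projClass i) (b.projClass j) = Φ' (b.projClass i) (b.projClass j)) :
    Φ = Φ' :=
  hb.basis.ext fun i => hb.basis.ext fun j => by simpa only [hb.basis_apply] using h i j

lemma IsBasisLink.exists_induces {b : FramedLink g ι} (hb : b.IsBasisLink) :
    ∃ Φ, b.Induces Φ := by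
  choose n hn using fun i j => (b.disjointCurves i j).exists_hasOvercrossingNumber
  refine ⟨hb.basis.constr ℤ fun i => hb.basis.constr ℤ fun j => n i j, fun i j => ?_⟩
  rw [← hb.basis_apply, ← hb.basis_apply, hb.basis.constr_basis, hb.basis.constr_basis]
  exact hn i j

lemma Induces.unique {b : FramedLink g ι} (hb : b.IsBasisLink)
    {Φ Φ' : H1 (Surface g) →ₗ[ℤ] H1 (Surface g) →ₗ[ℤ] ℤ} (h : b.Induces Φ) (h' : b.Induces Φ') :
    Φ' = Φ := hb.form_ext fun i j => (h' i j).unique (h i j)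

lemma Induces.eq_overcrossingSum {b b' : FramedLink g ι}
    {Φ : H1 (Surface g) →ₗ[ℤ] H1 (Surface g) →ₗ[ℤ] ℤ} (h : b.Induces Φ) (hi : b.Isotopic b')
    (hg : b'.IsGeneric) (i j : ι) : Φ (b'.projClass i) (b'.projClass j) =
      overcrossingSum (b'.core i) (b'.core j) := by
  rw [hi.projClass_eq, hi.projClass_eq, ← hg.overcrossingSum_pushoff]
  exact (hi.hasOvercrossingNumber (h i j)).unique (hg.overTransverse i j).hasOvercrossingNumber

lemma Induces.sub_flip {b : FramedLink g ι} (hb : b.IsBasisLink)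
    {Φ : H1 (Surface g) →ₗ[ℤ] H1 (Surface g) →ₗ[ℤ] ℤ} (h : b.Induces Φ) (x y : H1 (Surface g)) :
    Φ x y - Φ y x = intersectionForm g x y := by
  have e : Φ - Φ.flip = intersectionForm g := hb.form_ext fun i j => by
    simp only [LinearMap.sub_apply, LinearMap.flip_apply]
    rcases eq_or_ne i j with rfl | hij
    · rw [sub_self]; exact (intersectionForm_self _).symm
    · rw [(h i j).sub_eq (b.hasOvercrossingNumber_swap hij (h j i)) (b.disjointCurves i j),
        b.loopClass_pushoff]
      rfl
  rw [← e]; rfl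

end FramedLink

end

section

/-! ### Graphs on arbitrary finite vertex sets and their invariants -/

/-- A graph as in `UniTriGraph`, whose set of trivalent vertices is an arbitrary type `V`. -/
structure TriGraph (V H : Type) where
  edge : V × Fin 3 → V × Fin 3
  edge_edge : Function.Involutive edge
  colour : V × Fin 3 → H

namespace TriGraph

variable {V W H : Type}

/-- Move the graph along a bijection of the half-edges. -/
def map (τ : V × Fin 3 ≃ W × Fin 3) (G : TriGraph V H) : TriGraph W H where
  edge := fun h => τ (G.edge (τ.symm h))
  edge_edge := fun h => by simp [G.edge_edge (τ.symm h)]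
  colour := fun h => G.colour (τ.symm h)

lemma map_map {X : Type} (G : TriGraph V H) (τ : V × Fin 3 ≃ W × Fin 3)
    (τ' : W × Fin 3 ≃ X × Fin 3) : (G.map τ).map τ' = G.map (τ.trans τ') := rfl

/-- The graph on the numbered vertices. -/
def toUni {n : ℕ} (G : TriGraph (Fin n) H) : UniTriGraph H where
  order := n
  edge := G.edge
  edge_edge := G.edge_edge
  colour := G.colour

end TriGraph

/-- The graph with numbered vertices as a graph on the set of these numbers. -/
def UniTriGraph.toTri {H : Type} (Γ : UniTriGraph H) : TriGraph (Fin Γ.order) H where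
  edge := Γ.edge
  edge_edge := Γ.edge_edge
  colour := Γ.colour

/-- The bijection of half-edges given by a bijection of the vertices and bijections of the
half-edges at the vertices. -/
def blockEquiv {V W : Type} (ε : V ≃ W) (p : V → Equiv.Perm (Fin 3)) : V × Fin 3 ≃ W × Fin 3 where
  toFun h := (ε h.1, p h.1 h.2)
  invFun h := (ε.symm h.1, (p (ε.symm h.1)).symm h.2)
  left_inv h := by simp
  right_inv h := by simp

lemma blockEquiv_apply {V W : Type} (ε : V ≃ W) (p : V → Equiv.Perm (Fin 3))
    (h : V × Fin 3) : blockEquiv ε p h = (ε h.1, p h.1 h.2) := rfl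

/-- The bijection of half-edges given by a bijection of the vertices. -/
abbrev vertexEquiv {V W : Type} (ε : V ≃ W) : V × Fin 3 ≃ W × Fin 3 := blockEquiv ε fun _ => 1

/-- The permutation of half-edges in the IHX relation. -/
def ihxPerm {V : Type} [DecidableEq V] (v w : V) : Equiv.Perm (V × Fin 3) :=
  Equiv.swap (v, 1) (v, 2) * Equiv.swap (v, 2) (w, 1)

variable (H : Type) [AddCommGroup H]

/-- A function of graphs that is compatible with antisymmetry, the IHX relation and linearity in the
colours of the legs. -/
structure GraphInvariant (M : Type) [AddCommGroup M] : Type 1 where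
  val : ∀ {V : Type} [Finite V], TriGraph V H → M
  congr : ∀ {V : Type} [Finite V] (e : V × Fin 3 → V × Fin 3) (he : Function.Involutive e)
    (c c' : V × Fin 3 → H), (∀ h, e h = h → c h = c' h) → val ⟨e, he, c⟩ = val ⟨e, he, c'⟩
  map : ∀ {V W : Type} [Fintype V] [Finite W] (G : TriGraph V H) (ε : V ≃ W)
    (p : V → Equiv.Perm (Fin 3)),
    val (G.map (blockEquiv ε p)) = (∏ v, (Equiv.Perm.sign (p v) : ℤ)) • val G
  ihx : ∀ {V : Type} [Finite V] [DecidableEq V] (G : TriGraph V H) (v w : V), v ≠ w →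
    G.edge (v, 0) = (w, 0) →
      val G + val (G.map (ihxPerm v w)) + val (G.map (ihxPerm v w * ihxPerm v w)) = 0
  linear : ∀ {V : Type} [Finite V] (e : V × Fin 3 → V × Fin 3) (he : Function.Involutive e)
    (c c₁ c₂ : V × Fin 3 → H) (h : V × Fin 3), e h = h → (∀ k, k ≠ h → c₁ k = c k) →
    (∀ k, k ≠ h → c₂ k = c k) → c h = c₁ h + c₂ h →
      val ⟨e, he, c⟩ = val ⟨e, he, c₁⟩ + val ⟨e, he, c₂⟩

namespace GraphInvariant

variable {H} {M : Type} [AddCommGroup M] (F : GraphInvariant H M)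

lemma map_vertexEquiv {V W : Type} [Finite V] [Finite W] (G : TriGraph V H) (ε : V ≃ W) :
    F.val (G.map (vertexEquiv ε)) = F.val G := by
  have := Fintype.ofFinite V
  rw [F.map]; simp

/-- The homomorphism on the group of graphs that is given by an invariant of graphs. -/
def lift : GraphSpace H →+ M :=
  QuotientAddGroup.lift _ (FreeAbelianGroup.lift fun Γ => F.val Γ.toTri) (by
    rw [AddSubgroup.closure_le]
    rintro _ (⟨Γ, Γ', φ⟩ | ⟨Γ, v, w, hvw, h⟩ | ⟨Γ, h, x, y⟩)
    · change FreeAbelianGroup.lift _ _ = 0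
      rw [map_sub, map_zsmul, FreeAbelianGroup.lift_apply_of, FreeAbelianGroup.lift_apply_of,
        sub_eq_zero, UniTriGraph.Iso.sign, ← F.map _ φ.vertex]
      have he : Γ'.edge = (Γ.toTri.map (blockEquiv φ.vertex φ.perm)).edge := by
        funext k
        obtain ⟨k, rfl⟩ := (blockEquiv φ.vertex φ.perm).surjective k
        simp only [TriGraph.map, Equiv.symm_apply_apply]
        exact φ.edge_map k
      have hc : ∀ k, Γ'.edge k = k →
          Γ'.colour k = (Γ.toTri.map (blockEquiv φ.vertex φ.perm)).colour k := by
        intro k hk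
        rw [he] at hk
        obtain ⟨k, rfl⟩ := (blockEquiv φ.vertex φ.perm).surjective k
        simp only [TriGraph.map, Equiv.symm_apply_apply] at hk ⊢
        exact φ.colour_map k ((blockEquiv φ.vertex φ.perm).injective hk)
      generalize (Γ.toTri.map (blockEquiv φ.vertex φ.perm)) = G at he hc ⊢
      obtain ⟨n, e, hee, c⟩ := Γ'
      obtain ⟨e', hee', c'⟩ := G
      subst he
      exact F.congr _ _ _ _ hc
    · change FreeAbelianGroup.lift _ _ = 0
      rw [map_add, map_add, FreeAbelianGroup.lift_apply_of, FreeAbelianGroup.lift_apply_of,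
        FreeAbelianGroup.lift_apply_of]
      exact F.ihx Γ.toTri v w hvw h
    · change FreeAbelianGroup.lift _ _ = 0
      rw [map_sub, map_sub, FreeAbelianGroup.lift_apply_of, FreeAbelianGroup.lift_apply_of,
        FreeAbelianGroup.lift_apply_of, sub_sub, sub_eq_zero]
      refine F.linear Γ.edge Γ.edge_edge _ _ _ h.1 h.2 ?_ ?_ ?_
      · intro k hk; simp only [UniTriGraph.recolour, Function.update_of_ne hk]
      · intro k hk; simp only [UniTriGraph.recolour, Function.update_of_ne hk]
      · simp only [UniTriGraph.recolour, Function.update_self])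

lemma lift_graphClass (Γ : UniTriGraph H) : F.lift (graphClass Γ) = F.val Γ.toTri :=
  FreeAbelianGroup.lift_apply_of _ _

end GraphInvariant

variable {H}

lemma mk_eq_zero_of_isRelator {x : FreeAbelianGroup (UniTriGraph H)} (h : IsRelator H x) :
    QuotientAddGroup.mk' (AddSubgroup.closure {x | IsRelator H x}) x = 0 :=
  (QuotientAddGroup.eq_zero_iff _).2 (AddSubgroup.subset_closure h)

lemma graphClass_eq_of_iso {Γ Γ' : UniTriGraph H} (φ : UniTriGraph.Iso Γ Γ') :
    graphClass Γ' = φ.sign • graphClass Γ := by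
  have h := mk_eq_zero_of_isRelator (IsRelator.antisymmetry Γ Γ' φ)
  rw [map_sub, map_zsmul, sub_eq_zero] at h
  exact h

namespace TriGraph

/-- The element of `𝒜` represented by a graph. -/
def cls {V : Type} [Finite V] (G : TriGraph V H) : GraphSpace H :=
  graphClass (G.map (vertexEquiv (Finite.equivFin V))).toUni

end TriGraph

/-- An isomorphism of graphs that permutes the half-edges at the vertices changes the class by the sign
of these permutations. -/
lemma cls_eq_of_iso {V W : Type} [Fintype V] [Finite W] (G : TriGraph V H) (G' : TriGraph W H)
    (ε : V ≃ W) (p : V → Equiv.Perm (Fin 3))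
    (he : ∀ h, G'.edge (blockEquiv ε p h) = blockEquiv ε p (G.edge h))
    (hc : ∀ h, G.edge h = h → G'.colour (blockEquiv ε p h) = G.colour h) :
    G'.cls = (∏ v, (Equiv.Perm.sign (p v) : ℤ)) • G.cls := by
  set a := Finite.equivFin V
  set b := Finite.equivFin W
  let φ : UniTriGraph.Iso (G.map (vertexEquiv a)).toUni (G'.map (vertexEquiv b)).toUni :=
    { vertex := (a.symm.trans ε).trans b
      perm := fun v => p (a.symm v)
      edge_map := fun h => by
        obtain ⟨h, rfl⟩ := (vertexEquiv a).surjective h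
        have := he h
        simp only [blockEquiv_apply] at this
        change vertexEquiv b (G'.edge (b.symm (b (ε (a.symm (a h.1)))), p (a.symm (a h.1)) h.2)) =
          (b (ε (a.symm (a (G.edge (a.symm (a h.1), h.2)).1))),
            p (a.symm (a (G.edge (a.symm (a h.1), h.2)).1)) (G.edge (a.symm (a h.1), h.2)).2)
        simp only [Equiv.symm_apply_apply]
        rw [this]
        rfl
      colour_map := fun h hh => by
        obtain ⟨h, rfl⟩ := (vertexEquiv a).surjective h
        have := hc h (by
          simp only [TriGraph.toUni, TriGraph.map, Equiv.symm_apply_apply] at hh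
          exact (vertexEquiv a).injective hh)
        change G'.colour (b.symm (b (ε (a.symm (a h.1)))), p (a.symm (a h.1)) h.2) =
          G.colour (a.symm (a h.1), h.2)
        simp only [Equiv.symm_apply_apply]
        exact this }
  rw [TriGraph.cls, TriGraph.cls, graphClass_eq_of_iso φ]
  congr 1
  exact Equiv.prod_comp a.symm fun v => (Equiv.Perm.sign (p v) : ℤ)

lemma cls_congr {V : Type} [Finite V] {e : V × Fin 3 → V × Fin 3} {he : Function.Involutive e}
    {c c' : V × Fin 3 → H} (h : ∀ h, e h = h → c h = c' h) :
    (⟨e, he, c⟩ : TriGraph V H).cls = (⟨e, he, c'⟩ : TriGraph V H).cls := by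
  have := Fintype.ofFinite V
  rw [cls_eq_of_iso ⟨e, he, c'⟩ ⟨e, he, c⟩ (Equiv.refl V) (fun _ => 1) (fun _ => rfl)
    (fun k hk => h k hk)]
  simp

lemma toTri_cls (Γ : UniTriGraph H) : Γ.toTri.cls = graphClass Γ := by
  let φ : UniTriGraph.Iso Γ (Γ.toTri.map (vertexEquiv (Finite.equivFin _))).toUni :=
    { vertex := Finite.equivFin _
      perm := fun _ => 1
      edge_map := fun h => by
        change vertexEquiv _ (Γ.edge ((vertexEquiv (Finite.equivFin _)).symm
          (vertexEquiv (Finite.equivFin _) h))) = vertexEquiv _ (Γ.edge h)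
        rw [Equiv.symm_apply_apply]
      colour_map := fun h _ => by
        change Γ.colour ((vertexEquiv (Finite.equivFin _)).symm
          (vertexEquiv (Finite.equivFin _) h)) = Γ.colour h
        rw [Equiv.symm_apply_apply] }
  rw [TriGraph.cls, graphClass_eq_of_iso φ]
  simp [UniTriGraph.Iso.sign, φ]

lemma vertexEquiv_swap {V W : Type} [DecidableEq V] [DecidableEq W] (ε : V ≃ W)
    (h k : V × Fin 3) : (Equiv.swap h k).trans (vertexEquiv ε) =
      (vertexEquiv ε).trans (Equiv.swap (vertexEquiv ε h) (vertexEquiv ε k)) := by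
  ext x : 1
  simp only [Equiv.trans_apply]
  exact (vertexEquiv ε).injective.swap_apply h k x |>.symm

lemma ihxPerm_trans_vertexEquiv {V W : Type} [DecidableEq V] [DecidableEq W] (ε : V ≃ W) (v w : V) :
    (ihxPerm v w).trans (vertexEquiv ε) = (vertexEquiv ε).trans (ihxPerm (ε v) (ε w)) := by
  ext x : 1
  simp only [ihxPerm, Equiv.trans_apply, Equiv.Perm.coe_mul, Function.comp_apply]
  have h := fun h k x => DFunLike.congr_fun (vertexEquiv_swap ε h k) x
  simp only [Equiv.trans_apply] at h
  rw [h, h]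
  rfl

/-- The class of a graph is the universal invariant. -/
def clsInvariant (H : Type) [AddCommGroup H] : GraphInvariant H (GraphSpace H) where
  val G := G.cls
  congr _ _ _ _ h := cls_congr h
  map G ε p := cls_eq_of_iso _ _ ε p
    (fun h => by simp only [TriGraph.map, Equiv.symm_apply_apply])
    (fun h _ => by simp only [TriGraph.map, Equiv.symm_apply_apply])
  ihx {V} _ _ G v w hvw h := by
    set a := Finite.equivFin V with ha
    have h1 := mk_eq_zero_of_isRelator (IsRelator.ihx (G.map (vertexEquiv a)).toUni (a v) (a w)
      (a.injective.ne hvw) (by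
        change vertexEquiv a (G.edge ((vertexEquiv a).symm (vertexEquiv a (v, 0)))) = (a w, 0)
        rw [Equiv.symm_apply_apply, h]; rfl))
    rw [map_add, map_add] at h1
    have e1 : (G.map (ihxPerm v w)).map (vertexEquiv a) =
        (G.map (vertexEquiv a)).map (ihxPerm (a v) (a w)) := by
      rw [TriGraph.map_map, TriGraph.map_map, ihxPerm_trans_vertexEquiv]
    have e2 : (G.map (ihxPerm v w * ihxPerm v w)).map (vertexEquiv a) =
        (G.map (vertexEquiv a)).map (ihxPerm (a v) (a w) * ihxPerm (a v) (a w)) := by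
      have t : ∀ {X : Type} (τ : Equiv.Perm X), τ * τ = τ.trans τ := fun _ => rfl
      rw [t, t, ← TriGraph.map_map, ← TriGraph.map_map, TriGraph.map_map (G.map _),
        ihxPerm_trans_vertexEquiv, ← TriGraph.map_map, e1]
    rw [TriGraph.cls, TriGraph.cls, TriGraph.cls, ← ha, e1, e2]
    exact h1
  linear {V} _ e he c c₁ c₂ h hh h1 h2 h3 := by
    set a := Finite.equivFin V with ha
    let Γ := ((⟨e, he, c⟩ : TriGraph V H).map (vertexEquiv a)).toUni
    let k : Γ.Leg := ⟨vertexEquiv a h, by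
      change vertexEquiv a (e ((vertexEquiv a).symm (vertexEquiv a h))) = _
      rw [Equiv.symm_apply_apply, hh]⟩
    have h4 := mk_eq_zero_of_isRelator (IsRelator.linear Γ k (c₁ h) (c₂ h))
    rw [map_sub, map_sub, sub_sub, sub_eq_zero] at h4
    have key : ∀ (c' : V × Fin 3 → H), (∀ l, l ≠ h → c' l = c l) →
        Γ.recolour k (c' h) = ((⟨e, he, c'⟩ : TriGraph V H).map (vertexEquiv a)).toUni := by
      intro c' hc'
      have : Function.update Γ.colour k.1 (c' h) = fun l => c' ((vertexEquiv a).symm l) := by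
        funext l
        obtain ⟨l, rfl⟩ := (vertexEquiv a).surjective l
        rcases eq_or_ne l h with rfl | hl
        · rw [Equiv.symm_apply_apply]; exact Function.update_self _ _ _
        · rw [Equiv.symm_apply_apply, hc' l hl]
          refine (Function.update_of_ne ((vertexEquiv a).injective.ne hl) _ _).trans ?_
          change c ((vertexEquiv a).symm (vertexEquiv a l)) = _
          rw [Equiv.symm_apply_apply]
      unfold UniTriGraph.recolour
      rw [this]; rfl
    have h5 := key c fun _ _ => rfl
    rw [h3] at h5
    rw [h5, key c₁ h1, key c₂ h2] at h4
    exact h4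

lemma GraphInvariant.lift_cls {M : Type} [AddCommGroup M] (F : GraphInvariant H M) {V : Type}
    [Finite V] (G : TriGraph V H) : F.lift G.cls = F.val G := by
  rw [TriGraph.cls, F.lift_graphClass]
  exact F.map_vertexEquiv G _

/-- The group of graphs is generated by the classes of graphs. -/
lemma GraphSpace.induction_on {p : GraphSpace H → Prop} (x : GraphSpace H)
    (of : ∀ Γ : UniTriGraph H, p (graphClass Γ)) (neg : ∀ x, p x → p (-x))
    (add : ∀ x y, p x → p y → p (x + y)) (zero : p 0) : p x := by
  obtain ⟨x, rfl⟩ := QuotientAddGroup.mk'_surjective _ x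
  induction x using FreeAbelianGroup.induction_on with
  | zero => exact zero
  | of Γ => exact of Γ
  | neg Γ h => rw [map_neg]; exact neg _ h
  | add x y hx hy => rw [map_add]; exact add _ _ hx hy

lemma GraphSpace.hom_ext {M : Type} [AddCommGroup M] {f f' : GraphSpace H →+ M}
    (h : ∀ Γ, f (graphClass Γ) = f' (graphClass Γ)) : f = f' := by
  ext x
  induction x using GraphSpace.induction_on with
  | of Γ => exact h Γ
  | neg x hx => rw [map_neg, map_neg, hx]
  | add x y hx hy => rw [map_add, map_add, hx, hy]
  | zero => rw [map_zero, map_zero]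

end

section

/-! ### Sums over the ways to join legs -/

/-- The involutions that join some of the fixed points of an involution `e` in pairs. -/
abbrev Extension {X : Type} (e : X → X) : Type :=
  {E : X → X // Function.Involutive E ∧ ∀ h, e h ≠ h → E h = e h}

instance {X : Type} [Finite X] (e : X → X) : Fintype (Extension e) := Fintype.ofFinite _

section Pairing

variable {X Y : Type}

open Classical in
/-- The product of the weights of the pairs of `E` that are not pairs of `e`. The weight of the pair
`{h, k}` is `ω h k * ω k h`. -/
def pairWeight (ω : X → X → ℤ) (e E : X → X) : ℤ := ∏ᶠ h, if E h = e h then 1 else ω h (E h)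

lemma pairWeight_self (ω : X → X → ℤ) (e : X → X) : pairWeight ω e e = 1 := by
  simp [pairWeight]

lemma pairWeight_ne_zero [Finite X] {ω : X → X → ℤ} {e E : X → X} (h : pairWeight ω e E ≠ 0)
    (x : X) (hx : E x ≠ e x) : ω x (E x) ≠ 0 := by
  classical
  have := Fintype.ofFinite X
  rw [pairWeight, finprod_eq_prod_of_fintype, Finset.prod_ne_zero_iff] at h
  have := h x (Finset.mem_univ x)
  rwa [if_neg hx] at this

lemma pairWeight_congr {ω ω' : X → X → ℤ} {e E : X → X}
    (h : ∀ x, E x ≠ e x → ω x (E x) = ω' x (E x)) : pairWeight ω e E = pairWeight ω' e E := by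
  unfold pairWeight
  refine finprod_congr fun x => ?_
  split_ifs with hx
  · rfl
  · exact h x hx

lemma pairWeight_transpose (ω : X → X → ℤ) {e E : X → X} (he : Function.Involutive e)
    (hE : Function.Involutive E) : pairWeight (fun h k => ω k h) e E = pairWeight ω e E := by
  unfold pairWeight
  refine finprod_eq_of_bijective E hE.bijective fun h => ?_
  have : E (E h) = e (E h) ↔ E h = e h := by
    rw [hE h]
    constructor
    · intro k; rw [k, he, ← k]
    · intro k; rw [k, he]
  simp only [hE h]
  by_cases hx : E h = e h
  · rw [if_pos hx, if_pos (this.2 hx)]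
  · rw [if_neg hx, if_neg fun k => hx (this.1 k)]

lemma pairWeight_conj (τ : X ≃ Y) (ω : Y → Y → ℤ) (e E : X → X) :
    pairWeight ω (fun h => τ (e (τ.symm h))) (fun h => τ (E (τ.symm h))) =
      pairWeight (fun h k => ω (τ h) (τ k)) e E := by
  unfold pairWeight
  refine (finprod_eq_of_bijective τ τ.bijective fun h => ?_).symm
  simp only [Equiv.symm_apply_apply]
  by_cases hx : E h = e h
  · rw [if_pos hx, if_pos (by simp [hx])]
  · rw [if_neg hx, if_neg (by simpa using hx)]

/-- The extensions of conjugate involutions. -/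
def Extension.conj (τ : X ≃ Y) (e : X → X) : Extension e ≃ Extension fun h => τ (e (τ.symm h)) where
  toFun E := ⟨fun h => τ (E.1 (τ.symm h)), fun h => by simp [E.2.1 (τ.symm h)], fun h hh => by
    change τ (E.1 (τ.symm h)) = τ (e (τ.symm h))
    rw [E.2.2]; intro k; exact hh (by simp only [k, Equiv.apply_symm_apply])⟩
  invFun E := ⟨fun h => τ.symm (E.1 (τ h)), fun h => by simp [E.2.1 (τ h)], fun h hh => by
    change τ.symm (E.1 (τ h)) = e h
    rw [E.2.2 _ (by simpa using hh)]; simp⟩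
  left_inv E := by ext h; simp
  right_inv E := by ext h; simp

/-- The involution `e` itself. -/
def Extension.refl {e : X → X} (he : Function.Involutive e) : Extension e := ⟨e, he, fun _ _ => rfl⟩

end Pairing

variable {V V' W W' H : Type}

attribute [ext] TriGraph

namespace TriGraph

/-- Join legs. -/
def extend (G : TriGraph V H) (E : Extension G.edge) : TriGraph V H where
  edge := E.1
  edge_edge := E.2.1
  colour := G.colour

end TriGraph

/-- The half-edges of a disjoint union. -/
def halfSum (V W : Type) : (V × Fin 3) ⊕ (W × Fin 3) ≃ (V ⊕ W) × Fin 3 :=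
  (Equiv.sumProdDistrib V W (Fin 3)).symm

/-- The disjoint union of two graphs. -/
def TriGraph.sum (G : TriGraph V H) (G' : TriGraph W H) : TriGraph (V ⊕ W) H where
  edge := fun h => halfSum V W (Sum.map G.edge G'.edge ((halfSum V W).symm h))
  edge_edge := fun h => by
    simp only [Equiv.symm_apply_apply, Sum.map_map, G.edge_edge.comp_self, G'.edge_edge.comp_self]
    simp
  colour := fun h => Sum.elim G.colour G'.colour ((halfSum V W).symm h)

section Sum

variable (G : TriGraph V H) (G' : TriGraph W H)

@[simp] lemma sum_edge_inl (h : V × Fin 3) :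
    (G.sum G').edge (halfSum V W (.inl h)) = halfSum V W (.inl (G.edge h)) := by simp [TriGraph.sum]

@[simp] lemma sum_edge_inr (h : W × Fin 3) :
    (G.sum G').edge (halfSum V W (.inr h)) = halfSum V W (.inr (G'.edge h)) := by simp [TriGraph.sum]

@[simp] lemma sum_colour_inl (h : V × Fin 3) :
    (G.sum G').colour (halfSum V W (.inl h)) = G.colour h := by simp [TriGraph.sum]

@[simp] lemma sum_colour_inr (h : W × Fin 3) :
    (G.sum G').colour (halfSum V W (.inr h)) = G'.colour h := by simp [TriGraph.sum]

@[simp] lemma halfSum_inl_fst (h : V × Fin 3) : (halfSum V W (.inl h)).1 = .inl h.1 := rfl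

@[simp] lemma halfSum_inr_fst (h : W × Fin 3) : (halfSum V W (.inr h)).1 = .inr h.1 := rfl

end Sum

/-- The bijection of the half-edges of disjoint unions that is `τ` on the first summand. -/
def sumPerm (W : Type) (τ : V × Fin 3 ≃ V' × Fin 3) : (V ⊕ W) × Fin 3 ≃ (V' ⊕ W) × Fin 3 :=
  (halfSum V W).symm.trans ((Equiv.sumCongr τ (Equiv.refl _)).trans (halfSum V' W))

@[simp] lemma sumPerm_inl (τ : V × Fin 3 ≃ V' × Fin 3) (h : V × Fin 3) :
    sumPerm W τ (halfSum V W (.inl h)) = halfSum V' W (.inl (τ h)) := by simp [sumPerm]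

@[simp] lemma sumPerm_inr (τ : V × Fin 3 ≃ V' × Fin 3) (h : W × Fin 3) :
    sumPerm W τ (halfSum V W (.inr h)) = halfSum V' W (.inr h) := by simp [sumPerm]

lemma map_sum_eq (τ : V × Fin 3 ≃ V' × Fin 3) (G : TriGraph V H) (G' : TriGraph W H) :
    (G.map τ).sum G' = (G.sum G').map (sumPerm W τ) := by
  ext h : 2
  · obtain ⟨h, rfl⟩ := (sumPerm W τ).surjective h
    obtain ⟨h | h, rfl⟩ := (halfSum V W).surjective h
    · simp only [sumPerm_inl, sum_edge_inl, TriGraph.map, Equiv.symm_apply_apply]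
      rw [← sumPerm_inl, ← sumPerm_inl, Equiv.symm_apply_apply, sum_edge_inl]
    · simp only [sumPerm_inr, sum_edge_inr, TriGraph.map]
      rw [← sumPerm_inr τ, ← sumPerm_inr τ, Equiv.symm_apply_apply, sum_edge_inr]
  · obtain ⟨h, rfl⟩ := (sumPerm W τ).surjective h
    obtain ⟨h | h, rfl⟩ := (halfSum V W).surjective h
    · simp only [sumPerm_inl, sum_colour_inl, TriGraph.map, Equiv.symm_apply_apply]
      rw [← sumPerm_inl, Equiv.symm_apply_apply, sum_colour_inl]
    · simp only [sumPerm_inr, sum_colour_inr, TriGraph.map]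
      rw [← sumPerm_inr τ, Equiv.symm_apply_apply, sum_colour_inr]

lemma blockEquiv_sum (ε : V ≃ V') (p : V → Equiv.Perm (Fin 3)) :
    blockEquiv (ε.sumCongr (Equiv.refl W)) (Sum.elim p fun _ => 1) = sumPerm W (blockEquiv ε p) := by
  ext h : 1
  obtain ⟨h | h, rfl⟩ := (halfSum V W).surjective h
  · rw [sumPerm_inl]; rfl
  · rw [sumPerm_inr]; rfl

lemma sumPerm_mul (τ τ' : Equiv.Perm (V × Fin 3)) :
    sumPerm W (τ * τ') = sumPerm W τ * sumPerm W τ' := by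
  ext h : 1
  obtain ⟨h | h, rfl⟩ := (halfSum V W).surjective h
  · rw [sumPerm_inl, Equiv.Perm.mul_apply, Equiv.Perm.mul_apply, sumPerm_inl, sumPerm_inl]
  · rw [sumPerm_inr, Equiv.Perm.mul_apply, sumPerm_inr, sumPerm_inr]

lemma sumPerm_swap [DecidableEq V] [DecidableEq W] (a b : V × Fin 3) :
    sumPerm W (Equiv.swap a b) = Equiv.swap (halfSum V W (.inl a)) (halfSum V W (.inl b)) := by
  have hi : Function.Injective fun h : V × Fin 3 => halfSum V W (.inl h) :=
    (halfSum V W).injective.comp Sum.inl_injective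
  ext h : 1
  obtain ⟨h | h, rfl⟩ := (halfSum V W).surjective h
  · rw [sumPerm_inl]; exact (hi.swap_apply a b h).symm
  · rw [sumPerm_inr, Equiv.swap_apply_of_ne_of_ne] <;> simp

lemma ihxPerm_sum [DecidableEq V] [DecidableEq W] (v w : V) :
    ihxPerm (Sum.inl v : V ⊕ W) (Sum.inl w) = sumPerm W (ihxPerm v w) := by
  rw [ihxPerm, ihxPerm, sumPerm_mul, sumPerm_swap, sumPerm_swap]; rfl

/-- The weight of a pair of legs: the value of the form `-B` on the colours, if the legs belong to
different blocks, and zero otherwise. -/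
def blockWeight (B : H → H → ℤ) (c : V × Fin 3 → H) (b : V → ℕ) (h k : V × Fin 3) : ℤ :=
  if b h.1 < b k.1 then -B (c h) (c k) else if b k.1 < b h.1 then 1 else 0

lemma blockWeight_transpose (B : H → H → ℤ) (c : V × Fin 3 → H) {b b' : V → ℕ}
    (h : ∀ v w, b v < b w ↔ b' w < b' v) :
    (fun x y => blockWeight B c b y x) = blockWeight (fun x y => B y x) c b' := by
  funext x y
  simp only [blockWeight, h]

lemma sum_comm_eq (G : TriGraph V H) (G' : TriGraph W H) :
    G'.sum G = (G.sum G').map (vertexEquiv (Equiv.sumComm V W)) := by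
  ext h : 2
  · obtain ⟨v | v, i⟩ := h <;> rfl
  · obtain ⟨v | v, i⟩ := h <;> rfl

lemma colour_map_apply {X Y : Type} (τ : X × Fin 3 ≃ Y × Fin 3) (G : TriGraph X H) (h : X × Fin 3) :
    (G.map τ).colour (τ h) = G.colour h := by simp [TriGraph.map]

lemma blockWeight_map {X Y : Type} (B : H → H → ℤ) (τ : X × Fin 3 ≃ Y × Fin 3) (G : TriGraph X H)
    {b : X → ℕ} {b' : Y → ℕ} (hb : ∀ h, b' (τ h).1 = b h.1) :
    (fun h k => blockWeight B (G.map τ).colour b' (τ h) (τ k)) = blockWeight B G.colour b := by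
  funext h k
  simp only [blockWeight, colour_map_apply, hb]

/-- The two blocks of a disjoint union. -/
def side : V ⊕ W → ℕ := Sum.elim (fun _ => 0) fun _ => 1

variable [AddCommGroup H]

/-- The sum over all ways to join legs in pairs, weighted by the weights of the pairs. -/
def extSum [Finite V] (G : TriGraph V H) (ω : V × Fin 3 → V × Fin 3 → ℤ) : GraphSpace H :=
  ∑ E : Extension G.edge, pairWeight ω G.edge E.1 • (G.extend E).cls

lemma extSum_map [Finite V] [Finite W] (τ : V × Fin 3 ≃ W × Fin 3) (G : TriGraph V H)
    (ω : W × Fin 3 → W × Fin 3 → ℤ) : extSum (G.map τ) ω = ∑ E : Extension G.edge,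
      pairWeight (fun h k => ω (τ h) (τ k)) G.edge E.1 • ((G.extend E).map τ).cls := by
  refine (Fintype.sum_equiv (Extension.conj τ G.edge) _ _ fun E => ?_).symm
  rw [← pairWeight_conj]
  rfl

lemma extSum_map_vertexEquiv [Finite V] [Finite W] (ε : V ≃ W) (G : TriGraph V H)
    (ω : W × Fin 3 → W × Fin 3 → ℤ) : extSum (G.map (vertexEquiv ε)) ω =
      extSum G fun h k => ω (vertexEquiv ε h) (vertexEquiv ε k) := by
  rw [extSum_map]
  exact Finset.sum_congr rfl fun E _ => congrArg _ ((clsInvariant H).map_vertexEquiv _ ε)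

lemma extSum_transpose [Finite V] (G : TriGraph V H) (ω : V × Fin 3 → V × Fin 3 → ℤ) :
    extSum G (fun h k => ω k h) = extSum G ω :=
  Finset.sum_congr rfl fun E _ => by rw [pairWeight_transpose ω G.edge_edge E.2.1]

lemma extSum_eq_cls [Finite V] (G : TriGraph V H) {ω : V × Fin 3 → V × Fin 3 → ℤ}
    (h : ∀ h k, ω h k = 0) : extSum G ω = G.cls := by
  rw [extSum, Finset.sum_eq_single (Extension.refl G.edge_edge)]
  · rw [Extension.refl, pairWeight_self, one_smul]; rfl
  · intro E _ hE
    have : ∃ x, E.1 x ≠ G.edge x := by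
      by_contra! hc; exact hE (Subtype.ext (funext hc))
    obtain ⟨x, hx⟩ := this
    have h0 : pairWeight ω G.edge E.1 = 0 := by
      by_contra hne; exact pairWeight_ne_zero hne x hx (h _ _)
    rw [h0, zero_smul]
  · intro h; exact (h (Finset.mem_univ _)).elim

/-! ### The star product -/

/-- The star product of two graphs. -/
def star (B : H → H → ℤ) [Finite V] [Finite W] (G : TriGraph V H) (G' : TriGraph W H) :
    GraphSpace H :=
  extSum (G.sum G') (blockWeight B (G.sum G').colour side)

/-- A function of two variables that is additive in each. -/
structure IsBiadditive (B : H → H → ℤ) : Prop where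
  add_left : ∀ x y z, B (x + y) z = B x z + B y z
  add_right : ∀ x y z, B x (y + z) = B x y + B x z

lemma IsBiadditive.flip {B : H → H → ℤ} (hB : IsBiadditive B) :
    IsBiadditive fun x y => B y x := ⟨fun x y z => hB.add_right z x y, fun x y z => hB.add_left y z x⟩

lemma star_flip (B : H → H → ℤ) [Finite V] [Finite W] (G : TriGraph V H) (G' : TriGraph W H) :
    star (fun x y => B y x) G' G = star B G G' := by
  have h := blockWeight_map (fun x y => B y x) (vertexEquiv (Equiv.sumComm V W)) (G.sum G')
    (b := fun v => 1 - side v) (b' := side) (by rintro ⟨v | v, i⟩ <;> rfl)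
  rw [star, sum_comm_eq, extSum_map_vertexEquiv, h, ← blockWeight_transpose B _ (b := side) (by
    rintro (v | v) (w | w) <;> simp [side]), extSum_transpose, star]

lemma side_sumPerm (τ : V × Fin 3 ≃ V' × Fin 3) (h : (V ⊕ W) × Fin 3) :
    side (sumPerm W τ h).1 = side h.1 := by
  obtain ⟨h | h, rfl⟩ := (halfSum V W).surjective h
  · rw [sumPerm_inl]; rfl
  · rw [sumPerm_inr]; rfl

lemma star_map (B : H → H → ℤ) [Finite V] [Finite V'] [Finite W] (τ : V × Fin 3 ≃ V' × Fin 3)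
    (G : TriGraph V H) (G' : TriGraph W H) : star B (G.map τ) G' =
      ∑ E : Extension (G.sum G').edge,
        pairWeight (blockWeight B (G.sum G').colour side) (G.sum G').edge E.1 •
          (((G.sum G').extend E).map (sumPerm W τ)).cls := by
  rw [star, map_sum_eq, extSum_map, blockWeight_map B _ _ (side_sumPerm τ)]

/-- The star product with a fixed graph is an invariant of graphs. -/
def starInvariant {B : H → H → ℤ} (hB : IsBiadditive B) [Finite W] (G' : TriGraph W H) :
    GraphInvariant H (GraphSpace H) where
  val G := star B G G'
  congr {V} _ e he c c' h := by
    refine Finset.sum_congr rfl fun E _ => ?_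
    have hl : ∀ k, E.1 k = k → ((⟨e, he, c⟩ : TriGraph V H).sum G').edge k = k := fun k hk => by
      by_contra hc; exact hc (by rw [← E.2.2 k hc]; exact hk)
    have hcol : ∀ k, ((⟨e, he, c⟩ : TriGraph V H).sum G').edge k = k →
        ((⟨e, he, c⟩ : TriGraph V H).sum G').colour k =
          ((⟨e, he, c'⟩ : TriGraph V H).sum G').colour k := by
      intro k hk
      obtain ⟨k | k, rfl⟩ := (halfSum V W).surjective k
      · rw [sum_edge_inl] at hk
        rw [sum_colour_inl, sum_colour_inl]
        exact h k (Sum.inl_injective ((halfSum V W).injective hk))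
      · rw [sum_colour_inr, sum_colour_inr]
    have e1 : pairWeight (blockWeight B ((⟨e, he, c⟩ : TriGraph V H).sum G').colour side)
        ((⟨e, he, c⟩ : TriGraph V H).sum G').edge E.1 =
        pairWeight (blockWeight B ((⟨e, he, c'⟩ : TriGraph V H).sum G').colour side)
        ((⟨e, he, c⟩ : TriGraph V H).sum G').edge E.1 := by
      refine pairWeight_congr fun x hx => ?_
      have h1 : ((⟨e, he, c⟩ : TriGraph V H).sum G').edge x = x := by
        by_contra hc; exact hx (E.2.2 x hc)
      have h2 : ((⟨e, he, c⟩ : TriGraph V H).sum G').edge (E.1 x) = E.1 x := by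
        by_contra hc
        have := E.2.2 _ hc
        rw [E.2.1] at this
        have h3 := congrArg ((⟨e, he, c⟩ : TriGraph V H).sum G').edge this
        rw [TriGraph.edge_edge] at h3
        exact hx h3.symm
      simp only [blockWeight, hcol _ h1, hcol _ h2]
    rw [e1]
    exact congrArg _ (cls_congr fun k hk => hcol k (hl k hk))
  map {V V'} _ _ G ε p := by
    have := Fintype.ofFinite W
    rw [star_map, star, extSum, Finset.smul_sum]
    refine Finset.sum_congr rfl fun E _ => ?_
    rw [← blockEquiv_sum, smul_comm]
    congr 1
    refine ((clsInvariant H).map ((G.sum G').extend E) _ _).trans ?_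
    simp [clsInvariant]
  ihx {V} _ _ G v w hvw h := by
    classical
    rw [star_map, star_map, star, extSum, ← Finset.sum_add_distrib, ← Finset.sum_add_distrib]
    refine Finset.sum_eq_zero fun E _ => ?_
    rw [← smul_add, ← smul_add]
    have := (clsInvariant H).ihx ((G.sum G').extend E) (.inl v) (.inl w)
      (fun e => hvw (Sum.inl_injective e)) (by
        have h1 : (G.sum G').edge (Sum.inl v, 0) = (Sum.inl w, 0) :=
          (sum_edge_inl G G' (v, 0)).trans (by rw [h]; rfl)
        exact (E.2.2 _ (by rw [h1]; intro e; exact hvw (Sum.inl_injective (Prod.mk.inj e).1).symm)).trans h1)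
    rw [ihxPerm_sum, ← sumPerm_mul] at this
    exact (congrArg _ this).trans (smul_zero _)
  linear {V} _ e he c c₁ c₂ h hh h1 h2 h3 := by
    classical
    have := Fintype.ofFinite V
    have := Fintype.ofFinite W
    rw [star, star, star, extSum, extSum, extSum]
    refine Eq.trans ?_ Finset.sum_add_distrib
    refine Finset.sum_congr rfl fun E _ => ?_
    set G : (V × Fin 3 → H) → TriGraph (V ⊕ W) H := fun c => (⟨e, he, c⟩ : TriGraph V H).sum G' with hG
    set k := halfSum V W (.inl h) with hk
    have hne : ∀ (d : V × Fin 3 → H), (∀ l, l ≠ h → d l = c l) → ∀ x, x ≠ k →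
        (G d).colour x = (G c).colour x := by
      intro d hd x hx
      obtain ⟨x | x, rfl⟩ := (halfSum V W).surjective x
      · simp only [hG, sum_colour_inl]
        exact hd x fun e => hx (by rw [e])
      · simp only [hG, sum_colour_inr]
    have hkc : ∀ d, (G d).colour k = d h := fun d => sum_colour_inl _ _ _
    have hek : (G c).edge k = k := by
      have : (G c).edge k = halfSum V W (.inl (e h)) := sum_edge_inl _ _ _
      rw [this, hh]
    by_cases hE : E.1 k = k
    · -- the leg is not joined, so that the weights agree
      have hw : ∀ (d : V × Fin 3 → H), (∀ l, l ≠ h → d l = c l) →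
          pairWeight (blockWeight B (G d).colour side) (G c).edge E.1 =
            pairWeight (blockWeight B (G c).colour side) (G c).edge E.1 := by
        intro d hd
        refine pairWeight_congr fun x hx => ?_
        have x1 : x ≠ k := by rintro rfl; exact hx (hE.trans hek.symm)
        have x2 : E.1 x ≠ k := fun hc => x1 (by rw [← E.2.1 x, hc, hE])
        simp only [blockWeight, hne d hd _ x1, hne d hd _ x2]
      refine Eq.trans ?_ (congrArg₂ (· + ·) (congrArg (· • _) (hw c₁ h1).symm)
        (congrArg (· • _) (hw c₂ h2).symm))
      rw [← smul_add]
      congr 1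
      exact (clsInvariant H).linear E.1 E.2.1 _ _ _ k hE (fun x hx => hne c₁ h1 x hx)
        (fun x hx => hne c₂ h2 x hx) (by rw [hkc, hkc, hkc, h3])
    · -- the leg is joined: one factor of the weight is additive
      have hc : ∀ (d : V × Fin 3 → H), (∀ l, l ≠ h → d l = c l) →
          (⟨E.1, E.2.1, (G d).colour⟩ : TriGraph (V ⊕ W) H).cls =
            (⟨E.1, E.2.1, (G c).colour⟩ : TriGraph (V ⊕ W) H).cls := fun d hd =>
        cls_congr fun x hx => hne d hd x (by rintro rfl; exact hE hx)
      have hw : ∀ (d : V × Fin 3 → H), (∀ l, l ≠ h → d l = c l) →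
          pairWeight (blockWeight B (G d).colour side) (G c).edge E.1 =
            blockWeight B (G d).colour side k (E.1 k) * ∏ x ∈ Finset.univ.erase k,
              if E.1 x = (G c).edge x then 1 else blockWeight B (G c).colour side x (E.1 x) := by
        intro d hd
        rw [pairWeight, finprod_eq_prod_of_fintype, ← Finset.mul_prod_erase _ _ (Finset.mem_univ k),
          if_neg (by rw [hek]; exact hE)]
        congr 1
        refine Finset.prod_congr rfl fun x hx => ?_
        have x1 : x ≠ k := Finset.ne_of_mem_erase hx
        split_ifs with hx'
        · rfl
        · by_cases x2 : E.1 x = k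
          · have hs : side k.1 = 0 := rfl
            simp only [blockWeight, x2, hs, Nat.not_lt_zero, if_false]
          · simp only [blockWeight, hne d hd _ x1, hne d hd _ x2]
      have hadd : blockWeight B (G c).colour side k (E.1 k) =
          blockWeight B (G c₁).colour side k (E.1 k) + blockWeight B (G c₂).colour side k (E.1 k) := by
        have hs : side k.1 = 0 := rfl
        simp only [blockWeight, hkc, hs, Nat.not_lt_zero, if_false, h3, hB.add_left,
          hne c₁ h1 _ hE, hne c₂ h2 _ hE]
        split_ifs <;> ring
      refine Eq.trans ?_ (congrArg₂ (· + ·) (congrArg₂ (· • ·) (hw c₁ h1).symm (hc c₁ h1).symm)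
        (congrArg₂ (· • ·) (hw c₂ h2).symm (hc c₂ h2).symm))
      rw [← add_smul, ← add_mul, ← hadd]
      exact congrArg (· • _) (hw c fun _ _ => rfl)

end

section

/-! ### Associativity of the star product -/

/-- The bijection that reverses the order of three blocks. -/
def reverseEquiv (V W W' : Type) : (V ⊕ W) ⊕ W' ≃ (W' ⊕ W) ⊕ V where
  toFun := Sum.elim (Sum.elim .inr fun w => .inl (.inr w)) fun w => .inl (.inl w)
  invFun := Sum.elim (Sum.elim .inr fun w => .inl (.inr w)) fun w => .inl (.inl w)
  left_inv := by rintro ((_ | _) | _) <;> rfl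
  right_inv := by rintro ((_ | _) | _) <;> rfl

lemma sum_reverse_eq {V W W' H : Type} (G : TriGraph V H) (G' : TriGraph W H) (G'' : TriGraph W' H) :
    (G''.sum G').sum G = ((G.sum G').sum G'').map (vertexEquiv (reverseEquiv V W W')) := by
  ext h : 2
  · obtain ⟨(v | v) | v, i⟩ := h <;> rfl
  · obtain ⟨(v | v) | v, i⟩ := h <;> rfl

variable {V W W' H : Type} [AddCommGroup H]

/-- The star product with a graph on the left, as a homomorphism. -/
def starLeft {B : H → H → ℤ} (hB : IsBiadditive B) [Finite V] (G : TriGraph V H) :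
    GraphSpace H →+ GraphSpace H := (starInvariant hB.flip G).lift

lemma starLeft_cls {B : H → H → ℤ} (hB : IsBiadditive B) [Finite V] [Finite W] (G : TriGraph V H)
    (G' : TriGraph W H) : starLeft hB G G'.cls = star B G G' := by
  rw [starLeft, GraphInvariant.lift_cls]
  exact star_flip B G G'

lemma starLeft_ext {f f' : GraphSpace H →+ GraphSpace H}
    (h : ∀ Γ : UniTriGraph H, f Γ.toTri.cls = f' Γ.toTri.cls) : f = f' :=
  GraphSpace.hom_ext fun Γ => by rw [← toTri_cls]; exact h Γ

/-- The star product is an invariant of its first factor, with values in homomorphisms. -/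
def mulInvariant {B : H → H → ℤ} (hB : IsBiadditive B) :
    GraphInvariant H (GraphSpace H →+ GraphSpace H) where
  val G := starLeft hB G
  congr e he c c' h := starLeft_ext fun Γ => by
    rw [starLeft_cls, starLeft_cls]; exact (starInvariant hB Γ.toTri).congr e he c c' h
  map G ε p := starLeft_ext fun Γ => by
    rw [starLeft_cls, AddMonoidHom.smul_apply, starLeft_cls]
    exact (starInvariant hB Γ.toTri).map G ε p
  ihx G v w hvw h := starLeft_ext fun Γ => by
    rw [AddMonoidHom.add_apply, AddMonoidHom.add_apply, starLeft_cls, starLeft_cls, starLeft_cls]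
    exact (starInvariant hB Γ.toTri).ihx G v w hvw h
  linear e he c c₁ c₂ h hh h1 h2 h3 := starLeft_ext fun Γ => by
    rw [AddMonoidHom.add_apply, starLeft_cls, starLeft_cls, starLeft_cls]
    exact (starInvariant hB Γ.toTri).linear e he c c₁ c₂ h hh h1 h2 h3

/-- The star product as a biadditive map. -/
def starMul {B : H → H → ℤ} (hB : IsBiadditive B) : GraphSpace H →+ GraphSpace H →+ GraphSpace H :=
  (mulInvariant hB).lift

lemma starMul_cls {B : H → H → ℤ} (hB : IsBiadditive B) [Finite V] [Finite W] (G : TriGraph V H)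
    (G' : TriGraph W H) : starMul hB G.cls G'.cls = star B G G' := by
  rw [starMul, GraphInvariant.lift_cls]; exact starLeft_cls hB G G'

lemma starMul_flip {B : H → H → ℤ} (hB : IsBiadditive B) (x y : GraphSpace H) :
    starMul hB.flip y x = starMul hB x y := by
  have : (starMul hB.flip).flip = starMul hB := GraphSpace.hom_ext fun Γ => starLeft_ext fun Γ' => by
    rw [AddMonoidHom.flip_apply, ← toTri_cls, starMul_cls, starMul_cls]; exact star_flip B _ _
  rw [← this]; rfl

section Restrict

variable {X Y Z : Type} (s : X ⊕ Y ≃ Z)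

/-- The restriction of an involution to a summand; points that leave the summand become fixed. -/
def cutInl (E : Z → Z) (x : X) : X := Sum.elim id (fun _ => x) (s.symm (E (s (.inl x))))

variable {s} {E : Z → Z}

lemma cutInl_of_inl {x y : X} (h : E (s (.inl x)) = s (.inl y)) : cutInl s E x = y := by
  simp [cutInl, h]

lemma cutInl_of_inr {x : X} {y : Y} (h : E (s (.inl x)) = s (.inr y)) : cutInl s E x = x := by
  simp [cutInl, h]

lemma exists_inl_or_inr (s : X ⊕ Y ≃ Z) (z : Z) : (∃ x, z = s (.inl x)) ∨ ∃ y, z = s (.inr y) := by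
  obtain ⟨x | y, rfl⟩ := s.surjective z
  · exact .inl ⟨x, rfl⟩
  · exact .inr ⟨y, rfl⟩

lemma cutInl_involutive (hE : Function.Involutive E) : Function.Involutive (cutInl s E) := by
  intro x
  rcases exists_inl_or_inr s (E (s (.inl x))) with ⟨y, h⟩ | ⟨y, h⟩
  · rw [cutInl_of_inl h, cutInl_of_inl (y := x)]; rw [← h, hE]
  · rw [cutInl_of_inr h, cutInl_of_inr h]

lemma apply_of_cutInl_ne {x : X} (h : cutInl s E x ≠ x) : E (s (.inl x)) = s (.inl (cutInl s E x)) := by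
  rcases exists_inl_or_inr s (E (s (.inl x))) with ⟨y, h'⟩ | ⟨y, h'⟩
  · rw [cutInl_of_inl h', h']
  · exact (h (cutInl_of_inr h')).elim

end Restrict

/-- Joining legs of the first summand, and then legs of the result with legs of the second summand,
is the same as joining legs of the disjoint union. -/
lemma sum_star_extend [Finite V] [Finite W] (B : H → H → ℤ) (G : TriGraph V H) (G' : TriGraph W H)
    (ω : V × Fin 3 → V × Fin 3 → ℤ) (ω' : (V ⊕ W) × Fin 3 → (V ⊕ W) × Fin 3 → ℤ)
    (h₁ : ∀ a b, ω' (halfSum V W (.inl a)) (halfSum V W (.inl b)) = ω a b)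
    (h₂ : ∀ a b, ω' (halfSum V W (.inl a)) (halfSum V W (.inr b)) =
      blockWeight B (G.sum G').colour side (halfSum V W (.inl a)) (halfSum V W (.inr b)))
    (h₃ : ∀ a b, ω' (halfSum V W (.inr a)) b =
      blockWeight B (G.sum G').colour side (halfSum V W (.inr a)) b) :
    ∑ E : Extension G.edge, pairWeight ω G.edge E.1 • star B (G.extend E) G' =
      extSum (G.sum G') ω' := by
  classical
  have := Fintype.ofFinite V
  have := Fintype.ofFinite W
  set s := halfSum V W with hs
  set ω₀ := blockWeight B (G.sum G').colour side with hω₀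
  have hcol : ∀ E : Extension G.edge, ((G.extend E).sum G').colour = (G.sum G').colour :=
    fun E => rfl
  have hinl : ∀ (E : Extension G.edge) x, ((G.extend E).sum G').edge (s (.inl x)) = s (.inl (E.1 x)) :=
    fun E x => sum_edge_inl _ _ _
  have hinr : ∀ (E : Extension G.edge) x, ((G.extend E).sum G').edge (s (.inr x)) =
      s (.inr (G'.edge x)) := fun E x => sum_edge_inr _ _ _
  have hz : ∀ a b, ω₀ (s (.inl a)) (s (.inl b)) = 0 := fun a b => by
    simp [hω₀, blockWeight, side, hs]
  -- the part of an extension that lives on the first summand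
  let r : Extension (G.sum G').edge → Extension G.edge := fun E =>
    ⟨cutInl s E.1, cutInl_involutive E.2.1, fun x hx => cutInl_of_inl (by
      have e1 : (G.sum G').edge (s (.inl x)) = s (.inl (G.edge x)) := sum_edge_inl _ _ _
      rw [E.2.2, e1]
      rw [e1]; intro h; exact hx (Sum.inl_injective (s.injective h)))⟩
  let f : Extension (G.sum G').edge → Σ E : Extension G.edge, Extension ((G.extend E).sum G').edge :=
    fun E => ⟨r E, E.1, E.2.1, fun x hx => by
      rcases exists_inl_or_inr s x with ⟨x, rfl⟩ | ⟨x, rfl⟩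
      · rw [hinl] at hx ⊢
        exact apply_of_cutInl_ne fun h => hx (congrArg (fun y => s (.inl y)) h)
      · rw [hinr] at hx ⊢
        have e1 : (G.sum G').edge (s (.inr x)) = s (.inr (G'.edge x)) := sum_edge_inr _ _ _
        rw [E.2.2 _ (by rw [e1]; exact hx), e1]⟩
  simp only [star, extSum, Finset.smul_sum]
  rw [Finset.sum_sigma', Finset.univ_sigma_univ]
  symm
  refine Fintype.sum_of_injective f (fun E E' h => ?_) _ _ ?_ ?_
  · exact Subtype.ext (congrArg (fun p : Σ E : Extension G.edge,
      Extension ((G.extend E).sum G').edge => p.2.1) h)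
  · rintro ⟨E₁, E₂⟩ hr
    by_contra hne
    rw [hcol] at hne
    have hw : pairWeight ω₀ ((G.extend E₁).sum G').edge E₂.1 ≠ 0 := fun h0 => hne (by
      simp only
      rw [h0, zero_smul, smul_zero])
    refine hr ⟨⟨E₂.1, E₂.2.1, fun x hx => ?_⟩, ?_⟩
    · have key : ((G.extend E₁).sum G').edge x = (G.sum G').edge x := by
        rcases exists_inl_or_inr s x with ⟨x, rfl⟩ | ⟨x, rfl⟩
        · have e1 : (G.sum G').edge (s (.inl x)) = s (.inl (G.edge x)) := sum_edge_inl _ _ _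
          rw [hinl, e1, E₁.2.2]
          rw [e1] at hx; intro h; exact hx (congrArg (fun y => s (.inl y)) h)
        · rw [hinr]; exact (sum_edge_inr _ _ _).symm
      rw [E₂.2.2 x (by rw [key]; exact hx), key]
    · refine Sigma.subtype_ext (Subtype.ext (funext fun x => ?_)) rfl
      change cutInl s E₂.1 x = E₁.1 x
      rcases exists_inl_or_inr s (E₂.1 (s (.inl x))) with ⟨y, h⟩ | ⟨y, h⟩
      · rw [cutInl_of_inl h]
        by_contra hxy
        refine pairWeight_ne_zero hw (s (.inl x)) ?_ (by rw [h]; exact hz _ _)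
        rw [h, hinl]; intro h'; exact hxy (Sum.inl_injective (s.injective h'))
      · rw [cutInl_of_inr h]
        by_contra hxy
        have e2 := E₂.2.2 (s (.inl x)) (by
          rw [hinl]; intro h'; exact hxy (Sum.inl_injective (s.injective h')).symm)
        rw [h, hinl] at e2
        exact Sum.inr_ne_inl (s.injective e2)
  · intro E
    change pairWeight ω' (G.sum G').edge E.1 • _ =
      pairWeight ω G.edge (r E).1 • pairWeight ω₀ ((G.extend (r E)).sum G').edge E.1 •
        ((G.sum G').extend E).cls
    rw [smul_smul]
    congr 1
    unfold pairWeight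
    rw [finprod_eq_prod_of_fintype, finprod_eq_prod_of_fintype, finprod_eq_prod_of_fintype,
      ← s.prod_comp, ← s.prod_comp, Fintype.prod_sum_type, Fintype.prod_sum_type, ← mul_assoc,
      ← Finset.prod_mul_distrib]
    congr 1
    · refine Finset.prod_congr rfl fun x _ => ?_
      have e1 : (G.sum G').edge (s (.inl x)) = s (.inl (G.edge x)) := sum_edge_inl _ _ _
      rw [hinl, e1]
      rcases exists_inl_or_inr s (E.1 (s (.inl x))) with ⟨y, h⟩ | ⟨y, h⟩
      · have e2 : (r E).1 x = y := cutInl_of_inl h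
        rw [h, e2, if_pos rfl, mul_one, h₁]
        simp only [s.injective.eq_iff, Sum.inl.injEq]
        by_cases hyx : y = G.edge x <;> simp [hyx]
      · have e2 : (r E).1 x = x := cutInl_of_inr h
        have e3 : G.edge x = x := by
          by_contra hc
          have := E.2.2 (s (.inl x)) (by
            rw [e1]; intro h'; exact hc (Sum.inl_injective (s.injective h')))
          rw [h, e1] at this
          exact Sum.inr_ne_inl (s.injective this)
        have e4 : ∀ z, s (.inr y) ≠ s (.inl z) := fun z h' => Sum.inr_ne_inl (s.injective h')
        rw [h, e2, e3, if_neg (e4 _), if_pos rfl, one_mul, if_neg (e4 _), h₂]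
    · refine Finset.prod_congr rfl fun x _ => ?_
      have e1 : (G.sum G').edge (s (.inr x)) = s (.inr (G'.edge x)) := sum_edge_inr _ _ _
      rw [hinr, e1, h₃]

/-- The three blocks of a disjoint union. -/
def side₃ : (V ⊕ W) ⊕ W' → ℕ := Sum.elim (Sum.elim (fun _ => 0) fun _ => 1) fun _ => 2

lemma starMul_starMul {B : H → H → ℤ} (hB : IsBiadditive B) [Finite V] [Finite W] [Finite W']
    (G : TriGraph V H) (G' : TriGraph W H) (G'' : TriGraph W' H) :
    starMul hB (starMul hB G.cls G'.cls) G''.cls =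
      extSum ((G.sum G').sum G'') (blockWeight B ((G.sum G').sum G'').colour side₃) := by
  rw [starMul_cls, star, extSum, map_sum, AddMonoidHom.finsetSum_apply, ← sum_star_extend B (G.sum G') G''
    (blockWeight B (G.sum G').colour side)]
  · refine Finset.sum_congr rfl fun E _ => ?_
    rw [map_zsmul, AddMonoidHom.smul_apply, starMul_cls]
  · rintro ⟨a | a, i⟩ ⟨b | b, j⟩ <;> rfl
  · rintro ⟨a | a, i⟩ ⟨b, j⟩ <;> rfl
  · rintro ⟨a, i⟩ ⟨(b | b) | b, j⟩ <;> rfl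

lemma starMul_assoc {B : H → H → ℤ} (hB : IsBiadditive B) (x y z : GraphSpace H) :
    starMul hB (starMul hB x y) z = starMul hB x (starMul hB y z) := by
  have key : ∀ Γ Γ' Γ'' : UniTriGraph H,
      starMul hB (starMul hB (graphClass Γ) (graphClass Γ')) (graphClass Γ'') =
        starMul hB (graphClass Γ) (starMul hB (graphClass Γ') (graphClass Γ'')) := by
    intro Γ Γ' Γ''
    have e : starMul hB (graphClass Γ) (starMul hB (graphClass Γ') (graphClass Γ'')) =
        starMul hB.flip (starMul hB.flip (graphClass Γ'') (graphClass Γ')) (graphClass Γ) := by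
      rw [starMul_flip hB, starMul_flip hB]
    rw [e, ← toTri_cls, ← toTri_cls, ← toTri_cls, starMul_starMul, starMul_starMul,
      sum_reverse_eq Γ.toTri Γ'.toTri Γ''.toTri,
      extSum_map_vertexEquiv]
    have h := blockWeight_map (fun x y => B y x) (vertexEquiv (reverseEquiv _ _ _))
      ((Γ.toTri.sum Γ'.toTri).sum Γ''.toTri) (b := fun v => 2 - side₃ v) (b' := side₃)
      (by rintro ⟨(v | v) | v, i⟩ <;> rfl)
    rw [h, ← blockWeight_transpose B _ (b := side₃) (by
      rintro ((v | v) | v) ((w | w) | w) <;> simp [side₃]), extSum_transpose]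
  induction x using GraphSpace.induction_on with
  | neg x hx => simp only [map_neg, AddMonoidHom.neg_apply, hx]
  | add x x' hx hx' => simp only [map_add, AddMonoidHom.add_apply, hx, hx']
  | zero => simp only [map_zero, AddMonoidHom.zero_apply]
  | of Γ =>
    induction y using GraphSpace.induction_on with
    | neg x hx => simp only [map_neg, AddMonoidHom.neg_apply, hx]
    | add x x' hx hx' => simp only [map_add, AddMonoidHom.add_apply, hx, hx']
    | zero => simp only [map_zero, AddMonoidHom.zero_apply]
    | of Γ' =>
      induction z using GraphSpace.induction_on with
      | neg x hx => simp only [map_neg, hx]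
      | add x x' hx hx' => simp only [map_add, hx, hx']
      | zero => simp only [map_zero]
      | of Γ'' => exact key Γ Γ' Γ''

lemma star_of_isEmpty (B : H → H → ℤ) [Finite V] [Finite W] [IsEmpty V] (G : TriGraph V H)
    (G' : TriGraph W H) : star B G G' = G'.cls := by
  rw [star, extSum_eq_cls]
  · have : G.sum G' = G'.map (vertexEquiv (Equiv.emptySum V W).symm) := by
      ext h : 2
      · obtain ⟨v | v, i⟩ := h
        · exact (IsEmpty.false v).elim
        · rfl
      · obtain ⟨v | v, i⟩ := h
        · exact (IsEmpty.false v).elim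
        · rfl
    rw [this]
    exact (clsInvariant H).map_vertexEquiv _ _
  · rintro ⟨a | a, i⟩ ⟨b | b, j⟩
    · exact (IsEmpty.false a).elim
    · exact (IsEmpty.false a).elim
    · exact (IsEmpty.false b).elim
    · rfl

lemma starMul_one_left {B : H → H → ℤ} (hB : IsBiadditive B) (x : GraphSpace H) :
    starMul hB (graphClass UniTriGraph.empty) x = x := by
  have : starMul hB (graphClass UniTriGraph.empty) = AddMonoidHom.id _ := starLeft_ext fun Γ => by
    have : IsEmpty (Fin (UniTriGraph.empty (H := H)).order) := inferInstanceAs (IsEmpty (Fin 0))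
    rw [← toTri_cls, starMul_cls, star_of_isEmpty]; rfl
  rw [this]; rfl

lemma starMul_one_right {B : H → H → ℤ} (hB : IsBiadditive B) (x : GraphSpace H) :
    starMul hB x (graphClass UniTriGraph.empty) = x := by
  rw [← starMul_flip, starMul_one_left]

end

section

/-! ### The star product as a sum of contractions -/

section Glue

open UniTriGraph

variable {H : Type}

/-- The partial bijection whose graph is a given relation. -/
def pequivOfRel {α β : Type} (R : α → β → Prop) (h₁ : ∀ a b b', R a b → R a b' → b = b')
    (h₂ : ∀ a a' b, R a b → R a' b → a = a') : α ≃. β := by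
  classical
  exact
  { toFun := fun a => if h : ∃ b, R a b then some h.choose else none
    invFun := fun b => if h : ∃ a, R a b then some h.choose else none
    inv := fun a b => by
      have e₁ : (a ∈ if h : ∃ a, R a b then some h.choose else none) ↔ R a b := by
        split_ifs with h
        · rw [Option.mem_some_iff]
          exact ⟨fun e => e ▸ h.choose_spec, fun e => h₂ _ _ _ h.choose_spec e⟩
        · simpa using fun e => h ⟨a, e⟩
      have e₂ : (b ∈ if h : ∃ b, R a b then some h.choose else none) ↔ R a b := by
        split_ifs with h
        · rw [Option.mem_some_iff]
          exact ⟨fun e => e ▸ h.choose_spec, fun e => h₁ _ _ _ h.choose_spec e⟩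
        · simpa using fun e => h ⟨b, e⟩
      exact e₁.trans e₂.symm }

lemma pequivOfRel_eq_some {α β : Type} {R : α → β → Prop} {h₁ : ∀ a b b', R a b → R a b' → b = b'}
    {h₂ : ∀ a a' b, R a b → R a' b → a = a'} {a : α} {b : β} :
    pequivOfRel R h₁ h₂ a = some b ↔ R a b := by
  classical
  change (if h : ∃ b, R a b then some h.choose else none) = some b ↔ _
  split_ifs with h
  · rw [Option.some_inj]
    exact ⟨fun e => e ▸ h.choose_spec, fun e => h₁ _ _ _ h.choose_spec e⟩
  · simpa using fun e => h ⟨b, e⟩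

variable (Γ Γ' : UniTriGraph H) (m : Γ.Leg ≃. Γ'.Leg)

lemma glueEdge_inl_leg (a : Γ.Leg) : glueEdge Γ Γ' m (.inl a.1) =
    (m a).elim (.inl a.1) fun k => .inr k.1 := by
  simp only [glueEdge, a.2, dite_true, Subtype.coe_eta]

lemma glueEdge_inr_leg (a : Γ'.Leg) : glueEdge Γ Γ' m (.inr a.1) =
    (m.symm a).elim (.inr a.1) fun k => .inl k.1 := by
  simp only [glueEdge, a.2, dite_true, Subtype.coe_eta]

lemma glueEdge_inl_of_ne {h : Γ.HalfEdge} (hh : Γ.edge h ≠ h) :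
    glueEdge Γ Γ' m (.inl h) = .inl (Γ.edge h) := by
  simp only [glueEdge, hh, dite_false]

lemma glueEdge_inr_of_ne {h : Γ'.HalfEdge} (hh : Γ'.edge h ≠ h) :
    glueEdge Γ Γ' m (.inr h) = .inr (Γ'.edge h) := by
  simp only [glueEdge, hh, dite_false]

/-- Gluing legs of `Γ` to legs of `Γ'`, as a way to join legs of the disjoint union. -/
def glueExtension : Extension (Γ.toTri.sum Γ'.toTri).edge :=
  ⟨fun h => halfSum _ _ (glueEdge Γ Γ' m ((halfSum _ _).symm h)),
    fun h => by
      simp only [Equiv.symm_apply_apply, glueEdge_involutive Γ Γ' m ((halfSum _ _).symm h),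
        Equiv.apply_symm_apply],
    fun h hh => by
      obtain ⟨h | h, rfl⟩ := (halfSum _ _).surjective h
      · rw [sum_edge_inl] at hh ⊢
        beta_reduce
        rw [Equiv.symm_apply_apply, glueEdge_inl_of_ne]
        · rfl
        · exact fun e => hh (congrArg (fun x => halfSum _ _ (.inl x)) e)
      · rw [sum_edge_inr] at hh ⊢
        beta_reduce
        rw [Equiv.symm_apply_apply, glueEdge_inr_of_ne]
        · rfl
        · exact fun e => hh (congrArg (fun x => halfSum _ _ (.inr x)) e)⟩

lemma glueExtension_apply (h : Γ.HalfEdge ⊕ Γ'.HalfEdge) :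
    (glueExtension Γ Γ' m).1 (halfSum _ _ h) = halfSum _ _ (glueEdge Γ Γ' m h) := by
  simp [glueExtension]

lemma glueExtension_injective : Function.Injective (glueExtension Γ Γ') := by
  intro m m' h
  refine PEquiv.ext fun a => ?_
  have e := congrArg (fun E => (halfSum _ _).symm (E.1 (halfSum _ _ (.inl a.1)))) h
  simp only [glueExtension_apply, Equiv.symm_apply_apply, glueEdge_inl_leg] at e
  rcases hm : m a with _ | k <;> rcases hm' : m' a with _ | k' <;> rw [hm, hm'] at e <;>
    simp [Subtype.ext_iff] at e ⊢
  exact e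

/-- Only gluings contribute to the star product. -/
lemma exists_glueExtension_eq {B : H → H → ℤ} (E : Extension (Γ.toTri.sum Γ'.toTri).edge)
    (hE : pairWeight (blockWeight B (Γ.toTri.sum Γ'.toTri).colour side)
      (Γ.toTri.sum Γ'.toTri).edge E.1 ≠ 0) : ∃ m, glueExtension Γ Γ' m = E := by
  set s := halfSum (Fin Γ.order) (Fin Γ'.order) with hs
  have h1 : ∀ h h', E.1 (s (.inl h)) = s (.inl h') → h' = Γ.edge h := fun h h' e => by
    by_contra hne
    refine pairWeight_ne_zero hE (s (.inl h)) ?_ ?_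
    · rw [e]; intro e'; rw [sum_edge_inl] at e'
      exact hne (Sum.inl_injective (s.injective e'))
    · rw [e]; simp [blockWeight, side, hs]
  have h2 : ∀ h h', E.1 (s (.inr h)) = s (.inr h') → h' = Γ'.edge h := fun h h' e => by
    by_contra hne
    refine pairWeight_ne_zero hE (s (.inr h)) ?_ ?_
    · rw [e]; intro e'; rw [sum_edge_inr] at e'
      exact hne (Sum.inr_injective (s.injective e'))
    · rw [e]; simp [blockWeight, side, hs]
  have h3 : ∀ h h', E.1 (s (.inl h)) = s (.inr h') → Γ.edge h = h := fun h h' e => by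
    by_contra hne
    have := E.2.2 (s (.inl h)) (by
      rw [sum_edge_inl]; exact fun e' => hne (Sum.inl_injective (s.injective e')))
    rw [e, sum_edge_inl] at this
    exact Sum.inr_ne_inl (s.injective this)
  have h4 : ∀ h h', E.1 (s (.inr h)) = s (.inl h') → Γ'.edge h = h := fun h h' e => by
    by_contra hne
    have := E.2.2 (s (.inr h)) (by
      rw [sum_edge_inr]; exact fun e' => hne (Sum.inr_injective (s.injective e')))
    rw [e, sum_edge_inr] at this
    exact Sum.inl_ne_inr (s.injective this)
  have hinv : ∀ {x y}, E.1 x = y → E.1 y = x := fun e => by rw [← e, E.2.1]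
  let m : Γ.Leg ≃. Γ'.Leg := pequivOfRel (fun a b => E.1 (s (.inl a.1)) = s (.inr b.1))
    (fun a b b' e e' => Subtype.ext (Sum.inr_injective (s.injective (e.symm.trans e'))))
    (fun a a' b e e' => Subtype.ext (Sum.inl_injective (s.injective
      ((hinv e).symm.trans (hinv e')))))
  refine ⟨m, Subtype.ext (funext fun x => ?_)⟩
  rcases exists_inl_or_inr s x with ⟨h, rfl⟩ | ⟨h, rfl⟩
  · rw [glueExtension_apply]
    rcases exists_inl_or_inr s (E.1 (s (.inl h))) with ⟨h', e⟩ | ⟨h', e⟩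
    · rw [e, h1 h h' e]
      congr 1
      by_cases hh : Γ.edge h = h
      · rw [glueEdge_inl_leg Γ Γ' m ⟨h, hh⟩]
        rcases hm : m ⟨h, hh⟩ with _ | k
        · simp [hh]
        · have := pequivOfRel_eq_some.1 hm
          rw [e] at this
          exact (Sum.inl_ne_inr (s.injective this)).elim
      · exact glueEdge_inl_of_ne _ _ _ hh
    · rw [e]
      congr 1
      rw [glueEdge_inl_leg Γ Γ' m ⟨h, h3 _ _ e⟩,
        pequivOfRel_eq_some (b := ⟨h', h4 _ _ (hinv e)⟩) |>.2 e]
      rfl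
  · rw [glueExtension_apply]
    rcases exists_inl_or_inr s (E.1 (s (.inr h))) with ⟨h', e⟩ | ⟨h', e⟩
    · rw [e]
      congr 1
      rw [glueEdge_inr_leg Γ Γ' m ⟨h, h4 _ _ e⟩,
        (PEquiv.eq_some_iff m).2 (pequivOfRel_eq_some (a := ⟨h', h3 _ _ (hinv e)⟩) |>.2 (hinv e))]
      rfl
    · rw [e, h2 h h' e]
      congr 1
      by_cases hh : Γ'.edge h = h
      · rw [glueEdge_inr_leg Γ Γ' m ⟨h, hh⟩]
        rcases hm : m.symm ⟨h, hh⟩ with _ | k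
        · simp [hh]
        · have hk : E.1 (s (.inl k.1)) = s (.inr h) :=
            (pequivOfRel_eq_some (R := fun (a : Γ.Leg) (b : Γ'.Leg) =>
              E.1 (s (.inl a.1)) = s (.inr b.1))).1 ((PEquiv.eq_some_iff m).1 hm)
          have := hinv hk
          rw [e] at this
          exact (Sum.inr_ne_inl (s.injective this)).elim
      · exact glueEdge_inr_of_ne _ _ _ hh

/-- The weight of a gluing; all minus signs come from the pairs of glued legs. -/
lemma pairWeight_glueExtension (B : H → H → ℤ) :
    pairWeight (blockWeight B (Γ.toTri.sum Γ'.toTri).colour side) (Γ.toTri.sum Γ'.toTri).edge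
      (glueExtension Γ Γ' m).1 = (-1) ^ gluedPairs m * weight B Γ Γ' m := by
  classical
  set s := halfSum (Fin Γ.order) (Fin Γ'.order) with hs
  have e : (-1 : ℤ) ^ gluedPairs m * weight B Γ Γ' m =
      ∏ a : Γ.Leg, (m a).elim 1 fun b => -B (Γ.colour a) (Γ'.colour b) := by
    rw [gluedPairs, weight, ← Finset.prod_const, Finset.prod_filter, ← Finset.prod_mul_distrib]
    refine Finset.prod_congr rfl fun a _ => ?_
    rcases m a with _ | k <;> simp
  rw [e, pairWeight, finprod_eq_prod_of_fintype, ← s.prod_comp, Fintype.prod_sum_type]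
  refine (congrArg₂ (· * ·) rfl (Finset.prod_eq_one fun k _ => ?_)).trans ?_
  · rw [glueExtension_apply, sum_edge_inr]
    by_cases hk : Γ'.edge k = k
    · rw [glueEdge_inr_leg Γ Γ' m ⟨k, hk⟩]
      rcases m.symm ⟨k, hk⟩ with _ | a
      · rw [if_pos]; exact congrArg (fun x => s (.inr x)) hk.symm
      · simp [blockWeight, side, hs]
    · rw [glueEdge_inr_of_ne _ _ _ hk]; exact if_pos rfl
  rw [mul_one]
  symm
  refine Fintype.prod_of_injective (fun a : Γ.Leg => a.1) Subtype.val_injective _ _ ?_ ?_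
  · intro h hh
    have hh' : Γ.edge h ≠ h := fun hc => hh ⟨⟨h, hc⟩, rfl⟩
    rw [glueExtension_apply, sum_edge_inl, glueEdge_inl_of_ne _ _ _ hh']; exact if_pos rfl
  · rintro ⟨h, hh⟩
    rw [glueExtension_apply, sum_edge_inl, glueEdge_inl_leg Γ Γ' m ⟨h, hh⟩]
    rcases m ⟨h, hh⟩ with _ | k
    · rw [if_pos]
      · rfl
      · exact congrArg (fun x => s (.inl x)) hh.symm
    · simp [blockWeight, side, hs]; rfl

lemma glueExtension_bot :
    glueExtension Γ Γ' ⊥ = Extension.refl (Γ.toTri.sum Γ'.toTri).edge_edge := by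
  refine Subtype.ext (funext fun x => ?_)
  obtain ⟨h | h, rfl⟩ := (halfSum _ _).surjective x
  · rw [glueExtension_apply]
    change _ = (Γ.toTri.sum Γ'.toTri).edge _
    rw [sum_edge_inl]
    by_cases hh : Γ.edge h = h
    · rw [glueEdge_inl_leg Γ Γ' ⊥ ⟨h, hh⟩]; exact congrArg (fun x => halfSum _ _ (.inl x)) hh.symm
    · rw [glueEdge_inl_of_ne _ _ _ hh]; rfl
  · rw [glueExtension_apply]
    change _ = (Γ.toTri.sum Γ'.toTri).edge _
    rw [sum_edge_inr]
    by_cases hh : Γ'.edge h = h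
    · rw [glueEdge_inr_leg Γ Γ' ⊥ ⟨h, hh⟩]; exact congrArg (fun x => halfSum _ _ (.inr x)) hh.symm
    · rw [glueEdge_inr_of_ne _ _ _ hh]; rfl

variable [AddCommGroup H]

lemma graphClass_glue :
    graphClass (Γ.glue Γ' m) = ((Γ.toTri.sum Γ'.toTri).extend (glueExtension Γ Γ' m)).cls := by
  rw [← toTri_cls, cls_eq_of_iso (G' := (Γ.glue Γ' m).toTri) (ε := finSumFinEquiv) (p := fun _ => 1)
    (G := (Γ.toTri.sum Γ'.toTri).extend (glueExtension Γ Γ' m))]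
  · simp
  all_goals
    intro h
    obtain ⟨h, rfl⟩ := (halfSum _ _).surjective h
    have hx : ∀ x, blockEquiv finSumFinEquiv (fun _ => 1) (halfSum _ _ x) =
      sumHalfEdge Γ.order Γ'.order x := by rintro (x | x) <;> rfl
  · refine (congrArg (fun y => sumHalfEdge Γ.order Γ'.order (glueEdge Γ Γ' m
      ((sumHalfEdge Γ.order Γ'.order).symm y))) (hx h)).trans ?_
    rw [Equiv.symm_apply_apply]
    exact ((congrArg (blockEquiv finSumFinEquiv fun _ => 1) (glueExtension_apply Γ Γ' m h)).trans
      (hx _)).symm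
  · intro _
    refine (congrArg (fun y => Sum.elim Γ.colour Γ'.colour
      ((sumHalfEdge Γ.order Γ'.order).symm y)) (hx h)).trans ?_
    rw [Equiv.symm_apply_apply]
    exact congrArg (Sum.elim Γ.colour Γ'.colour) (Equiv.symm_apply_apply _ _).symm

lemma star_toTri (B : H → H → ℤ) : star B Γ.toTri Γ'.toTri =
    ∑ m : Γ.Leg ≃. Γ'.Leg, ((-1 : ℤ) ^ gluedPairs m * weight B Γ Γ' m) • graphClass (Γ.glue Γ' m) := by
  symm
  refine Fintype.sum_of_injective (glueExtension Γ Γ') (glueExtension_injective Γ Γ') _ _ ?_ ?_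
  · intro E hE
    have h0 : pairWeight (blockWeight B (Γ.toTri.sum Γ'.toTri).colour side)
        (Γ.toTri.sum Γ'.toTri).edge E.1 = 0 := by
      by_contra hc; exact hE (exists_glueExtension_eq Γ Γ' E hc)
    rw [h0, zero_smul]
  · intro m
    rw [pairWeight_glueExtension, graphClass_glue]

lemma star_toTri_eq_finsum (B : H → H → ℤ) :
    star B Γ.toTri Γ'.toTri = ∑ᶠ l : ℕ, contraction B l Γ Γ' := by
  rw [finsum_eq_sum_of_support_subset (s := Finset.range (Fintype.card Γ.Leg + 1)), star_toTri]
  · rw [← Finset.sum_fiberwise_of_maps_to (g := gluedPairs)]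
    · refine Finset.sum_congr rfl fun l _ => ?_
      rw [contraction, Finset.smul_sum]
      refine Finset.sum_congr rfl fun m hm => ?_
      rw [(Finset.mem_filter.1 hm).2, mul_smul]
    · intro m _
      rw [Finset.mem_range, Nat.lt_succ_iff]
      exact Finset.card_filter_le _ _
  · intro l hl
    rw [Finset.coe_range, Set.mem_Iio]
    by_contra hc
    exact hl (contraction_eq_zero B Γ Γ' l (by omega))

lemma support_contraction_finite (B : H → H → ℤ) :
    (Function.support fun l => contraction B l Γ Γ').Finite :=
  (Set.finite_le_nat (Fintype.card Γ.Leg)).subset fun l hl => by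
    change l ≤ _
    by_contra hc
    exact hl (contraction_eq_zero B Γ Γ' l (by omega))

/-- The star product, as an associative product with unit. -/
def starProduct {B : H → H → ℤ} (hB : IsBiadditive B) : StarProduct B where
  mul := starMul hB
  mul_graphClass Γ Γ' := by
    rw [← toTri_cls, ← toTri_cls, starMul_cls, star_toTri_eq_finsum]
  mul_assoc := starMul_assoc hB
  one_mul := starMul_one_left hB
  mul_one := starMul_one_right hB

lemma gluedPairs_eq_zero {α β : Type} [Fintype α] {m : α ≃. β} : gluedPairs m = 0 ↔ m = ⊥ := by
  rw [gluedPairs, Finset.card_eq_zero, Finset.filter_eq_empty_iff]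
  refine ⟨fun h => PEquiv.ext fun a => ?_, ?_⟩
  · have := h (Finset.mem_univ a)
    rw [PEquiv.bot_apply]
    simpa using this
  · rintro rfl a _; simp

lemma contraction_zero (B : H → H → ℤ) : contraction B 0 Γ Γ' = (Γ.toTri.sum Γ'.toTri).cls := by
  have : (Finset.univ.filter fun m : Γ.Leg ≃. Γ'.Leg => gluedPairs m = 0) = {⊥} := by
    ext m; simp [gluedPairs_eq_zero]
  rw [contraction, this, Finset.sum_singleton, pow_zero, one_smul, graphClass_glue, glueExtension_bot]
  have hw : weight B Γ Γ' ⊥ = 1 := by simp [weight]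
  rw [hw, one_smul]; rfl

lemma sum_cls_comm {V W : Type} [Finite V] [Finite W] (G : TriGraph V H) (G' : TriGraph W H) :
    (G'.sum G).cls = (G.sum G').cls := by
  rw [sum_comm_eq]; exact (clsInvariant H).map_vertexEquiv _ _

lemma finsum_nat_eq_zero_add {M : Type} [AddCommMonoid M] {f : ℕ → M}
    (hf : (Function.support f).Finite) : ∑ᶠ l, f l = f 0 + ∑ᶠ l, f (l + 1) := by
  obtain ⟨n, hn⟩ := hf.bddAbove
  rw [finsum_eq_sum_of_support_subset (s := Finset.range (n + 1)), Finset.sum_range_succ', add_comm,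
    finsum_eq_sum_of_support_subset (s := Finset.range n)]
  · intro l hl
    have := hn hl
    simp only [Finset.coe_range, Set.mem_Iio]; omega
  · intro l hl
    have := hn hl
    simp only [Finset.coe_range, Set.mem_Iio]; omega

/-- The terms in which no legs are glued cancel in a commutator. -/
lemma commutator_ofGraph {B : H → H → ℤ} (S : StarProduct B) :
    S.ofGraph Γ * S.ofGraph Γ' - S.ofGraph Γ' * S.ofGraph Γ =
      ∑ᶠ l : ℕ, (contraction B (l + 1) Γ Γ' - contraction B (l + 1) Γ' Γ) := by
  have hs : ∀ Γ Γ', (Function.support fun l => contraction B (l + 1) Γ Γ').Finite := fun Γ Γ' =>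
    (support_contraction_finite Γ Γ' B).preimage (fun a _ b _ h => Nat.succ_injective h)
  have e : ∀ Γ Γ', S.ofGraph Γ * S.ofGraph Γ' = ∑ᶠ l : ℕ, contraction B l Γ Γ' :=
    S.mul_graphClass
  have hc : (contraction B 0 Γ Γ' : GraphSpace H) = contraction B 0 Γ' Γ := by
    rw [contraction_zero, contraction_zero, sum_cls_comm]
  rw [finsum_sub_distrib (hs _ _) (hs _ _)]
  have h1 := finsum_nat_eq_zero_add (support_contraction_finite Γ Γ' B)
  have h2 := finsum_nat_eq_zero_add (support_contraction_finite Γ' Γ B)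
  rw [← hc] at h2
  rw [e, e]
  refine (congrArg₂ (fun x y : GraphSpace H => x - y) h1 h2).trans ?_
  exact add_sub_add_left_eq_sub _ _ _

end Glue

end

section

/-! ### Connected graphs and components -/

variable {V W H : Type}

namespace TriGraph

/-- A set of vertices is saturated if no edge leaves it, that is, if it is a union of connected
components. -/
def IsSaturated (G : TriGraph V H) (S : Set V) : Prop := ∀ h, h.1 ∈ S → (G.edge h).1 ∈ S

/-- The number of saturated sets of vertices, which is `2 ^ k` for a graph with `k` components. -/
def saturatedCount (G : TriGraph V H) : ℕ := Nat.card {S : Set V // G.IsSaturated S}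

/-- A graph is connected if it is not empty and cannot be cut into two pieces. -/
def IsConnected (G : TriGraph V H) : Prop :=
  Nonempty V ∧ ∀ S, G.IsSaturated S → S = ∅ ∨ S = Set.univ

/-- The inclusion of the half-edges at a set of vertices. -/
def incl (S : Set V) (h : S × Fin 3) : V × Fin 3 := (h.1.1, h.2)

open Classical in
/-- The part of a graph at a set of vertices; edges that leave the set become legs. -/
def restrict (G : TriGraph V H) (S : Set V) : TriGraph S H where
  edge h := if hh : (G.edge (incl S h)).1 ∈ S then (⟨_, hh⟩, (G.edge (incl S h)).2) else h
  edge_edge h := by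
    by_cases hh : (G.edge (incl S h)).1 ∈ S
    · simp only [hh, dite_true]
      have : G.edge (incl S (⟨_, hh⟩, (G.edge (incl S h)).2)) = incl S h := G.edge_edge _
      simp only [this]
      exact dif_pos h.1.2
    · simp only [hh, dite_false]
  colour h := G.colour (incl S h)

variable {G : TriGraph V H} {S : Set V}

lemma incl_injective (S : Set V) : Function.Injective (incl S) := fun h k e =>
  by
  obtain ⟨e1, e2⟩ := Prod.mk.inj e
  exact Prod.ext (Subtype.ext e1) e2

lemma incl_restrict_edge (hS : G.IsSaturated S) (h : S × Fin 3) :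
    incl S ((G.restrict S).edge h) = G.edge (incl S h) := by
  have hh : (G.edge (incl S h)).1 ∈ S := hS _ h.1.2
  simp only [restrict, hh, dite_true]
  rfl

lemma IsSaturated.mem_iff (hS : G.IsSaturated S) (h : V × Fin 3) :
    (G.edge h).1 ∈ S ↔ h.1 ∈ S :=
  ⟨fun e => G.edge_edge h ▸ hS _ e, hS h⟩

lemma IsSaturated.compl (hS : G.IsSaturated S) : G.IsSaturated Sᶜ :=
  fun h hh e => hh ((hS.mem_iff h).1 e)

lemma isSaturated_empty (G : TriGraph V H) : G.IsSaturated ∅ := fun _ h => h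

lemma isSaturated_univ (G : TriGraph V H) : G.IsSaturated Set.univ := fun _ _ => trivial

lemma isSaturated_map (G : TriGraph V H) (τ : V × Fin 3 ≃ W × Fin 3) {T : Set W}
    (h : ∀ h, (τ h).1 ∈ T ↔ h.1 ∈ S) : (G.map τ).IsSaturated T ↔ G.IsSaturated S := by
  refine ⟨fun hT x hx => ?_, fun hS x hx => ?_⟩
  · have := hT (τ x) ((h x).2 hx)
    simp only [map, Equiv.symm_apply_apply] at this
    exact (h _).1 this
  · obtain ⟨x, rfl⟩ := τ.surjective x
    simp only [map, Equiv.symm_apply_apply]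
    exact (h _).2 (hS x ((h x).1 hx))

lemma restrict_map (G : TriGraph V H) (τ : V × Fin 3 ≃ W × Fin 3) {T : Set W}
    (h : ∀ h, (τ h).1 ∈ T ↔ h.1 ∈ S) (hS : G.IsSaturated S) (τ' : S × Fin 3 ≃ T × Fin 3)
    (hτ : ∀ h, incl T (τ' h) = τ (incl S h)) : (G.map τ).restrict T = (G.restrict S).map τ' := by
  have hT := (isSaturated_map G τ h).2 hS
  refine TriGraph.ext (funext fun x => ?_) (funext fun x => ?_)
  · obtain ⟨x, rfl⟩ := τ'.surjective x
    apply incl_injective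
    rw [incl_restrict_edge hT, hτ]
    simp only [map, Equiv.symm_apply_apply]
    rw [hτ, incl_restrict_edge hS]
  · obtain ⟨x, rfl⟩ := τ'.surjective x
    simp only [map, Equiv.symm_apply_apply, restrict]
    rw [hτ, Equiv.symm_apply_apply]

lemma isConnected_map (G : TriGraph V H) (ε : V ≃ W) (p : V → Equiv.Perm (Fin 3)) :
    (G.map (blockEquiv ε p)).IsConnected ↔ G.IsConnected := by
  refine and_congr ε.symm.nonempty_congr ⟨fun h S hS => ?_, fun h S hS => ?_⟩
  · have := h (ε.symm ⁻¹' S) ((isSaturated_map G (blockEquiv ε p) (S := S)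
      (by intro h; simp [blockEquiv_apply])).2 hS)
    rwa [Set.preimage_eq_empty_iff, ε.symm.surjective.range_eq, Set.disjoint_univ, 
      Set.preimage_eq_univ_iff, ε.symm.surjective.range_eq, Set.univ_subset_iff] at this
  · have := h (ε ⁻¹' S) ((isSaturated_map G (blockEquiv ε p) (T := S)
      (by intro h; simp [blockEquiv_apply])).1 hS)
    rwa [Set.preimage_eq_empty_iff, ε.surjective.range_eq, Set.disjoint_univ, 
      Set.preimage_eq_univ_iff, ε.surjective.range_eq, Set.univ_subset_iff] at this

lemma saturatedCount_map (G : TriGraph V H) (ε : V ≃ W) (p : V → Equiv.Perm (Fin 3)) :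
    (G.map (blockEquiv ε p)).saturatedCount = G.saturatedCount :=
  (Nat.card_congr ((Equiv.Set.congr ε).subtypeEquiv fun S => (isSaturated_map G (blockEquiv ε p)
    (by intro h; simp [blockEquiv_apply, Equiv.Set.congr])).symm)).symm

lemma IsConnected.saturatedCount (h : G.IsConnected) : G.saturatedCount = 2 := by
  obtain ⟨⟨v⟩, h⟩ := h
  refine Nat.card_eq_two_iff.2 ⟨⟨∅, G.isSaturated_empty⟩, ⟨Set.univ, G.isSaturated_univ⟩, ?_, ?_⟩
  · intro e
    have e' : (∅ : Set V) = Set.univ := congrArg Subtype.val e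
    exact Set.notMem_empty v (e' ▸ trivial)
  · refine Set.eq_univ_of_forall fun S => ?_
    rcases h S.1 S.2 with e | e
    · exact .inl (Subtype.ext e)
    · exact .inr (Subtype.ext e)

lemma isConnected_of_saturatedCount [Finite V] [hV : Nonempty V] (h : G.saturatedCount ≤ 2) :
    G.IsConnected := by
  refine ⟨hV, fun S hS => ?_⟩
  by_contra! hc
  have : 2 < G.saturatedCount := by
    rw [saturatedCount]
    let f : Fin 3 → {S : Set V // G.IsSaturated S} :=
      ![⟨∅, G.isSaturated_empty⟩, ⟨Set.univ, G.isSaturated_univ⟩, ⟨S, hS⟩]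
    have hf : Function.Injective f := by
      have hne : (∅ : Set V) ≠ Set.univ := Set.empty_ne_univ
      intro i j hij
      have := congrArg Subtype.val hij
      fin_cases i <;> fin_cases j <;> simp [f, hne, hne.symm, hc.2, hc.2.symm] at this ⊢
      · exact hc.1.ne_empty this.symm
      · exact hc.1.ne_empty this
    have := Nat.card_le_card_of_injective f hf
    rwa [Nat.card_fin] at this
  omega

lemma saturatedCount_of_isEmpty [IsEmpty V] (G : TriGraph V H) : G.saturatedCount = 1 := by
  rw [saturatedCount, Nat.card_eq_one_iff_unique]
  exact ⟨⟨fun _ _ => Subtype.ext (Subsingleton.elim _ _)⟩, ⟨⟨∅, G.isSaturated_empty⟩⟩⟩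

lemma isSaturated_sum (G : TriGraph V H) (G' : TriGraph W H) (S : Set (V ⊕ W)) :
    (G.sum G').IsSaturated S ↔ G.IsSaturated (Sum.inl ⁻¹' S) ∧ G'.IsSaturated (Sum.inr ⁻¹' S) := by
  refine ⟨fun h => ⟨fun x hx => ?_, fun x hx => ?_⟩, fun h x hx => ?_⟩
  · have := h (halfSum V W (.inl x)) hx
    rwa [sum_edge_inl] at this
  · have := h (halfSum V W (.inr x)) hx
    rwa [sum_edge_inr] at this
  · obtain ⟨x | x, rfl⟩ := (halfSum V W).surjective x
    · rw [sum_edge_inl]; exact h.1 x hx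
    · rw [sum_edge_inr]; exact h.2 x hx

lemma saturatedCount_sum (G : TriGraph V H) (G' : TriGraph W H) :
    (G.sum G').saturatedCount = G.saturatedCount * G'.saturatedCount := by
  rw [saturatedCount, saturatedCount, saturatedCount, ← Nat.card_prod]
  exact Nat.card_congr
    { toFun := fun S => (⟨_, ((isSaturated_sum G G' S.1).1 S.2).1⟩,
        ⟨_, ((isSaturated_sum G G' S.1).1 S.2).2⟩)
      invFun := fun S => ⟨{x | Sum.elim (· ∈ S.1.1) (· ∈ S.2.1) x},
        (isSaturated_sum G G' _).2 ⟨S.1.2, S.2.2⟩⟩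
      left_inv := fun S => Subtype.ext (by ext (x | x) <;> rfl)
      right_inv := fun S => rfl }

open Classical in
lemma eq_map_sum_restrict (hS : G.IsSaturated S) :
    G = ((G.restrict S).sum (G.restrict Sᶜ)).map (vertexEquiv (Equiv.Set.sumCompl S)) := by
  refine TriGraph.ext (funext fun x => ?_) (funext fun x => ?_)
  all_goals
    obtain ⟨x, rfl⟩ := (vertexEquiv (Equiv.Set.sumCompl S)).surjective x
    obtain ⟨x | x, rfl⟩ := (halfSum _ _).surjective x
    all_goals simp only [map, Equiv.symm_apply_apply]
  · rw [sum_edge_inl]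
    exact (incl_restrict_edge hS x).symm
  · rw [sum_edge_inr]
    exact (incl_restrict_edge hS.compl x).symm
  · rfl
  · rfl

lemma IsSaturated.preimage_val (hS : G.IsSaturated S) {T : Set V} (hT : G.IsSaturated T) :
    (G.restrict S).IsSaturated (Subtype.val ⁻¹' T) := fun x hx => by
  have : G.edge (incl S x) = incl S ((G.restrict S).edge x) := (incl_restrict_edge hS x).symm
  change (incl S ((G.restrict S).edge x)).1 ∈ T
  rw [← this]
  exact hT (incl S x) hx

lemma saturatedCount_restrict (hS : G.IsSaturated S) :
    G.saturatedCount = (G.restrict S).saturatedCount * (G.restrict Sᶜ).saturatedCount := by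
  classical
  rw [← saturatedCount_sum]
  nth_rewrite 1 [eq_map_sum_restrict hS]
  exact saturatedCount_map _ _ _

/-- Every nonempty finite graph has a connected component. -/
lemma exists_isConnected_restrict [Finite V] [Nonempty V] (G : TriGraph V H) :
    ∃ S, G.IsSaturated S ∧ (G.restrict S).IsConnected := by
  have : ({S : Set V | G.IsSaturated S ∧ S.Nonempty}).Nonempty :=
    ⟨_, G.isSaturated_univ, Set.univ_nonempty⟩
  obtain ⟨S, ⟨hS, hne⟩, hmin⟩ := (Set.toFinite _).exists_minimal this
  refine ⟨S, hS, hne.to_subtype, fun T hT => ?_⟩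
  rcases T.eq_empty_or_nonempty with h | ⟨t, ht⟩
  · exact .inl h
  · right
    have hT' : G.IsSaturated (Subtype.val '' T) := by
      rintro x ⟨y, hy, hxy⟩
      have e : x = incl S (y, x.2) := Prod.ext hxy.symm rfl
      rw [e, ← incl_restrict_edge hS]
      exact ⟨_, hT (y, x.2) hy, rfl⟩
    have := hmin ⟨hT', ⟨_, t, ht, rfl⟩⟩ (by rintro _ ⟨y, _, rfl⟩; exact y.2)
    refine Set.eq_univ_of_forall fun y => ?_
    obtain ⟨z, hz, e⟩ := this y.2
    rwa [← Subtype.ext e]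

lemma ihxPerm_fst_mem [DecidableEq V] {v w : V} (h : v ∈ S ↔ w ∈ S) (x : V × Fin 3) :
    (ihxPerm v w x).1 ∈ S ↔ x.1 ∈ S := by
  have key : ∀ {v w : V} {i j} (_ : v ∈ S ↔ w ∈ S) (x : V × Fin 3),
      (Equiv.swap (v, i) (w, j) x).1 ∈ S ↔ x.1 ∈ S := by
    intro v w i j h x
    rw [Equiv.swap_apply_def]
    split_ifs with h1 h2
    · rw [h1]; exact h.symm
    · rw [h2]; exact h
    · rfl
  rw [ihxPerm, Equiv.Perm.mul_apply, key Iff.rfl, key h]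

lemma map_ihxPerm_edge [DecidableEq V] {v w : V} (h : G.edge (v, 0) = (w, 0)) :
    (G.map (ihxPerm v w)).edge (v, 0) = (w, 0) := by
  have h0 : ∀ u : V, ihxPerm v w (u, 0) = (u, 0) := fun u => by
    simp [ihxPerm, Equiv.swap_apply_def]
  have e : (ihxPerm v w).symm (v, 0) = (v, 0) := by rw [Equiv.symm_apply_eq, h0]
  simp only [map, e, h, h0]

lemma isSaturated_map_ihxPerm [DecidableEq V] {v w : V}
    (h : G.edge (v, 0) = (w, 0)) : (G.map (ihxPerm v w)).IsSaturated S ↔ G.IsSaturated S := by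
  refine ⟨fun hS => ?_, fun hS => ?_⟩
  · have := hS.mem_iff (v, 0)
    rw [map_ihxPerm_edge h] at this
    exact (isSaturated_map G _ (ihxPerm_fst_mem this.symm)).1 hS
  · have := hS.mem_iff (v, 0)
    rw [h] at this
    exact (isSaturated_map G _ (ihxPerm_fst_mem this.symm)).2 hS

lemma isConnected_map_ihxPerm [DecidableEq V] {v w : V}
    (h : G.edge (v, 0) = (w, 0)) : (G.map (ihxPerm v w)).IsConnected ↔ G.IsConnected :=
  and_congr Iff.rfl (forall_congr' fun _ => imp_congr_left (isSaturated_map_ihxPerm h))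

/-- If joining legs adds an edge that leaves a saturated set `S`, the number of saturated sets drops at least
by a factor of two: taking the symmetric difference with `S` is an injection of the sets that remain
saturated into those that do not. -/
lemma two_mul_saturatedCount_extend_le [Finite V] {E : Extension G.edge}
    (hS : G.IsSaturated S) {h : V × Fin 3} (h1 : h.1 ∈ S) (h2 : (E.1 h).1 ∉ S) :
    2 * (G.extend E).saturatedCount ≤ G.saturatedCount := by
  classical
  have hsub : ∀ {T}, (G.extend E).IsSaturated T → G.IsSaturated T := fun {T} hT x hx => by
    by_cases hc : G.edge x = x
    · rwa [hc]
    · rw [← E.2.2 x hc]; exact hT x hx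
  have hd : ∀ {T}, G.IsSaturated T → G.IsSaturated (symmDiff T S) := fun {T} hT x hx => by
    rw [Set.mem_symmDiff, hT.mem_iff, hS.mem_iff]; exact hx
  let f : {T : Set V // (G.extend E).IsSaturated T} ⊕ {T : Set V // (G.extend E).IsSaturated T} →
      {T : Set V // G.IsSaturated T} :=
    Sum.elim (fun T => ⟨T.1, hsub T.2⟩) fun T => ⟨symmDiff T.1 S, hd (hsub T.2)⟩
  have key : ∀ T T' : {T : Set V // (G.extend E).IsSaturated T}, T.1 ≠ symmDiff T'.1 S := by
    intro T T' e
    have e1 := T.2.mem_iff h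
    have e2 := T'.2.mem_iff h
    rw [e, Set.mem_symmDiff, Set.mem_symmDiff] at e1
    change (E.1 h).1 ∈ _ ↔ _ at e2
    change ((E.1 h).1 ∈ _ ∧ _ ∨ _) ↔ _ at e1
    tauto
  have hf : Function.Injective f := by
    rintro (T | T) (T' | T') e
    · have e' : (f (.inl T)).1 = (f (.inl T')).1 := congrArg _ e
      exact congrArg _ (Subtype.ext e')
    · exact (key T T' (congrArg Subtype.val e)).elim
    · exact (key T' T (congrArg Subtype.val e).symm).elim
    · have e' : symmDiff T.1 S = symmDiff T'.1 S := congrArg Subtype.val e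
      exact congrArg _ (Subtype.ext (symmDiff_left_injective S e'))
  have := Nat.card_le_card_of_injective f hf
  rw [Nat.card_sum] at this
  rw [saturatedCount, saturatedCount]
  omega

end TriGraph

lemma connected_iff (Γ : UniTriGraph H) : Γ.Connected ↔ Γ.toTri.IsConnected := by
  refine and_congr Fin.pos_iff_nonempty ⟨fun h S hS => ?_, fun h v w => ?_⟩
  · rcases S.eq_empty_or_nonempty with e | ⟨v, hv⟩
    · exact .inl e
    · refine .inr (Set.eq_univ_of_forall fun w => ?_)
      induction h v w with
      | refl => exact hv
      | tail _ hab ih =>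
        obtain ⟨i, j, hij⟩ := hab
        have := hS (_, i) ih
        rwa [show Γ.toTri.edge _ = _ from hij] at this
  · rcases h {w | Relation.ReflTransGen Γ.Adj v w} (fun x hx => hx.tail ⟨x.2, _, rfl⟩) with e | e
    · exact (Set.eq_empty_iff_forall_notMem.1 e v .refl).elim
    · exact Set.eq_univ_iff_forall.1 e w

end

section

/-! ### The connected part and the filtration by the number of components -/

section

variable {V W H : Type} [AddCommGroup H]

variable (H) in
/-- The subgroup of `𝒜` generated by the connected graphs. -/
def connectedSpan : AddSubgroup (GraphSpace H) :=
  AddSubgroup.closure {x | ∃ Γ : UniTriGraph H, Γ.Connected ∧ x = graphClass Γ}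

lemma TriGraph.IsConnected.cls_mem [Finite V] {G : TriGraph V H} (h : G.IsConnected) :
    G.cls ∈ connectedSpan H :=
  AddSubgroup.subset_closure ⟨(G.map (vertexEquiv (Finite.equivFin V))).toUni, (connected_iff _).2
    ((G.isConnected_map (Finite.equivFin V) fun _ => 1).2 h), rfl⟩

lemma connectedSpan_le {M : AddSubgroup (GraphSpace H)}
    (h : ∀ Γ : UniTriGraph H, Γ.toTri.IsConnected → Γ.toTri.cls ∈ M) : connectedSpan H ≤ M := by
  refine (AddSubgroup.closure_le _).2 ?_
  rintro _ ⟨Γ, hΓ, rfl⟩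
  rw [← toTri_cls]
  exact h Γ ((connected_iff Γ).1 hΓ)

variable (H) in
/-- The subgroup of `𝒜` generated by the graphs with fewer than `n` components. -/
def componentFiltration (n : ℕ) : AddSubgroup (GraphSpace H) :=
  AddSubgroup.closure {x | ∃ Γ : UniTriGraph H, Γ.toTri.saturatedCount < 2 ^ n ∧ x = Γ.toTri.cls}

lemma cls_mem_componentFiltration [Finite V] {G : TriGraph V H} {n : ℕ}
    (h : G.saturatedCount < 2 ^ n) : G.cls ∈ componentFiltration H n := by
  refine AddSubgroup.subset_closure ⟨_, ?_, (toTri_cls _).symm⟩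
  exact (TriGraph.saturatedCount_map G (Finite.equivFin V) fun _ => 1).trans_lt h

/-- Up to graphs in which the two factors are joined, the star product is the disjoint union. -/
lemma star_sub_sum_mem (B : H → H → ℤ) [Finite V] [Finite W] (G : TriGraph V H) (G' : TriGraph W H)
    (hG : G.IsConnected) {M : AddSubgroup (GraphSpace H)}
    (hM : ∀ E : Extension (G.sum G').edge, ((G.sum G').extend E).saturatedCount ≤ G'.saturatedCount →
      ((G.sum G').extend E).cls ∈ M) : star B G G' - (G.sum G').cls ∈ M := by
  classical
  rw [star, extSum, ← Finset.add_sum_erase _ _ (Finset.mem_univ (Extension.refl (G.sum G').edge_edge))]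
  have e : pairWeight (blockWeight B (G.sum G').colour side) (G.sum G').edge
      (Extension.refl (G.sum G').edge_edge).1 • ((G.sum G').extend (Extension.refl
        (G.sum G').edge_edge)).cls = (G.sum G').cls := by
    rw [Extension.refl, pairWeight_self, one_smul]; rfl
  rw [e, add_sub_cancel_left]
  refine sum_mem fun E hE => ?_
  by_cases hw : pairWeight (blockWeight B (G.sum G').colour side) (G.sum G').edge E.1 = 0
  · rw [hw, zero_smul]; exact zero_mem _
  refine AddSubgroup.zsmul_mem _ (hM E ?_) _
  have : ∃ x, E.1 x ≠ (G.sum G').edge x := by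
    by_contra! hc; exact Finset.ne_of_mem_erase hE (Subtype.ext (funext hc))
  obtain ⟨x, hx⟩ := this
  have hb := pairWeight_ne_zero hw x hx
  have hxs : (side x.1 : ℕ) ≠ side (E.1 x).1 := by
    intro hc
    simp only [blockWeight, hc, lt_irrefl, if_false] at hb
    exact hb rfl
  have hS : (G.sum G').IsSaturated (Set.range Sum.inl) := by
    rw [TriGraph.isSaturated_sum]
    refine ⟨fun _ _ => ⟨_, rfl⟩, fun y hy => ?_⟩
    obtain ⟨z, hz⟩ := hy
    exact (Sum.inl_ne_inr hz).elim
  have hside : ∀ y : V ⊕ W, y ∈ Set.range Sum.inl ↔ side y = 0 := by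
    rintro (y | y) <;> simp [side]
  have hside' : ∀ y : V ⊕ W, y ∉ Set.range Sum.inl ↔ side y = 1 := by
    rintro (y | y) <;> simp [side]
  have key : 2 * ((G.sum G').extend E).saturatedCount ≤ (G.sum G').saturatedCount := by
    by_cases h1 : x.1 ∈ Set.range Sum.inl
    · refine TriGraph.two_mul_saturatedCount_extend_le hS h1 fun h2 => ?_
      rw [hside] at h1 h2; exact hxs (h1.trans h2.symm)
    · refine TriGraph.two_mul_saturatedCount_extend_le hS (h := E.1 x) ?_ ?_
      · by_contra h2; rw [hside'] at h1 h2; exact hxs (h1.trans h2.symm)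
      · rwa [E.2.1]
  rw [TriGraph.saturatedCount_sum, hG.saturatedCount] at key
  omega

lemma star_sub_star_mem (B : H → H → ℤ) [Finite V] [Finite W] {G : TriGraph V H} {G' : TriGraph W H}
    (hG : G.IsConnected) (hG' : G'.IsConnected) : star B G G' - star B G' G ∈ connectedSpan H := by
  have key : ∀ {V W : Type} [Finite V] [Finite W] {G : TriGraph V H} {G' : TriGraph W H},
      G.IsConnected → G'.IsConnected → star B G G' - (G.sum G').cls ∈ connectedSpan H := by
    intro V W _ _ G G' hG hG'
    refine star_sub_sum_mem B G G' hG fun E hE => TriGraph.IsConnected.cls_mem ?_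
    have : Nonempty V := hG.1
    exact TriGraph.isConnected_of_saturatedCount (hG'.saturatedCount ▸ hE)
  have := sub_mem (key hG hG') (key hG' hG)
  rwa [sum_cls_comm, sub_sub_sub_cancel_right] at this

/-- The subgroup of the connected graphs is closed under commutators. -/
lemma starMul_sub_starMul_mem {B : H → H → ℤ} (hB : IsBiadditive B) {x y : GraphSpace H}
    (hx : x ∈ connectedSpan H) (hy : y ∈ connectedSpan H) :
    starMul hB x y - starMul hB y x ∈ connectedSpan H := by
  have h : ∀ Γ : UniTriGraph H, Γ.toTri.IsConnected → connectedSpan H ≤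
      (connectedSpan H).comap (starMul hB Γ.toTri.cls - (starMul hB).flip Γ.toTri.cls) :=
    fun Γ hΓ => connectedSpan_le fun Γ' hΓ' => by
      change starMul hB Γ.toTri.cls Γ'.toTri.cls - starMul hB Γ'.toTri.cls Γ.toTri.cls ∈ connectedSpan H
      rw [starMul_cls, starMul_cls]; exact star_sub_star_mem B hΓ hΓ'
  have h' : connectedSpan H ≤ (connectedSpan H).comap ((starMul hB).flip y - starMul hB y) :=
    connectedSpan_le fun Γ hΓ => h Γ hΓ hy
  exact h' hx

lemma isBiadditive_zero : IsBiadditive fun _ _ : H => (0 : ℤ) :=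
  ⟨fun _ _ _ => (add_zero _).symm, fun _ _ _ => (add_zero _).symm⟩

/-- The product of `𝒜` given by the disjoint union, that is, the star product for the zero form. -/
def disjointUnion : GraphSpace H →+ GraphSpace H →+ GraphSpace H := starMul isBiadditive_zero

lemma disjointUnion_cls [Finite V] [Finite W] (G : TriGraph V H) (G' : TriGraph W H) :
    disjointUnion G.cls G'.cls = (G.sum G').cls := by
  rw [disjointUnion, starMul_cls, star, extSum, Finset.sum_eq_single (Extension.refl (G.sum G').edge_edge)]
  · rw [Extension.refl, pairWeight_self, one_smul]; rfl
  · intro E _ hE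
    have : ∃ x, E.1 x ≠ (G.sum G').edge x := by
      by_contra! hc; exact hE (Subtype.ext (funext hc))
    obtain ⟨x, hx⟩ := this
    have h0 : pairWeight (blockWeight (fun _ _ => 0) (G.sum G').colour side) (G.sum G').edge E.1 = 0 := by
      by_contra hne
      have h1 := pairWeight_ne_zero hne x hx
      have h2 := pairWeight_ne_zero hne (E.1 x) (by
        rw [E.2.1]; intro h
        exact hx ((congrArg (G.sum G').edge h).trans ((G.sum G').edge_edge _)).symm)
      rw [E.2.1] at h2
      simp only [blockWeight, neg_zero] at h1 h2
      split_ifs at h1 h2 <;> first | exact h1 rfl | exact h2 rfl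
    rw [h0, zero_smul]
  · intro h; exact (h (Finset.mem_univ _)).elim

end

end

section

/-! ### Splitting off a component -/

section

open TriGraph

variable {V W H : Type}

lemma restrict_map_ihxPerm [DecidableEq V] {G : TriGraph V H} {S : Set V} (hS : G.IsSaturated S)
    {v w : V} (hv : v ∈ S) (hw : w ∈ S) :
    (G.map (ihxPerm v w)).restrict S = (G.restrict S).map (ihxPerm ⟨v, hv⟩ ⟨w, hw⟩) ∧
    (G.map (ihxPerm v w * ihxPerm v w)).restrict S =
      (G.restrict S).map (ihxPerm ⟨v, hv⟩ ⟨w, hw⟩ * ihxPerm ⟨v, hv⟩ ⟨w, hw⟩) := by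
  have hm := ihxPerm_fst_mem (S := S) (iff_of_true hv hw)
  have e : ∀ x, incl S (ihxPerm ⟨v, hv⟩ ⟨w, hw⟩ x) = ihxPerm v w (incl S x) := by
    intro x
    simp only [ihxPerm, Equiv.Perm.mul_apply, (incl_injective S).map_swap]
    rfl
  refine ⟨restrict_map G _ hm hS _ e, restrict_map G _ (fun h => ?_) hS _ fun h => ?_⟩
  · rw [Equiv.Perm.mul_apply, hm, hm]
  · rw [Equiv.Perm.mul_apply, e, e, Equiv.Perm.mul_apply]

lemma restrict_map_ihxPerm_of_notMem [DecidableEq V] {G : TriGraph V H} {S : Set V}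
    (hS : G.IsSaturated S) {v w : V} (hv : v ∉ S) (hw : w ∉ S) :
    (G.map (ihxPerm v w)).restrict S = G.restrict S ∧
    (G.map (ihxPerm v w * ihxPerm v w)).restrict S = G.restrict S := by
  have hm := ihxPerm_fst_mem (S := S) (iff_of_false hv hw)
  have e : ∀ x, incl S x = ihxPerm v w (incl S x) := by
    intro x
    have h1 : ∀ i, incl S x ≠ (v, i) := fun i h => hv (by
      have e : (incl S x).1 = v := congrArg Prod.fst h
      rw [← e]; exact x.1.2)
    have h2 : ∀ i, incl S x ≠ (w, i) := fun i h => hw (by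
      have e : (incl S x).1 = w := congrArg Prod.fst h
      rw [← e]; exact x.1.2)
    rw [ihxPerm, Equiv.Perm.mul_apply, Equiv.swap_apply_of_ne_of_ne (h1 _) (h2 _),
      Equiv.swap_apply_of_ne_of_ne (h1 _) (h1 _)]
  refine ⟨restrict_map G _ hm hS (Equiv.refl _) e,
    restrict_map G _ (fun h => ?_) hS (Equiv.refl _) fun h => ?_⟩
  · rw [Equiv.Perm.mul_apply, hm, hm]
  · rw [Equiv.Perm.mul_apply, ← e, ← e]; rfl

lemma incl_of_restrict_edge_eq {G : TriGraph V H} {S : Set V} (hS : G.IsSaturated S) {k : S × Fin 3}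
    (hk : (G.restrict S).edge k = k) : G.edge (incl S k) = incl S k := by
  rw [← incl_restrict_edge hS, hk]

variable [AddCommGroup H]

/-- The part of a graph at a saturated set that is the image of an embedded graph. -/
lemma cls_restrict_range [Finite V] [Finite W] {G : TriGraph V H} {G' : TriGraph W H} {f : W → V}
    (hf : Function.Injective f) {S : Set V} (hS : S = Set.range f)
    (he : ∀ h, G.edge (f h.1, h.2) = (f (G'.edge h).1, (G'.edge h).2))
    (hc : ∀ h, G.colour (f h.1, h.2) = G'.colour h) : (G.restrict S).cls = G'.cls := by
  subst hS
  have := Fintype.ofFinite W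
  have hsat : G.IsSaturated (Set.range f) := by
    rintro ⟨_, i⟩ ⟨w, rfl⟩
    rw [he (w, i)]; exact ⟨_, rfl⟩
  rw [cls_eq_of_iso G' (G.restrict (Set.range f)) (Equiv.ofInjective f hf) fun _ => 1]
  · simp
  · intro h
    apply incl_injective
    rw [incl_restrict_edge hsat]
    exact he h
  · intro h _; exact hc h

lemma cls_restrict_congr [Finite V] {e : V × Fin 3 → V × Fin 3} {he : Function.Involutive e}
    {c c' : V × Fin 3 → H} {S : Set V} (hS : (⟨e, he, c⟩ : TriGraph V H).IsSaturated S)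
    (h : ∀ k, k.1 ∈ S → e k = k → c k = c' k) :
    (restrict ⟨e, he, c⟩ S).cls = (restrict ⟨e, he, c'⟩ S).cls :=
  cls_congr (e := (restrict ⟨e, he, c⟩ S).edge)
    (he := (restrict ⟨e, he, c⟩ S).edge_edge) (c := fun k => c (incl S k))
    (c' := fun k => c' (incl S k))
    fun k hk => h _ k.1.2 (incl_of_restrict_edge_eq hS hk)

lemma cls_restrict_linear [Finite V] {e : V × Fin 3 → V × Fin 3} {he : Function.Involutive e}
    {c c₁ c₂ : V × Fin 3 → H} {S : Set V} (hS : (⟨e, he, c⟩ : TriGraph V H).IsSaturated S)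
    {h : V × Fin 3} (hh : e h = h) (hm : h.1 ∈ S) (h1 : ∀ k, k ≠ h → c₁ k = c k)
    (h2 : ∀ k, k ≠ h → c₂ k = c k) (h3 : c h = c₁ h + c₂ h) :
    (restrict ⟨e, he, c⟩ S).cls =
      (restrict ⟨e, he, c₁⟩ S).cls + (restrict ⟨e, he, c₂⟩ S).cls := by
  have hi : ∀ {k}, k ≠ ((⟨h.1, hm⟩ : S), h.2) → incl S k ≠ h := fun hk e =>
    hk (incl_injective S e)
  refine (clsInvariant H).linear (restrict ⟨e, he, c⟩ S).edge
    (restrict ⟨e, he, c⟩ S).edge_edge (fun k => c (incl S k))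
    (fun k => c₁ (incl S k)) (fun k => c₂ (incl S k)) (⟨h.1, hm⟩, h.2) ?_
    (fun k hk => h1 _ (hi hk)) (fun k hk => h2 _ (hi hk)) h3
  apply incl_injective
  rw [incl_restrict_edge hS]
  exact hh

lemma cls_restrict_map [Fintype V] [Finite W] {G : TriGraph V H} (ε : V ≃ W)
    (p : V → Equiv.Perm (Fin 3)) {S : Set V} [Fintype S] (hS : G.IsSaturated S) :
    ((G.map (blockEquiv ε p)).restrict (ε '' S)).cls =
      (∏ v : S, (Equiv.Perm.sign (p v) : ℤ)) • (G.restrict S).cls := by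
  rw [restrict_map G (blockEquiv ε p) (S := S) (by
    intro h; simp [blockEquiv_apply]) hS (blockEquiv (ε.image S) fun v => p v) fun h => rfl]
  exact (clsInvariant H).map _ _ _

section Conn

variable {R : Type} [AddCommGroup R] (j : connectedSpan H →+ R)

open Classical in
/-- A homomorphism on the connected part, extended by zero to the graphs that are not connected. -/
def connInvariant : GraphInvariant H R where
  val G := if h : G.IsConnected then j ⟨G.cls, h.cls_mem⟩ else 0
  congr e he c c' h := by
    by_cases hG : (⟨e, he, c⟩ : TriGraph _ H).IsConnected
    · have hG' : (⟨e, he, c'⟩ : TriGraph _ H).IsConnected := hG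
      rw [dif_pos hG, dif_pos hG']
      exact congrArg j (Subtype.ext (cls_congr h))
    · have hG' : ¬ (⟨e, he, c'⟩ : TriGraph _ H).IsConnected := hG
      rw [dif_neg hG, dif_neg hG']
  map G ε p := by
    have h := TriGraph.isConnected_map G ε p
    by_cases hG : G.IsConnected
    · rw [dif_pos hG, dif_pos (h.2 hG), ← map_zsmul]
      exact congrArg j (Subtype.ext ((clsInvariant H).map G ε p))
    · rw [dif_neg hG, dif_neg (mt h.1 hG), smul_zero]
  ihx G v w hvw h := by
    have h1 := TriGraph.isConnected_map_ihxPerm (G := G) h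
    have h2 := TriGraph.isConnected_map_ihxPerm (TriGraph.map_ihxPerm_edge h)
    by_cases hG : G.IsConnected
    · rw [dif_pos hG, dif_pos (h1.2 hG), dif_pos (show (G.map (ihxPerm v w * ihxPerm v w)).IsConnected
        from h2.2 (h1.2 hG)), ← map_add, ← map_add, ← map_zero j]
      exact congrArg j (Subtype.ext ((clsInvariant H).ihx G v w hvw h))
    · rw [dif_neg hG, dif_neg (mt h1.1 hG),
        dif_neg (show ¬ (G.map (ihxPerm v w * ihxPerm v w)).IsConnected from
          mt h2.1 (mt h1.1 hG)), add_zero, add_zero]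
  linear e he c c₁ c₂ h hh h1 h2 h3 := by
    by_cases hG : (⟨e, he, c⟩ : TriGraph _ H).IsConnected
    · have hG₁ : (⟨e, he, c₁⟩ : TriGraph _ H).IsConnected := hG
      have hG₂ : (⟨e, he, c₂⟩ : TriGraph _ H).IsConnected := hG
      rw [dif_pos hG, dif_pos hG₁, dif_pos hG₂, ← map_add]
      exact congrArg j (Subtype.ext ((clsInvariant H).linear e he c c₁ c₂ h hh h1 h2 h3))
    · have hG₁ : ¬ (⟨e, he, c₁⟩ : TriGraph _ H).IsConnected := hG
      have hG₂ : ¬ (⟨e, he, c₂⟩ : TriGraph _ H).IsConnected := hG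
      rw [dif_neg hG, dif_neg hG₁, dif_neg hG₂, add_zero]

lemma connInvariant_lift_cls [Finite V] {G : TriGraph V H} (h : G.IsConnected) :
    (connInvariant j).lift G.cls = j ⟨G.cls, h.cls_mem⟩ := by
  rw [GraphInvariant.lift_cls]; exact dif_pos h

lemma connInvariant_lift_cls_eq_zero [Finite V] {G : TriGraph V H} (h : ¬ G.IsConnected) :
    (connInvariant j).lift G.cls = 0 := by
  rw [GraphInvariant.lift_cls]; exact dif_neg h

end Conn

section Peel

variable {R : Type} [Ring R] (c f : GraphSpace H →+ R)

open Classical in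
/-- The term of a saturated set in the sum `peel`. -/
def peelTerm [Finite V] (G : TriGraph V H) (S : Set V) : R :=
  if G.IsSaturated S then c (G.restrict S).cls * f (G.restrict Sᶜ).cls else 0

lemma peelTerm_of [Finite V] {G : TriGraph V H} {S : Set V} (hS : G.IsSaturated S) :
    peelTerm c f G S = c (G.restrict S).cls * f (G.restrict Sᶜ).cls := if_pos hS

lemma peelTerm_of_not [Finite V] {G : TriGraph V H} {S : Set V}
    (hS : ¬ G.IsSaturated S) : peelTerm c f G S = 0 := if_neg hS

/-- Cut a graph into two pieces in all possible ways, and apply `c` to the first and `f` to the second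
piece. -/
def peel : GraphInvariant H R where
  val {V} _ G := ∑ᶠ S : Set V, peelTerm c f G S
  congr e he c c' h := finsum_congr fun S => by
    by_cases hS : (⟨e, he, c⟩ : TriGraph _ H).IsSaturated S
    · have hS' : (⟨e, he, c'⟩ : TriGraph _ H).IsSaturated S := hS
      rw [peelTerm_of _ _ hS, peelTerm_of _ _ hS',
        cls_restrict_congr hS fun k _ => h k, cls_restrict_congr hS.compl fun k _ => h k]
    · have hS' : ¬ (⟨e, he, c'⟩ : TriGraph _ H).IsSaturated S := hS
      rw [peelTerm_of_not _ _ hS, peelTerm_of_not _ _ hS']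
  map G ε p := by
    classical
    rw [← finsum_comp_equiv (Equiv.Set.congr ε), smul_finsum' _ (Set.toFinite _)]
    refine finsum_congr fun S => ?_
    have hiff := TriGraph.isSaturated_map G (blockEquiv ε p) (S := S) (T := ε '' S)
      (by intro h; simp [blockEquiv_apply])
    change peelTerm c f _ (ε '' S) = _
    by_cases hS : G.IsSaturated S
    · rw [peelTerm_of _ _ hS, peelTerm_of _ _ (hiff.2 hS),
        ← Set.image_compl_eq ε.bijective, cls_restrict_map ε p hS, cls_restrict_map ε p hS.compl,
        map_zsmul, map_zsmul, smul_mul_smul_comm]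
      congr 1
      exact Fintype.prod_subtype_mul_prod_subtype (· ∈ S) fun v => (Equiv.Perm.sign (p v) : ℤ)
    · rw [peelTerm_of_not _ _ hS, peelTerm_of_not _ _ (mt hiff.1 hS), smul_zero]
  ihx G v w hvw h := by
    have hfin : ∀ {X : Type} [Finite X] (F : X → R), (Function.support F).Finite := fun F => Set.toFinite _
    rw [← finsum_add_distrib (hfin _) (hfin _), ← finsum_add_distrib (hfin _) (hfin _)]
    refine finsum_eq_zero_of_forall_eq_zero fun S => ?_
    have h1 := TriGraph.isSaturated_map_ihxPerm (S := S) h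
    have h2 : (G.map (ihxPerm v w * ihxPerm v w)).IsSaturated S ↔ _ :=
      TriGraph.isSaturated_map_ihxPerm (S := S) (TriGraph.map_ihxPerm_edge h)
    by_cases hS : G.IsSaturated S
    · rw [peelTerm_of _ _ hS, peelTerm_of _ _ (h1.2 hS),
        peelTerm_of _ _ (h2.2 (h1.2 hS))]
      have hvw' := hS.mem_iff (v, 0)
      rw [h] at hvw'
      by_cases hv : v ∈ S
      · have hw : w ∈ S := hvw'.2 hv
        have e1 := restrict_map_ihxPerm hS hv hw
        have e2 := restrict_map_ihxPerm_of_notMem hS.compl (fun h => h hv) (fun h => h hw)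
        rw [e1.1, e1.2, e2.1, e2.2, ← add_mul, ← add_mul, ← map_add, ← map_add]
        have := (clsInvariant H).ihx (G.restrict S) ⟨v, hv⟩ ⟨w, hw⟩
          (fun e => hvw (congrArg Subtype.val e)) (by
            apply incl_injective
            rw [incl_restrict_edge hS]; exact h)
        exact (congrArg (· * _) ((congrArg c this).trans (map_zero c))).trans (zero_mul _)
      · have hw : w ∉ S := mt hvw'.1 hv
        have e1 := restrict_map_ihxPerm hS.compl hv hw
        have e2 := restrict_map_ihxPerm_of_notMem hS hv hw
        rw [e1.1, e1.2, e2.1, e2.2, ← mul_add, ← mul_add, ← map_add, ← map_add]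
        have := (clsInvariant H).ihx (G.restrict Sᶜ) ⟨v, hv⟩ ⟨w, hw⟩
          (fun e => hvw (congrArg Subtype.val e)) (by
            apply incl_injective
            rw [incl_restrict_edge hS.compl]; exact h)
        exact (congrArg (_ * ·) ((congrArg f this).trans (map_zero f))).trans (mul_zero _)
    · rw [peelTerm_of_not _ _ hS, peelTerm_of_not _ _ (mt h1.1 hS),
        peelTerm_of_not _ _ (mt h2.1 (mt h1.1 hS)), add_zero, add_zero]
  linear e he c c₁ c₂ h hh h1 h2 h3 := by
    rw [← finsum_add_distrib (Set.toFinite _) (Set.toFinite _)]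
    refine finsum_congr fun S => ?_
    by_cases hS : (⟨e, he, c⟩ : TriGraph _ H).IsSaturated S
    · have hS₁ : (⟨e, he, c₁⟩ : TriGraph _ H).IsSaturated S := hS
      have hS₂ : (⟨e, he, c₂⟩ : TriGraph _ H).IsSaturated S := hS
      rw [peelTerm_of _ _ hS, peelTerm_of _ _ hS₁,
        peelTerm_of _ _ hS₂]
      by_cases hm : h.1 ∈ S
      · rw [cls_restrict_linear hS hh hm h1 h2 h3, map_add, add_mul,
          cls_restrict_congr hS₁.compl (c' := c) fun k hk _ => h1 k fun e => hk (e ▸ hm),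
          cls_restrict_congr hS₂.compl (c' := c) fun k hk _ => h2 k fun e => hk (e ▸ hm)]
      · rw [cls_restrict_linear hS.compl hh hm h1 h2 h3, map_add, mul_add,
          cls_restrict_congr hS₁ (c' := c) fun k hk _ => h1 k fun e => hm (e ▸ hk),
          cls_restrict_congr hS₂ (c' := c) fun k hk _ => h2 k fun e => hm (e ▸ hk)]
    · have hS₁ : ¬ (⟨e, he, c₁⟩ : TriGraph _ H).IsSaturated S := hS
      have hS₂ : ¬ (⟨e, he, c₂⟩ : TriGraph _ H).IsSaturated S := hS
      rw [peelTerm_of_not _ _ hS, peelTerm_of_not _ _ hS₁,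
        peelTerm_of_not _ _ hS₂, add_zero]

lemma peel_cls [Finite V] (G : TriGraph V H) :
    (peel c f).lift G.cls = ∑ᶠ S : Set V, peelTerm c f G S := (peel c f).lift_cls G

/-- If `c` vanishes on the graphs that are not connected, there are two ways to split off a component
from the disjoint union of a connected graph `G` with `G'`: split off `G`, or a component of `G'`. -/
lemma peel_sum (hc : ∀ {V : Type} [Finite V] (G : TriGraph V H), ¬ G.IsConnected → c G.cls = 0)
    [Finite V] [Finite W] {G : TriGraph V H} (hG : G.IsConnected) (G' : TriGraph W H) :
    (peel c f).lift (G.sum G').cls = c G.cls * f G'.cls +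
      (peel c (f.comp (disjointUnion G.cls))).lift G'.cls := by
  classical
  have := Fintype.ofFinite (Set (V ⊕ W))
  have := Fintype.ofFinite (Set W)
  obtain ⟨v₀⟩ := hG.1
  have hl : (G.sum G').IsSaturated (Set.range Sum.inl) := by
    rw [TriGraph.isSaturated_sum]
    refine ⟨fun _ _ => ⟨_, rfl⟩, fun y hy => ?_⟩
    obtain ⟨z, hz⟩ := hy
    exact (Sum.inl_ne_inr hz).elim
  have hr : ∀ S : Set W, (G.sum G').IsSaturated (Sum.inr '' S) ↔ G'.IsSaturated S := fun S => by
    rw [TriGraph.isSaturated_sum, Set.preimage_image_eq _ Sum.inr_injective]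
    refine and_iff_right fun x hx => ?_
    obtain ⟨z, _, hz⟩ := hx
    exact (Sum.inr_ne_inl hz).elim
  rw [peel_cls, peel_cls, finsum_eq_sum_of_fintype, finsum_eq_sum_of_fintype]
  let F : Option (Set W) → Set (V ⊕ W) := fun o => o.elim (Set.range Sum.inl) fun S => Sum.inr '' S
  have hF : Function.Injective F := by
    have hne : ∀ S : Set W, (Set.range Sum.inl : Set (V ⊕ W)) ≠ Sum.inr '' S := fun S e => by
      have : (Sum.inl v₀ : V ⊕ W) ∈ Sum.inr '' S := e ▸ ⟨v₀, rfl⟩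
      obtain ⟨z, _, hz⟩ := this
      exact Sum.inr_ne_inl hz
    rintro (_ | S) (_ | T) e
    · rfl
    · exact (hne T e).elim
    · exact (hne S e.symm).elim
    · exact congrArg some (Sum.inr_injective.image_injective e)
  rw [← Fintype.sum_of_injective F hF (fun o => o.elim (c G.cls * f G'.cls)
    (peelTerm c (f.comp (disjointUnion G.cls)) G')) _ ?_ ?_, Fintype.sum_option]
  · rfl
  · intro S hS
    by_cases hsat : (G.sum G').IsSaturated S
    · rw [peelTerm_of _ _ hsat, hc, zero_mul]
      intro hconn
      have hT := hsat.preimage_val hl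
      rcases hconn.2 _ hT with e | e
      · refine hS ⟨some (Sum.inr ⁻¹' S), ?_⟩
        refine Set.ext fun x => ⟨?_, fun hx => ?_⟩
        · rintro ⟨y, hy, rfl⟩; exact hy
        · rcases x with x | x
          · exact (Set.eq_empty_iff_forall_notMem.1 e ⟨_, hx⟩ ⟨x, rfl⟩).elim
          · exact ⟨x, hx, rfl⟩
      · rcases hG.2 _ ((TriGraph.isSaturated_sum G G' S).1 hsat).1 with e' | e'
        · obtain ⟨x, hx⟩ := hconn.1
          obtain ⟨z, rfl⟩ := Set.eq_univ_iff_forall.1 e ⟨x, hx⟩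
          exact Set.eq_empty_iff_forall_notMem.1 e' z hx
        · refine hS ⟨none, Set.ext fun x => ⟨?_, fun hx => ?_⟩⟩
          · rintro ⟨y, rfl⟩; exact Set.eq_univ_iff_forall.1 e' y
          · exact Set.eq_univ_iff_forall.1 e ⟨x, hx⟩
    · exact peelTerm_of_not _ _ hsat
  · rintro (_ | S)
    · change _ = peelTerm c f (G.sum G') (Set.range Sum.inl)
      rw [peelTerm_of _ _ hl, cls_restrict_range (G' := G) Sum.inl_injective rfl,
        cls_restrict_range (G' := G') Sum.inr_injective Set.compl_range_inl]
      · rfl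
      all_goals intro h; rfl
    · change peelTerm _ _ G' S = peelTerm c f (G.sum G') (Sum.inr '' S)
      by_cases hS : G'.IsSaturated S
      · rw [peelTerm_of _ _ hS, peelTerm_of _ _ ((hr S).2 hS),
          AddMonoidHom.comp_apply, disjointUnion_cls, cls_restrict_range (G' := G'.restrict S)
          (f := fun x : S => Sum.inr x.1) (Sum.inr_injective.comp Subtype.val_injective),
          cls_restrict_range (G' := G.sum (G'.restrict Sᶜ)) (f := Sum.map id Subtype.val)
          (Sum.map_injective.2 ⟨Function.injective_id, Subtype.val_injective⟩)]
        · ext (x | x) <;> simp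
        · rintro ⟨x | x, i⟩
          · rfl
          · exact congrArg (fun y => halfSum V W (.inr y)) (incl_restrict_edge hS.compl (x, i)).symm
        · rintro ⟨x | x, i⟩ <;> rfl
        · ext (x | x) <;> simp
        · rintro ⟨x, i⟩
          exact congrArg (fun y => halfSum V W (.inr y)) (incl_restrict_edge hS (x, i)).symm
        · rintro ⟨x, i⟩; rfl
      · rw [peelTerm_of_not _ _ hS, peelTerm_of_not _ _ (mt (hr S).1 hS)]

end Peel

end

end

section

/-! ### Symmetrization -/

section

variable {V W H : Type} [AddCommGroup H] {R : Type} [Ring R] (j : connectedSpan H →+ R)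

open Classical in
variable (H R) in
/-- The invariant that is one for the empty graph, and zero for all other graphs. -/
def emptyInvariant : GraphInvariant H R where
  val {V} _ _ := if IsEmpty V then 1 else 0
  congr _ _ _ _ _ := rfl
  map {V W} _ _ G ε p := by
    by_cases hV : IsEmpty V
    · have hW : IsEmpty W := ε.symm.isEmpty
      rw [if_pos hV, if_pos hW, Fintype.prod_empty, one_smul]
    · rw [if_neg hV, if_neg (fun h : IsEmpty W => hV ε.isEmpty), smul_zero]
  ihx {V} _ _ G v w _ _ := by
    have hV : ¬ IsEmpty V := not_isEmpty_iff.2 ⟨v⟩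
    rw [if_neg hV, add_zero, add_zero]
  linear {V} _ _ _ _ _ _ h _ _ _ _ := by
    have hV : ¬ IsEmpty V := not_isEmpty_iff.2 ⟨h.1⟩
    rw [if_neg hV, add_zero]

/-- The map that sends a graph with `n` components to the sum over all orders of its components of
the product of their images under `j`, and the other graphs to zero. -/
def symmetrize : ℕ → GraphSpace H →+ R
  | 0 => (emptyInvariant H R).lift
  | n + 1 => (peel (connInvariant j).lift (symmetrize n)).lift

lemma symmetrize_zero_of_isEmpty [Finite V] [IsEmpty V] (G : TriGraph V H) :
    symmetrize j 0 G.cls = 1 :=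
  ((emptyInvariant H R).lift_cls G).trans (if_pos ‹_›)

lemma symmetrize_zero_of_nonempty [Finite V] [hV : Nonempty V] (G : TriGraph V H) :
    symmetrize j 0 G.cls = 0 :=
  ((emptyInvariant H R).lift_cls G).trans (if_neg (not_isEmpty_iff.2 hV))

lemma symmetrize_succ_cls [Finite V] (n : ℕ) (G : TriGraph V H) : symmetrize j (n + 1) G.cls =
    ∑ᶠ S : Set V, peelTerm (connInvariant j).lift (symmetrize j n) G S := peel_cls _ _ _

lemma symmetrize_cls_eq_zero (n : ℕ) : ∀ {V : Type} [Finite V] (G : TriGraph V H),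
    G.saturatedCount < 2 ^ n → symmetrize j n G.cls = 0 := by
  induction n with
  | zero =>
    intro V _ G h
    have : Nonempty {S : Set V // G.IsSaturated S} := ⟨⟨_, G.isSaturated_univ⟩⟩
    have : 0 < G.saturatedCount := Nat.card_pos
    omega
  | succ n ih =>
    intro V _ G h
    rw [symmetrize_succ_cls]
    refine finsum_eq_zero_of_forall_eq_zero fun S => ?_
    by_cases hS : G.IsSaturated S
    · rw [peelTerm_of _ _ hS]
      by_cases hc : (G.restrict S).IsConnected
      · rw [ih, mul_zero]
        rw [TriGraph.saturatedCount_restrict hS, hc.saturatedCount, pow_succ] at h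
        omega
      · rw [connInvariant_lift_cls_eq_zero j hc, zero_mul]
    · exact peelTerm_of_not _ _ hS

lemma symmetrize_eq_zero {n : ℕ} {x : GraphSpace H} (hx : x ∈ componentFiltration H n) :
    symmetrize j n x = 0 := by
  have : componentFiltration H n ≤ (symmetrize j n).ker := by
    refine (AddSubgroup.closure_le _).2 ?_
    rintro _ ⟨Γ, hΓ, rfl⟩
    exact symmetrize_cls_eq_zero j n _ hΓ
  exact this hx

lemma GraphSpace.mem_of_cls_mem {M : AddSubgroup (GraphSpace H)}
    (h : ∀ Γ : UniTriGraph H, Γ.toTri.cls ∈ M) (x : GraphSpace H) : x ∈ M :=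
  GraphSpace.induction_on x (fun Γ => toTri_cls Γ ▸ h Γ) (fun _ => neg_mem) (fun _ _ => add_mem)
    (zero_mem _)

variable [Algebra ℚ R] {M : Submodule ℚ R}

lemma connInvariant_lift_mem (hM : ∀ x, j x ∈ M) (x : GraphSpace H) :
    (connInvariant j).lift x ∈ M := by
  refine GraphSpace.mem_of_cls_mem (M := M.toAddSubgroup.comap (connInvariant j).lift)
    (fun Γ => ?_) x
  change (connInvariant j).lift Γ.toTri.cls ∈ M
  by_cases h : Γ.toTri.IsConnected
  · rw [connInvariant_lift_cls j h]; exact hM _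
  · rw [connInvariant_lift_cls_eq_zero j h]; exact zero_mem _

lemma mul_mem_pow_succ {m u : R} {n : ℕ} (hm : m ∈ M) (hu : u ∈ (1 ⊔ M) ^ n) :
    m * u ∈ (1 ⊔ M) ^ (n + 1) := by
  rw [pow_succ']
  exact Submodule.mul_mem_mul (Submodule.mem_sup_right hm) hu

lemma one_sup_pow_mono {m n : ℕ} (h : m ≤ n) : (1 ⊔ M) ^ m ≤ (1 ⊔ M) ^ n :=
  pow_le_pow_right' le_sup_left h

lemma symmetrize_mem (hM : ∀ x, j x ∈ M) (n : ℕ) (x : GraphSpace H) :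
    symmetrize j n x ∈ (1 ⊔ M) ^ n := by
  induction n generalizing x with
  | zero =>
    refine GraphSpace.mem_of_cls_mem (M := ((1 ⊔ M) ^ 0).toAddSubgroup.comap (symmetrize j 0))
      (fun Γ => ?_) x
    change symmetrize j 0 Γ.toTri.cls ∈ (1 ⊔ M) ^ 0
    rw [pow_zero]
    rcases isEmpty_or_nonempty (Fin Γ.order) with h | h
    · rw [symmetrize_zero_of_isEmpty]; exact Submodule.one_le.1 le_rfl
    · rw [symmetrize_zero_of_nonempty]; exact zero_mem _
  | succ n ih =>
    refine GraphSpace.mem_of_cls_mem (M := ((1 ⊔ M) ^ (n + 1)).toAddSubgroup.comap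
      (symmetrize j (n + 1))) (fun Γ => ?_) x
    change symmetrize j (n + 1) Γ.toTri.cls ∈ (1 ⊔ M) ^ (n + 1)
    rw [symmetrize_succ_cls]
    have := Fintype.ofFinite (Set (Fin Γ.order))
    rw [finsum_eq_sum_of_fintype]
    refine sum_mem fun S _ => ?_
    by_cases hS : Γ.toTri.IsSaturated S
    · rw [peelTerm_of _ _ hS]
      exact mul_mem_pow_succ (connInvariant_lift_mem j hM _) (ih _)
    · rw [peelTerm_of_not _ _ hS]; exact zero_mem _

/-- Up to shorter products, it does not matter where the factor of a component is inserted. -/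
lemma symmetrize_sum_sub_mem (hM : ∀ x, j x ∈ M) (hcomm : ∀ x ∈ M, ∀ y ∈ M, x * y - y * x ∈ M)
    [Finite V] {G : TriGraph V H} (hG : G.IsConnected) (n : ℕ) (x : GraphSpace H) :
    symmetrize j (n + 1) (disjointUnion G.cls x) -
      (n + 1) • (j ⟨G.cls, hG.cls_mem⟩ * symmetrize j n x) ∈ (1 ⊔ M) ^ n := by
  have hj : (connInvariant j).lift G.cls = j ⟨G.cls, hG.cls_mem⟩ := connInvariant_lift_cls j hG
  set m := j ⟨G.cls, hG.cls_mem⟩ with hm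
  have hsum : ∀ (n : ℕ) (Γ : UniTriGraph H), symmetrize j (n + 1) (disjointUnion G.cls Γ.toTri.cls) =
      m * symmetrize j n Γ.toTri.cls +
        (peel (connInvariant j).lift ((symmetrize j n).comp (disjointUnion G.cls))).lift Γ.toTri.cls := by
    intro n Γ
    rw [disjointUnion_cls, ← hj]
    exact peel_sum _ _ (fun G h => connInvariant_lift_cls_eq_zero j h) hG _
  induction n generalizing x with
  | zero =>
    have h0 : (symmetrize j 0).comp (disjointUnion G.cls) = 0 := GraphSpace.hom_ext fun Γ => by
      have : Nonempty (V ⊕ Fin Γ.order) := ⟨.inl hG.1.some⟩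
      rw [← toTri_cls, AddMonoidHom.comp_apply, disjointUnion_cls, symmetrize_zero_of_nonempty]; rfl
    refine GraphSpace.mem_of_cls_mem (M := ((1 ⊔ M) ^ 0).toAddSubgroup.comap
      ((symmetrize j 1).comp (disjointUnion G.cls) -
        (0 + 1) • (AddMonoidHom.mulLeft m).comp (symmetrize j 0))) (fun Γ => ?_) x
    change symmetrize j 1 (disjointUnion G.cls Γ.toTri.cls) - (0 + 1) • (m * symmetrize j 0 Γ.toTri.cls)
      ∈ (1 ⊔ M) ^ 0
    rw [hsum, h0, zero_add, one_smul, add_sub_cancel_left, peel_cls, finsum_eq_zero_of_forall_eq_zero]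
    · exact zero_mem _
    · intro S
      unfold peelTerm
      split_ifs
      · rw [AddMonoidHom.zero_apply, mul_zero]
      · rfl
  | succ n ih =>
    refine GraphSpace.mem_of_cls_mem (M := ((1 ⊔ M) ^ (n + 1)).toAddSubgroup.comap
      ((symmetrize j (n + 2)).comp (disjointUnion G.cls) -
        (n + 1 + 1) • (AddMonoidHom.mulLeft m).comp (symmetrize j (n + 1)))) (fun Γ => ?_) x
    change symmetrize j (n + 2) (disjointUnion G.cls Γ.toTri.cls) -
      (n + 1 + 1) • (m * symmetrize j (n + 1) Γ.toTri.cls) ∈ (1 ⊔ M) ^ (n + 1)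
    rw [hsum, succ_nsmul', add_sub_add_left_eq_sub, peel_cls, symmetrize_succ_cls]
    have := Fintype.ofFinite (Set (Fin Γ.order))
    rw [finsum_eq_sum_of_fintype, finsum_eq_sum_of_fintype, Finset.mul_sum, Finset.smul_sum,
      ← Finset.sum_sub_distrib]
    refine sum_mem fun S _ => ?_
    by_cases hS : Γ.toTri.IsSaturated S
    · rw [peelTerm_of _ _ hS, peelTerm_of _ _ hS, AddMonoidHom.comp_apply]
      set y := (Γ.toTri.restrict S).cls
      set z := (Γ.toTri.restrict Sᶜ).cls
      set d := (connInvariant j).lift y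
      have hd : d ∈ M := connInvariant_lift_mem j hM y
      have e : d * symmetrize j (n + 1) (disjointUnion G.cls z) -
          (n + 1) • (m * (d * symmetrize j n z)) =
          d * (symmetrize j (n + 1) (disjointUnion G.cls z) - (n + 1) • (m * symmetrize j n z)) +
            (n + 1) • ((d * m - m * d) * symmetrize j n z) := by
        rw [mul_sub, mul_smul_comm, sub_mul, smul_sub, mul_assoc, mul_assoc]
        abel
      rw [e]
      exact add_mem (mul_mem_pow_succ hd (ih z)) (nsmul_mem (mul_mem_pow_succ
        (hcomm _ hd _ (hM _)) (symmetrize_mem j hM n z)) _)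
    · rw [peelTerm_of_not _ _ hS, peelTerm_of_not _ _ hS, mul_zero, smul_zero,
        sub_zero]
      exact zero_mem _

end

/-! ### The enveloping algebra -/

section

variable {H : Type} [AddCommGroup H] {B : H → H → ℤ} {hB : IsBiadditive B} {A : Type} [Ring A]
  {κ : GraphSpace H ≃+ A} {R : Type} [Ring R] [Algebra ℚ R] {j : connectedSpan H →+ R}
  {θ : R →ₐ[ℚ] ℚ ⊗[ℤ] A}

lemma star_mem_componentFiltration {V : Type} [Finite V] {G : TriGraph V H} (hG : G.IsConnected)
    {n : ℕ} {x : GraphSpace H} (hx : x ∈ componentFiltration H n) :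
    starMul hB G.cls x - disjointUnion G.cls x ∈ componentFiltration H n ∧
      disjointUnion G.cls x ∈ componentFiltration H (n + 1) := by
  have h1 : componentFiltration H n ≤
      (componentFiltration H n).comap (starMul hB G.cls - disjointUnion G.cls) := by
    refine (AddSubgroup.closure_le _).2 ?_
    rintro _ ⟨Γ, hΓ, rfl⟩
    change starMul hB G.cls Γ.toTri.cls - disjointUnion G.cls Γ.toTri.cls ∈ componentFiltration H n
    rw [starMul_cls, disjointUnion_cls]
    exact star_sub_sum_mem B G Γ.toTri hG fun E hE => cls_mem_componentFiltration (hE.trans_lt hΓ)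
  have h2 : componentFiltration H n ≤ (componentFiltration H (n + 1)).comap (disjointUnion G.cls) := by
    refine (AddSubgroup.closure_le _).2 ?_
    rintro _ ⟨Γ, hΓ, rfl⟩
    change disjointUnion G.cls Γ.toTri.cls ∈ componentFiltration H (n + 1)
    rw [disjointUnion_cls]
    refine cls_mem_componentFiltration ?_
    rw [TriGraph.saturatedCount_sum, hG.saturatedCount, pow_succ]
    omega
  exact ⟨h1 hx, h2 hx⟩

lemma componentFiltration_mono {m n : ℕ} (h : m ≤ n) :
    componentFiltration H m ≤ componentFiltration H n :=
  AddSubgroup.closure_mono fun _ ⟨Γ, hΓ, e⟩ =>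
    ⟨Γ, hΓ.trans_le (Nat.pow_le_pow_right two_pos h), e⟩

lemma cls_eq_empty {V : Type} [Finite V] [IsEmpty V] (G : TriGraph V H) :
    G.cls = graphClass UniTriGraph.empty := by
  have : Fintype V := Fintype.ofFinite V
  rw [← toTri_cls, cls_eq_of_iso G (UniTriGraph.empty (H := H)).toTri (Equiv.equivOfIsEmpty V (Fin 0))
    fun _ => 1]
  · simp
  · exact fun h => (IsEmpty.false h.1).elim
  · exact fun h => (IsEmpty.false h.1).elim

variable (κ) in
/-- The subspace spanned by the graphs with fewer than `n` components. -/
def rationalFiltration (n : ℕ) : Submodule ℚ (ℚ ⊗[ℤ] A) :=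
  Submodule.span ℚ {t | ∃ x ∈ componentFiltration H n, t = 1 ⊗ₜ κ x}

variable (κ j) in
/-- The rational extension of `symmetrize`. -/
def rationalSymmetrize (n : ℕ) : ℚ ⊗[ℤ] A →ₗ[ℚ] R :=
  LinearMap.liftBaseChange ℚ ((symmetrize j n).comp κ.symm.toAddMonoidHom).toIntLinearMap

lemma rationalSymmetrize_tmul (n : ℕ) (x : GraphSpace H) :
    rationalSymmetrize κ j n (1 ⊗ₜ κ x) = symmetrize j n x := by
  rw [rationalSymmetrize, LinearMap.liftBaseChange_tmul, one_smul]
  exact congrArg (symmetrize j n) (κ.symm_apply_apply x)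

lemma rationalSymmetrize_eq_zero {n : ℕ} {t : ℚ ⊗[ℤ] A} (ht : t ∈ rationalFiltration κ n) :
    rationalSymmetrize κ j n t = 0 := by
  have : rationalFiltration κ n ≤ LinearMap.ker (rationalSymmetrize κ j n) := by
    refine Submodule.span_le.2 ?_
    rintro _ ⟨x, hx, rfl⟩
    exact (rationalSymmetrize_tmul n x).trans (symmetrize_eq_zero j hx)
  exact this ht

lemma rationalFiltration_mono {m n : ℕ} (h : m ≤ n) :
    rationalFiltration κ m ≤ rationalFiltration (A := A) κ n :=
  Submodule.span_mono fun _ ⟨x, hx, e⟩ => ⟨x, componentFiltration_mono h hx, e⟩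

end

end

section

section

variable {H : Type} [AddCommGroup H] {B : H → H → ℤ} {hB : IsBiadditive B} {A : Type} [Ring A]
  {κ : GraphSpace H ≃+ A} {R : Type} [Ring R] [Algebra ℚ R] {j : connectedSpan H →+ R}
  {θ : R →ₐ[ℚ] ℚ ⊗[ℤ] A}

/-- Multiplication by a connected graph, compared with the insertion of a factor. -/
lemma rationalSymmetrize_mul (hκ : ∀ x y, κ (starMul hB x y) = κ x * κ y) {M : Submodule ℚ R}
    (hM : ∀ x, j x ∈ M) (hcomm : ∀ x ∈ M, ∀ y ∈ M, x * y - y * x ∈ M) (y : connectedSpan H) {n : ℕ}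
    {t : ℚ ⊗[ℤ] A} (ht : t ∈ rationalFiltration κ n) :
    (1 : ℚ) ⊗ₜ κ y.1 * t ∈ rationalFiltration κ (n + 1) ∧ ∀ k, n = k + 1 →
      rationalSymmetrize κ j n ((1 : ℚ) ⊗ₜ κ y.1 * t) - n • (j y * rationalSymmetrize κ j k t) ∈
        (1 ⊔ M) ^ k := by
  obtain ⟨y, hy⟩ := y
  -- both claims are additive in the connected element, and so it may be assumed to be a graph
  let P : AddSubgroup (GraphSpace H) :=
    { carrier := {y | ∃ hy : y ∈ connectedSpan H, (1 : ℚ) ⊗ₜ κ y * t ∈ rationalFiltration κ (n + 1) ∧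
        ∀ k, n = k + 1 → rationalSymmetrize κ j n ((1 : ℚ) ⊗ₜ κ y * t) -
          n • (j ⟨y, hy⟩ * rationalSymmetrize κ j k t) ∈ (1 ⊔ M) ^ k}
      zero_mem' := ⟨zero_mem _, by
        have : (⟨0, zero_mem _⟩ : connectedSpan H) = 0 := rfl
        simp [this]⟩
      add_mem' := by
        rintro x y ⟨hx, h1, h2⟩ ⟨hy, h3, h4⟩
        refine ⟨add_mem hx hy, ?_, fun k hk => ?_⟩
        · rw [map_add, TensorProduct.tmul_add, add_mul]; exact add_mem h1 h3
        · have : (⟨x + y, add_mem hx hy⟩ : connectedSpan H) = ⟨x, hx⟩ + ⟨y, hy⟩ := rfl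
          rw [map_add, TensorProduct.tmul_add, add_mul, this, map_add, map_add, add_mul, smul_add,
            add_sub_add_comm]
          exact add_mem (h2 k hk) (h4 k hk)
      neg_mem' := by
        rintro x ⟨hx, h1, h2⟩
        have e : (1 : ℚ) ⊗ₜ κ (-x) * t = -((1 : ℚ) ⊗ₜ κ x * t) := by
          rw [map_neg, TensorProduct.tmul_neg]; exact neg_mul ((1 : ℚ) ⊗ₜ[ℤ] κ x) t
        refine ⟨neg_mem hx, ?_, fun k hk => ?_⟩
        · rw [e]; exact neg_mem h1
        · have : (⟨-x, neg_mem hx⟩ : connectedSpan H) = -⟨x, hx⟩ := rfl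
          rw [e, this, map_neg, map_neg, neg_mul, smul_neg,
            ← neg_sub', neg_mem_iff]
          exact h2 k hk }
  have hP : connectedSpan H ≤ P := connectedSpan_le fun Γ hΓ => by
    refine ⟨hΓ.cls_mem, ?_, ?_⟩
    · have : rationalFiltration κ n ≤ (rationalFiltration κ (n + 1)).comap
          (LinearMap.mulLeft ℚ ((1 : ℚ) ⊗ₜ κ Γ.toTri.cls)) := by
        refine Submodule.span_le.2 ?_
        rintro _ ⟨x, hx, rfl⟩
        obtain ⟨h1, h2⟩ := star_mem_componentFiltration (hB := hB) hΓ hx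
        refine Submodule.subset_span ⟨starMul hB Γ.toTri.cls x, ?_, ?_⟩
        · rw [← sub_add_cancel (starMul hB Γ.toTri.cls x)]
          exact add_mem (componentFiltration_mono n.le_succ h1) h2
        · rw [LinearMap.mulLeft_apply, Algebra.TensorProduct.tmul_mul_tmul, one_mul, hκ]
      exact this ht
    · rintro k rfl
      let m := j ⟨Γ.toTri.cls, hΓ.cls_mem⟩
      have : rationalFiltration κ (k + 1) ≤ ((1 ⊔ M) ^ k).comap
          ((rationalSymmetrize κ j (k + 1)).comp (LinearMap.mulLeft ℚ ((1 : ℚ) ⊗ₜ κ Γ.toTri.cls)) -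
            (k + 1) • (LinearMap.mulLeft ℚ m).comp (rationalSymmetrize κ j k)) := by
        refine Submodule.span_le.2 ?_
        rintro _ ⟨x, hx, rfl⟩
        obtain ⟨h1, _⟩ := star_mem_componentFiltration (hB := hB) hΓ hx
        change rationalSymmetrize κ j (k + 1) (((1 : ℚ) ⊗ₜ κ Γ.toTri.cls) * ((1 : ℚ) ⊗ₜ κ x)) -
          (k + 1) • (m * rationalSymmetrize κ j k (1 ⊗ₜ κ x)) ∈ (1 ⊔ M) ^ k
        rw [Algebra.TensorProduct.tmul_mul_tmul, one_mul, ← hκ, rationalSymmetrize_tmul,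
          rationalSymmetrize_tmul, ← sub_add_cancel (starMul hB Γ.toTri.cls x)
            (disjointUnion Γ.toTri.cls x), map_add, symmetrize_eq_zero j h1, zero_add]
        exact symmetrize_sum_sub_mem j hM hcomm hΓ k x
      exact this ht
  obtain ⟨_, h⟩ := hP hy
  exact h

/-- On products of at most `n` factors, `symmetrize` inverts `θ` up to the factor `n!` and up to
products of fewer factors. -/
lemma rationalSymmetrize_comp (hκ : ∀ x y, κ (starMul hB x y) = κ x * κ y)
    (h1 : κ (graphClass UniTriGraph.empty) = 1) {M : Submodule ℚ R}
    (hM : M = Submodule.span ℚ (Set.range j)) (hcomm : ∀ x ∈ M, ∀ y ∈ M, x * y - y * x ∈ M)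
    (hθ : ∀ x, θ (j x) = 1 ⊗ₜ κ x.1) (n : ℕ) :
    (1 ⊔ M) ^ n ≤ (rationalFiltration κ (n + 1)).comap θ.toLinearMap ∧
    (∀ u ∈ (1 ⊔ M) ^ n, ∀ k, n = k + 1 →
      rationalSymmetrize κ j n (θ u) - n.factorial • u ∈ (1 ⊔ M) ^ k) ∧
    (n = 0 → ∀ u ∈ (1 ⊔ M) ^ n, rationalSymmetrize κ j n (θ u) = u) := by
  have hjM : ∀ x, j x ∈ M := fun x => hM ▸ Submodule.subset_span ⟨x, rfl⟩
  have hempty : graphClass (UniTriGraph.empty (H := H)) ∈ componentFiltration H 1 := by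
    have : IsEmpty (Fin (UniTriGraph.empty (H := H)).order) := inferInstanceAs (IsEmpty (Fin 0))
    rw [← toTri_cls]
    refine cls_mem_componentFiltration ?_
    rw [TriGraph.saturatedCount_of_isEmpty]; norm_num
  induction n with
  | zero =>
    refine ⟨?_, fun _ _ k hk => by omega, fun _ => ?_⟩
    · rw [pow_zero, Submodule.one_le]
      change θ 1 ∈ rationalFiltration κ 1
      rw [map_one]
      exact Submodule.subset_span ⟨_, hempty, by rw [h1]; rfl⟩
    · intro u hu
      rw [pow_zero] at hu
      obtain ⟨q, rfl⟩ := Submodule.mem_one.1 hu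
      have e : (1 : ℚ ⊗[ℤ] A) = (1 : ℚ) ⊗ₜ κ (graphClass UniTriGraph.empty) := by rw [h1]; rfl
      have : IsEmpty (Fin (UniTriGraph.empty (H := H)).order) := inferInstanceAs (IsEmpty (Fin 0))
      rw [AlgHom.commutes, Algebra.algebraMap_eq_smul_one, Algebra.algebraMap_eq_smul_one, map_smul,
        e, rationalSymmetrize_tmul, ← toTri_cls, symmetrize_zero_of_isEmpty]
  | succ n ih =>
    obtain ⟨ih1, ih2, ih3⟩ := ih
    have key : ∀ u ∈ (1 ⊔ M) ^ n, 1 ⊔ M ≤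
        ((rationalFiltration κ (n + 2)).comap θ.toLinearMap ⊓ ((1 ⊔ M) ^ n).comap
          ((rationalSymmetrize κ j (n + 1)).comp θ.toLinearMap - (n + 1).factorial • LinearMap.id)).comap
            (LinearMap.mulRight ℚ u) := by
      intro u hu
      have hu' : θ u ∈ rationalFiltration κ (n + 1) := ih1 hu
      refine sup_le (Submodule.one_le.2 ⟨?_, ?_⟩) ?_
      · change θ (1 * u) ∈ rationalFiltration κ (n + 2)
        rw [one_mul]
        exact rationalFiltration_mono (κ := κ) (Nat.le_succ (n + 1)) hu'
      · change rationalSymmetrize κ j (n + 1) (θ (1 * u)) - (n + 1).factorial • (1 * u) ∈ (1 ⊔ M) ^ n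
        rw [one_mul, rationalSymmetrize_eq_zero hu', zero_sub]
        exact neg_mem (nsmul_mem hu _)
      · conv_lhs => rw [hM]
        refine Submodule.span_le.2 ?_
        rintro _ ⟨x, rfl⟩
        obtain ⟨h2, h3⟩ := rationalSymmetrize_mul hκ hjM hcomm x hu'
        have e : θ (j x * u) = (1 : ℚ) ⊗ₜ κ x.1 * θ u := by rw [map_mul, hθ]
        refine ⟨?_, ?_⟩
        · change θ (j x * u) ∈ rationalFiltration κ (n + 2)
          rw [e]; exact h2
        · change rationalSymmetrize κ j (n + 1) (θ (j x * u)) - (n + 1).factorial • (j x * u) ∈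
            (1 ⊔ M) ^ n
          have h4 : j x * (rationalSymmetrize κ j n (θ u) - n.factorial • u) ∈ (1 ⊔ M) ^ n := by
            rcases n with _ | n
            · rw [ih3 rfl u hu, Nat.factorial_zero, one_smul, sub_self, mul_zero]; exact zero_mem _
            · exact mul_mem_pow_succ (hjM x) (ih2 u hu n rfl)
          have e' : rationalSymmetrize κ j (n + 1) (θ (j x * u)) - (n + 1).factorial • (j x * u) =
              (rationalSymmetrize κ j (n + 1) ((1 : ℚ) ⊗ₜ κ x.1 * θ u) -
                (n + 1) • (j x * rationalSymmetrize κ j n (θ u))) +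
              (n + 1) • (j x * (rationalSymmetrize κ j n (θ u) - n.factorial • u)) := by
            rw [e, Nat.factorial_succ, mul_sub, smul_sub, mul_smul, mul_smul_comm]
            abel
          rw [e']
          exact add_mem (h3 n rfl) (nsmul_mem h4 _)
    have key' : (1 ⊔ M) ^ (n + 1) ≤ (rationalFiltration κ (n + 2)).comap θ.toLinearMap ⊓
        ((1 ⊔ M) ^ n).comap ((rationalSymmetrize κ j (n + 1)).comp θ.toLinearMap -
          (n + 1).factorial • LinearMap.id) := by
      rw [pow_succ', Submodule.mul_le]
      exact fun m hm u hu => key u hu hm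
    refine ⟨key'.trans inf_le_left, ?_, fun h => by omega⟩
    rintro u hu k hk
    obtain rfl : n = k := by omega
    exact (key' hu).2

/-- A kernel element that is a product of at most `n + 1` factors is one of at most `n` factors, since
`(n + 1)!` is invertible. -/
lemma injective_of_symmetrize (hκ : ∀ x y, κ (starMul hB x y) = κ x * κ y)
    (h1 : κ (graphClass UniTriGraph.empty) = 1) {M : Submodule ℚ R}
    (hM : M = Submodule.span ℚ (Set.range j)) (hcomm : ∀ x ∈ M, ∀ y ∈ M, x * y - y * x ∈ M)
    (hθ : ∀ x, θ (j x) = 1 ⊗ₜ κ x.1) (hgen : ∀ u, ∃ n, u ∈ (1 ⊔ M) ^ n) : Function.Injective θ := by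
  rw [injective_iff_map_eq_zero]
  intro u hu
  obtain ⟨n, hn⟩ := hgen u
  induction n with
  | zero =>
    rw [← (rationalSymmetrize_comp hκ h1 hM hcomm hθ 0).2.2 rfl u hn, hu, map_zero]
  | succ n ih =>
    have := (rationalSymmetrize_comp hκ h1 hM hcomm hθ (n + 1)).2.1 u hn n rfl
    rw [hu, map_zero, zero_sub, neg_mem_iff, ← Nat.cast_smul_eq_nsmul ℚ] at this
    exact ih ((Submodule.smul_mem_iff _ (Nat.cast_ne_zero.2 (Nat.factorial_ne_zero _))).1 this)

/-- Split off a connected component; the correction terms have fewer components. -/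
lemma surjective_of_connected (hκ : ∀ x y, κ (starMul hB x y) = κ x * κ y)
    (h1 : κ (graphClass UniTriGraph.empty) = 1) (hθ : ∀ x, θ (j x) = 1 ⊗ₜ κ x.1) :
    Function.Surjective θ := by
  let N : AddSubgroup (GraphSpace H) := θ.range.toSubring.toAddSubgroup.comap
    ((TensorProduct.mk ℤ ℚ A 1).toAddMonoidHom.comp κ.toAddMonoidHom)
  have hN : ∀ x, x ∈ N ↔ (1 : ℚ) ⊗ₜ κ x ∈ θ.range := fun x => Iff.rfl
  have key : ∀ (n : ℕ) {V : Type} [Finite V] (G : TriGraph V H), G.saturatedCount < 2 ^ n →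
      G.cls ∈ N := by
    intro n
    induction n with
    | zero =>
      intro V _ G h
      have : Nonempty {S : Set V // G.IsSaturated S} := ⟨⟨_, G.isSaturated_univ⟩⟩
      have : 0 < G.saturatedCount := Nat.card_pos
      omega
    | succ n ih =>
      intro V _ G h
      classical
      rcases isEmpty_or_nonempty V with hV | hV
      · rw [cls_eq_empty, hN, h1]
        exact one_mem θ.range
      · obtain ⟨S, hS, hconn⟩ := G.exists_isConnected_restrict
        rw [TriGraph.saturatedCount_restrict hS, hconn.saturatedCount, pow_succ] at h
        have h' : (G.restrict Sᶜ).saturatedCount < 2 ^ n := by omega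
        have e : G.cls = ((G.restrict S).sum (G.restrict Sᶜ)).cls := by
          conv_lhs => rw [TriGraph.eq_map_sum_restrict hS]
          exact (clsInvariant H).map_vertexEquiv _ _
        have h2 : star B (G.restrict S) (G.restrict Sᶜ) -
            ((G.restrict S).sum (G.restrict Sᶜ)).cls ∈ N :=
          star_sub_sum_mem B _ _ hconn fun E hE => ih _ (hE.trans_lt h')
        have h3 : star B (G.restrict S) (G.restrict Sᶜ) ∈ N := by
          rw [← starMul_cls hB, hN, hκ, ← one_mul (1 : ℚ), ← Algebra.TensorProduct.tmul_mul_tmul]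
          exact mul_mem ⟨j ⟨_, hconn.cls_mem⟩, hθ _⟩ ((hN _).1 (ih _ h'))
        rw [e, ← sub_sub_cancel (star B (G.restrict S) (G.restrict Sᶜ))
          ((G.restrict S).sum (G.restrict Sᶜ)).cls]
        exact sub_mem h3 h2
  have hall : ∀ x, x ∈ N := GraphSpace.mem_of_cls_mem fun Γ =>
    key _ _ (Nat.lt_two_pow_self (n := Γ.toTri.saturatedCount))
  intro t
  change t ∈ θ.range
  induction t using TensorProduct.induction_on with
  | zero => exact zero_mem _
  | add x y hx hy => exact add_mem hx hy
  | tmul q a =>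
    obtain ⟨x, rfl⟩ := κ.surjective a
    have : q ⊗ₜ[ℤ] κ x = q • ((1 : ℚ) ⊗ₜ κ x) := by rw [TensorProduct.smul_tmul', smul_eq_mul, mul_one]
    rw [this]
    exact Subalgebra.smul_mem _ ((hN x).1 (hall x)) q

end

/-! ### Enveloping algebras of Lie algebras over the rationals -/

section

attribute [local instance] LieRing.ofAssociativeRing

variable {L A : Type} [LieRing L] [LieAlgebra ℚ L] [Ring A] [Algebra ℚ A]

/-- The extension to the enveloping algebra of a linear map that sends brackets to commutators. -/
def liftOfCommutator (f : L →ₗ[ℚ] A) (h : ∀ x y, f ⁅x, y⁆ = f x * f y - f y * f x) :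
    UniversalEnvelopingAlgebra ℚ L →ₐ[ℚ] A :=
  UniversalEnvelopingAlgebra.lift ℚ { f with map_lie' := fun {x y} => h x y }

lemma liftOfCommutator_ι (f : L →ₗ[ℚ] A) (h : ∀ x y, f ⁅x, y⁆ = f x * f y - f y * f x) (x : L) :
    liftOfCommutator f h (UniversalEnvelopingAlgebra.ι ℚ x) = f x :=
  UniversalEnvelopingAlgebra.lift_ι_apply ℚ _ x

/-- An enveloping algebra is generated by the Lie algebra. -/
lemma exists_mem_one_sup_range_pow
    (u : UniversalEnvelopingAlgebra ℚ L) :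
    ∃ n, u ∈ (1 ⊔ LinearMap.range (UniversalEnvelopingAlgebra.ι ℚ (L := L)).toLinearMap) ^ n := by
  set M := LinearMap.range (UniversalEnvelopingAlgebra.ι ℚ (L := L)).toLinearMap
  let T : Subalgebra ℚ (UniversalEnvelopingAlgebra ℚ L) :=
    { carrier := {u | ∃ n, u ∈ (1 ⊔ M) ^ n}
      mul_mem' := by
        rintro x y ⟨m, hx⟩ ⟨n, hy⟩
        exact ⟨m + n, by rw [pow_add]; exact Submodule.mul_mem_mul hx hy⟩
      add_mem' := by
        rintro x y ⟨m, hx⟩ ⟨n, hy⟩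
        exact ⟨max m n, add_mem (one_sup_pow_mono (le_max_left m n) hx)
          (one_sup_pow_mono (le_max_right m n) hy)⟩
      algebraMap_mem' := fun q => ⟨0, by rw [pow_zero]; exact Submodule.mem_one.2 ⟨q, rfl⟩⟩ }
  have hι : ∀ x, UniversalEnvelopingAlgebra.ι ℚ x ∈ T := fun x =>
    ⟨1, by rw [pow_one]; exact Submodule.mem_sup_right ⟨x, rfl⟩⟩
  let ι' : L →ₗ⁅ℚ⁆ T :=
    { toFun := fun x => ⟨UniversalEnvelopingAlgebra.ι ℚ x, hι x⟩
      map_add' := fun x y => Subtype.ext (map_add _ x y)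
      map_smul' := fun q x => Subtype.ext (map_smul _ q x)
      map_lie' := fun {x y} => Subtype.ext (LieHom.map_lie _ x y) }
  have : T.val.comp (UniversalEnvelopingAlgebra.lift ℚ ι') = AlgHom.id ℚ _ := by
    refine UniversalEnvelopingAlgebra.hom_ext ℚ (LieHom.ext fun x => ?_)
    change (UniversalEnvelopingAlgebra.lift ℚ ι' (UniversalEnvelopingAlgebra.ι ℚ x)).1 = _
    rw [UniversalEnvelopingAlgebra.lift_ι_apply]
    rfl
  have h : (UniversalEnvelopingAlgebra.lift ℚ ι' u).1 = u := AlgHom.congr_fun this u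
  obtain ⟨n, hn⟩ := (UniversalEnvelopingAlgebra.lift ℚ ι' u).2
  exact ⟨n, h ▸ hn⟩

end

/-! ### The enveloping algebra of the connected part -/

section

variable {H : Type} [AddCommGroup H] {B : H → H → ℤ} (hB : IsBiadditive B)

/-- The connected part as a Lie subring. -/
def connectedLie : LieSubalgebra ℤ (starProduct hB).Carrier where
  carrier := (starProduct hB).connectedPart
  add_mem' := add_mem
  zero_mem' := zero_mem _
  smul_mem' n _ hx := AddSubgroup.zsmul_mem _ hx n
  lie_mem' hx hy := starMul_sub_starMul_mem hB hx hy

lemma baseChange_lie (x y : ℚ ⊗[ℤ] connectedLie hB) :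
    LinearMap.baseChange ℚ ((connectedLie hB).toSubmodule.subtype) ⁅x, y⁆ =
      LinearMap.baseChange ℚ ((connectedLie hB).toSubmodule.subtype) x *
        LinearMap.baseChange ℚ ((connectedLie hB).toSubmodule.subtype) y -
      LinearMap.baseChange ℚ ((connectedLie hB).toSubmodule.subtype) y *
        LinearMap.baseChange ℚ ((connectedLie hB).toSubmodule.subtype) x := by
  set φ := LinearMap.baseChange ℚ ((connectedLie hB).toSubmodule.subtype)
  induction x using TensorProduct.induction_on with
  | zero => rw [zero_lie, map_zero, zero_mul, mul_zero, sub_zero]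
  | add x x' hx hx' =>
    rw [add_lie, map_add, map_add, hx, hx', add_mul, mul_add]; abel
  | tmul p x =>
    induction y using TensorProduct.induction_on with
    | zero =>
      exact (congrArg φ (lie_zero (p ⊗ₜ[ℤ] x))).trans (by
        rw [map_zero, zero_mul, mul_zero, sub_zero])
    | add y y' hy hy' =>
      exact (congrArg φ (lie_add (p ⊗ₜ[ℤ] x) y y')).trans (by
        rw [map_add, hy, hy', map_add, add_mul, mul_add]; abel)
    | tmul q y =>
      have h1 : φ ⁅p ⊗ₜ[ℤ] x, q ⊗ₜ[ℤ] y⁆ = (p * q) ⊗ₜ[ℤ] (⁅x, y⁆ : connectedLie hB).1 := by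
        rw [LieAlgebra.ExtendScalars.bracket_tmul]; rfl
      have h2 : (⁅x, y⁆ : connectedLie hB).1 = x.1 * y.1 - y.1 * x.1 := rfl
      have h3 : φ (p ⊗ₜ[ℤ] x) * φ (q ⊗ₜ[ℤ] y) = (p * q) ⊗ₜ[ℤ] (x.1 * y.1) :=
        Algebra.TensorProduct.tmul_mul_tmul _ _ _ _
      have h4 : φ (q ⊗ₜ[ℤ] y) * φ (p ⊗ₜ[ℤ] x) = (q * p) ⊗ₜ[ℤ] (y.1 * x.1) :=
        Algebra.TensorProduct.tmul_mul_tmul _ _ _ _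
      rw [h1, h2, h3, h4, mul_comm q p, ← TensorProduct.tmul_sub]

/-- The algebra map from the enveloping algebra of the connected part that extends its inclusion. -/
def universalHom : UniversalEnvelopingAlgebra ℚ (ℚ ⊗[ℤ] connectedLie hB) →ₐ[ℚ]
    ℚ ⊗[ℤ] (starProduct hB).Carrier :=
  liftOfCommutator (LinearMap.baseChange ℚ ((connectedLie hB).toSubmodule.subtype)) (baseChange_lie hB)

lemma universalHom_ι (x : connectedLie hB) :
    universalHom hB (UniversalEnvelopingAlgebra.ι ℚ ((1 : ℚ) ⊗ₜ[ℤ] x)) = (1 : ℚ) ⊗ₜ[ℤ] x.1 :=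
  liftOfCommutator_ι _ _ _

attribute [local instance] LieRing.ofAssociativeRing

/-- The map from the connected part to its enveloping algebra. -/
def connectedToUniversal : connectedSpan H →+ UniversalEnvelopingAlgebra ℚ (ℚ ⊗[ℤ] connectedLie hB) where
  toFun x := UniversalEnvelopingAlgebra.ι ℚ ((1 : ℚ) ⊗ₜ[ℤ] (⟨x.1, x.2⟩ : connectedLie hB))
  map_zero' := by
    have : (⟨(0 : connectedSpan H).1, (0 : connectedSpan H).2⟩ : connectedLie hB) = 0 := rfl
    rw [this, TensorProduct.tmul_zero, map_zero]
  map_add' x y := by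
    have : (⟨(x + y).1, (x + y).2⟩ : connectedLie hB) =
      (⟨x.1, x.2⟩ : connectedLie hB) + ⟨y.1, y.2⟩ := rfl
    rw [this, TensorProduct.tmul_add, map_add]

lemma span_range_connectedToUniversal : Submodule.span ℚ (Set.range (connectedToUniversal hB)) =
    LinearMap.range (UniversalEnvelopingAlgebra.ι ℚ (L := ℚ ⊗[ℤ] connectedLie hB)).toLinearMap := by
  refine le_antisymm (Submodule.span_le.2 ?_) ?_
  · rintro _ ⟨x, rfl⟩
    exact ⟨_, rfl⟩
  · rintro _ ⟨t, rfl⟩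
    induction t using TensorProduct.induction_on with
    | zero => rw [map_zero]; exact zero_mem _
    | add x y hx hy => rw [map_add]; exact add_mem hx hy
    | tmul q x =>
      have : q ⊗ₜ[ℤ] x = q • ((1 : ℚ) ⊗ₜ[ℤ] x) := by
        rw [TensorProduct.smul_tmul', smul_eq_mul, mul_one]
      rw [this, map_smul]
      exact Submodule.smul_mem _ _ (Submodule.subset_span ⟨⟨x.1, x.2⟩, rfl⟩)

lemma bijective_universalHom : Function.Bijective (universalHom hB) := by
  let κ : GraphSpace H ≃+ (starProduct hB).Carrier := AddEquiv.refl (GraphSpace H)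
  have hθ : ∀ x, universalHom hB (connectedToUniversal hB x) = (1 : ℚ) ⊗ₜ[ℤ] κ x.1 := fun x =>
    universalHom_ι hB ⟨x.1, x.2⟩
  have hκ : ∀ x y, κ (starMul hB x y) = κ x * κ y := fun _ _ => rfl
  refine ⟨injective_of_symmetrize (κ := κ) hκ rfl (span_range_connectedToUniversal hB).symm ?_ hθ
    exists_mem_one_sup_range_pow, surjective_of_connected (κ := κ) hκ rfl hθ⟩
  rintro _ ⟨x, rfl⟩ _ ⟨y, rfl⟩
  exact ⟨⁅x, y⁆, LieHom.map_lie _ x y⟩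

end

end

end

end FramedGraph

theorem mainTheorem10 (g : ℕ) :
    FramedGraph.IsIntersectionForm (FramedGraph.intersectionForm g) ∧
    ∀ (ι : Type) [Finite ι] (b : FramedGraph.FramedLink g ι), b.IsBasisLink →
      ∃ Φ : FramedGraph.H1 (FramedGraph.Surface g) →ₗ[ℤ]
          FramedGraph.H1 (FramedGraph.Surface g) →ₗ[ℤ] ℤ,
        -- (i) `Φ` is the unique form induced by the framed link `b`; it can be computed
        -- from the overcrossings of any generic link that is isotopic to `b`; and its
        -- antisymmetrization is the intersection form
        (b.Induces Φ ∧ ∀ Φ', b.Induces Φ' → Φ' = Φ) ∧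
        (∀ b' : FramedGraph.FramedLink g ι, b.Isotopic b' → b'.IsGeneric → ∀ i j,
          Φ (b'.projClass i) (b'.projClass j) =
            FramedGraph.overcrossingSum (b'.core i) (b'.core j)) ∧
        (∀ x y, Φ x y - Φ y x = FramedGraph.intersectionForm g x y) ∧
        -- (ii) the graphs coloured by `H₁(Σ × I)` form a ring with the star product
        ∃ S : FramedGraph.StarProduct (FramedGraph.cylinderForm Φ),
          -- (iii) the commutator of graphs, and the Lie subring of the connected graphs
          (∀ Γ Γ', S.ofGraph Γ * S.ofGraph Γ' - S.ofGraph Γ' * S.ofGraph Γ =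
            ∑ᶠ l : ℕ, (FramedGraph.contraction (FramedGraph.cylinderForm Φ) (l + 1) Γ Γ' -
              FramedGraph.contraction (FramedGraph.cylinderForm Φ) (l + 1) Γ' Γ)) ∧
          ∃ L : LieSubalgebra ℤ S.Carrier, (L : Set S.Carrier) = S.connectedPart ∧
            -- (iv) over `ℚ` the ring is the universal enveloping algebra of the Lie subring
            ∃ e : UniversalEnvelopingAlgebra ℚ (ℚ ⊗[ℤ] L) ≃ₐ[ℚ] ℚ ⊗[ℤ] S.Carrier,
              ∀ x : L, e (UniversalEnvelopingAlgebra.ι ℚ ((1 : ℚ) ⊗ₜ[ℤ] x)) =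
                (1 : ℚ) ⊗ₜ[ℤ] (x : S.Carrier) := by
  refine ⟨FramedGraph.isIntersectionForm g, fun ι _ b hb => ?_⟩
  obtain ⟨Φ, hΦ⟩ := FramedGraph.FramedLink.IsBasisLink.exists_induces hb
  have hB : FramedGraph.IsBiadditive (FramedGraph.cylinderForm Φ) :=
    ⟨fun x y z => by simp [FramedGraph.cylinderForm], fun x y z => by simp [FramedGraph.cylinderForm]⟩
  refine ⟨Φ, ⟨hΦ, fun Φ' h' => FramedGraph.FramedLink.Induces.unique hb hΦ h'⟩,
    fun b' hi hg i j => FramedGraph.FramedLink.Induces.eq_overcrossingSum hΦ hi hg i j,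
    FramedGraph.FramedLink.Induces.sub_flip hb hΦ, FramedGraph.starProduct hB,
    fun Γ Γ' => FramedGraph.commutator_ofGraph Γ Γ' _, FramedGraph.connectedLie hB, rfl,
    AlgEquiv.ofBijective (FramedGraph.universalHom hB) (FramedGraph.bijective_universalHom hB),
    FramedGraph.universalHom_ι hB⟩
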